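/- **Walks.** A Kreweras walk is a finite word $w=w_1\cdots w_n$ (possibly empty) on $\{a,b,c\}$, with $a=(1,0)$, $b=(0,1)$, $c=(-1,-1)$. For $x\in\{a,b\}$, an $x$-step $w_i$ and a $c$-step $w_j$ *match* if $i<j$, the word $w_i\cdots w_j$ has as many $x$'s as $c$'s, and for all $i\le k<j$ the word $w_i\cdots w_k$ has more $x$'s than $c$'s. A step $a$ or $b$ with no match is *unmatched*. A $c$-step with both an $a$-match $w_i$ and a $b$-match $w_j$ is *matched*, of type $a$ if $i<j$ and of type $b$ if $j<i$; a $c$-step without $a$-match (resp. $b$-match) is an *unmatched $c$-step of type $a$* (resp. *type $b$*). Let $\overline{\mathcal K}$ be the set of walks in which every $c$-step has at least one matching step. **Maps.** Let $\mathcal T$ be the set of rooted loopless planar triangulations with simple boundary (multiple edges allowed): the root-face is the face on the right of the oriented root-edge, its boundary visits no vertex twice, and all other faces are triangles; the map with one edge and two vertices is included. Maps are considered up to orientation-preserving homeomorphism. Vertices and edges on the root-face are *outer*; vertices not on it are *inner*; faces other than the root-face are *inner*. A percolation configuration $\sigma$ colors each vertex white or black; $(M,\sigma)$ satisfies the *root-interface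 condition* if the root-edge goes from a white to a black vertex and no other outer edge goes from white to black in counterclockwise direction around the root-face. Then the *top-edge* is the unique outer edge going from a black vertex (*top-right*) to a white vertex (*top-left*) in that direction (for the one-edge map it is the root-edge), and the *percolation path* is the interface that starts at the root-edge, crosses the bicolor edges of the successive inner triangles it traverses, and ends at the top-edge. Unicolor white (resp. black) outer edges are called *left* (resp. *right*). Let $\overline{\mathcal T}_P$ be the set of pairs $(M,\sigma)$ with $M\in\mathcal T$, $\sigma$ satisfying the root-interface condition, and the outer edges marked *active* or *inactive*, such that the top-edge is active, the root-edge is inactive unless it is the top-edge, the active edges are consecutive around the root-face, and the percolation path goes through every inner triangle incident to an active outer edge. *In-edges* are the edges that are not active outer edges; *in-vertices* are the vertices not incident to an active outer edge (all inner vertices are in-vertices). **Construction.** $\overline\Phi(w)=\overline\phi_{w_n}\circ\cdots\circ\overline\phi_{w_1}(M_0,\sigma_0)$, where $(M_0,\sigma_0)$ is the one-edge map, with its edge active, oriented from white to black. $\overline\phi_a$ (resp. $\overline\phi_b$) glues to the top-edge a triangle whose new vertex is white (resp. black); the two new outer edges are active. $\overline\phi_c$ is defined if there is an active left or right edge. Let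 $e$ be the top-edge, $v_\ell,v_r$ the top-left and top-right vertices, and $e_\ell,e_r\ne e$ the other outer edges at $v_\ell,v_r$. If there are both an active left edge and an active right edge, let $t_\ell,t_r$ be the inner triangles at $e_\ell,e_r$: if the path visits $t_r$ after $t_\ell$, recolor $v_r$ white and glue $e$ to $e_\ell$; otherwise recolor $v_\ell$ black and glue $e$ to $e_r$. If there is no active left edge, recolor $v_r$ white and make $e$ inactive; if there is no active right edge, recolor $v_\ell$ black and make $e$ inactive. For each $i$, let $\eta_{\rm e}(i)$ be the edge of $\overline\Phi(w)$ that was the top-edge just before step $i$. Let $\eta_{\rm vf}(i)$ be the triangle added at step $i$ if $w_i\in\{a,b\}$, and, if $w_i=c$, the vertex ($v_\ell$ if $v_r$ is recolored, $v_r$ if $v_\ell$ is recolored) that becomes an in-vertex at step $i$. For an unmatched $a$-step (resp. $b$-step) $w_i$, let $\eta_{\rm lr}(i)$ be the unique active left (resp. right) edge incident to $\eta_{\rm vf}(i)$. **Theorem (bijection in the general case).** $\overline\Phi$ is well defined on $\overline{\mathcal K}$ (whenever $\overline\phi_c$ is applied, there is an active left or right edge), and it is a bijection from $\overline{\mathcal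 K}$ onto $\overline{\mathcal T}_P$. Moreover, for $w\in\overline{\mathcal K}$ and $\overline\Phi(w)=(M,\sigma)$: (i) $\eta_{\rm e}$ is a one-to-one correspondence between the steps of $w$ and the in-edges of $(M,\sigma)$; it restricts to a one-to-one correspondence between the unmatched $c$-steps of type $a$ (resp. $b$) and the inactive left (resp. right) outer edges. (ii) $\eta_{\rm vf}$ gives a one-to-one correspondence between the $a$-steps and $b$-steps of $w$ and the inner triangles of $M$, under which the unmatched $a$-steps (resp. $b$-steps) correspond to the triangles incident to an active left (resp. right) edge. It also gives a one-to-one correspondence between the $c$-steps (matched or not) of type $a$ (resp. $b$) and the white (resp. black) in-vertices, under which the matched ones correspond to the inner vertices and the unmatched ones to the outer in-vertices of that color. (iii) $\eta_{\rm lr}$ is well defined and gives a one-to-one correspondence between the unmatched $a$-steps (resp. $b$-steps) and the active left (resp. right) edges. **In particular**, $\overline\Phi$ (forgetting the marking) induces a bijection from the set of walks in $\overline{\mathcal K}$ without unmatched $a$-steps or $b$-steps onto the set of all pairs $(M,\sigma)$ with $M\in\mathcal T$ and $\sigma$ satisfying the root-interface condition. For such a walk, $\eta_{\rm vf}$ gives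 one-to-one correspondences between the $a$- and $b$-steps and the inner triangles, between the matched $c$-steps of type $a$ (resp. $b$) and the white (resp. black) inner vertices, and between the unmatched $c$-steps of type $a$ (resp. $b$) and the white (resp. black) outer vertices not incident to the top-edge. -/

import Mathlib

open Equiv (Perm)

namespace KrewerasBij

/-! ## Kreweras walks as words -/

/-- The three steps `a = (1,0)`, `b = (0,1)`, `c = (-1,-1)`. -/
inductive Step
  | a
  | b
  | c
  deriving DecidableEq

/-- A Kreweras walk is identified with its word of steps. The steps of a word of length `n` are
indexed by `0, …, n - 1`. -/
abbrev Word := List Step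

/-- Number of `x`-steps among the steps with index in `[i..k]`. -/
def cnt (w : Word) (x : Step) (i k : ℕ) : ℕ := ((w.drop i).take (k + 1 - i)).count x

/-- The `x`-step of index `i` (for `x = a` or `x = b`) and the `c`-step of index `j` match. -/
def Matching (w : Word) (x : Step) (i j : ℕ) : Prop :=
  i < j ∧ w[i]? = some x ∧ w[j]? = some Step.c ∧ cnt w x i j = cnt w Step.c i j ∧
    ∀ k, i ≤ k → k < j → cnt w Step.c i k < cnt w x i k

/-- Indices of all the steps. -/
def steps (w : Word) : Set ℕ := {i | i < w.length}

/-- Indices of the `a`-steps and `b`-steps. -/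
def abSteps (w : Word) : Set ℕ := {i | w[i]? = some Step.a ∨ w[i]? = some Step.b}

/-- Indices of the `x`-steps (`x = a` or `x = b`) without a matching `c`-step. -/
def unmatchedSteps (w : Word) (x : Step) : Set ℕ :=
  {i | w[i]? = some x ∧ ∀ j, ¬ Matching w x i j}

/-- Matched `c`-steps of type `a`: the matching `a`-step comes before the matching `b`-step. -/
def matchedCa (w : Word) : Set ℕ :=
  {k | ∃ i j, Matching w Step.a i k ∧ Matching w Step.b j k ∧ i < j}

/-- Matched `c`-steps of type `b`: the matching `b`-step comes before the matching `a`-step. -/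
def matchedCb (w : Word) : Set ℕ :=
  {k | ∃ i j, Matching w Step.a i k ∧ Matching w Step.b j k ∧ j < i}

/-- `c`-steps without a matching `x`-step: the unmatched `c`-steps of type `x`
(`x = a` or `x = b`). -/
def unmatchedC (w : Word) (x : Step) : Set ℕ :=
  {k | w[k]? = some Step.c ∧ ∀ i, ¬ Matching w x i k}

/-- Walks in which every `c`-step has at least one matching step. -/
def KBar : Set Word :=
  {w | ∀ k, w[k]? = some Step.c → (∃ i, Matching w Step.a i k) ∨ (∃ i, Matching w Step.b i k)}

/-- Walks in which moreover every `a`-step and every `b`-step is matched. -/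
def KSuf : Set Word :=
  {w | w ∈ KBar ∧ unmatchedSteps w Step.a = ∅ ∧ unmatchedSteps w Step.b = ∅}

/-! ## Rooted planar maps with a site-percolation configuration

A map is given by its darts (oriented edges). A dart `d` stands for an edge together with a
direction; `rev d` is the same edge in the other direction, and `next d` is the dart which follows
`d` along the boundary of the face on the right of `d`. Edges, faces and vertices are the orbits of
`rev`, of `next` and of `next ∘ rev` (darts with the same origin). Darts are labelled by natural
numbers, and `rev`, `next` fix all the numbers that are not darts. -/

/-- The data of a rooted map with a colouring of its vertices. `white` is the set of darts whose
origin is white; the darts with black origin are the other ones. -/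
structure PercMap where
  darts : Finset ℕ
  rev : Perm ℕ
  next : Perm ℕ
  root : ℕ
  white : Set ℕ

namespace PercMap

variable (M : PercMap)

/-- Rotation around the origin of a dart. -/
def rot : Perm ℕ := M.next * M.rev

/-- The edge of a dart. -/
def edgeOf (d : ℕ) : Set ℕ := {x | M.rev.SameCycle d x}

/-- The face on the right of a dart. -/
def faceOf (d : ℕ) : Set ℕ := {x | M.next.SameCycle d x}

/-- The origin of a dart. -/
def vertexOf (d : ℕ) : Set ℕ := {x | M.rot.SameCycle d x}

def edges : Set (Set ℕ) := M.edgeOf '' (M.darts : Set ℕ)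
def faces : Set (Set ℕ) := M.faceOf '' (M.darts : Set ℕ)
def vertices : Set (Set ℕ) := M.vertexOf '' (M.darts : Set ℕ)

/-- The root-face is on the right of the root-edge. Its elements are the outer darts: the outer
edges, directed counterclockwise when the root-face is drawn as the infinite face. -/
def rootFace : Set ℕ := M.faceOf M.root

/-- The data form a connected rooted planar map (planarity is Euler's formula), and the colouring
is well defined on vertices. -/
structure IsPlanarMap : Prop where
  rev_mem : ∀ d ∈ M.darts, M.rev d ∈ M.darts
  rev_ne : ∀ d ∈ M.darts, M.rev d ≠ d
  rev_rev : ∀ d ∈ M.darts, M.rev (M.rev d) = d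
  rev_fix : ∀ d, d ∉ M.darts → M.rev d = d
  next_mem : ∀ d ∈ M.darts, M.next d ∈ M.darts
  next_fix : ∀ d, d ∉ M.darts → M.next d = d
  root_mem : M.root ∈ M.darts
  connected : ∀ d ∈ M.darts, ∃ g ∈ Subgroup.closure {M.rev, M.next}, g M.root = d
  euler : M.vertices.ncard + M.faces.ncard = M.edges.ncard + 2
  white_sub : M.white ⊆ (M.darts : Set ℕ)
  white_rot : ∀ d ∈ M.darts, (M.rot d ∈ M.white ↔ d ∈ M.white)

/-- Rooted loopless triangulations with a simple boundary: every inner face has degree 3, the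
endpoints of any edge are distinct, and the root-face visits no vertex twice. The map with a single
edge and two vertices is included. -/
structure IsTriangulation : Prop extends M.IsPlanarMap where
  triangle : ∀ d ∈ M.darts, d ∉ M.rootFace → (M.faceOf d).ncard = 3
  loopless : ∀ d ∈ M.darts, M.rev d ∉ M.vertexOf d
  simple : ∀ d ∈ M.rootFace, ∀ d' ∈ M.rootFace, d' ∈ M.vertexOf d → d = d'

/-- The root-edge goes from a white to a black vertex, and no other outer edge goes from a white
to a black vertex in counterclockwise direction. -/
def RootInterface : Prop :=
  (M.root ∈ M.white ∧ M.rev M.root ∉ M.white) ∧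
    ∀ d ∈ M.rootFace, d ≠ M.root → ¬ (d ∈ M.white ∧ M.rev d ∉ M.white)

/-- The top-edge, as an outer dart: under the root-interface condition, there is a unique outer
dart from a black vertex (the top-right vertex) to a white one (the top-left vertex). For the map
with a single edge, the top-edge is the root-edge. -/
noncomputable def top : ℕ := sInf {d | d ∈ M.rootFace ∧ d ∉ M.white ∧ M.rev d ∈ M.white}

/-- `d` is a dart of a unicolor white edge. -/
def WhiteEdge (d : ℕ) : Prop := d ∈ M.white ∧ M.rev d ∈ M.white

/-- `d` is a dart of a unicolor black edge. -/
def BlackEdge (d : ℕ) : Prop := d ∉ M.white ∧ M.rev d ∉ M.white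

/-- An interface enters a triangle through a dart `g` of the triangle from black to white. It
leaves it through the other bicolor edge, which depends on the colour of the third vertex (the
origin of `next (next g)`); the result is the dart of that edge on the other side. -/
noncomputable def interfaceStep (g : ℕ) : ℕ :=
  open Classical in
  if M.next (M.next g) ∈ M.white then M.rev (M.next (M.next g)) else M.rev (M.next g)

/-- The `k`-th dart crossed by the percolation path, which starts at the root-edge. It is
meaningful as long as the path has not left the map. -/
noncomputable def entry (k : ℕ) : ℕ := M.interfaceStep^[k] (M.rev M.root)

/-- `f` is the triangle of index `k` along the percolation path. -/
def OnPathAt (k : ℕ) (f : Set ℕ) : Prop :=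
  (∀ i ≤ k, M.entry i ∉ M.rootFace) ∧ M.entry k ∈ f

/-- The percolation path goes through the triangle `f`. -/
def OnPath (f : Set ℕ) : Prop := ∃ k, M.OnPathAt k f

/-- The percolation path visits the triangle `f` before the triangle `f'`. -/
def PathBefore (f f' : Set ℕ) : Prop := ∃ j k, j < k ∧ M.OnPathAt j f ∧ M.OnPathAt k f'

/-- The inner triangles. -/
def innerFaces : Set (Set ℕ) := M.faces \ {M.rootFace}

def outerVertices : Set (Set ℕ) := M.vertexOf '' M.rootFace

def innerVertices : Set (Set ℕ) := M.vertices \ M.outerVertices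

def whiteVertices : Set (Set ℕ) := {v | v ∈ M.vertices ∧ v ⊆ M.white}

def blackVertices : Set (Set ℕ) := {v | v ∈ M.vertices ∧ Disjoint v M.white}

/-- The outer vertices which are not incident to the top-edge. -/
def nonTopOuterVertices : Set (Set ℕ) :=
  {v | v ∈ M.outerVertices ∧ M.top ∉ v ∧ M.rev M.top ∉ v}

/-- Equality of site-percolated rooted maps, up to relabelling of the darts. -/
def Iso (N : PercMap) : Prop :=
  ∃ π : Perm ℕ, N.darts = M.darts.map π.toEmbedding ∧ N.rev = π * M.rev * π⁻¹ ∧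
    N.next = π * M.next * π⁻¹ ∧ N.root = π M.root ∧ N.white = π '' M.white

end PercMap

/-- A percolated map together with a marking of its outer edges as active or inactive. `active` is
the set of the darts (in both directions) of the active outer edges. -/
structure MarkedMap extends PercMap where
  active : Set ℕ

namespace MarkedMap

variable (M : MarkedMap)

/-- Equality of marked site-percolated rooted maps, up to relabelling of the darts. -/
def Iso (N : MarkedMap) : Prop :=
  ∃ π : Perm ℕ, N.darts = M.darts.map π.toEmbedding ∧ N.rev = π * M.rev * π⁻¹ ∧
    N.next = π * M.next * π⁻¹ ∧ N.root = π M.root ∧ N.white = π '' M.white ∧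
    N.active = π '' M.active

end MarkedMap

theorem PercMap.iso_equivalence : Equivalence PercMap.Iso where
  refl M := ⟨1, Finset.map_refl.symm, by simp, by simp, by simp, by simp⟩
  symm := by
    rintro M N ⟨π, h1, h2, h3, h4, h5⟩
    refine ⟨π⁻¹, ?_, ?_, ?_, ?_, ?_⟩
    · ext x; simp [h1, Equiv.Perm.inv_def]
    · rw [h2]; group
    · rw [h3]; group
    · simp [h4]
    · rw [h5, Set.image_image]; simp
  trans := by
    rintro M N P ⟨π, h1, h2, h3, h4, h5⟩ ⟨ρ, k1, k2, k3, k4, k5⟩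
    refine ⟨ρ * π, ?_, ?_, ?_, ?_, ?_⟩
    · rw [k1, h1, Finset.map_map]; rfl
    · rw [k2, h2]; group
    · rw [k3, h3]; group
    · simp [k4, h4]
    · rw [k5, h5, Set.image_image]; rfl

theorem MarkedMap.iso_equivalence : Equivalence MarkedMap.Iso where
  refl M := ⟨1, Finset.map_refl.symm, by simp, by simp, by simp, by simp, by simp⟩
  symm := by
    rintro M N ⟨π, h1, h2, h3, h4, h5, h6⟩
    refine ⟨π⁻¹, ?_, ?_, ?_, ?_, ?_, ?_⟩
    · ext x; simp [h1, Equiv.Perm.inv_def]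
    · rw [h2]; group
    · rw [h3]; group
    · simp [h4]
    · rw [h5, Set.image_image]; simp
    · rw [h6, Set.image_image]; simp
  trans := by
    rintro M N P ⟨π, h1, h2, h3, h4, h5, h6⟩ ⟨ρ, k1, k2, k3, k4, k5, k6⟩
    refine ⟨ρ * π, ?_, ?_, ?_, ?_, ?_, ?_⟩
    · rw [k1, h1, Finset.map_map]; rfl
    · rw [k2, h2]; group
    · rw [k3, h3]; group
    · simp [k4, h4]
    · rw [k5, h5, Set.image_image]; rfl
    · rw [k6, h6, Set.image_image]; rfl

/-- Site-percolated rooted maps, considered up to isomorphism. -/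
def PercClass : Type := Quotient (⟨PercMap.Iso, PercMap.iso_equivalence⟩ : Setoid PercMap)

/-- Marked site-percolated rooted maps, considered up to isomorphism. -/
def MarkedClass : Type := Quotient (⟨MarkedMap.Iso, MarkedMap.iso_equivalence⟩ : Setoid MarkedMap)

def PercMap.toClass (M : PercMap) : PercClass := Quotient.mk _ M

def MarkedMap.toClass (M : MarkedMap) : MarkedClass := Quotient.mk _ M

/-- The site-percolated rooted loopless triangulations with a simple boundary that satisfy the
root-interface condition. -/
def TSuf : Set PercClass :=
  PercMap.toClass '' {M | M.IsTriangulation ∧ M.RootInterface}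

namespace MarkedMap

variable (M : MarkedMap)

/-- The conditions on a triangulation with active and inactive outer edges. -/
structure IsTBar : Prop where
  triangulation : M.IsTriangulation
  rootInterface : M.RootInterface
  active_sub : M.active ⊆ (M.darts : Set ℕ)
  active_rev : ∀ d ∈ M.active, M.rev d ∈ M.active
  active_outer : ∀ d ∈ M.active, d ∈ M.rootFace ∨ M.rev d ∈ M.rootFace
  top_active : M.top ∈ M.active
  root_inactive : M.edgeOf M.root ≠ M.edgeOf M.top → M.root ∉ M.active
  /-- The active edges are consecutive around the root-face. -/
  consecutive : ∃ s ∈ M.rootFace, ∃ L : ℕ,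
    ∀ x ∈ M.rootFace, (x ∈ M.active ↔ ∃ i < L, (M.next ^ i) s = x)
  /-- The percolation path goes through all the inner triangles incident to an active edge. -/
  path : ∀ d ∈ M.active, d ∉ M.rootFace → M.OnPath (M.faceOf d)

end MarkedMap

/-- The set of percolated triangulations with active and inactive outer edges. -/
def TBar : Set MarkedClass := MarkedMap.toClass '' {M | M.IsTBar}

/-! ## The step-by-step construction -/

/-- Remove `d` from its cycle in `p`: the predecessor of `d` is sent to `p d`, and `d` is fixed. -/
def removeDart (p : Perm ℕ) (d : ℕ) : Perm ℕ := Equiv.swap d (p d) * p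

namespace MarkedMap

variable (M : MarkedMap)

/-- A label that exceeds all the darts. -/
def fresh : ℕ := M.darts.sup id + 1

/-- Gluing a triangle to the top-edge `d`, directed from the top-right vertex `v` to the top-left
vertex `v'`. With `u` the new vertex, the new darts are `p : v → u` and `q : u → v'`, which replace
`d` in the root-face, and their reverses `p' : u → v` and `q' : v' → u`; the new triangle is
`d, q', p'`. If `uWhite` then `u` is white, else it is black. -/
noncomputable def glueTriangle (uWhite : Bool) : MarkedMap :=
  let d := M.top
  let p := M.fresh
  let q := M.fresh + 1
  let p' := M.fresh + 2
  let q' := M.fresh + 3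
  { darts := M.darts ∪ {p, q, p', q'}
    rev := Equiv.swap p p' * Equiv.swap q q' * M.rev
    next := [d, p, q, M.next d, q', p'].formPerm * M.next
    root := M.root
    white := M.white ∪ (if uWhite then {q', q, p'} else {q'})
    active := (M.active \ {d, M.rev d}) ∪ {p, q, p', q'} }

/-- There is an active left edge (unicolor white). -/
def HasActiveLeft : Prop := ∃ x ∈ M.rootFace, x ∈ M.active ∧ M.WhiteEdge x

/-- There is an active right edge (unicolor black). -/
def HasActiveRight : Prop := ∃ x ∈ M.rootFace, x ∈ M.active ∧ M.BlackEdge x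

/-- The outer dart after the top one: the outer edge `e_ℓ ≠ e` incident to the top-left vertex. -/
noncomputable def leftDart : ℕ := M.next M.top

/-- The outer dart before the top one: the outer edge `e_r ≠ e` incident to the top-right vertex. -/
noncomputable def rightDart : ℕ := M.next.symm M.top

/-- The step `c` recolors the top-right vertex in white (and the top-left vertex stops being
incident to an active edge): this happens if there is no active left edge, or if there are active
left and right edges and the percolation path visits the inner triangle incident to `e_ℓ` before
the one incident to `e_r`. Otherwise the step `c` recolors the top-left vertex in black. -/
def RecolorsRight : Prop :=
  ¬ M.HasActiveLeft ∨ (M.HasActiveRight ∧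
    M.PathBefore (M.faceOf (M.rev M.leftDart)) (M.faceOf (M.rev M.rightDart)))

/-- The new colouring after a step `c`. -/
noncomputable def recolored : Set ℕ :=
  open Classical in
  if M.RecolorsRight then M.white ∪ M.vertexOf M.top else M.white \ M.vertexOf (M.rev M.top)

/-- Gluing the top-edge with the neighbouring outer edge, given by its outer dart `f`: the darts
`M.top` and `f` are removed from the root-face and their reverses become the two darts of one
edge. -/
noncomputable def glueTop (f : ℕ) : MarkedMap :=
  let d := M.top
  { darts := M.darts \ {d, f}
    rev := Equiv.swap (M.rev d) (M.rev f) * Equiv.swap d (M.rev d) * Equiv.swap f (M.rev f) * M.rev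
    next := removeDart (removeDart M.next d) f
    root := M.root
    white := M.recolored \ {d, f}
    active := M.active \ {d, M.rev d, f, M.rev f} }

/-- The step `c`. It is meant for maps with an active left edge or an active right edge. With both,
the top-edge is glued to `e_ℓ` or to `e_r`; with only one kind, the top-edge becomes inactive. -/
noncomputable def stepC : MarkedMap :=
  open Classical in
  if M.HasActiveLeft ∧ M.HasActiveRight then
    M.glueTop (if M.RecolorsRight then M.leftDart else M.rightDart)
  else
    { M with
      white := M.recolored
      active := M.active \ {M.top, M.rev M.top} }

noncomputable def step : Step → MarkedMap
  | Step.a => M.glueTriangle true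
  | Step.b => M.glueTriangle false
  | Step.c => M.stepC

/-- The map with a single edge, its root-edge, from a white vertex to a black vertex. -/
def init : MarkedMap where
  darts := {0, 1}
  rev := Equiv.swap 0 1
  next := Equiv.swap 0 1
  root := 0
  white := {0}
  active := {0, 1}

/-! In-edges, in-vertices, and other families of edges, vertices and triangles. -/

/-- The edges that are not active outer edges. -/
def inEdges : Set (Set ℕ) := {e | e ∈ M.edges ∧ Disjoint e M.active}

/-- The vertices that are not incident to an active outer edge. -/
def inVertices : Set (Set ℕ) := {v | v ∈ M.vertices ∧ Disjoint v M.active}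

def leftActiveEdges : Set (Set ℕ) :=
  M.edgeOf '' {d | d ∈ M.rootFace ∧ M.WhiteEdge d ∧ d ∈ M.active}

def rightActiveEdges : Set (Set ℕ) :=
  M.edgeOf '' {d | d ∈ M.rootFace ∧ M.BlackEdge d ∧ d ∈ M.active}

def leftInactiveEdges : Set (Set ℕ) :=
  M.edgeOf '' {d | d ∈ M.rootFace ∧ M.WhiteEdge d ∧ d ∉ M.active}

def rightInactiveEdges : Set (Set ℕ) :=
  M.edgeOf '' {d | d ∈ M.rootFace ∧ M.BlackEdge d ∧ d ∉ M.active}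

/-- The inner triangles incident to some edge of the family `S`. -/
def trianglesAt (S : Set (Set ℕ)) : Set (Set ℕ) :=
  {f | f ∈ M.innerFaces ∧ ∃ e ∈ S, (f ∩ e).Nonempty}

end MarkedMap

/-- The bijection: read the steps of the walk and apply the corresponding mappings. -/
noncomputable def Phi (w : Word) : MarkedMap := w.foldl MarkedMap.step MarkedMap.init

/-- The map obtained just before the step of index `i`. -/
noncomputable def before (w : Word) (i : ℕ) : MarkedMap := Phi (w.take i)

/-! ## The correspondences between steps and cells

A dart that lies in an inner face, as well as the root, keeps its label in all later steps. Hence an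
edge, triangle or vertex created in the construction is designated by such a dart of it. -/

/-- The in-edge of `Phi w` that was the top-edge before the step of index `i`. -/
noncomputable def etaE (w : Word) (i : ℕ) : Set ℕ :=
  (Phi w).edgeOf ((before w i).rev (before w i).top)

/-- For an `a`-step or a `b`-step, the triangle glued at that step (it contains the dart which was
the outer dart of the top-edge). For a `c`-step, the top-left or top-right vertex which becomes an
in-vertex: the top-left one if the top-right vertex is recolored, and conversely. -/
noncomputable def etaVF (w : Word) (i : ℕ) : Set ℕ :=
  open Classical in
  if w[i]? = some Step.c then
    if (before w i).RecolorsRight then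
      (Phi w).vertexOf ((before w i).rev (before w i).top)
    else
      (Phi w).vertexOf ((before w i).rev (before w i).rightDart)
  else (Phi w).faceOf (before w i).top

/-- For an `a`-step (`b`-step), the unicolor edge of the triangle glued at that step, which was a
left (right) edge just after the step. -/
noncomputable def etaLR (w : Word) (i : ℕ) : Set ℕ :=
  if w[i]? = some Step.a then (Phi w).edgeOf ((Phi w).next (before w i).top)
  else (Phi w).edgeOf ((Phi w).next ((Phi w).next (before w i).top))

end KrewerasBij

open KrewerasBij

/-! The bijection between Kreweras walks and percolated triangulations. -/

namespace KrewerasBij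

/-! ### Matchings in words -/

/-- The effect of the steps of a word, the first of which has index `n`, on the stack `s` of the
`x`-steps which are still unmatched. -/
def stackFrom (x : Step) : ℕ → List ℕ → Word → List ℕ
  | _, s, [] => s
  | n, s, y :: w => stackFrom x (n + 1) (if y = x then n :: s else if y = Step.c then s.tail else s) w

/-- The indices of the unmatched `x`-steps of a word, the last one first. -/
def stack (w : Word) (x : Step) : List ℕ := stackFrom x 0 [] w

theorem stackFrom_append (x : Step) (w : Word) (y : Step) (n : ℕ) (s : List ℕ) :
    stackFrom x n s (w ++ [y]) = if y = x then (n + w.length) :: stackFrom x n s w else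
      if y = Step.c then (stackFrom x n s w).tail else stackFrom x n s w := by
  induction w generalizing n s with
  | nil => simp [stackFrom]
  | cons z w ih =>
    simp only [List.cons_append, stackFrom, ih, List.length_cons]
    grind

theorem stack_append_self (w : Word) (x : Step) : stack (w ++ [x]) x = w.length :: stack w x := by
  simp [stack, stackFrom_append]

theorem stack_append_c (w : Word) {x : Step} (hx : x ≠ Step.c) :
    stack (w ++ [Step.c]) x = (stack w x).tail := by
  simp [stack, stackFrom_append, hx.symm]

theorem stack_append_other (w : Word) {x y : Step} (hxy : y ≠ x) (hy : y ≠ Step.c) :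
    stack (w ++ [y]) x = stack w x := by
  simp [stack, stackFrom_append, hxy, hy]

theorem cnt_append {w v : Word} {x : Step} {i k : ℕ} (hk : k < w.length) (hi : i ≤ k) :
    cnt (w ++ v) x i k = cnt w x i k := by
  unfold cnt
  rw [List.drop_append_of_le_length (by omega), List.take_append_of_le_length]
  simp; omega

theorem cnt_last {w : Word} {x : Step} {i : ℕ} (y : Step) :
    cnt (w ++ [y]) x i w.length = ((w ++ [y]).drop i).count x := by
  unfold cnt
  rw [List.take_of_length_le]
  simp

theorem matching_append {w v : Word} {x : Step} {i j : ℕ} (hj : j < w.length) :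
    Matching (w ++ v) x i j ↔ Matching w x i j := by
  unfold Matching
  grind [cnt_append]

theorem Matching.lt {w : Word} {x : Step} {i j : ℕ} (h : Matching w x i j) : j < w.length :=
  (List.getElem?_eq_some_iff.1 h.2.2.1).1

/-- The stack holds the steps that exceed the later `c`-steps up to the end of the word, and the
position of such a step in the stack counts the excess. -/
structure StackSpec (w : Word) (x : Step) (s : List ℕ) : Prop where
  get : ∀ i ∈ s, w[i]? = some x
  excess : ∀ m i, s[m]? = some i → (w.drop i).count x = (w.drop i).count Step.c + m + 1
  isOpen : ∀ i ∈ s, ∀ k, i ≤ k → k < w.length → cnt w Step.c i k < cnt w x i k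
  mem : ∀ i, w[i]? = some x → (∀ k, i ≤ k → k < w.length → cnt w Step.c i k < cnt w x i k) → i ∈ s
  sorted : s.Pairwise (· > ·)

theorem StackSpec.lt {w : Word} {x : Step} {s : List ℕ} (h : StackSpec w x s) {i : ℕ} (hi : i ∈ s) :
    i < w.length := (List.getElem?_eq_some_iff.1 (h.get i hi)).1

theorem drop_append_count {w : Word} {x y : Step} {i : ℕ} (hi : i ≤ w.length) :
    ((w ++ [y]).drop i).count x = (w.drop i).count x + if y = x then 1 else 0 := by
  rw [List.drop_append_of_le_length hi, List.count_append]
  simp [List.count_singleton]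

theorem stackSpec (w : Word) {x : Step} (hx : x ≠ Step.c) : StackSpec w x (stack w x) := by
  induction w using List.reverseRecOn with
  | nil => constructor <;> simp [stack, stackFrom]
  | append_singleton w y ih =>
    have old : ∀ i ∈ stack w x, i < w.length := fun i hi => ih.lt hi
    have hlen : (w ++ [y]).length = w.length + 1 := by simp
    have hcx := hx.symm
    -- the conditions on the steps of `w` in terms of the longer word
    have step : ∀ i, i < w.length → (∀ k, i ≤ k → k < w.length + 1 →
        cnt (w ++ [y]) Step.c i k < cnt (w ++ [y]) x i k) →
        (∀ k, i ≤ k → k < w.length → cnt w Step.c i k < cnt w x i k) := by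
      intro i hi h k h1 h2
      have := h k h1 (by omega)
      rwa [cnt_append h2 h1, cnt_append h2 h1] at this
    have step' : ∀ i, i < w.length → (∀ k, i ≤ k → k < w.length → cnt w Step.c i k < cnt w x i k) →
        ((w ++ [y]).drop i).count Step.c < ((w ++ [y]).drop i).count x →
        (∀ k, i ≤ k → k < w.length + 1 →
        cnt (w ++ [y]) Step.c i k < cnt (w ++ [y]) x i k) := by
      intro i hi h h' k h1 h2
      rcases Nat.lt_succ_iff_lt_or_eq.1 h2 with h2 | rfl
      · rw [cnt_append h2 h1, cnt_append h2 h1]; exact h k h1 h2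
      · rwa [cnt_last, cnt_last]
    by_cases hyx : y = x
    · subst hyx
      rw [stack_append_self]
      constructor
      · intro i hi
        rcases List.mem_cons.1 hi with rfl | hi
        · simp
        · rw [List.getElem?_append_left (old i hi)]; exact ih.get i hi
      · intro m i hm
        cases m with
        | zero =>
          obtain rfl : w.length = i := by simpa using hm
          simp [hx]
        | succ m =>
          have hm' : (stack w y)[m]? = some i := by simpa using hm
          have hi := (old i (List.mem_of_getElem? hm')).le
          rw [drop_append_count hi, drop_append_count hi, ih.excess m i hm', if_pos rfl, if_neg hx]
          ring
      · intro i hi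
        rcases List.mem_cons.1 hi with rfl | hi
        · intro k h1 h2
          obtain rfl : w.length = k := by omega
          rw [cnt_last, cnt_last]
          simp [hx]
        · rw [hlen]
          refine step' i (old i hi) (ih.isOpen i hi) ?_
          obtain ⟨m, hm⟩ := List.getElem?_of_mem hi
          rw [drop_append_count (old i hi).le, drop_append_count (old i hi).le, ih.excess m i hm]
          simp [hx]; omega
      · intro i hi h
        have hi' := (List.getElem?_eq_some_iff.1 hi).1
        rw [hlen] at h hi'
        rcases Nat.lt_succ_iff_lt_or_eq.1 hi' with hi' | rfl
        · rw [List.getElem?_append_left hi'] at hi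
          exact List.mem_cons_of_mem _ (ih.mem i hi (step i hi' h))
        · simp
      · exact List.pairwise_cons.2 ⟨old, ih.sorted⟩
    by_cases hyc : y = Step.c
    · subst hyc
      rw [stack_append_c _ hx]
      have ht : ∀ i ∈ (stack w x).tail, i ∈ stack w x := fun i hi => List.mem_of_mem_tail hi
      constructor
      · intro i hi
        rw [List.getElem?_append_left (old i (ht i hi))]; exact ih.get i (ht i hi)
      · intro m i hm
        have hm' : (stack w x)[m + 1]? = some i := by rwa [List.getElem?_tail] at hm
        have hi := (old i (List.mem_of_getElem? hm')).le
        rw [drop_append_count hi, drop_append_count hi, ih.excess _ i hm', if_pos rfl, if_neg hcx]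
        ring
      · intro i hi
        rw [hlen]
        refine step' i (old i (ht i hi)) (ih.isOpen i (ht i hi)) ?_
        obtain ⟨m, hm⟩ := List.getElem?_of_mem hi
        rw [List.getElem?_tail] at hm
        have hi := (old i (ht i hi)).le
        rw [drop_append_count hi, drop_append_count hi, ih.excess _ i hm]
        simp [hcx]
      · intro i hi h
        have hi' := (List.getElem?_eq_some_iff.1 hi).1
        rw [hlen] at h hi'
        rcases Nat.lt_succ_iff_lt_or_eq.1 hi' with hi' | rfl
        · rw [List.getElem?_append_left hi'] at hi
          have hs := ih.mem i hi (step i hi' h)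
          obtain ⟨m, hm⟩ := List.getElem?_of_mem hs
          have h1 := ih.excess m i hm
          have h2 := h w.length (by omega) (by omega)
          rw [cnt_last, cnt_last, drop_append_count hi'.le, drop_append_count hi'.le, h1] at h2
          simp only [hcx, if_true, if_false] at h2
          obtain ⟨m, rfl⟩ : ∃ m', m = m' + 1 := ⟨m - 1, by omega⟩
          rw [← List.getElem?_tail] at hm
          exact List.mem_of_getElem? hm
        · simp [hcx] at hi
      · exact ih.sorted.tail
    · rw [stack_append_other _ hyx hyc]
      constructor
      · intro i hi
        rw [List.getElem?_append_left (old i hi)]; exact ih.get i hi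
      · intro m i hm
        have hi := (old i (List.mem_of_getElem? hm)).le
        rw [drop_append_count hi, drop_append_count hi, ih.excess _ i hm, if_neg hyx, if_neg hyc]
        ring
      · intro i hi
        rw [hlen]
        refine step' i (old i hi) (ih.isOpen i hi) ?_
        obtain ⟨m, hm⟩ := List.getElem?_of_mem hi
        rw [drop_append_count (old i hi).le, drop_append_count (old i hi).le, ih.excess m i hm]
        simp [hyx, hyc]
      · intro i hi h
        have hi' := (List.getElem?_eq_some_iff.1 hi).1
        rw [hlen] at h hi'
        rcases Nat.lt_succ_iff_lt_or_eq.1 hi' with hi' | rfl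
        · rw [List.getElem?_append_left hi'] at hi
          exact ih.mem i hi (step i hi' h)
        · simp [hyx] at hi
      · exact ih.sorted

/-- A new `c`-step is matched with the last unmatched step. -/
theorem matching_append_c {w : Word} {x : Step} (hx : x ≠ Step.c) {i : ℕ} :
    Matching (w ++ [Step.c]) x i w.length ↔ (stack w x).head? = some i := by
  have hS := stackSpec w hx
  rw [List.head?_eq_getElem?]
  constructor
  · rintro ⟨h1, h2, -, h4, h5⟩
    rw [List.getElem?_append_left h1] at h2
    have hi := hS.mem i h2 fun k hk hk' => by
      grind [cnt_append]
    obtain ⟨m, hm⟩ := List.getElem?_of_mem hi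
    grind [hS.excess, cnt_last, drop_append_count]
  · intro h
    have hi := List.mem_of_getElem? h
    have hl := hS.lt hi
    refine ⟨hl, ?_, by simp, ?_, fun k hk hk' => ?_⟩
    · grind [hS.get]
    · grind [cnt_last, drop_append_count, hS.excess]
    · rw [cnt_append hk' hk, cnt_append hk' hk]
      exact hS.isOpen i hi k hk hk'

theorem matching_append_last {w : Word} {x y : Step} (hy : y ≠ Step.c) {i j : ℕ} :
    Matching (w ++ [y]) x i j ↔ Matching w x i j := by
  constructor
  · intro h
    have hj := h.lt
    simp only [List.length_append, List.length_singleton] at hj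
    rcases Nat.lt_succ_iff_lt_or_eq.1 hj with hj | rfl
    · exact (matching_append hj).1 h
    · have := h.2.2.1
      simp [hy] at this
  · intro h
    exact (matching_append h.lt).2 h

theorem matching_append_c_iff {w : Word} {x : Step} (hx : x ≠ Step.c) {i j : ℕ} :
    Matching (w ++ [Step.c]) x i j ↔
      Matching w x i j ∨ (j = w.length ∧ (stack w x).head? = some i) := by
  constructor
  · intro h
    have hj := h.lt
    simp only [List.length_append, List.length_singleton] at hj
    grind [matching_append, matching_append_c]
  · rintro (h | ⟨rfl, h⟩)
    · exact (matching_append h.lt).2 h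
    · exact (matching_append_c hx).2 h

theorem getElem?_append_last {w : Word} {x y : Step} {k : ℕ} :
    (w ++ [y])[k]? = some x ↔ w[k]? = some x ∨ (k = w.length ∧ y = x) := by
  rcases lt_trichotomy k w.length with h | rfl | h
  · rw [List.getElem?_append_left h]
    simp [h.ne]
  · simp
  · rw [List.getElem?_eq_none (by simp; omega), List.getElem?_eq_none (by omega)]
    simp [h.ne']

theorem lt_of_getElem? {w : Word} {x : Step} {k : ℕ} (h : w[k]? = some x) : k < w.length :=
  (List.getElem?_eq_some_iff.1 h).1

theorem unmatchedSteps_eq (w : Word) {x : Step} (hx : x ≠ Step.c) :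
    unmatchedSteps w x = {i | i ∈ stack w x} := by
  induction w using List.reverseRecOn with
  | nil => simp [unmatchedSteps, stack, stackFrom]
  | append_singleton w y ih =>
    have hS := stackSpec w hx
    have ih' : ∀ i, (w[i]? = some x ∧ ∀ j, ¬ Matching w x i j) ↔ i ∈ stack w x := fun i =>
      Set.ext_iff.1 ih i
    ext i
    simp only [unmatchedSteps, Set.mem_ofPred_eq, getElem?_append_last]
    by_cases hyc : y = Step.c
    · subst hyc
      simp only [matching_append_c_iff hx, stack_append_c _ hx, hx.symm, and_false, or_false]
      have h1 : i ∈ (stack w x).tail ↔ i ∈ stack w x ∧ ¬ (stack w x).head? = some i := by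
        have hs := hS.sorted
        generalize stack w x = s at hs
        cases s with
        | nil => simp
        | cons m s =>
          rw [List.pairwise_cons] at hs
          grind
      grind
    · simp only [matching_append_last hyc]
      by_cases hyx : y = x
      · subst hyx
        rw [stack_append_self, List.mem_cons, ← ih']
        constructor
        · grind
        · rintro (rfl | h)
          · refine ⟨.inr ⟨rfl, rfl⟩, fun j hj => ?_⟩
            have := lt_of_getElem? hj.2.1
            omega
          · exact ⟨.inl h.1, h.2⟩
      · grind [stack_append_other]

theorem mem_KBar_append {w : Word} {y : Step} (hy : y ≠ Step.c) : w ++ [y] ∈ KBar ↔ w ∈ KBar := by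
  simp [KBar, getElem?_append_last, matching_append_last hy, hy]

theorem mem_KBar_append_c {w : Word} :
    w ++ [Step.c] ∈ KBar ↔ w ∈ KBar ∧ (stack w Step.a ≠ [] ∨ stack w Step.b ≠ []) := by
  have ha : Step.a ≠ Step.c := by decide
  have hb : Step.b ≠ Step.c := by decide
  have hh : ∀ s : List ℕ, s ≠ [] ↔ ∃ i, s.head? = some i := by
    intro s; cases s <;> simp
  simp only [KBar, Set.mem_ofPred_eq, getElem?_append_last, matching_append_c_iff ha,
    matching_append_c_iff hb, hh]
  constructor
  · intro h
    refine ⟨fun k hk => ?_, ?_⟩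
    · grind
    · rcases h w.length (.inr ⟨rfl, trivial⟩) with ⟨i, hi | hi⟩ | ⟨i, hi | hi⟩
      · exact absurd hi.lt (lt_irrefl _)
      · exact .inl ⟨i, hi.2⟩
      · exact absurd hi.lt (lt_irrefl _)
      · exact .inr ⟨i, hi.2⟩
  · grind

theorem abSteps_append_c {w : Word} : abSteps (w ++ [Step.c]) = abSteps w := by
  ext; simp [abSteps, getElem?_append_last]

theorem abSteps_append {w : Word} {y : Step} (hy : y ≠ Step.c) :
    abSteps (w ++ [y]) = insert w.length (abSteps w) := by
  ext k
  cases y <;> simp_all [abSteps, getElem?_append_last] <;> tauto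

theorem steps_append {w : Word} {y : Step} : steps (w ++ [y]) = insert w.length (steps w) := by
  ext k; simp only [steps, List.length_append, List.length_singleton, Set.mem_ofPred_eq,
    Set.mem_insert_iff]; omega

theorem matchedCa_append {w : Word} {y : Step} (hy : y ≠ Step.c) :
    matchedCa (w ++ [y]) = matchedCa w := by
  simp [matchedCa, matching_append_last hy]

theorem matchedCb_append {w : Word} {y : Step} (hy : y ≠ Step.c) :
    matchedCb (w ++ [y]) = matchedCb w := by
  simp [matchedCb, matching_append_last hy]

theorem unmatchedC_append {w : Word} {x y : Step} (hy : y ≠ Step.c) :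
    unmatchedC (w ++ [y]) x = unmatchedC w x := by
  simp [unmatchedC, matching_append_last hy, getElem?_append_last, hy]

theorem matchedCa_append_c {w : Word} : matchedCa (w ++ [Step.c]) = matchedCa w ∪
    {k | k = w.length ∧ ∃ i j, (stack w Step.a).head? = some i ∧
      (stack w Step.b).head? = some j ∧ i < j} := by
  ext k
  simp only [matchedCa, Set.mem_union, Set.mem_ofPred_eq,
    matching_append_c_iff (x := Step.a) (by decide), matching_append_c_iff (x := Step.b) (by decide)]
  constructor
  · rintro ⟨i, j, h1 | ⟨rfl, h1⟩, h2 | ⟨h3, h2⟩, h⟩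
    · exact .inl ⟨i, j, h1, h2, h⟩
    · exact absurd h1.lt (by omega)
    · exact absurd h2.lt (by omega)
    · grind
  · rintro (⟨i, j, h1, h2, h⟩ | ⟨rfl, i, j, h1, h2, h⟩)
    · grind
    · exact ⟨i, j, .inr ⟨rfl, h1⟩, .inr ⟨rfl, h2⟩, h⟩

theorem matchedCb_append_c {w : Word} : matchedCb (w ++ [Step.c]) = matchedCb w ∪
    {k | k = w.length ∧ ∃ i j, (stack w Step.a).head? = some i ∧
      (stack w Step.b).head? = some j ∧ j < i} := by
  ext k
  simp only [matchedCb, Set.mem_union, Set.mem_ofPred_eq,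
    matching_append_c_iff (x := Step.a) (by decide), matching_append_c_iff (x := Step.b) (by decide)]
  constructor
  · rintro ⟨i, j, h1 | ⟨rfl, h1⟩, h2 | ⟨h3, h2⟩, h⟩
    · exact .inl ⟨i, j, h1, h2, h⟩
    · exact absurd h1.lt (by omega)
    · exact absurd h2.lt (by omega)
    · grind
  · rintro (⟨i, j, h1, h2, h⟩ | ⟨rfl, i, j, h1, h2, h⟩)
    · grind
    · exact ⟨i, j, .inr ⟨rfl, h1⟩, .inr ⟨rfl, h2⟩, h⟩

theorem unmatchedC_append_c {w : Word} {x : Step} (hx : x ≠ Step.c) :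
    unmatchedC (w ++ [Step.c]) x = unmatchedC w x ∪ {k | k = w.length ∧ stack w x = []} := by
  ext k
  simp only [unmatchedC, Set.mem_union, Set.mem_ofPred_eq, matching_append_c_iff hx,
    getElem?_append_last]
  have hh : stack w x = [] ↔ ∀ i, (stack w x).head? ≠ some i := by
    cases stack w x <;> simp
  rw [hh]
  constructor
  · grind
  · rintro (⟨h, h'⟩ | ⟨rfl, h⟩)
    · grind
    · refine ⟨.inr ⟨rfl, trivial⟩, fun i => ?_⟩
      rintro (hi | ⟨-, hi⟩)
      · exact absurd hi.lt (lt_irrefl _)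
      · exact h i hi

/-! ### Cycles of finitely supported permutations -/

section Cycles

variable {p q : Perm ℕ} {D : Finset ℕ}

theorem sameCycle_apply (p : Perm ℕ) (x : ℕ) : p.SameCycle x (p x) := ⟨1, by simp⟩

/-- To map the cycles of `p` into classes of an equivalence relation, it suffices to look at a
single step of `p`. -/
theorem sameCycle_induct {r : ℕ → ℕ → Prop} (hr : Equivalence r) (h : ∀ a, r a (p a)) {a b : ℕ}
    (hab : p.SameCycle a b) : r a b := by
  obtain ⟨n, rfl⟩ := hab
  have key : ∀ (n : ℕ) a, r a ((p ^ n) a) := by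
    intro n
    induction n with
    | zero => intro a; exact hr.refl a
    | succ n ih => intro a; rw [pow_succ', Perm.mul_apply]; exact hr.trans (ih a) (h _)
  obtain ⟨n, rfl | rfl⟩ := n.eq_nat_or_neg
  · simpa using key n a
  · have := key n ((p ^ (-(n : ℤ))) a)
    rw [zpow_neg, zpow_natCast, ← Perm.mul_apply, mul_inv_cancel, Perm.one_apply] at this
    simpa using hr.symm this

theorem sameCycle_map {f : ℕ → ℕ} (h : ∀ a, q.SameCycle (f a) (f (p a))) {a b : ℕ}
    (hab : p.SameCycle a b) : q.SameCycle (f a) (f b) :=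
  sameCycle_induct (r := fun a b => q.SameCycle (f a) (f b))
    ⟨fun _ => .refl _ _, fun h => h.symm, fun h h' => h.trans h'⟩ h hab

theorem mem_iff_of_sameCycle {S : Set ℕ} (h : ∀ x, x ∈ S ↔ p x ∈ S) {a b : ℕ}
    (hab : p.SameCycle a b) : a ∈ S ↔ b ∈ S :=
  sameCycle_induct (r := fun a b => a ∈ S ↔ b ∈ S)
    ⟨fun _ => Iff.rfl, fun h => h.symm, fun h h' => h.trans h'⟩ h hab

theorem apply_mem_iff (hD : ∀ x ∉ D, p x = x) (x : ℕ) : p x ∈ D ↔ x ∈ D := by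
  constructor
  · intro h
    by_contra hx
    exact hx (hD x hx ▸ h)
  · intro h
    by_contra hx
    have := p.injective (hD _ hx)
    rw [this] at hx
    exact hx h

theorem sameCycle_mem_iff (hD : ∀ x ∉ D, p x = x) {a b : ℕ} (hab : p.SameCycle a b) :
    a ∈ D ↔ b ∈ D :=
  mem_iff_of_sameCycle (S := (D : Set ℕ)) (fun x => by simpa using (apply_mem_iff hD x).symm) hab

theorem exists_pow_fixed (hD : ∀ x ∉ D, p x = x) (x : ℕ) : ∃ k, 0 < k ∧ (p ^ k) x = x := by
  by_cases hx : x ∈ D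
  · have hmem : ∀ n : ℕ, (p ^ n) x ∈ (D : Set ℕ) := by
      intro n
      induction n with
      | zero => simpa using hx
      | succ n ih =>
        rw [pow_succ', Perm.mul_apply]
        simpa using (apply_mem_iff hD _).2 ih
    obtain ⟨m, n, hmn, h⟩ := D.finite_toSet.exists_lt_map_eq_of_forall_mem hmem
    refine ⟨n - m, by omega, ?_⟩
    have : (p ^ m) ((p ^ (n - m)) x) = (p ^ m) x := by
      rw [← Perm.mul_apply, ← pow_add, show m + (n - m) = n by omega, h]
    exact (p ^ m).injective this
  · exact ⟨1, one_pos, by simpa using hD x hx⟩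

theorem exists_nat_pow_eq (hD : ∀ x ∉ D, p x = x) {x y : ℕ} (h : p.SameCycle x y) :
    ∃ n : ℕ, (p ^ n) x = y := by
  refine sameCycle_induct (r := fun x y => (∃ n : ℕ, (p ^ n) x = y)) ⟨?_, ?_, ?_⟩ ?_ h
  · exact fun x => ⟨0, rfl⟩
  · rintro x y ⟨n, rfl⟩
    obtain ⟨k, hk, hkx⟩ := exists_pow_fixed hD x
    have hmul : ∀ m : ℕ, (p ^ (k * m)) x = x := by
      intro m
      induction m with
      | zero => simp
      | succ m ih => rw [Nat.mul_succ, pow_add, Perm.mul_apply, hkx, ih]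
    refine ⟨k * n - n, ?_⟩
    rw [← Perm.mul_apply, ← pow_add, Nat.sub_add_cancel (Nat.le_mul_of_pos_left n hk), hmul]
  · rintro x y z ⟨m, rfl⟩ ⟨n, rfl⟩
    exact ⟨n + m, by rw [pow_add, Perm.mul_apply]⟩
  · exact fun x => ⟨1, by simp⟩

/-- A set stable under a finitely supported permutation is a union of cycles. -/
theorem mem_of_sameCycle (hD : ∀ x ∉ D, p x = x) {S : Set ℕ} (h : ∀ x ∈ S, p x ∈ S) {a b : ℕ}
    (hab : p.SameCycle a b) (ha : a ∈ S) : b ∈ S := by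
  obtain ⟨n, rfl⟩ := exists_nat_pow_eq hD hab
  induction n with
  | zero => exact ha
  | succ n ih =>
    rw [pow_succ', Perm.mul_apply]
    exact h _ (ih ⟨n, by simp⟩)

theorem sameCycle_of_fixed {x y : ℕ} (hx : p x = x) : p.SameCycle x y ↔ x = y :=
  ⟨fun h => h.eq_of_left hx, fun h => h ▸ .refl _ _⟩

/-! Removing a point from its cycle. -/

theorem removeDart_apply (p : Perm ℕ) (d x : ℕ) :
    removeDart p d x = if x = d then d else if p x = d then p d else p x := by
  simp only [removeDart, Perm.mul_apply, Equiv.swap_apply_def]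
  split_ifs with h1 h2 h3 h4 <;> first | rfl | skip
  all_goals first | (subst h2; simp_all) | simp_all

theorem removeDart_self (p : Perm ℕ) (d : ℕ) : removeDart p d d = d := by simp [removeDart_apply]

theorem removeDart_inv (p : Perm ℕ) (d : ℕ) : (removeDart p d)⁻¹ = removeDart p⁻¹ d := by
  have : removeDart p d = p * Equiv.swap (p⁻¹ d) d := by
    rw [removeDart, Equiv.mul_swap_eq_swap_mul]; simp
  rw [this, removeDart, mul_inv_rev, Equiv.swap_inv, Equiv.swap_comm]

theorem removeDart_sameCycle (p : Perm ℕ) {d a b : ℕ} (ha : a ≠ d) (hb : b ≠ d) :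
    (removeDart p d).SameCycle a b ↔ p.SameCycle a b := by
  constructor
  · intro h
    refine sameCycle_induct (Perm.SameCycle.equivalence p) (fun a => ?_) h
    rw [removeDart_apply]
    split_ifs with h1 h2
    · rw [h1]
    · rw [← h2]; exact (sameCycle_apply p a).trans (sameCycle_apply p _)
    · exact sameCycle_apply p a
  · intro h
    have := sameCycle_map (p := p) (q := removeDart p d) (f := fun a => if a = d then p d else a)
      (fun a => ?_) h
    · simpa [ha, hb] using this
    · by_cases h1 : a = d
      · subst h1
        have : (if p a = a then p a else p a) = p a := by split_ifs <;> rfl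
        simp only [if_true, this]
        exact .refl _ _
      · have h2 : (removeDart p d) a = if p a = d then p d else p a := by
          rw [removeDart_apply]; simp [h1]
        grind [sameCycle_apply]

/-! Composition with a transposition joins two cycles or splits a cycle. -/

theorem sameCycle_swap_mul_of_not (hD : ∀ x ∉ D, p x = x) {x y : ℕ} (h : ¬ p.SameCycle x y) :
    (Equiv.swap x y * p).SameCycle x y := by
  classical
  have hex := exists_pow_fixed hD x
  obtain ⟨hk, hkx⟩ := Nat.find_spec hex
  set k := Nat.find hex with hkdef
  have hmin : ∀ i, 0 < i → i < k → (p ^ i) x ≠ x := fun i hi hik he => Nat.find_min hex hik ⟨hi, he⟩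
  have hpow : ∀ i < k, ((Equiv.swap x y * p) ^ i) x = (p ^ i) x := by
    intro i
    induction i with
    | zero => simp
    | succ i ih =>
      intro hi
      rw [pow_succ', Perm.mul_apply, ih (by omega), Perm.mul_apply, ← Perm.mul_apply p,
        ← pow_succ', Equiv.swap_apply_of_ne_of_ne (hmin _ (by omega) hi)]
      rintro rfl
      exact h ⟨(i + 1 : ℕ), by rw [zpow_natCast]⟩
  refine ⟨(k : ℕ), ?_⟩
  rw [zpow_natCast]
  obtain ⟨i, hi⟩ : ∃ i, k = i + 1 := ⟨k - 1, by omega⟩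
  rw [hi, pow_succ', Perm.mul_apply, hpow i (by omega), Perm.mul_apply, ← Perm.mul_apply p,
    ← pow_succ', ← hi, hkx, Equiv.swap_apply_left]

theorem not_sameCycle_swap_mul (hD : ∀ x ∉ D, p x = x) {x y : ℕ} (hxy : x ≠ y)
    (h : p.SameCycle x y) : ¬ (Equiv.swap x y * p).SameCycle x y := by
  classical
  have hex := exists_nat_pow_eq hD h
  have hk := Nat.find_spec hex
  set k := Nat.find hex with hkdef
  have hmin : ∀ i < k, (p ^ i) x ≠ y := fun i hik he => Nat.find_min hex hik he
  have hx : x ∈ D := by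
    grind [sameCycle_of_fixed]
  have hy : y ∈ D := (sameCycle_mem_iff hD h).1 hx
  have hD' : ∀ z ∉ D, (Equiv.swap x y * p) z = z := by
    intro z hz
    rw [Perm.mul_apply, hD z hz, Equiv.swap_apply_of_ne_of_ne] <;> rintro rfl <;> contradiction
  intro hs
  have := mem_of_sameCycle hD' (S := {z | ∃ i < k, (p ^ i) x = z}) ?_ hs
    ⟨0, ?_, rfl⟩
  · grind
  · rintro z ⟨i, hi, rfl⟩
    rw [Perm.mul_apply, ← Perm.mul_apply p, ← pow_succ']
    by_cases h1 : (p ^ (i + 1)) x = x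
    · exfalso
      apply hmin (k - (i + 1)) (by omega)
      rw [← hk]
      conv_rhs => rw [show k = (k - (i + 1)) + (i + 1) by omega, pow_add, Perm.mul_apply, h1]
    by_cases h2 : (p ^ (i + 1)) x = y
    · rw [h2, Equiv.swap_apply_right]
      exact ⟨0, by omega, rfl⟩
    · grind
  · by_contra hk0
    rw [show k = 0 by omega] at hk
    exact hxy hk

/-- The relation obtained from `r` by joining the classes of `x` and `y`. -/
def join (r : ℕ → ℕ → Prop) (x y a b : ℕ) : Prop := r a b ∨ ((r x a ∨ r y a) ∧ (r x b ∨ r y b))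

theorem join_equivalence {r : ℕ → ℕ → Prop} (hr : Equivalence r) (x y : ℕ) :
    Equivalence (join r x y) where
  refl a := Or.inl (hr.refl a)
  symm := by
    rintro a b (h | ⟨h, h'⟩)
    · exact Or.inl (hr.symm h)
    · exact Or.inr ⟨h', h⟩
  trans := by
    rintro a b c (h | ⟨h, h'⟩) (k | ⟨k, k'⟩)
    · exact Or.inl (hr.trans h k)
    · exact Or.inr ⟨k.imp (fun k => hr.trans k (hr.symm h)) (fun k => hr.trans k (hr.symm h)), k'⟩
    · exact Or.inr ⟨h, h'.imp (fun h' => hr.trans h' k) (fun h' => hr.trans h' k)⟩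
    · exact Or.inr ⟨h, k'⟩

theorem sameCycle_swap_mul (hD : ∀ x ∉ D, p x = x) {x y : ℕ} (h : ¬ p.SameCycle x y) (a b : ℕ) :
    (Equiv.swap x y * p).SameCycle a b ↔ join p.SameCycle x y a b := by
  have hxy := sameCycle_swap_mul_of_not hD h
  have hE := Perm.SameCycle.equivalence p
  constructor
  · refine sameCycle_induct (join_equivalence hE x y) (fun a => ?_)
    rw [Perm.mul_apply, Equiv.swap_apply_def]
    have h0 := sameCycle_apply p a
    split_ifs with h1 h2
    · exact Or.inr ⟨Or.inl (h1 ▸ h0.symm), Or.inr (.refl _ _)⟩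
    · exact Or.inr ⟨Or.inr (h2 ▸ h0.symm), Or.inl (.refl _ _)⟩
    · exact Or.inl h0
  · have hle : ∀ {a b}, p.SameCycle a b → (Equiv.swap x y * p).SameCycle a b := by
      intro a b
      refine sameCycle_induct (Perm.SameCycle.equivalence _) (fun a => ?_)
      have h0 := sameCycle_apply (Equiv.swap x y * p) a
      rw [Perm.mul_apply, Equiv.swap_apply_def] at h0
      split_ifs at h0 with h1 h2
      · exact h0.trans (h1 ▸ hxy.symm)
      · exact h0.trans (h2 ▸ hxy)
      · exact h0
    rintro (h | ⟨h | h, h' | h'⟩)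
    · exact hle h
    · exact (hle h).symm.trans (hle h')
    · exact (hle h).symm.trans (hxy.trans (hle h'))
    · exact (hle h).symm.trans (hxy.symm.trans (hle h'))
    · exact (hle h).symm.trans (hle h')

end Cycles

/-! ### Counting cycles, and the genus inequality -/

section Genus

variable {D : Finset ℕ}

/-- The number of classes of the relation `r` that meet `D`. -/
noncomputable def classes (D : Finset ℕ) (r : ℕ → ℕ → Prop) : ℕ :=
  ((fun d => {x | r d x}) '' (D : Set ℕ)).ncard

/-- The number of cycles of `p` on `D`. -/
noncomputable def cyc (D : Finset ℕ) (p : Perm ℕ) : ℕ := classes D p.SameCycle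

theorem class_eq_iff {r : ℕ → ℕ → Prop} (hr : Equivalence r) {a b : ℕ} :
    {x | r a x} = {x | r b x} ↔ r a b := by
  constructor
  · intro h
    have : b ∈ {x | r a x} := by rw [h]; exact hr.refl b
    exact this
  · intro h
    ext x
    exact ⟨fun k => hr.trans (hr.symm h) k, fun k => hr.trans h k⟩

theorem classes_join {r r' : ℕ → ℕ → Prop} (hr : Equivalence r) {x y : ℕ} (hx : x ∈ D) (hy : y ∈ D)
    (hxy : ¬ r x y) (h : ∀ a b, r' a b ↔ join r x y a b) : classes D r = classes D r' + 1 := by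
  set C := (fun d => {z | r d z}) '' (D : Set ℕ) with hC
  have hfin : C.Finite := D.finite_toSet.image _
  have hXY : ({z | r x z} : Set ℕ) ≠ {z | r y z} := fun he => hxy ((class_eq_iff hr).1 he)
  have hU : ∀ a, (r x a ∨ r y a) → {z | r' a z} = {z | r x z} ∪ {z | r y z} := by
    intro a ha
    ext z
    simp only [Set.mem_ofPred_eq, Set.mem_union, h, join]
    grind [hr.trans]
  have hN : ∀ a, ¬ (r x a ∨ r y a) → {z | r' a z} = {z | r a z} := by
    intro a ha
    ext z
    simp only [Set.mem_ofPred_eq, h, join]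
    tauto
  have key : (fun d => {z | r' d z}) '' (D : Set ℕ)
      = insert ({z | r x z} ∪ {z | r y z}) (C \ {{z | r x z}, {z | r y z}}) := by
    ext s
    constructor
    · rintro ⟨a, ha, rfl⟩
      by_cases hxa : r x a ∨ r y a
      · exact Or.inl (hU a hxa)
      · refine Or.inr ⟨?_, ?_⟩
        · grind
        · simp only [hN a hxa, Set.mem_insert_iff, Set.mem_singleton_iff, class_eq_iff hr]
          grind [hr.symm]
    · rintro (rfl | ⟨⟨a, ha, rfl⟩, hs⟩)
      · exact ⟨x, hx, hU x (Or.inl (hr.refl x))⟩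
      · refine ⟨a, ha, hN a ?_⟩
        rintro (k | k)
        · exact hs (Or.inl ((class_eq_iff hr).2 (hr.symm k)))
        · exact hs (Or.inr ((class_eq_iff hr).2 (hr.symm k)))
  have hnot : ({z | r x z} ∪ {z | r y z}) ∉ C \ {{z | r x z}, {z | r y z}} := by
    rintro ⟨⟨a, ha, he⟩, hs⟩
    have : x ∈ {z | r a z} := by
      simp only at he; rw [he]; exact Or.inl (hr.refl x)
    apply hs
    rw [← he]
    exact Or.inl ((class_eq_iff hr).2 this)
  have hsub : ({{z | r x z}, {z | r y z}} : Set (Set ℕ)) ⊆ C := by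
    grind
  have h2 : ({{z | r x z}, {z | r y z}} : Set (Set ℕ)).ncard = 2 := Set.ncard_pair hXY
  have h3 := Set.ncard_sdiff hsub (Set.toFinite _)
  have h4 := Set.ncard_le_ncard hsub hfin
  rw [classes, classes, key, Set.ncard_insert_of_notMem hnot (hfin.subset Set.sdiff_subset), h3,
    ← hC]
  omega

theorem cyc_swap_mul {p : Perm ℕ} (hD : ∀ x ∉ D, p x = x) {x y : ℕ} (hx : x ∈ D) (hy : y ∈ D)
    (h : ¬ p.SameCycle x y) : cyc D p = cyc D (Equiv.swap x y * p) + 1 :=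
  classes_join (Perm.SameCycle.equivalence p) hx hy h (sameCycle_swap_mul hD h)

theorem swap_mul_fixed {p : Perm ℕ} (hD : ∀ x ∉ D, p x = x) {x y : ℕ} (hx : x ∈ D) (hy : y ∈ D) :
    ∀ z ∉ D, (Equiv.swap x y * p) z = z := by
  intro z hz
  rw [Perm.mul_apply, hD z hz, Equiv.swap_apply_of_ne_of_ne] <;> rintro rfl <;> contradiction

theorem cyc_swap_mul_of_sameCycle {p : Perm ℕ} (hD : ∀ x ∉ D, p x = x) {x y : ℕ} (hx : x ∈ D)
    (hy : y ∈ D) (hxy : x ≠ y) (h : p.SameCycle x y) :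
    cyc D (Equiv.swap x y * p) = cyc D p + 1 := by
  have := cyc_swap_mul (swap_mul_fixed hD hx hy) hx hy (not_sameCycle_swap_mul hD hxy h)
  rwa [← mul_assoc, Equiv.swap_mul_self, one_mul] at this

theorem cyc_removeDart {p : Perm ℕ} (hD : ∀ x ∉ D, p x = x) {d : ℕ} (hd : d ∈ D) (hpd : p d ≠ d) :
    cyc (D.erase d) (removeDart p d) = cyc D p := by
  classical
  have hE := Perm.SameCycle.equivalence p
  have hfix : ∀ a, a ≠ d → ∀ x, (removeDart p d).SameCycle a x ↔ x ≠ d ∧ p.SameCycle a x := by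
    intro a ha x
    by_cases hx : x = d
    · subst hx
      simp only [ne_eq, not_true_eq_false, false_and, iff_false]
      intro h
      exact ha (h.eq_of_right (removeDart_self p x))
    · simp [hx, removeDart_sameCycle p ha hx]
  unfold cyc classes
  symm
  apply Set.ncard_congr (fun s _ => s \ {d})
  · rintro s ⟨a, ha, rfl⟩
    by_cases had : a = d
    · subst had
      refine ⟨p a, ?_, ?_⟩
      · grind [apply_mem_iff]
      · ext x
        simp only [Set.mem_ofPred_eq, hfix _ hpd, Perm.sameCycle_apply_left, Set.mem_sdiff,
          Set.mem_singleton_iff]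
        tauto
    · refine ⟨a, by simpa [had] using ha, ?_⟩
      grind
  · rintro s t ⟨a, ha, rfl⟩ ⟨b, hb, rfl⟩ h
    have hrep : ∀ a, ∃ a', a' ≠ d ∧ p.SameCycle a a' := by
      intro a
      by_cases had : a = d
      · grind [sameCycle_apply]
      · exact ⟨a, had, .refl _ _⟩
    obtain ⟨a', ha', haa'⟩ := hrep a
    have : a' ∈ {x | p.SameCycle a x} \ {d} := ⟨haa', ha'⟩
    simp only at h
    rw [h] at this
    exact (class_eq_iff hE).2 (haa'.trans this.1.symm)
  · rintro s ⟨a, ha, rfl⟩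
    simp only [Finset.coe_erase, Set.mem_sdiff, Finset.mem_coe, Set.mem_singleton_iff] at ha
    refine ⟨_, ⟨a, ha.1, rfl⟩, ?_⟩
    grind

theorem cyc_erase_of_fixed {p : Perm ℕ} {d : ℕ} (hd : d ∈ D) (hpd : p d = d) :
    cyc D p = cyc (D.erase d) p + 1 := by
  classical
  have hE := Perm.SameCycle.equivalence p
  unfold cyc classes
  rw [← Finset.insert_erase hd, Finset.coe_insert, Set.image_insert_eq, Finset.erase_insert (by simp),
    Set.ncard_insert_of_notMem _ ((Finset.finite_toSet _).image _)]
  rintro ⟨a, ha, he⟩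
  have h1 := (class_eq_iff hE).1 he
  have := h1.eq_of_right hpd
  simp [this] at ha

/-- The orbits of the group generated by `a` and `b`. -/
def conn (a b : Perm ℕ) : ℕ → ℕ → Prop := Relation.EqvGen fun u v => v = a u ∨ v = b u

theorem conn_equivalence (a b : Perm ℕ) : Equivalence (conn a b) := Relation.EqvGen.is_equivalence _

theorem conn_left (a b : Perm ℕ) (u : ℕ) : conn a b u (a u) := .rel _ _ (Or.inl rfl)

theorem conn_right (a b : Perm ℕ) (u : ℕ) : conn a b u (b u) := .rel _ _ (Or.inr rfl)

theorem conn_le {a b : Perm ℕ} {r : ℕ → ℕ → Prop} (hr : Equivalence r) (ha : ∀ u, r u (a u))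
    (hb : ∀ u, r u (b u)) {u v : ℕ} (h : conn a b u v) : r u v := by
  induction h with
  | rel u v h =>
    rcases h with rfl | rfl
    · exact ha u
    · exact hb u
  | refl u => exact hr.refl u
  | symm u v _ ih => exact hr.symm ih
  | trans u v w _ _ ih ih' => exact hr.trans ih ih'

theorem conn_of_sameCycle_right {a b : Perm ℕ} {u v : ℕ} (h : b.SameCycle u v) : conn a b u v :=
  sameCycle_induct (conn_equivalence a b) (conn_right a b) h

theorem conn_of_sameCycle_mul {a b : Perm ℕ} {u v : ℕ} (h : (b * a).SameCycle u v) : conn a b u v :=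
  sameCycle_induct (conn_equivalence a b)
    (fun u => (conn_equivalence a b).trans (conn_left a b u) (conn_right a b (a u))) h

/-- The genus of a map is nonnegative: the numbers of cycles of `a`, `b` and `b * a` satisfy
`cyc a + cyc b + cyc (b * a) ≤ |D| + 2 * (number of orbits)`. The induction removes the points of
the support of `a` one by one. -/
theorem genus_inequality (a b : Perm ℕ) (ha : ∀ x ∉ D, a x = x) (hb : ∀ x ∉ D, b x = x) :
    cyc D a + cyc D b + cyc D (b * a) ≤ D.card + 2 * classes D (conn a b) := by
  classical
  induction hn : (D.filter fun x => a x ≠ x).card using Nat.strong_induction_on generalizing a with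
  | _ n ih =>
  by_cases h1 : ∀ x ∈ D, a x = x
  · have ha1 : a = 1 := by
      ext x
      by_cases hx : x ∈ D
      · simp [h1 x hx]
      · simp [ha x hx]
    subst ha1
    have e1 : cyc D 1 = D.card := by
      unfold cyc classes
      rw [Set.ncard_image_of_injective, Set.ncard_coe_finset]
      intro x y hxy
      simpa [eq_comm] using (Set.ext_iff.1 hxy x)
    have e2 : conn 1 b = b.SameCycle := by
      ext u v
      exact ⟨conn_le (Perm.SameCycle.equivalence b) (fun u => .refl _ _) (sameCycle_apply b),
        conn_of_sameCycle_right⟩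
    rw [e1, e2, mul_one]
    unfold cyc
    omega
  · push Not at h1
    obtain ⟨x, hx, hax⟩ := h1
    set y := a x with hy
    have hyD : y ∈ D := (apply_mem_iff ha x).2 hx
    set a' := Equiv.swap x y * a with ha'
    have haa' : a = Equiv.swap x y * a' := by rw [ha', ← mul_assoc, Equiv.swap_mul_self, one_mul]
    have ha'D : ∀ z ∉ D, a' z = z := swap_mul_fixed ha hx hyD
    have ha'x : a' x = x := by rw [ha', Perm.mul_apply, ← hy, Equiv.swap_apply_right]
    have hbx : b x ∈ D := (apply_mem_iff hb x).2 hx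
    have hby : b y ∈ D := (apply_mem_iff hb y).2 hyD
    have hba'D : ∀ z ∉ D, (b * a') z = z := fun z hz => by rw [Perm.mul_apply, ha'D z hz, hb z hz]
    have hIH := ih _ ?_ a' ha'D rfl
    · have hns : ¬ a'.SameCycle x y := by
        grind [sameCycle_of_fixed]
      have e1 := cyc_swap_mul ha'D hx hyD hns
      rw [← haa'] at e1
      have hmul : b * a = Equiv.swap (b x) (b y) * (b * a') := by
        rw [haa', ← mul_assoc, Equiv.mul_swap_eq_swap_mul, mul_assoc]
      have hE' := conn_equivalence a' b
      have hE := conn_equivalence a b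
      have hle : ∀ {u v}, conn a' b u v → conn a b u v := by
        refine conn_le hE (fun u => ?_) (conn_right a b)
        have hxy : conn a b x y := conn_left a b x
        rw [ha', Perm.mul_apply, Equiv.swap_apply_def]
        grind [conn_left, hE.trans, hE.symm]
      have hge : ∀ {u v}, conn a b u v → join (conn a' b) x y u v := by
        refine conn_le (join_equivalence hE' x y) (fun u => ?_) (fun u => Or.inl (conn_right _ _ u))
        rw [haa', Perm.mul_apply, Equiv.swap_apply_def]
        have h0 := hE'.symm (conn_left a' b u)
        split_ifs with k1 k2
        · exact Or.inr ⟨Or.inl (k1 ▸ h0), Or.inr (hE'.refl _)⟩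
        · exact Or.inr ⟨Or.inr (k2 ▸ h0), Or.inl (hE'.refl _)⟩
        · exact Or.inl (hE'.symm h0)
      have hjoin : ∀ u v, conn a b u v ↔ join (conn a' b) x y u v := by
        refine fun u v => ⟨hge, ?_⟩
        have hxy : conn a b x y := conn_left a b x
        rintro (h | ⟨h | h, h' | h'⟩)
        · exact hle h
        · exact hE.trans (hE.symm (hle h)) (hle h')
        · grind [hE.trans, hE.symm]
        · grind [hE.trans, hE.symm]
        · exact hE.trans (hE.symm (hle h)) (hle h')
      by_cases hc : conn a' b x y
      · have heq : conn a b = conn a' b := by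
          ext u v
          refine ⟨fun h => ?_, hle⟩
          rcases hge h with h | ⟨h | h, h' | h'⟩
          · exact h
          · exact hE'.trans (hE'.symm h) h'
          · exact hE'.trans (hE'.symm h) (hE'.trans hc h')
          · grind [hE'.trans, hE'.symm]
          · exact hE'.trans (hE'.symm h) h'
        rw [heq]
        by_cases hs : (b * a').SameCycle (b x) (b y)
        · have e2 := cyc_swap_mul_of_sameCycle hba'D hbx hby (fun h => hax (b.injective h).symm) hs
          grind
        · have e2 := cyc_swap_mul hba'D hbx hby hs
          grind
      · have e3 := classes_join hE' hx hyD hc hjoin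
        have hs : ¬ (b * a').SameCycle (b x) (b y) := by
          intro hs
          exact hc (hE'.trans (conn_right _ _ x) (hE'.trans (conn_of_sameCycle_mul hs)
            (hE'.symm (conn_right _ _ y))))
        have e2 := cyc_swap_mul hba'D hbx hby hs
        grind
    · rw [← hn]
      apply Finset.card_lt_card
      rw [Finset.ssubset_iff_of_subset]
      · exact ⟨x, by simp [hx, ← hy, hax], by simp [ha'x]⟩
      · intro z hz
        simp only [Finset.mem_filter] at hz ⊢
        refine ⟨hz.1, fun haz => hz.2 ?_⟩
        have hzx : z ≠ x := by grind
        rw [ha', Perm.mul_apply, haz, Equiv.swap_apply_of_ne_of_ne hzx]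
        rintro rfl
        exact hax (a.injective haz).symm.symm

/-- The discrete Jordan curve theorem: in a planar map, two corners `x` and `y` that lie in the same
face and at the same vertex bound a closed curve, and cutting along it disconnects the map. -/
theorem not_connected_of_pinch {a b : Perm ℕ} (ha : ∀ x ∉ D, a x = x) (hb : ∀ x ∉ D, b x = x)
    (hS : D.card + 2 ≤ cyc D a + cyc D b + cyc D (b * a)) {x y : ℕ} (hx : x ∈ D) (hy : y ∈ D)
    (hxy : x ≠ y) (h1 : b.SameCycle x y) (h2 : (b * a).SameCycle x y) :
    ¬ ∀ u ∈ D, ∀ v ∈ D, conn a (Equiv.swap x y * b) u v := by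
  intro hall
  have e1 := cyc_swap_mul_of_sameCycle hb hx hy hxy h1
  have hba : ∀ z ∉ D, (b * a) z = z := fun z hz => by rw [Perm.mul_apply, ha z hz, hb z hz]
  have e2 := cyc_swap_mul_of_sameCycle hba hx hy hxy h2
  have e3 := genus_inequality a (Equiv.swap x y * b) ha (swap_mul_fixed hb hx hy)
  rw [mul_assoc] at e3
  have e4 : classes D (conn a (Equiv.swap x y * b)) ≤ 1 := by
    unfold classes
    rw [Set.ncard_le_one ((Finset.finite_toSet _).image _)]
    rintro s ⟨u, hu, rfl⟩ t ⟨v, hv, rfl⟩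
    exact (class_eq_iff (conn_equivalence _ _)).2 (hall u hu v hv)
  omega

end Genus

theorem cycle_ncard_eq_three {p : Perm ℕ} {D : Finset ℕ} (hD : ∀ x ∉ D, p x = x) (x : ℕ) :
    {y | p.SameCycle x y}.ncard = 3 ↔ p (p (p x)) = x ∧ p x ≠ x := by
  classical
  constructor
  · intro h
    have hex := exists_pow_fixed hD x
    obtain ⟨hk, hkx⟩ := Nat.find_spec hex
    set k := Nat.find hex with hkdef
    have hmin : ∀ i, 0 < i → i < k → (p ^ i) x ≠ x :=
      fun i hi hik he => Nat.find_min hex hik ⟨hi, he⟩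
    have hset : {y | p.SameCycle x y} = (fun i : ℕ => (p ^ i) x) '' (Finset.range k : Set ℕ) := by
      ext y
      constructor
      · intro hy
        refine mem_of_sameCycle hD ?_ hy ⟨0, by simpa using hk, rfl⟩
        rintro _ ⟨i, hi, rfl⟩
        simp only [Finset.coe_range, Set.mem_Iio] at hi
        simp only [← Perm.mul_apply, ← pow_succ']
        rcases Nat.lt_or_ge (i + 1) k with h3 | h3
        · grind
        · exact ⟨0, by simpa using hk, by rw [show i + 1 = k by omega, hkx]; rfl⟩
      · rintro ⟨i, -, rfl⟩
        exact ⟨i, by simp⟩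
    have hinj : Set.InjOn (fun i : ℕ => (p ^ i) x) (Finset.range k : Set ℕ) := by
      have key : ∀ i j, i < j → j < k → (p ^ i) x ≠ (p ^ j) x := by
        intro i j hij hj he
        apply hmin (j - i) (by omega) (by omega)
        apply (p ^ i).injective
        rw [← Perm.mul_apply, ← pow_add, show i + (j - i) = j by omega, he]
      intro i hi j hj he
      grind
    rw [hset, hinj.ncard_image, Set.ncard_coe_finset, Finset.card_range] at h
    rw [h] at hkx hmin
    exact ⟨by simpa [pow_succ] using hkx, by simpa using hmin 1 (by omega) (by omega)⟩
  · rintro ⟨h3, h1⟩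
    have hset : {y | p.SameCycle x y} = {x, p x, p (p x)} := by
      ext y
      constructor
      · intro hy
        refine mem_of_sameCycle hD ?_ hy (by simp)
        grind
      · rintro (rfl | rfl | rfl)
        · exact .refl _ _
        · exact sameCycle_apply _ _
        · exact (sameCycle_apply p x).trans (sameCycle_apply _ _)
    rw [hset, Set.ncard_eq_three]
    grind

namespace PercMap

/-! ### Dart structures -/

/-- The conditions on the darts of a map that do not involve planarity or colours. -/
structure Comb (M : PercMap) : Prop where
  rev_mem : ∀ d ∈ M.darts, M.rev d ∈ M.darts
  rev_ne : ∀ d ∈ M.darts, M.rev d ≠ d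
  rev_rev : ∀ d, M.rev (M.rev d) = d
  rev_fix : ∀ d, d ∉ M.darts → M.rev d = d
  next_fix : ∀ d, d ∉ M.darts → M.next d = d
  root_mem : M.root ∈ M.darts

variable {M : PercMap}

theorem IsPlanarMap.comb (h : M.IsPlanarMap) : M.Comb where
  rev_mem := h.rev_mem
  rev_ne := h.rev_ne
  rev_rev d := by
    by_cases hd : d ∈ M.darts
    · exact h.rev_rev d hd
    · rw [h.rev_fix d hd, h.rev_fix d hd]
  rev_fix := h.rev_fix
  next_fix := h.next_fix
  root_mem := h.root_mem

theorem rot_apply (M : PercMap) (d : ℕ) : M.rot d = M.next (M.rev d) := rfl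

theorem mem_faceOf {d x : ℕ} : x ∈ M.faceOf d ↔ M.next.SameCycle d x := Iff.rfl

theorem mem_vertexOf {d x : ℕ} : x ∈ M.vertexOf d ↔ M.rot.SameCycle d x := Iff.rfl

theorem mem_rootFace {x : ℕ} : x ∈ M.rootFace ↔ M.next.SameCycle M.root x := Iff.rfl

theorem root_mem_rootFace : M.root ∈ M.rootFace := Perm.SameCycle.refl _ _

theorem faceOf_eq_iff {a b : ℕ} : M.faceOf a = M.faceOf b ↔ b ∈ M.faceOf a :=
  class_eq_iff (Perm.SameCycle.equivalence _)

theorem vertexOf_eq_iff {a b : ℕ} : M.vertexOf a = M.vertexOf b ↔ b ∈ M.vertexOf a :=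
  class_eq_iff (Perm.SameCycle.equivalence _)

theorem edgeOf_eq_iff {a b : ℕ} : M.edgeOf a = M.edgeOf b ↔ b ∈ M.edgeOf a :=
  class_eq_iff (Perm.SameCycle.equivalence _)

theorem self_mem_faceOf (d : ℕ) : d ∈ M.faceOf d := Perm.SameCycle.refl _ _

theorem self_mem_vertexOf (d : ℕ) : d ∈ M.vertexOf d := Perm.SameCycle.refl _ _

theorem self_mem_edgeOf (d : ℕ) : d ∈ M.edgeOf d := Perm.SameCycle.refl _ _

theorem mem_vertexOf_comm {a b : ℕ} : a ∈ M.vertexOf b ↔ b ∈ M.vertexOf a :=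
  Perm.sameCycle_comm

theorem mem_faceOf_comm {a b : ℕ} : a ∈ M.faceOf b ↔ b ∈ M.faceOf a :=
  Perm.sameCycle_comm

theorem next_mem_rootFace {x : ℕ} : M.next x ∈ M.rootFace ↔ x ∈ M.rootFace :=
  Perm.sameCycle_apply_right

theorem symm_mem_rootFace {x : ℕ} : M.next.symm x ∈ M.rootFace ↔ x ∈ M.rootFace := by
  rw [← next_mem_rootFace, Equiv.apply_symm_apply]

theorem next_mem_faceOf {d x : ℕ} : M.next x ∈ M.faceOf d ↔ x ∈ M.faceOf d :=
  Perm.sameCycle_apply_right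

theorem rot_mem_vertexOf {d x : ℕ} : M.rot x ∈ M.vertexOf d ↔ x ∈ M.vertexOf d :=
  Perm.sameCycle_apply_right

theorem mem_rootFace_of_mem_faceOf {d x : ℕ} (h : x ∈ M.faceOf d) :
    x ∈ M.rootFace ↔ d ∈ M.rootFace := by
  rw [mem_rootFace, mem_rootFace]
  exact ⟨fun k => k.trans (Perm.SameCycle.symm h), fun k => k.trans h⟩

namespace Comb

variable (hM : M.Comb)
include hM

theorem rev_mem_iff {d : ℕ} : M.rev d ∈ M.darts ↔ d ∈ M.darts := apply_mem_iff hM.rev_fix d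

theorem next_mem_iff {d : ℕ} : M.next d ∈ M.darts ↔ d ∈ M.darts := apply_mem_iff hM.next_fix d

theorem rot_fix (d : ℕ) (hd : d ∉ M.darts) : M.rot d = d := by
  rw [rot_apply, hM.rev_fix d hd, hM.next_fix d hd]

theorem rot_rev (d : ℕ) : M.rot (M.rev d) = M.next d := by rw [rot_apply, hM.rev_rev]

theorem next_mem_vertexOf_rev (d : ℕ) : M.next d ∈ M.vertexOf (M.rev d) := by
  rw [← hM.rot_rev]; exact sameCycle_apply _ _

theorem next_mem_vertexOf_iff {d x : ℕ} : M.next x ∈ M.vertexOf d ↔ M.rev x ∈ M.vertexOf d := by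
  rw [← hM.rot_rev, rot_mem_vertexOf]

theorem vertexOf_next (d : ℕ) : M.vertexOf (M.next d) = M.vertexOf (M.rev d) :=
  (vertexOf_eq_iff.2 (hM.next_mem_vertexOf_rev d)).symm

theorem rootFace_sub {d : ℕ} (hd : d ∈ M.rootFace) : d ∈ M.darts :=
  (sameCycle_mem_iff hM.next_fix hd).1 hM.root_mem

theorem faceOf_sub {d x : ℕ} (hx : x ∈ M.faceOf d) : x ∈ M.darts ↔ d ∈ M.darts :=
  (sameCycle_mem_iff hM.next_fix hx).symm

theorem vertexOf_sub {d x : ℕ} (hx : x ∈ M.vertexOf d) : x ∈ M.darts ↔ d ∈ M.darts :=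
  (sameCycle_mem_iff hM.rot_fix hx).symm

theorem rev_sameCycle {a b : ℕ} : M.rev.SameCycle a b ↔ b = a ∨ b = M.rev a := by
  constructor
  · intro h
    refine mem_of_sameCycle hM.rev_fix (S := {x | x = a ∨ x = M.rev a}) ?_ h (Or.inl rfl)
    rintro x (rfl | rfl)
    · exact Or.inr rfl
    · exact Or.inl (hM.rev_rev _)
  · rintro (rfl | rfl)
    · exact .refl _ _
    · exact sameCycle_apply _ _

theorem edgeOf_eq (d : ℕ) : M.edgeOf d = {d, M.rev d} := by
  ext x; exact hM.rev_sameCycle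

theorem mem_edgeOf {d x : ℕ} : x ∈ M.edgeOf d ↔ x = d ∨ x = M.rev d := hM.rev_sameCycle

end Comb

/-- Connectedness, in terms of sets of darts stable under `rev` and `next`. -/
theorem connected_iff :
    (∀ d ∈ M.darts, ∃ g ∈ Subgroup.closure {M.rev, M.next}, g M.root = d) ↔
      ∀ S : Set ℕ, M.root ∈ S → (∀ x, x ∈ S ↔ M.rev x ∈ S) → (∀ x, x ∈ S ↔ M.next x ∈ S) →
        ∀ d ∈ M.darts, d ∈ S := by
  constructor
  · intro h S h0 h1 h2 d hd
    obtain ⟨g, hg, rfl⟩ := h d hd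
    have key : ∀ x, x ∈ S ↔ g x ∈ S := by
      clear hd
      induction hg using Subgroup.closure_induction with
      | mem g hg =>
        grind
      | one => intro x; rfl
      | mul a b _ _ ha hb => intro x; rw [hb x, ha (b x)]; rfl
      | inv a _ ha =>
        intro x
        rw [ha (a⁻¹ x), ← Perm.mul_apply, mul_inv_cancel]; rfl
    exact (key _).1 h0
  · intro h
    refine h {d | ∃ g ∈ Subgroup.closure {M.rev, M.next}, g M.root = d} ⟨1, one_mem _, rfl⟩ ?_ ?_
    all_goals
      intro x
      constructor
    · rintro ⟨g, hg, rfl⟩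
      exact ⟨M.rev * g, mul_mem (Subgroup.subset_closure (by simp)) hg, rfl⟩
    · rintro ⟨g, hg, he⟩
      refine ⟨M.rev⁻¹ * g, mul_mem (inv_mem (Subgroup.subset_closure (by simp))) hg, ?_⟩
      rw [Perm.mul_apply, he, ← Perm.mul_apply, inv_mul_cancel]; rfl
    · rintro ⟨g, hg, rfl⟩
      exact ⟨M.next * g, mul_mem (Subgroup.subset_closure (by simp)) hg, rfl⟩
    · rintro ⟨g, hg, he⟩
      refine ⟨M.next⁻¹ * g, mul_mem (inv_mem (Subgroup.subset_closure (by simp))) hg, ?_⟩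
      rw [Perm.mul_apply, he, ← Perm.mul_apply, inv_mul_cancel]; rfl

/-! ### Triangulations -/

namespace IsPlanarMap

variable (hM : M.IsPlanarMap)
include hM

theorem white_mem {d : ℕ} (hd : d ∈ M.white) : d ∈ M.darts := hM.white_sub hd

theorem white_rot_iff (d : ℕ) : M.rot d ∈ M.white ↔ d ∈ M.white := by
  by_cases hd : d ∈ M.darts
  · exact hM.white_rot d hd
  · rw [hM.comb.rot_fix d hd]

theorem white_next (d : ℕ) : M.next d ∈ M.white ↔ M.rev d ∈ M.white := by
  rw [← hM.comb.rot_rev, hM.white_rot_iff]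

theorem white_vertexOf {d x : ℕ} (h : x ∈ M.vertexOf d) : x ∈ M.white ↔ d ∈ M.white :=
  (mem_iff_of_sameCycle (fun x => (hM.white_rot_iff x).symm) h).symm

end IsPlanarMap

/-- A dart from a black vertex to a white one. -/
def BW (M : PercMap) (g : ℕ) : Prop := g ∉ M.white ∧ M.rev g ∈ M.white

namespace IsTriangulation

variable (hM : M.IsTriangulation)
include hM

theorem comb : M.Comb := hM.toIsPlanarMap.comb

theorem next3 {g : ℕ} (hg : g ∈ M.darts) (hg' : g ∉ M.rootFace) :
    M.next (M.next (M.next g)) = g ∧ M.next g ≠ g :=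
  (cycle_ncard_eq_three hM.comb.next_fix g).1 (hM.triangle g hg hg')

theorem symm_eq {g : ℕ} (hg : g ∈ M.darts) (hg' : g ∉ M.rootFace) :
    M.next.symm g = M.next (M.next g) := by
  rw [Equiv.symm_apply_eq, (hM.next3 hg hg').1]

theorem mem_faceOf_inner {g x : ℕ} (hg : g ∈ M.darts) (hg' : g ∉ M.rootFace) :
    x ∈ M.faceOf g ↔ x = g ∨ x = M.next g ∨ x = M.next (M.next g) := by
  constructor
  · intro h
    refine mem_of_sameCycle hM.comb.next_fix
      (S := {x | x = g ∨ x = M.next g ∨ x = M.next (M.next g)}) ?_ h (Or.inl rfl)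
    grind [hM.next3]
  · rintro (rfl | rfl | rfl)
    · exact self_mem_faceOf _
    · exact next_mem_faceOf.2 (self_mem_faceOf _)
    · exact next_mem_faceOf.2 (next_mem_faceOf.2 (self_mem_faceOf _))

theorem outer_eq {x y : ℕ} (hx : x ∈ M.rootFace) (hy : y ∈ M.rootFace) (h : y ∈ M.vertexOf x) :
    x = y := hM.simple x hx y hy h

theorem rev_not_vertexOf {d : ℕ} (hd : d ∈ M.darts) : M.rev d ∉ M.vertexOf d := hM.loopless d hd

theorem next_ne {d : ℕ} (hd : d ∈ M.darts) : M.next d ≠ d := by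
  intro h
  have := hM.comb.next_mem_vertexOf_rev d
  rw [h, mem_vertexOf_comm] at this
  exact hM.loopless d hd this

/-- If both sides of an edge lie in the root-face, then the map has a single edge. -/
theorem single_edge {d : ℕ} (hd : d ∈ M.rootFace) (hd' : M.rev d ∈ M.rootFace) :
    M.next d = M.rev d ∧ M.next (M.rev d) = d ∧ (∀ x, x ∈ M.darts ↔ x = d ∨ x = M.rev d) := by
  have h1 : M.next d = M.rev d :=
    (hM.outer_eq hd' (next_mem_rootFace.2 hd) (hM.comb.next_mem_vertexOf_rev d)).symm
  have h2 : M.next (M.rev d) = d := by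
    refine (hM.outer_eq hd (next_mem_rootFace.2 hd') ?_).symm
    have := hM.comb.next_mem_vertexOf_rev (M.rev d)
    rwa [hM.comb.rev_rev] at this
  refine ⟨h1, h2, fun x => ⟨fun hx => ?_, ?_⟩⟩
  · have hroot : M.root = d ∨ M.root = M.rev d := by
      refine mem_of_sameCycle hM.comb.next_fix (S := {x | x = d ∨ x = M.rev d}) ?_
        (Perm.SameCycle.symm hd) (Or.inl rfl)
      grind
    refine connected_iff.1 hM.connected {x | x = d ∨ x = M.rev d} hroot ?_ ?_ x hx
    · intro x
      simp only [Set.mem_ofPred_eq]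
      constructor
      · grind [hM.comb.rev_rev]
      · rintro (h | h)
        · exact Or.inr (by rw [← h, hM.comb.rev_rev])
        · exact Or.inl (M.rev.injective h)
    · intro x
      simp only [Set.mem_ofPred_eq]
      constructor
      · grind
      · rintro (h | h)
        · exact Or.inr (M.next.injective (h.trans h2.symm))
        · exact Or.inl (M.next.injective (h.trans h1.symm))
  · grind [hM.comb.rootFace_sub]

end IsTriangulation

/-! The boundary of a map satisfying the root-interface condition. -/

section Boundary

/-- Going around the root-face from the root, the origins of the darts are black up to the top-edge,
and then white up to the root. -/
theorem exists_boundary (hM : M.IsTriangulation) (hR : M.RootInterface) :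
    ∃ τ n : ℕ, 1 ≤ τ ∧ τ < n ∧ (M.next ^ n) M.root = M.root ∧
      (∀ i, 1 ≤ i → i < n → (M.next ^ i) M.root ≠ M.root) ∧
      (∀ i, 1 ≤ i → i ≤ τ → (M.next ^ i) M.root ∉ M.white) ∧
      (∀ i, τ < i → i ≤ n → (M.next ^ i) M.root ∈ M.white) := by
  classical
  have hex := exists_pow_fixed hM.comb.next_fix M.root
  obtain ⟨hn, hnr⟩ := Nat.find_spec hex
  set n := Nat.find hex with hndef
  have hmin : ∀ i, 1 ≤ i → i < n → (M.next ^ i) M.root ≠ M.root :=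
    fun i hi hik he => Nat.find_min hex hik ⟨hi, he⟩
  have hex2 : ∃ i, (M.next ^ (i + 1)) M.root ∈ M.white :=
    ⟨n - 1, by rw [Nat.sub_add_cancel hn, hnr]; exact hR.1.1⟩
  have hτ := Nat.find_spec hex2
  set τ := Nat.find hex2 with hτdef
  have hτmin : ∀ i < τ, (M.next ^ (i + 1)) M.root ∉ M.white := fun i hi => Nat.find_min hex2 hi
  have hτn : τ < n := by
    have := Nat.find_min' hex2 (m := n - 1) (by rw [Nat.sub_add_cancel hn, hnr]; exact hR.1.1)
    omega
  have h1 : 1 ≤ τ := by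
    by_contra h0
    rw [show τ = 0 by omega] at hτ
    simp only [zero_add, pow_one] at hτ
    rw [hM.white_next] at hτ
    exact hR.1.2 hτ
  refine ⟨τ, n, h1, hτn, hnr, hmin, ?_, ?_⟩
  · intro i hi hiτ
    have := hτmin (i - 1) (by omega)
    grind
  · intro i hi
    induction i, hi using Nat.le_induction with
    | base => intro _; exact hτ
    | succ i hi ih =>
      intro hin
      have hw := ih (by omega)
      rw [pow_succ', Perm.mul_apply, hM.white_next]
      by_contra hb
      exact hR.2 _ (show M.next.SameCycle _ _ from ⟨i, by simp⟩)
        (hmin i (by omega) (by omega)) ⟨hw, hb⟩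

theorem rootFace_pow (hM : M.Comb) {x : ℕ} (hx : x ∈ M.rootFace) {n : ℕ} (hn : 0 < n)
    (hnr : (M.next ^ n) M.root = M.root) : ∃ i, 1 ≤ i ∧ i ≤ n ∧ (M.next ^ i) M.root = x := by
  refine mem_of_sameCycle hM.next_fix
    (S := {x | ∃ i, 1 ≤ i ∧ i ≤ n ∧ (M.next ^ i) M.root = x}) ?_ hx ⟨n, hn, le_rfl, hnr⟩
  rintro _ ⟨i, h1, h2, rfl⟩
  rcases Nat.lt_or_ge i n with h | h
  · exact ⟨i + 1, by omega, by omega, by rw [pow_succ', Perm.mul_apply]⟩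
  · exact ⟨1, le_rfl, hn, by rw [show i = n by omega, hnr, pow_one]⟩

theorem bw_outer_unique (hM : M.IsTriangulation) (hR : M.RootInterface) :
    ∃ t, ∀ x, (x ∈ M.rootFace ∧ M.BW x) ↔ x = t := by
  obtain ⟨τ, n, h1, hτn, hnr, -, hb, hw⟩ := exists_boundary hM hR
  refine ⟨(M.next ^ τ) M.root, fun x => ⟨?_, ?_⟩⟩
  · rintro ⟨hx, hx1, hx2⟩
    obtain ⟨i, hi1, hin, rfl⟩ := rootFace_pow hM.comb hx (by omega) hnr
    rw [← hM.white_next, ← Perm.mul_apply, ← pow_succ'] at hx2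
    grind
  · rintro rfl
    refine ⟨⟨τ, by simp⟩, hb τ h1 le_rfl, ?_⟩
    rw [← hM.white_next, ← Perm.mul_apply, ← pow_succ']
    exact hw _ (by omega) (by omega)

theorem bw_outer_iff (hM : M.IsTriangulation) (hR : M.RootInterface) {x : ℕ} :
    (x ∈ M.rootFace ∧ M.BW x) ↔ x = M.top := by
  obtain ⟨t, ht⟩ := bw_outer_unique hM hR
  have : M.top = t := by
    have hset : {d | d ∈ M.rootFace ∧ d ∉ M.white ∧ M.rev d ∈ M.white} = {t} := by
      ext x; exact ht x
    rw [top, hset, csInf_singleton]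
  rw [ht, this]

theorem top_mem (hM : M.IsTriangulation) (hR : M.RootInterface) : M.top ∈ M.rootFace :=
  ((bw_outer_iff hM hR).2 rfl).1

theorem top_bw (hM : M.IsTriangulation) (hR : M.RootInterface) : M.BW M.top :=
  ((bw_outer_iff hM hR).2 rfl).2

theorem eq_top (hM : M.IsTriangulation) (hR : M.RootInterface) {x : ℕ} (hx : x ∈ M.rootFace)
    (h : M.BW x) : x = M.top := (bw_outer_iff hM hR).1 ⟨hx, h⟩

end Boundary

/-! ### The percolation path -/

section Path

theorem entry_zero (M : PercMap) : M.entry 0 = M.rev M.root := rfl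

theorem entry_succ (M : PercMap) (k : ℕ) : M.entry (k + 1) = M.interfaceStep (M.entry k) :=
  Function.iterate_succ_apply' _ _ _

theorem interfaceStep_white {g : ℕ} (h : M.next (M.next g) ∈ M.white) :
    M.interfaceStep g = M.rev (M.next (M.next g)) := by simp [interfaceStep, h]

theorem interfaceStep_black {g : ℕ} (h : M.next (M.next g) ∉ M.white) :
    M.interfaceStep g = M.rev (M.next g) := by simp [interfaceStep, h]

/-- The path crosses inner darts until the index `K`, where it leaves the map. -/
structure PathEnd (M : PercMap) (K : ℕ) : Prop where
  inner : ∀ l < K, M.entry l ∉ M.rootFace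
  outer : M.entry K ∈ M.rootFace

theorem PathEnd.unique {K K' : ℕ} (h : M.PathEnd K) (h' : M.PathEnd K') : K = K' := by
  rcases lt_trichotomy K K' with hl | hl | hl
  · exact absurd h.outer (h'.inner _ hl)
  · exact hl
  · exact absurd h'.outer (h.inner _ hl)

variable (hM : M.IsTriangulation)
include hM

theorem BW.mem {g : ℕ} (hg : M.BW g) : g ∈ M.darts := by
  rw [← hM.comb.rev_mem_iff]
  exact hM.white_mem hg.2

theorem BW.interfaceStep {g : ℕ} (hg : M.BW g) (hg' : g ∉ M.rootFace) :
    M.BW (M.interfaceStep g) := by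
  have hgD := BW.mem hM hg
  have h3 := (hM.next3 hgD hg').1
  by_cases h : M.next (M.next g) ∈ M.white
  · rw [interfaceStep_white h]
    refine ⟨?_, by rwa [hM.comb.rev_rev]⟩
    rw [← hM.white_next, h3]
    exact hg.1
  · rw [interfaceStep_black h]
    refine ⟨by rwa [← hM.white_next], ?_⟩
    rw [hM.comb.rev_rev, hM.white_next]
    exact hg.2

/-- An inner triangle has at most one dart from black to white. -/
theorem BW.unique {g g' : ℕ} (hg : M.BW g) (hi : g ∉ M.rootFace) (hg' : M.BW g')
    (h : g' ∈ M.faceOf g) : g' = g := by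
  have hgD := BW.mem hM hg
  have h3 := (hM.next3 hgD hi).1
  rcases (hM.mem_faceOf_inner hgD hi).1 h with rfl | rfl | rfl
  · rfl
  · exact absurd ((hM.white_next _).2 hg.2) hg'.1
  · have := (hM.white_next _).2 hg'.2
    rw [h3] at this
    exact absurd this hg.1

theorem rev_interfaceStep_mem (g : ℕ) : M.rev (M.interfaceStep g) ∈ M.faceOf g := by
  unfold PercMap.interfaceStep
  split_ifs <;> rw [hM.comb.rev_rev]
  · exact next_mem_faceOf.2 (next_mem_faceOf.2 (self_mem_faceOf _))
  · exact next_mem_faceOf.2 (self_mem_faceOf _)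

theorem entry_bw (hR : M.RootInterface) {k : ℕ} (h : ∀ l < k, M.entry l ∉ M.rootFace) :
    M.BW (M.entry k) := by
  induction k with
  | zero =>
    rw [entry_zero]
    exact ⟨hR.1.2, by rw [hM.comb.rev_rev]; exact hR.1.1⟩
  | succ k ih =>
    rw [entry_succ]
    exact (ih fun l hl => h l (by omega)).interfaceStep hM (h k (by omega))

theorem entry_injective (hR : M.RootInterface) {i j : ℕ} (hij : i < j)
    (h : ∀ l < j, M.entry l ∉ M.rootFace) : M.entry i ≠ M.entry j := by
  induction i generalizing j with
  | zero =>
    intro he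
    obtain ⟨j, rfl⟩ : ∃ j', j = j' + 1 := ⟨j - 1, by omega⟩
    grind [rev_interfaceStep_mem, entry_succ, entry_zero, hM.comb.rev_rev,
        mem_rootFace_of_mem_faceOf, root_mem_rootFace]
  | succ i ih =>
    intro he
    obtain ⟨j, rfl⟩ : ∃ j', j = j' + 1 := ⟨j - 1, by omega⟩
    have h1 := rev_interfaceStep_mem hM (M.entry j)
    have h2 := rev_interfaceStep_mem hM (M.entry i)
    rw [← entry_succ, ← he, entry_succ] at h1
    have hbi := entry_bw hM hR (k := i) fun l hl => h l (by omega)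
    have hbj := entry_bw hM hR (k := j) fun l hl => h l (by omega)
    apply ih (j := j) (by omega) fun l hl => h l (by omega)
    exact (hbi.unique hM (h i (by omega)) hbj
      (Perm.SameCycle.trans h2 (Perm.SameCycle.symm h1))).symm

/-- The percolation path leaves the map, through the top-edge. -/
theorem exists_pathEnd (hR : M.RootInterface) : ∃ K, M.PathEnd K := by
  classical
  by_cases hex : ∃ K, M.entry K ∈ M.rootFace
  · exact ⟨Nat.find hex, fun l hl => Nat.find_min hex hl, Nat.find_spec hex⟩
  · push Not at hex
    exfalso
    obtain ⟨i, j, hij, he⟩ := M.darts.finite_toSet.exists_lt_map_eq_of_forall_mem (f := M.entry)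
      fun k => (entry_bw hM hR (fun l _ => hex l)).mem hM
    grind [entry_injective]

variable {K : ℕ} (hK : M.PathEnd K)
include hK

theorem PathEnd.bw (hR : M.RootInterface) {l : ℕ} (hl : l ≤ K) : M.BW (M.entry l) :=
  entry_bw hM hR fun i hi => hK.inner i (by omega)

theorem PathEnd.mem (hR : M.RootInterface) {l : ℕ} (hl : l ≤ K) : M.entry l ∈ M.darts :=
  (hK.bw hM hR hl).mem hM

theorem PathEnd.eq_top (hR : M.RootInterface) : M.entry K = M.top :=
  PercMap.eq_top hM hR hK.outer (hK.bw hM hR le_rfl)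

theorem PathEnd.inj (hR : M.RootInterface) {i j : ℕ} (hi : i ≤ K) (hj : j ≤ K)
    (h : M.entry i = M.entry j) : i = j := by
  rcases lt_trichotomy i j with hl | hl | hl
  · exact absurd h (entry_injective hM hR hl fun l hl => hK.inner l (by omega))
  · exact hl
  · exact absurd h.symm (entry_injective hM hR hl fun l hl => hK.inner l (by omega))

theorem PathEnd.face_inj (hR : M.RootInterface) {i j : ℕ} (hi : i < K) (hj : j < K)
    (h : M.entry j ∈ M.faceOf (M.entry i)) : i = j :=
  hK.inj hM hR hi.le hj.le
    ((hK.bw hM hR hi.le).unique hM (hK.inner i hi) (hK.bw hM hR hj.le) h).symm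

omit hM in
theorem PathEnd.onPathAt {k : ℕ} {f : Set ℕ} : M.OnPathAt k f ↔ k < K ∧ M.entry k ∈ f := by
  constructor
  · rintro ⟨h, h'⟩
    refine ⟨?_, h'⟩
    by_contra hk
    exact h K (by omega) hK.outer
  · rintro ⟨h, h'⟩
    exact ⟨fun i hi => hK.inner i (by omega), h'⟩

/-- The path visits the triangle at the top-edge last. -/
theorem PathEnd.top_face {l : ℕ} (hl : l + 1 = K) (hR : M.RootInterface) :
    M.rev M.top ∈ M.faceOf (M.entry l) := by
  have := rev_interfaceStep_mem hM (M.entry l)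
  rwa [← entry_succ, hl, hK.eq_top hM hR] at this

end Path

/-- Two paths agree as long as the interface steps do. -/
theorem entry_congr {M N : PercMap} {k : ℕ} (h0 : N.rev N.root = M.rev M.root)
    (h : ∀ l < k, N.interfaceStep (M.entry l) = M.interfaceStep (M.entry l)) {l : ℕ} (hl : l ≤ k) :
    N.entry l = M.entry l := by
  induction l with
  | zero => exact h0
  | succ l ih => rw [entry_succ, entry_succ, ih (by omega), h l (by omega)]

theorem vertices_ncard (M : PercMap) : M.vertices.ncard = cyc M.darts M.rot := rfl

theorem faces_ncard (M : PercMap) : M.faces.ncard = cyc M.darts M.next := rfl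

theorem edges_ncard (M : PercMap) : M.edges.ncard = cyc M.darts M.rev := rfl

/-! ### Gluing a triangle to an outer edge -/

section Glue

/-- The labels `p`, `q`, `p'`, `q'` are distinct and not used by darts of `D`. -/
structure Fresh4 (D : Finset ℕ) (p q p' q' : ℕ) : Prop where
  p_mem : p ∉ D
  q_mem : q ∉ D
  p'_mem : p' ∉ D
  q'_mem : q' ∉ D
  pq : p ≠ q
  pp' : p ≠ p'
  pq' : p ≠ q'
  qp' : q ≠ p'
  qq' : q ≠ q'
  p'q' : p' ≠ q'

/-- Gluing a triangle to the dart `d`, with arbitrary labels for the new darts and an arbitrary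
colouring. -/
def glueAt (M : PercMap) (d p q p' q' : ℕ) (W : Set ℕ) : PercMap where
  darts := M.darts ∪ {p, q, p', q'}
  rev := Equiv.swap p p' * Equiv.swap q q' * M.rev
  next := [d, p, q, M.next d, q', p'].formPerm * M.next
  root := M.root
  white := W

variable (hM : M.Comb) {d p q p' q' : ℕ} {W : Set ℕ} (hd : d ∈ M.darts) (hnd : M.next d ≠ d)
  (hF : Fresh4 M.darts p q p' q')
include hM hF

omit hM hF in
theorem glueAt_mem {x : ℕ} : x ∈ (M.glueAt d p q p' q' W).darts ↔
    x ∈ M.darts ∨ x = p ∨ x = q ∨ x = p' ∨ x = q' := by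
  simp only [glueAt, Finset.mem_union, Finset.mem_insert, Finset.mem_singleton]

theorem glueAt_rev (x : ℕ) : (M.glueAt d p q p' q' W).rev x =
    if x = p then p' else if x = p' then p else if x = q then q' else if x = q' then q
    else M.rev x := by
  obtain ⟨h1, h2, h3, h4, -, -, -, -, -, -⟩ := id hF
  have k1 := hM.rev_fix p h1
  have k2 := hM.rev_fix q h2
  have k3 := hM.rev_fix p' h3
  have k4 := hM.rev_fix q' h4
  have hi := M.rev.injective
  obtain ⟨-, -, -, -, a1, a2, a3, a4, a5, a6⟩ := hF
  simp only [glueAt, Perm.mul_apply, Equiv.swap_apply_def]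
  grind

include hd hnd

theorem glueAt_next (x : ℕ) : (M.glueAt d p q p' q' W).next x =
    if x = d then q' else if x = q' then p' else if x = p' then d else if x = p then q
    else if x = q then M.next d else if M.next x = d then p else M.next x := by
  obtain ⟨h1, h2, h3, h4, -, -, -, -, -, -⟩ := id hF
  have k1 := hM.next_fix p h1
  have k2 := hM.next_fix q h2
  have k3 := hM.next_fix p' h3
  have k4 := hM.next_fix q' h4
  have hi := M.next.injective
  obtain ⟨-, -, -, -, a1, a2, a3, a4, a5, a6⟩ := hF
  simp only [glueAt, Perm.mul_apply, List.formPerm_cons_cons, List.formPerm_singleton,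
    Equiv.swap_apply_def, mul_one]
  have e3 : M.next x = p' ↔ x = p' := by grind
  have e4 : M.next x = q' ↔ x = q' := by grind
  simp only [e3, e4]
  grind

/-- The values of `rev` and `next` after gluing a triangle. -/
theorem glueAt_values :
    (M.glueAt d p q p' q' W).rev p = p' ∧ (M.glueAt d p q p' q' W).rev p' = p ∧
    (M.glueAt d p q p' q' W).rev q = q' ∧ (M.glueAt d p q p' q' W).rev q' = q ∧
    (M.glueAt d p q p' q' W).next d = q' ∧ (M.glueAt d p q p' q' W).next q' = p' ∧
    (M.glueAt d p q p' q' W).next p' = d ∧ (M.glueAt d p q p' q' W).next p = q ∧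
    (M.glueAt d p q p' q' W).next q = M.next d ∧
    (∀ x ∈ M.darts, (M.glueAt d p q p' q' W).rev x = M.rev x) ∧
    (∀ x, M.next x = d → (M.glueAt d p q p' q' W).next x = p) ∧
    (∀ x ∈ M.darts, x ≠ d → M.next x ≠ d → (M.glueAt d p q p' q' W).next x = M.next x) := by
  have hR := glueAt_rev hM (W := W) (d := d) hF
  have hX := glueAt_next hM (W := W) hd hnd hF
  have hm : ∀ x, M.next x = d → x ∈ M.darts := fun x hx => hM.next_mem_iff.1 (hx ▸ hd)
  obtain ⟨m1, m2, m3, m4, a1, a2, a3, a4, a5, a6⟩ := id hF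
  have b4 : q' ≠ d := fun h => m4 (h ▸ hd)
  grind

theorem glueAt_rot (x : ℕ) : (M.glueAt d p q p' q' W).rot x =
    if x = M.rev d then q' else if x = q' then M.next d else if x = p then d else if x = q then p'
    else if x = p' then q else if M.rot x = d then p else M.rot x := by
  have hrd := hM.rev_mem d hd
  have c1 : p ≠ M.rev d := fun h => hF.p_mem (h ▸ hrd)
  have c2 : q ≠ M.rev d := fun h => hF.q_mem (h ▸ hrd)
  have c3 : p' ≠ M.rev d := fun h => hF.p'_mem (h ▸ hrd)
  have c4 : q' ≠ M.rev d := fun h => hF.q'_mem (h ▸ hrd)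
  have e0 : M.rev x = d ↔ x = M.rev d := by grind [hM.rev_rev]
  have k1 := hM.rev_fix p hF.p_mem
  have k2 := hM.rev_fix q hF.q_mem
  have k3 := hM.rev_fix p' hF.p'_mem
  have k4 := hM.rev_fix q' hF.q'_mem
  have hi := M.rev.injective
  have e4 : M.rev x = q' ↔ x = q' := by grind
  rw [rot_apply, glueAt_rev hM hF, glueAt_next hM hd hnd hF, rot_apply]
  obtain ⟨-, -, -, -, a1, a2, a3, a4, a5, a6⟩ := hF
  grind

theorem glueAt_comb : (M.glueAt d p q p' q' W).Comb where
  rev_mem x hx := by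
    grind [glueAt_mem, glueAt_rev, hM.rev_mem]
  rev_ne x hx := by
    rw [glueAt_mem] at hx
    rw [glueAt_rev hM hF]
    have := hM.rev_ne x
    obtain ⟨-, -, -, -, a1, a2, a3, a4, a5, a6⟩ := hF
    grind
  rev_rev x := by
    rw [glueAt_rev hM hF, glueAt_rev hM hF]
    have := hM.rev_rev x
    have k1 := hM.rev_fix p hF.p_mem
    have k2 := hM.rev_fix q hF.q_mem
    have k3 := hM.rev_fix p' hF.p'_mem
    have k4 := hM.rev_fix q' hF.q'_mem
    obtain ⟨-, -, -, -, a1, a2, a3, a4, a5, a6⟩ := hF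
    grind
  rev_fix x hx := by
    grind [glueAt_mem, glueAt_rev, hM.rev_fix]
  next_fix x hx := by
    grind [glueAt_mem, glueAt_next, hM.next_fix]
  root_mem := by
    rw [glueAt_mem]
    exact Or.inl hM.root_mem

theorem glueAt_rot_sameCycle {a b : ℕ} (ha : a ∈ M.darts) (hb : b ∈ M.darts) :
    (M.glueAt d p q p' q' W).rot.SameCycle a b ↔ M.rot.SameCycle a b := by
  have hR := glueAt_rot hM (W := W) hd hnd hF
  have hrd := hM.rot_rev d
  have h0 : ∀ u, M.rot.SameCycle u u := fun u => .refl _ _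
  have h1 : ∀ u, M.rot.SameCycle u (M.rot u) := sameCycle_apply _
  have l1 := hM.rot_fix p hF.p_mem
  have l3 := hM.rot_fix p' hF.p'_mem
  have l4 := hM.rot_fix q' hF.q'_mem
  have hi : ∀ {u v}, M.rot u = M.rot v → u = v := fun h => M.rot.injective h
  obtain ⟨m1, m2, m3, m4, a1, a2, a3, a4, a5, a6⟩ := id hF
  constructor
  · intro h
    have := sameCycle_map (p := (M.glueAt d p q p' q' W).rot) (q := M.rot)
      (f := fun u => if u = p then d else if u = q' then M.next d else if u = p' then q else u)
      (fun u => ?_) h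
    · grind
    · rw [hR u]
      have hndD := hM.next_mem_iff.2 hd
      have := h1 u
      grind
  · refine sameCycle_map (p := M.rot) (q := (M.glueAt d p q p' q' W).rot) (f := fun u => u)
      (fun u => ?_)
    have g1 : ∀ u, (M.glueAt d p q p' q' W).rot.SameCycle u ((M.glueAt d p q p' q' W).rot u) :=
      sameCycle_apply _
    have s1 := g1 u
    have s2 := s1.trans (g1 _)
    have hrd' := hM.rev_mem d hd
    by_cases c1 : u = M.rev d
    · subst c1
      rw [hrd]
      rw [hR (M.rev d), if_pos rfl, hR q'] at s2
      grind
    by_cases c2 : u ∈ M.darts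
    · by_cases c3 : M.rot u = d
      · rw [c3]
        have : (M.glueAt d p q p' q' W).rot u = p := by rw [hR]; grind
        rw [this, hR p] at s2
        grind
      · have : (M.glueAt d p q p' q' W).rot u = M.rot u := by rw [hR]; grind
        rwa [this] at s1
    · rw [hM.rot_fix u c2]

theorem glueAt_next_sameCycle {a b : ℕ} (ha : a ∈ M.darts) (hb : b ∈ M.darts) (had : a ≠ d)
    (hbd : b ≠ d) :
    (M.glueAt d p q p' q' W).next.SameCycle a b ↔ M.next.SameCycle a b := by
  have hR := glueAt_next hM (W := W) hd hnd hF
  have h0 : ∀ u, M.next.SameCycle u u := fun u => .refl _ _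
  have h1 : ∀ u, M.next.SameCycle u (M.next u) := sameCycle_apply _
  have l1 := hM.next_fix p hF.p_mem
  have l2 := hM.next_fix q hF.q_mem
  have l3 := hM.next_fix p' hF.p'_mem
  have l4 := hM.next_fix q' hF.q'_mem
  have hi : ∀ {u v}, M.next u = M.next v → u = v := fun h => M.next.injective h
  obtain ⟨m1, m2, m3, m4, a1, a2, a3, a4, a5, a6⟩ := id hF
  constructor
  · intro h
    have := sameCycle_map (p := (M.glueAt d p q p' q' W).next) (q := M.next)
      (f := fun u => if u = p ∨ u = q ∨ u = p' ∨ u = q' then d else u)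
      (fun u => ?_) h
    · grind
    · rw [hR u]
      have := h1 u
      grind
  · intro h
    have := sameCycle_map (p := M.next) (q := (M.glueAt d p q p' q' W).next)
      (f := fun u => if u = d then p else u) (fun u => ?_) h
    · grind
    · have g1 : ∀ u, (M.glueAt d p q p' q' W).next.SameCycle u
        ((M.glueAt d p q p' q' W).next u) := sameCycle_apply _
      by_cases c1 : u = d
      · subst c1
        have s2 := (g1 p).trans (g1 _)
        rw [hR p] at s2
        grind
      by_cases c2 : u ∈ M.darts
      · by_cases c3 : M.next u = d
        · have : (M.glueAt d p q p' q' W).next u = p := by rw [hR]; grind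
          grind
        · have : (M.glueAt d p q p' q' W).next u = M.next u := by rw [hR]; grind
          grind
      · have := hM.next_fix u c2
        rw [this]

theorem glueAt_faceOf_d {x : ℕ} :
    (M.glueAt d p q p' q' W).next.SameCycle d x ↔ x = d ∨ x = q' ∨ x = p' := by
  have hR := glueAt_next hM (W := W) hd hnd hF
  have hC := glueAt_comb hM (W := W) hd hnd hF
  obtain ⟨m1, m2, m3, m4, a1, a2, a3, a4, a5, a6⟩ := id hF
  have e1 : (M.glueAt d p q p' q' W).next d = q' := by rw [hR]; grind
  have e2 : (M.glueAt d p q p' q' W).next q' = p' := by rw [hR]; grind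
  have e3 : (M.glueAt d p q p' q' W).next p' = d := by rw [hR]; grind
  constructor
  · intro h
    refine mem_of_sameCycle hC.next_fix (S := {x | x = d ∨ x = q' ∨ x = p'}) ?_ h (Or.inl rfl)
    rintro x (rfl | rfl | rfl) <;> simp [e1, e2, e3]
  · have g1 : ∀ u, (M.glueAt d p q p' q' W).next.SameCycle u
        ((M.glueAt d p q p' q' W).next u) := sameCycle_apply _
    rintro (rfl | rfl | rfl)
    · exact .refl _ _
    · grind
    · have := (g1 d).trans (g1 _)
      rwa [e1, e2] at this

theorem glueAt_cyc_rot :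
    cyc (M.glueAt d p q p' q' W).darts (M.glueAt d p q p' q' W).rot = cyc M.darts M.rot + 1 := by
  classical
  have hR := glueAt_rot hM (W := W) hd hnd hF
  have hC := glueAt_comb hM (W := W) hd hnd hF
  set N := M.glueAt d p q p' q' W with hN
  have l1 := hM.rot_fix p hF.p_mem
  have l2 := hM.rot_fix q hF.q_mem
  have l3 := hM.rot_fix p' hF.p'_mem
  have l4 := hM.rot_fix q' hF.q'_mem
  have hrd := hM.rev_mem d hd
  have hrr := hM.rot_rev d
  have hi : ∀ {u v}, M.rot u = M.rot v → u = v := fun h => M.rot.injective h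
  obtain ⟨m1, m2, m3, m4, a1, a2, a3, a4, a5, a6⟩ := id hF
  have hfix : ∀ {P : Perm ℕ} {D : Finset ℕ} (e : ℕ), (∀ x ∉ D, P x = x) →
      ∀ x ∉ D.erase e, removeDart P e x = x := by
    grind [removeDart_apply]
  have s1 := cyc_removeDart hC.rot_fix (d := p) (by rw [hN, glueAt_mem]; simp)
    (by rw [hR]; grind)
  have s2 := cyc_removeDart (hfix p hC.rot_fix) (d := q')
    (by rw [Finset.mem_erase, hN, glueAt_mem]; simp [a3.symm])
    (by rw [removeDart_apply, hR]; grind)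
  have s3 := cyc_removeDart (hfix q' (hfix p hC.rot_fix)) (d := q)
    (by rw [Finset.mem_erase, Finset.mem_erase, hN, glueAt_mem]; simp [a1.symm, a5])
    (by rw [removeDart_apply, removeDart_apply, hR]; grind)
  have r4 : M.rev d ≠ q' := fun h => m4 (h ▸ hrd)
  have hP1 : ∀ x, removeDart N.rot p x = if x = M.rev d then q' else if x = q' then M.next d
      else if x = q then p' else if x = p' then q else M.rot x := by
    intro x
    simp only [removeDart_apply, hR]
    grind
  have hP2 : ∀ x, removeDart (removeDart N.rot p) q' x =
      if x = q then p' else if x = p' then q else M.rot x := by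
    intro x
    rw [removeDart_apply]
    simp only [hP1]
    grind
  have hP : removeDart (removeDart (removeDart N.rot p) q') q = M.rot := by
    grind [removeDart_apply]
  rw [hP] at s3
  have s4 := cyc_erase_of_fixed (D := ((N.darts.erase p).erase q').erase q) (p := M.rot) (d := p')
    (by simp only [Finset.mem_erase, hN, glueAt_mem]; grind) l3
  have hD : (((N.darts.erase p).erase q').erase q).erase p' = M.darts := by
    ext x
    simp only [Finset.mem_erase, hN, glueAt_mem]
    grind
  rw [hD] at s4
  omega

theorem glueAt_cyc_next :
    cyc (M.glueAt d p q p' q' W).darts (M.glueAt d p q p' q' W).next = cyc M.darts M.next + 1 := by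
  classical
  have hR := glueAt_next hM (W := W) hd hnd hF
  have hC := glueAt_comb hM (W := W) hd hnd hF
  set N := M.glueAt d p q p' q' W with hN
  have l1 := hM.next_fix p hF.p_mem
  have l2 := hM.next_fix q hF.q_mem
  have l3 := hM.next_fix p' hF.p'_mem
  have l4 := hM.next_fix q' hF.q'_mem
  have hndD := hM.next_mem_iff.2 hd
  have hi : ∀ {u v}, M.next u = M.next v → u = v := fun h => M.next.injective h
  obtain ⟨m1, m2, m3, m4, a1, a2, a3, a4, a5, a6⟩ := id hF
  have b3 : d ≠ p' := fun h => m3 (h ▸ hd)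
  have b4 : d ≠ q' := fun h => m4 (h ▸ hd)
  have hfix : ∀ {P : Perm ℕ} {D : Finset ℕ} (e : ℕ), (∀ x ∉ D, P x = x) →
      ∀ x ∉ D.erase e, removeDart P e x = x := by
    grind [removeDart_apply]
  have s1 := cyc_removeDart hC.next_fix (d := p) (by rw [hN, glueAt_mem]; simp)
    (by rw [hR]; grind)
  have s2 := cyc_removeDart (hfix p hC.next_fix) (d := q)
    (by rw [Finset.mem_erase, hN, glueAt_mem]; simp [a1.symm])
    (by rw [removeDart_apply, hR]; grind)
  have s3 := cyc_removeDart (hfix q (hfix p hC.next_fix)) (d := q')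
    (by rw [Finset.mem_erase, Finset.mem_erase, hN, glueAt_mem]; simp [a3.symm, a5.symm])
    (by simp only [removeDart_apply, hR]; grind)
  have s4 := cyc_removeDart (hfix q' (hfix q (hfix p hC.next_fix))) (d := p')
    (by simp only [Finset.mem_erase, hN, glueAt_mem]; grind)
    (by simp only [removeDart_apply, hR]; grind)
  have hP1 : ∀ x, removeDart N.next p x = if x = d then q' else if x = q' then p'
      else if x = p' then d else if x = q then M.next d else if M.next x = d then q
      else M.next x := by
    intro x
    simp only [removeDart_apply, hR]
    grind
  have hP2 : ∀ x, removeDart (removeDart N.next p) q x =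
      if x = d then q' else if x = q' then p' else if x = p' then d
      else if M.next x = d then M.next d else M.next x := by
    intro x
    rw [removeDart_apply]
    simp only [hP1]
    grind
  have hP : removeDart (removeDart (removeDart (removeDart N.next p) q) q') p'
      = removeDart M.next d := by
    ext x
    simp only [removeDart_apply _ p', removeDart_apply _ q', removeDart_apply _ d, hP2]
    grind
  have hD : (((N.darts.erase p).erase q).erase q').erase p' = M.darts := by
    ext x
    grind [glueAt_mem]
  rw [hP, hD] at s4
  have s5 := cyc_erase_of_fixed hd (removeDart_self M.next d)
  have s6 := cyc_removeDart hM.next_fix hd hnd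
  omega

theorem glueAt_cyc_rev :
    cyc (M.glueAt d p q p' q' W).darts (M.glueAt d p q p' q' W).rev = cyc M.darts M.rev + 2 := by
  classical
  have hR := glueAt_rev hM (W := W) (d := d) hF
  have hC := glueAt_comb hM (W := W) hd hnd hF
  set N := M.glueAt d p q p' q' W with hN
  have l1 := hM.rev_fix p hF.p_mem
  have l2 := hM.rev_fix q hF.q_mem
  have l3 := hM.rev_fix p' hF.p'_mem
  have l4 := hM.rev_fix q' hF.q'_mem
  have hi : ∀ {u v}, M.rev u = M.rev v → u = v := fun h => M.rev.injective h
  obtain ⟨m1, m2, m3, m4, a1, a2, a3, a4, a5, a6⟩ := id hF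
  have hfix : ∀ {P : Perm ℕ} {D : Finset ℕ} (e : ℕ), (∀ x ∉ D, P x = x) →
      ∀ x ∉ D.erase e, removeDart P e x = x := by
    grind [removeDart_apply]
  have s1 := cyc_removeDart hC.rev_fix (d := p) (by rw [hN, glueAt_mem]; simp)
    (by rw [hR]; grind)
  have s2 := cyc_removeDart (hfix p hC.rev_fix) (d := q)
    (by rw [Finset.mem_erase, hN, glueAt_mem]; simp [a1.symm])
    (by rw [removeDart_apply, hR]; grind)
  have hP : removeDart (removeDart N.rev p) q = M.rev := by
    ext x
    simp only [removeDart_apply, hR]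
    grind
  rw [hP] at s2
  have s3 := cyc_erase_of_fixed (D := (N.darts.erase p).erase q) (d := p')
    (by simp only [Finset.mem_erase, hN, glueAt_mem]; grind) l3
  have s4 := cyc_erase_of_fixed (D := ((N.darts.erase p).erase q).erase p') (d := q')
    (by simp only [Finset.mem_erase, hN, glueAt_mem]; grind) l4
  have hD : (((N.darts.erase p).erase q).erase p').erase q' = M.darts := by
    grind [glueAt_mem]
  rw [hD] at s4
  omega

theorem glueAt_euler_iff : ((M.glueAt d p q p' q' W).vertices.ncard +
      (M.glueAt d p q p' q' W).faces.ncard = (M.glueAt d p q p' q' W).edges.ncard + 2) ↔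
    M.vertices.ncard + M.faces.ncard = M.edges.ncard + 2 := by
  simp only [vertices_ncard, faces_ncard, edges_ncard]
  rw [glueAt_cyc_rot hM hd hnd hF, glueAt_cyc_next hM hd hnd hF, glueAt_cyc_rev hM hd hnd hF]
  omega

theorem glueAt_connected {S : Set ℕ} :
    ((∀ x, x ∈ S ↔ (M.glueAt d p q p' q' W).rev x ∈ S) ∧
      (∀ x, x ∈ S ↔ (M.glueAt d p q p' q' W).next x ∈ S)) ↔
    (∀ x, x ∈ S ↔ M.rev x ∈ S) ∧ (∀ x, x ∈ S ↔ M.next x ∈ S) ∧ (p ∈ S ↔ d ∈ S) ∧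
      (q ∈ S ↔ d ∈ S) ∧ (p' ∈ S ↔ d ∈ S) ∧ (q' ∈ S ↔ d ∈ S) := by
  obtain ⟨v1, v2, v3, v4, v5, v6, v7, v8, v9, v10, v11, v12⟩ := glueAt_values hM (W := W) hd hnd hF
  have hC := glueAt_comb hM (W := W) hd hnd hF
  have hmem := fun x => glueAt_mem (M := M) (d := d) (p := p) (q := q) (p' := p') (q' := q')
    (W := W) (x := x)
  have l : ∀ z, z ∉ M.darts → M.next z = z := hM.next_fix
  have k : ∀ z, z ∉ M.darts → M.rev z = z := hM.rev_fix
  obtain ⟨m1, m2, m3, m4, -, -, -, -, -, -⟩ := id hF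
  generalize M.glueAt d p q p' q' W = N at *
  have n1 := hC.next_fix
  have n2 := hC.rev_fix
  constructor
  · rintro ⟨h1, h2⟩
    have f1 := h2 p
    have f2 := h2 q
    have f3 := h2 d
    have f4 := h2 p'
    have f5 := h1 p
    have f6 := h1 q
    rw [v8] at f1
    rw [v9] at f2
    rw [v5] at f3
    rw [v7] at f4
    rw [v1] at f5
    rw [v3] at f6
    refine ⟨fun z => ?_, fun z => ?_, f5.trans f4, f6.trans f3.symm, f4, f3.symm⟩
    · by_cases hz : z ∈ M.darts
      · rw [← v10 z hz]; exact h1 z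
      · rw [k z hz]
    · by_cases hz : z ∈ M.darts
      · grind
      · rw [l z hz]
  · rintro ⟨h1, h2, f1, f2, f3, f4⟩
    refine ⟨fun z => ?_, fun z => ?_⟩
    · by_cases hz : z ∈ N.darts
      · grind
      · rw [n2 z hz]
    · have e := h2 d
      by_cases hz : z ∈ N.darts
      · grind
      · rw [n1 z hz]

theorem glueAt_connected_iff :
    (∀ x ∈ (M.glueAt d p q p' q' W).darts, ∃ g ∈ Subgroup.closure
      {(M.glueAt d p q p' q' W).rev, (M.glueAt d p q p' q' W).next},
        g (M.glueAt d p q p' q' W).root = x) ↔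
      ∀ x ∈ M.darts, ∃ g ∈ Subgroup.closure {M.rev, M.next}, g M.root = x := by
  rw [connected_iff, connected_iff]
  have hroot : (M.glueAt d p q p' q' W).root = M.root := rfl
  constructor
  · intro h S h0 h1 h2 x hx
    obtain ⟨S', hS'⟩ : ∃ S' : Set ℕ, ∀ z, z ∈ S' ↔
        if z = p ∨ z = q ∨ z = p' ∨ z = q' then d ∈ S else z ∈ S := ⟨{z | _}, fun z => Iff.rfl⟩
    have hold : ∀ z ∈ M.darts, z ∈ S' ↔ z ∈ S := by
      intro z hz
      obtain ⟨m1, m2, m3, m4, -, -, -, -, -, -⟩ := hF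
      grind
    have hnew : ∀ z, z ∉ M.darts → M.rev z = z ∧ M.next z = z := by grind [hM.rev_fix, hM.next_fix]
    have hd1 := hold d hd
    have key := (glueAt_connected hM (W := W) (S := S') hd hnd hF).2
      ⟨fun z => ?_, fun z => ?_, ?_, ?_, ?_, ?_⟩
    · rw [← hold x hx]
      exact h S' (by rw [hroot, hold _ hM.root_mem]; exact h0) key.1 key.2 x
        (glueAt_mem.2 (Or.inl hx))
    · by_cases hz : z ∈ M.darts
      · grind [hM.rev_mem]
      · rw [(hnew z hz).1]
    · by_cases hz : z ∈ M.darts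
      · rw [hold z hz, hold _ (hM.next_mem_iff.2 hz), ← h2]
      · rw [(hnew z hz).2]
    all_goals rw [hd1, hS']; simp
  · intro h S h0 h1 h2
    obtain ⟨k1, k2, f1, f2, f3, f4⟩ := (glueAt_connected hM (W := W) hd hnd hF).1 ⟨h1, h2⟩
    have key := h S h0 k1 k2
    have hdS := key d hd
    intro x hx
    rcases glueAt_mem.1 hx with hx | rfl | rfl | rfl | rfl
    · exact key x hx
    · exact f1.2 hdS
    · exact f2.2 hdS
    · exact f3.2 hdS
    · exact f4.2 hdS

end Glue

/-! ### Gluing two consecutive outer edges -/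

section Zip

/-- The two consecutive darts `x` and `y` of a face of degree at least 3 can be glued together. -/
structure Zippable (M : PercMap) (x y : ℕ) : Prop where
  mem : x ∈ M.darts
  next_x : M.next x = y
  ne : y ≠ x
  rev_ne : M.rev x ≠ y
  next_y : M.next y ≠ x
  next_rev_x : M.next (M.rev x) ≠ x
  next_rev_y : M.next (M.rev y) ≠ x
  root_x : M.root ≠ x
  root_y : M.root ≠ y

/-- Gluing the outer darts `x` and `y = next x`, with an arbitrary colouring of the result. -/
def zipAt (M : PercMap) (x y : ℕ) (W : Set ℕ) : PercMap where
  darts := M.darts \ {x, y}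
  rev := Equiv.swap (M.rev x) (M.rev y) * Equiv.swap x (M.rev x) * Equiv.swap y (M.rev y) * M.rev
  next := removeDart (removeDart M.next x) y
  root := M.root
  white := W

variable (hM : M.Comb) {x y : ℕ} {W : Set ℕ} (hz : M.Zippable x y)

theorem zipAt_mem {z : ℕ} : z ∈ (M.zipAt x y W).darts ↔ z ∈ M.darts ∧ z ≠ x ∧ z ≠ y := by
  simp only [zipAt, Finset.mem_sdiff, Finset.mem_insert, Finset.mem_singleton, not_or]

include hM hz

theorem Zippable.mem_y : y ∈ M.darts := by
  rw [← hz.next_x, hM.next_mem_iff]; exact hz.mem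

/-- Distinctness of the darts involved in the gluing. -/
theorem Zippable.distinct : M.rev x ≠ x ∧ M.rev y ≠ y ∧ M.rev x ≠ y ∧ M.rev y ≠ x ∧
    M.rev x ≠ M.rev y ∧ M.next y ≠ y ∧ M.next (M.rev x) ≠ y ∧ M.next (M.rev y) ≠ y := by
  have h1 := hM.rev_ne x hz.mem
  have h4 : M.rev y ≠ x := fun h => hz.rev_ne (by rw [← h, hM.rev_rev])
  refine ⟨h1, hM.rev_ne y (hz.mem_y hM), hz.rev_ne, h4, fun h => hz.ne (M.rev.injective h).symm,
    fun h => ?_, fun h => ?_, fun h => ?_⟩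
  · exact hz.ne (M.next.injective (h.trans hz.next_x.symm))
  · exact h1 (M.next.injective (h.trans hz.next_x.symm))
  · exact h4 (M.next.injective (h.trans hz.next_x.symm))

/-- The values of `rev` and `next` after gluing. -/
theorem zipAt_values :
    (M.zipAt x y W).rev x = x ∧ (M.zipAt x y W).rev y = y ∧
    (M.zipAt x y W).rev (M.rev x) = M.rev y ∧ (M.zipAt x y W).rev (M.rev y) = M.rev x ∧
    (∀ z, z ≠ x → z ≠ y → z ≠ M.rev x → z ≠ M.rev y → (M.zipAt x y W).rev z = M.rev z) ∧
    (M.zipAt x y W).next x = x ∧ (M.zipAt x y W).next y = y ∧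
    (∀ z, M.next z = x → (M.zipAt x y W).next z = M.next y) ∧
    (∀ z, z ≠ x → z ≠ y → M.next z ≠ x → (M.zipAt x y W).next z = M.next z) := by
  obtain ⟨d1, d2, d3, d4, d5, d6, d7, d8⟩ := hz.distinct hM
  have hne := hz.ne
  have hrr := hM.rev_rev
  have hrev : ∀ z, (M.zipAt x y W).rev z = if z = x then x else if z = y then y
      else if z = M.rev x then M.rev y else if z = M.rev y then M.rev x else M.rev z := by
    intro z
    have e1 : M.rev z = y ↔ z = M.rev y := by grind
    have e2 : M.rev z = M.rev y ↔ z = y := M.rev.injective.eq_iff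
    have e3 : M.rev z = x ↔ z = M.rev x := by grind
    have e4 : M.rev z = M.rev x ↔ z = x := M.rev.injective.eq_iff
    simp only [zipAt, Perm.mul_apply, Equiv.swap_apply_def, e1, e2]
    clear hM hz hrr
    grind
  have hnext : ∀ z, (M.zipAt x y W).next z = if z = x then x else if z = y then y
      else if M.next z = x then M.next y else M.next z := by
    intro z
    have e1 : M.next z = y ↔ z = x := by rw [← hz.next_x]; exact M.next.injective.eq_iff
    have h1 := hz.next_x
    have h2 := hz.next_y
    simp only [zipAt, removeDart_apply]
    clear hM hrr hrev hz
    grind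
  refine ⟨?_, ?_, ?_, ?_, fun z h1 h2 h3 h4 => ?_, ?_, ?_, fun z h => ?_, fun z h1 h2 h3 => ?_⟩
  · simp [hrev]
  · simp [hrev, hne]
  · simp [hrev, d1, d3]
  · simp [hrev, d2, d4, d5.symm]
  · simp [hrev, h1, h2, h3, h4]
  · simp [hnext]
  · simp [hnext, hne]
  · have h1 : z ≠ x := by rintro rfl; exact hne (hz.next_x.symm.trans h)
    have h2 : z ≠ y := by rintro rfl; exact hz.next_y h
    simp [hnext, h1, h2, h]
  · simp [hnext, h1, h2, h3]

theorem zipAt_rot_values :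
    (M.zipAt x y W).rot x = x ∧ (M.zipAt x y W).rot y = y ∧
    (M.zipAt x y W).rot (M.rev x) = M.next (M.rev y) ∧
    (M.zipAt x y W).rot (M.rev y) = M.next (M.rev x) ∧
    (∀ z, M.rot z = x → (M.zipAt x y W).rot z = M.next y) ∧
    (∀ z, z ≠ x → z ≠ y → z ≠ M.rev x → z ≠ M.rev y → M.rot z ≠ x →
      (M.zipAt x y W).rot z = M.rot z) := by
  obtain ⟨d1, d2, d3, d4, d5, d6, d7, d8⟩ := hz.distinct hM
  obtain ⟨v1, v2, v3, v4, v5, v6, v7, v8, v9⟩ := zipAt_values (W := W) hM hz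
  have hrr := hM.rev_rev
  refine ⟨?_, ?_, ?_, ?_, fun z h => ?_, fun z h1 h2 h3 h4 h5 => ?_⟩
  · rw [rot_apply, v1, v6]
  · rw [rot_apply, v2, v7]
  · rw [rot_apply, v3, v9 _ d4 d2 hz.next_rev_y]
  · rw [rot_apply, v4, v9 _ d1 d3 hz.next_rev_x]
  · have k1 : z ≠ x := by rintro rfl; exact hz.next_rev_x h
    have k2 : z ≠ y := by rintro rfl; exact hz.next_rev_y h
    grind [hM.rot_rev, hz.next_x, hz.ne, hz.next_y, rot_apply]
  · grind [rot_apply]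

theorem zipAt_comb : (M.zipAt x y W).Comb := by
  obtain ⟨d1, d2, d3, d4, d5, d6, d7, d8⟩ := hz.distinct hM
  obtain ⟨v1, v2, v3, v4, v5, v6, v7, v8, v9⟩ := zipAt_values (W := W) hM hz
  have hrr := hM.rev_rev
  have hry := hM.rev_mem y (hz.mem_y hM)
  have hrx := hM.rev_mem x hz.mem
  have hb : ∀ z a, M.rev z = a → z = M.rev a := by grind
  refine ⟨fun z h => ?_, fun z h => ?_, fun z => ?_, fun z h => ?_, fun z h => ?_, ?_⟩
  · grind [zipAt_mem, hM.rev_mem]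
  · grind [zipAt_mem, d5.symm, hM.rev_ne]
  · grind
  · by_cases k1 : z = x
    · rw [k1, v1]
    by_cases k2 : z = y
    · rw [k2, v2]
    have hzD : z ∉ M.darts := fun h' => h (zipAt_mem.2 ⟨h', k1, k2⟩)
    grind [hM.rev_fix]
  · by_cases k1 : z = x
    · rw [k1, v6]
    by_cases k2 : z = y
    · rw [k2, v7]
    have hzD : z ∉ M.darts := fun h' => h (zipAt_mem.2 ⟨h', k1, k2⟩)
    grind [hM.next_fix]
  · exact zipAt_mem.2 ⟨hM.root_mem, hz.root_x, hz.root_y⟩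

omit hM hz in
theorem zipAt_next_sameCycle {a b : ℕ} (ha : a ≠ x) (hb : b ≠ x) (ha' : a ≠ y) (hb' : b ≠ y) :
    (M.zipAt x y W).next.SameCycle a b ↔ M.next.SameCycle a b := by
  rw [zipAt, removeDart_sameCycle _ ha' hb', removeDart_sameCycle _ ha hb]

/-- The rotation after gluing: the vertices of `x` and of `next y` are joined, and the darts `x`
and `y` are removed. -/
theorem zipAt_rot_eq : (M.zipAt x y W).rot =
    removeDart (removeDart (Equiv.swap x (M.next y) * M.rot) x) y := by
  obtain ⟨d1, d2, d3, d4, d5, d6, d7, d8⟩ := hz.distinct hM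
  obtain ⟨w1, w2, w3, w4, w5, w6⟩ := zipAt_rot_values (W := W) hM hz
  have e1 : M.rot (M.rev x) = y := by rw [hM.rot_rev, hz.next_x]
  have e2 : M.rot (M.rev y) = M.next y := hM.rot_rev y
  have hne := hz.ne
  have f1 : M.rot x ≠ x := hz.next_rev_x
  have f2 : M.rot y ≠ x := hz.next_rev_y
  have f3 : M.rot x ≠ y := d7
  have f4 : M.rot y ≠ y := d8
  have f5 : M.rot x ≠ M.next y := fun h => d4 (M.rot.injective (h.trans e2.symm)).symm
  have f6 : M.rot y ≠ M.next y := fun h => d2 (M.rot.injective (h.trans e2.symm)).symm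
  have f7 := hz.next_y
  have hP : ∀ z, removeDart (Equiv.swap x (M.next y) * M.rot) x z = if z = x then x else
      if z = M.rev y then M.rot x else if M.rot z = x then M.next y else M.rot z := by
    intro z
    have e3 : M.rot z = M.next y ↔ z = M.rev y := by rw [← e2]; exact M.rot.injective.eq_iff
    rw [removeDart_apply]
    simp only [Perm.mul_apply, Equiv.swap_apply_def, e3]
    grind
  ext z
  have e3 : M.rot z = y ↔ z = M.rev x := by rw [← e1]; exact M.rot.injective.eq_iff
  rw [removeDart_apply]
  simp only [hP]
  by_cases k1 : z = x
  · grind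
  by_cases k2 : z = y
  · subst k2; rw [w2]; simp
  by_cases h1 : z = M.rev x
  · subst h1; rw [w3]
    have : M.rot y = M.next (M.rev y) := rfl
    grind
  by_cases h2 : z = M.rev y
  · subst h2; rw [w4]
    have : M.rot x = M.next (M.rev x) := rfl
    simp [k2, k1, this, d7]
  grind

theorem zipAt_rot_sameCycle (hv : ¬ M.rot.SameCycle x (M.next y)) {a b : ℕ}
    (ha : a ≠ x) (hb : b ≠ x) (ha' : a ≠ y) (hb' : b ≠ y) :
    (M.zipAt x y W).rot.SameCycle a b ↔ join M.rot.SameCycle x (M.next y) a b := by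
  rw [zipAt_rot_eq hM hz, removeDart_sameCycle _ ha' hb', removeDart_sameCycle _ ha hb,
    sameCycle_swap_mul hM.rot_fix hv]

theorem zipAt_cyc_next : cyc (M.zipAt x y W).darts (M.zipAt x y W).next = cyc M.darts M.next := by
  classical
  obtain ⟨d1, d2, d3, d4, d5, d6, d7, d8⟩ := hz.distinct hM
  have hy := hz.mem_y hM
  have hfix : ∀ z ∉ M.darts.erase x, removeDart M.next x z = z := by
    grind [removeDart_apply, hM.next_fix]
  have s1 := cyc_removeDart hM.next_fix hz.mem (by rw [hz.next_x]; exact hz.ne)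
  have s2 := cyc_removeDart hfix (d := y) (Finset.mem_erase.2 ⟨hz.ne, hy⟩)
    (by rw [removeDart_apply, if_neg hz.ne, if_neg hz.next_y]; exact d6)
  have hD : (M.darts.erase x).erase y = (M.zipAt x y W).darts := by
    grind [zipAt_mem]
  rw [hD] at s2
  exact s2.trans s1

theorem zipAt_cyc_rot (hv : ¬ M.rot.SameCycle x (M.next y)) :
    cyc M.darts M.rot = cyc (M.zipAt x y W).darts (M.zipAt x y W).rot + 1 := by
  classical
  obtain ⟨d1, d2, d3, d4, d5, d6, d7, d8⟩ := hz.distinct hM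
  have hy := hz.mem_y hM
  have hn : M.next y ∈ M.darts := hM.next_mem_iff.2 hy
  set P := Equiv.swap x (M.next y) * M.rot with hPdef
  have hPfix : ∀ z ∉ M.darts, P z = z := swap_mul_fixed hM.rot_fix hz.mem hn
  have f5 : M.rot x ≠ M.next y := fun h =>
    d4 (M.rot.injective (h.trans (hM.rot_rev y).symm)).symm
  have f6 : M.rot y ≠ M.next y := fun h =>
    d2 (M.rot.injective (h.trans (hM.rot_rev y).symm)).symm
  have f1 : M.rot x ≠ x := hz.next_rev_x
  have f2 : M.rot y ≠ x := hz.next_rev_y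
  have f4 : M.rot y ≠ y := d8
  have hPx : P x = M.rot x := by
    rw [hPdef, Perm.mul_apply, Equiv.swap_apply_of_ne_of_ne f1 f5]
  have hPy : P y = M.rot y := by
    rw [hPdef, Perm.mul_apply, Equiv.swap_apply_of_ne_of_ne f2 f6]
  have hfix : ∀ z ∉ M.darts.erase x, removeDart P x z = z := by
    grind [removeDart_apply]
  have s0 := cyc_swap_mul hM.rot_fix hz.mem hn hv
  have s1 := cyc_removeDart hPfix hz.mem (by rw [hPx]; exact f1)
  have s2 := cyc_removeDart hfix (d := y) (Finset.mem_erase.2 ⟨hz.ne, hy⟩)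
    (by rw [removeDart_apply, if_neg hz.ne, hPy, if_neg f2]; exact f4)
  have hD : (M.darts.erase x).erase y = (M.zipAt x y W).darts := by
    grind [zipAt_mem]
  grind [zipAt_rot_eq]

theorem zipAt_cyc_rev :
    cyc M.darts M.rev = cyc (M.zipAt x y W).darts (M.zipAt x y W).rev + 1 := by
  classical
  obtain ⟨d1, d2, d3, d4, d5, d6, d7, d8⟩ := hz.distinct hM
  obtain ⟨v1, v2, v3, v4, v5, v6, v7, v8, v9⟩ := zipAt_values (W := W) hM hz
  have hy := hz.mem_y hM
  have hrr := hM.rev_rev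
  have hfix : ∀ z ∉ M.darts.erase x, removeDart M.rev x z = z := by
    grind [removeDart_apply, hM.rev_fix]
  have s1 := cyc_removeDart hM.rev_fix hz.mem d1
  have s2 := cyc_removeDart hfix (d := y) (Finset.mem_erase.2 ⟨hz.ne, hy⟩)
    (by rw [removeDart_apply, if_neg hz.ne, if_neg d4]; exact d2)
  have hD : (M.darts.erase x).erase y = (M.zipAt x y W).darts := by
    grind [zipAt_mem]
  rw [hD] at s2
  have hP : (M.zipAt x y W).rev =
      Equiv.swap (M.rev x) (M.rev y) * removeDart (removeDart M.rev x) y := by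
    ext z
    rw [Perm.mul_apply, removeDart_apply]
    simp only [removeDart_apply]
    grind
  have hQfix : ∀ z ∉ (M.zipAt x y W).darts, removeDart (removeDart M.rev x) y z = z := by
    grind [removeDart_apply]
  have hQ : removeDart (removeDart M.rev x) y (M.rev x) = M.rev x := by
    grind [removeDart_apply]
  have s3 := cyc_swap_mul hQfix (x := M.rev x) (y := M.rev y)
    (zipAt_mem.2 ⟨hM.rev_mem x hz.mem, d1, d3⟩) (zipAt_mem.2 ⟨hM.rev_mem y hy, d4, d2⟩)
    (by rw [sameCycle_of_fixed hQ]; exact d5)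
  rw [← hP] at s3
  omega

theorem zipAt_euler_iff (hv : ¬ M.rot.SameCycle x (M.next y)) :
    ((M.zipAt x y W).vertices.ncard + (M.zipAt x y W).faces.ncard
      = (M.zipAt x y W).edges.ncard + 2) ↔
    M.vertices.ncard + M.faces.ncard = M.edges.ncard + 2 := by
  simp only [vertices_ncard, faces_ncard, edges_ncard]
  rw [zipAt_cyc_rot (W := W) hM hz hv, zipAt_cyc_next hM hz, zipAt_cyc_rev (W := W) hM hz]
  omega

set_option maxHeartbeats 400000 in
theorem zipAt_connected_iff (hv : ¬ M.rot.SameCycle x (M.next y)) :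
    (∀ z ∈ (M.zipAt x y W).darts, ∃ g ∈ Subgroup.closure
      {(M.zipAt x y W).rev, (M.zipAt x y W).next}, g (M.zipAt x y W).root = z) ↔
      ∀ z ∈ M.darts, ∃ g ∈ Subgroup.closure {M.rev, M.next}, g M.root = z := by
  rw [connected_iff, connected_iff]
  have hroot : (M.zipAt x y W).root = M.root := rfl
  obtain ⟨d1, d2, d3, d4, d5, d6, d7, d8⟩ := hz.distinct hM
  obtain ⟨v1, v2, v3, v4, v5, v6, v7, v8, v9⟩ := zipAt_values (W := W) hM hz
  have hrr := hM.rev_rev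
  have hy := hz.mem_y hM
  constructor
  · intro h S h0 h1 h2 z hzz
    have hxy : x ∈ S ↔ y ∈ S := by rw [h2 x, hz.next_x]
    have key := h S h0 (fun u => ?_) (fun u => ?_)
    · by_cases k1 : z = x
      · rw [k1, h1]
        exact key _ (zipAt_mem.2 ⟨hM.rev_mem x hz.mem, d1, d3⟩)
      by_cases k2 : z = y
      · rw [k2, h1]
        exact key _ (zipAt_mem.2 ⟨hM.rev_mem y hy, d4, d2⟩)
      exact key z (zipAt_mem.2 ⟨hzz, k1, k2⟩)
    · grind
    · grind
  · intro h S h0 h1 h2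
    have hrot : ∀ u, u ∈ S ↔ (M.zipAt x y W).rot u ∈ S := fun u => by rw [h1 u, h2, rot_apply]
    have hn : M.rev y ∈ S ↔ M.next y ∈ S := by
      refine mem_iff_of_sameCycle hrot ((zipAt_rot_sameCycle hM hz hv d4 hz.next_y d2 d6).2 ?_)
      left
      rw [← hM.rot_rev y]
      exact sameCycle_apply _ _
    have hx : M.rev x ∈ S ↔ M.rev y ∈ S := by rw [h1 (M.rev x), v3]
    obtain ⟨S', hS'⟩ : ∃ S' : Set ℕ, ∀ u, u ∈ S' ↔
        if u = x ∨ u = y then M.rev x ∈ S else u ∈ S := ⟨{u | _}, fun u => Iff.rfl⟩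
    have hold : ∀ u, u ≠ x → u ≠ y → (u ∈ S' ↔ u ∈ S) := by grind
    have hSx : x ∈ S' ↔ M.rev x ∈ S := by rw [hS']; simp
    have hSy : y ∈ S' ↔ M.rev x ∈ S := by rw [hS']; simp
    have key := h S' ((hold _ hz.root_x hz.root_y).2 h0) (fun u => ?_) (fun u => ?_)
    · grind [zipAt_mem]
    · by_cases k1 : u = x
      · rw [k1, hSx, hold _ d1 d3]
      by_cases k2 : u = y
      · rw [k2, hSy, hold _ d4 d2, hx]
      by_cases h3 : u = M.rev x
      · rw [h3, hrr, hSx, hold _ d1 d3]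
      by_cases h4 : u = M.rev y
      · grind
      grind
    · by_cases k1 : u = x
      · rw [k1, hz.next_x, hSx, hSy]
      by_cases k2 : u = y
      · grind
      by_cases h3 : M.next u = x
      · grind
      · rw [hold u k1 k2, h2 u, v9 u k1 k2 h3, hold _ h3]
        intro h'
        exact k1 (M.next.injective (h'.trans hz.next_x.symm))

end Zip

/-! ### Mirror images -/

section Mirror

/-- The mirror image of a map, with the colours exchanged. The label of a dart of `M` stands in the
mirror image for the reversed dart, so that the root is still directed from white to black and the
faces are still on the right. -/
def mirror (M : PercMap) : PercMap where
  darts := M.darts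
  rev := M.rev
  next := M.next⁻¹
  root := M.root
  white := {x | x ∈ M.darts ∧ M.rev x ∉ M.white}

theorem mem_mirror_white {x : ℕ} : x ∈ M.mirror.white ↔ x ∈ M.darts ∧ M.rev x ∉ M.white := Iff.rfl

theorem mirror_next (x : ℕ) : M.mirror.next x = M.next.symm x := rfl

theorem mirror_faceOf (d : ℕ) : M.mirror.faceOf d = M.faceOf d := by
  ext x; exact Perm.sameCycle_inv

theorem mirror_rootFace : M.mirror.rootFace = M.rootFace := mirror_faceOf _

section

variable (hM : M.Comb)
include hM

theorem mirror_comb : M.mirror.Comb where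
  rev_mem := hM.rev_mem
  rev_ne := hM.rev_ne
  rev_rev := hM.rev_rev
  rev_fix := hM.rev_fix
  next_fix d hd := by
    rw [mirror_next, Equiv.symm_apply_eq, hM.next_fix d hd]
  root_mem := hM.root_mem

theorem mirror_mirror (hw : M.white ⊆ (M.darts : Set ℕ)) : M.mirror.mirror = M := by
  have : M.mirror.mirror.white = M.white := by
    ext x
    have h1 : M.mirror.mirror.white = {x | x ∈ M.darts ∧ M.rev x ∉ M.mirror.white} := rfl
    grind [mem_mirror_white, hM.rev_mem_iff, hM.rev_rev]
  have h2 : M.mirror.mirror = { M with next := M.next⁻¹⁻¹, white := M.mirror.mirror.white } := rfl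
  rw [h2, this, inv_inv]

theorem mem_mirror_vertexOf {d x : ℕ} :
    x ∈ M.mirror.vertexOf d ↔ M.rev x ∈ M.vertexOf (M.rev d) := by
  have hr : M.rev⁻¹ = M.rev := by
    ext x
    exact M.rev.injective ((Equiv.apply_symm_apply M.rev x).trans (hM.rev_rev x).symm)
  have : M.mirror.rot = M.rev * M.rot⁻¹ * M.rev⁻¹ := by
    have h1 : M.mirror.rot = M.next⁻¹ * M.rev := rfl
    have h2 : M.rot = M.next * M.rev := rfl
    rw [h1, h2, mul_inv_rev]
    conv_lhs => rw [← hr]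
    group
  rw [mem_vertexOf, this, Perm.sameCycle_conj, Perm.sameCycle_inv, hr, mem_vertexOf]

theorem mirror_vertexOf (d : ℕ) : M.mirror.vertexOf d = M.rev '' M.vertexOf (M.rev d) := by
  ext x
  rw [mem_mirror_vertexOf hM]
  constructor
  · intro h; exact ⟨_, h, hM.rev_rev x⟩
  · rintro ⟨y, h, rfl⟩; rwa [hM.rev_rev]

theorem mirror_vertices : M.mirror.vertices = (fun v => M.rev '' v) '' M.vertices := by
  ext s
  constructor
  · rintro ⟨d, hd, rfl⟩
    exact ⟨_, ⟨M.rev d, hM.rev_mem d hd, rfl⟩, (mirror_vertexOf hM d).symm⟩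
  · rintro ⟨_, ⟨d, hd, rfl⟩, rfl⟩
    refine ⟨M.rev d, hM.rev_mem d hd, ?_⟩
    rw [mirror_vertexOf hM, hM.rev_rev]

theorem mirror_top : M.mirror.top = M.top := by
  have : {d | d ∈ M.mirror.rootFace ∧ d ∉ M.mirror.white ∧ M.mirror.rev d ∈ M.mirror.white} =
      {d | d ∈ M.rootFace ∧ d ∉ M.white ∧ M.rev d ∈ M.white} := by
    ext d
    have h1 : M.mirror.rev d = M.rev d := rfl
    grind [mirror_rootFace, mem_mirror_white, hM.rev_mem_iff, hM.rev_rev, hM.rootFace_sub]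
  rw [top, this, top]

theorem mirror_whiteEdge {d : ℕ} (hd : d ∈ M.darts) : M.mirror.WhiteEdge d ↔ M.BlackEdge d := by
  have h1 : M.mirror.rev d = M.rev d := rfl
  simp only [WhiteEdge, BlackEdge, mem_mirror_white, h1, hM.rev_mem_iff, hM.rev_rev]
  tauto

theorem mirror_blackEdge {d : ℕ} (hd : d ∈ M.darts) : M.mirror.BlackEdge d ↔ M.WhiteEdge d := by
  have h1 : M.mirror.rev d = M.rev d := rfl
  simp only [WhiteEdge, BlackEdge, mem_mirror_white, h1, hM.rev_mem_iff, hM.rev_rev]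
  tauto

end

theorem mirror_isPlanarMap (hM : M.IsPlanarMap) : M.mirror.IsPlanarMap where
  rev_mem := hM.rev_mem
  rev_ne := hM.rev_ne
  rev_rev := hM.rev_rev
  rev_fix := hM.rev_fix
  next_mem d hd := (mirror_comb hM.comb).next_mem_iff.2 hd
  next_fix := (mirror_comb hM.comb).next_fix
  root_mem := hM.root_mem
  connected := by
    rw [connected_iff]
    intro S h0 h1 h2
    refine connected_iff.1 hM.connected S h0 h1 fun x => ?_
    grind [mirror_next]
  euler := by
    have h1 : M.mirror.faces = M.faces := by
      unfold faces
      rw [show M.mirror.faceOf = M.faceOf from funext mirror_faceOf]; rfl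
    have h2 : M.mirror.edges = M.edges := rfl
    rw [h1, h2, mirror_vertices hM.comb, Set.ncard_image_of_injective _
      (Set.image_injective.2 M.rev.injective)]
    exact hM.euler
  white_sub _ hx := hx.1
  white_rot d hd := by
    have h1 : M.mirror.rot d = M.next.symm (M.rev d) := rfl
    have h2 := hM.white_next (M.next.symm (M.rev d))
    rw [Equiv.apply_symm_apply] at h2
    rw [h1, mem_mirror_white, mem_mirror_white, ← h2, ← hM.comb.next_mem_iff,
      Equiv.apply_symm_apply, hM.comb.rev_mem_iff]

theorem mirror_isTriangulation (hM : M.IsTriangulation) : M.mirror.IsTriangulation where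
  toIsPlanarMap := mirror_isPlanarMap hM.toIsPlanarMap
  triangle d hd hd' := by
    rw [mirror_rootFace] at hd'
    rw [mirror_faceOf]
    exact hM.triangle d hd hd'
  loopless d hd h := by
    rw [mem_mirror_vertexOf hM.comb] at h
    exact hM.rev_not_vertexOf (hM.comb.rev_mem d hd) h
  simple d hd d' hd' h := by
    rw [mirror_rootFace] at hd hd'
    rw [mem_mirror_vertexOf hM.comb, ← hM.comb.next_mem_vertexOf_iff,
      ← hM.comb.vertexOf_next] at h
    exact M.next.injective
      (hM.outer_eq (next_mem_rootFace.2 hd) (next_mem_rootFace.2 hd') h)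

theorem mirror_rootInterface (hM : M.Comb) (hR : M.RootInterface) : M.mirror.RootInterface := by
  have h1 : ∀ d, M.mirror.rev d = M.rev d := fun _ => rfl
  have h2 : M.mirror.root = M.root := rfl
  refine ⟨⟨?_, ?_⟩, fun d hd hd' => ?_⟩
  · rw [mem_mirror_white]; exact ⟨hM.root_mem, hR.1.2⟩
  · rw [mem_mirror_white, h1, h2, hM.rev_rev]; exact fun h => h.2 hR.1.1
  · rw [mirror_rootFace] at hd
    rw [mem_mirror_white, mem_mirror_white, h1, hM.rev_rev, hM.rev_mem_iff]
    have := hR.2 d hd hd'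
    grind

theorem mirror_entry (hM : M.IsTriangulation) (hR : M.RootInterface) {K : ℕ} (hK : M.PathEnd K)
    {l : ℕ} (hl : l ≤ K) : M.mirror.entry l = M.entry l := by
  refine entry_congr (M := M) (N := M.mirror) rfl (fun l hl => ?_) hl
  set g := M.entry l with hg
  have hgD : g ∈ M.darts := hK.mem hM hR hl.le
  have hi := hK.inner l hl
  have e1 : M.mirror.next g = M.next (M.next g) := by rw [mirror_next, hM.symm_eq hgD hi]
  have e2 : M.mirror.next (M.mirror.next g) = M.next g := by
    rw [e1, mirror_next, Equiv.symm_apply_apply]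
  have h1 : ∀ d, M.mirror.rev d = M.rev d := fun _ => rfl
  grind [mem_mirror_white, hM.white_next, hM.comb.next_mem_iff, interfaceStep_white,
      interfaceStep_black]

theorem mirror_pathEnd (hM : M.IsTriangulation) (hR : M.RootInterface) {K : ℕ} (hK : M.PathEnd K) :
    M.mirror.PathEnd K where
  inner l hl := by
    rw [mirror_rootFace, mirror_entry hM hR hK hl.le]; exact hK.inner l hl
  outer := by rw [mirror_rootFace, mirror_entry hM hR hK le_rfl]; exact hK.outer

theorem mirror_onPathAt (hM : M.IsTriangulation) (hR : M.RootInterface) {k : ℕ} {f : Set ℕ} :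
    M.mirror.OnPathAt k f ↔ M.OnPathAt k f := by
  obtain ⟨K, hK⟩ := exists_pathEnd hM hR
  rw [hK.onPathAt, (mirror_pathEnd hM hR hK).onPathAt]
  refine and_congr_right fun h => ?_
  rw [mirror_entry hM hR hK h.le]

theorem mirror_pathBefore (hM : M.IsTriangulation) (hR : M.RootInterface) {f f' : Set ℕ} :
    M.mirror.PathBefore f f' ↔ M.PathBefore f f' := by
  simp only [PathBefore, mirror_onPathAt hM hR]

end Mirror

end PercMap

namespace MarkedMap

open PercMap

variable {M : MarkedMap}

/-- The mirror image of a marked map. -/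
def mirror (M : MarkedMap) : MarkedMap where
  toPercMap := M.toPercMap.mirror
  active := M.active

theorem mirror_toPercMap : M.mirror.toPercMap = M.toPercMap.mirror := rfl

theorem mirror_active : M.mirror.active = M.active := rfl

theorem mirror_mirror (hM : M.IsPlanarMap) : M.mirror.mirror = M := by
  have : M.mirror.mirror = { M.toPercMap.mirror.mirror with active := M.active } := rfl
  rw [this, PercMap.mirror_mirror hM.comb hM.white_sub]

section

variable (hM : M.Comb)
include hM

theorem mirror_top : M.mirror.top = M.top := PercMap.mirror_top hM

theorem mirror_leftDart : M.mirror.leftDart = M.rightDart := by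
  rw [leftDart, mirror_top hM]; rfl

theorem mirror_rightDart : M.mirror.rightDart = M.leftDart := by
  rw [rightDart, mirror_top hM]; rfl

theorem mirror_hasActiveLeft : M.mirror.HasActiveLeft ↔ M.HasActiveRight := by
  unfold HasActiveLeft HasActiveRight
  refine exists_congr fun x => ?_
  rw [mirror_toPercMap, PercMap.mirror_rootFace, mirror_active]
  refine and_congr_right fun hx => and_congr_right fun _ =>
    PercMap.mirror_whiteEdge hM (hM.rootFace_sub hx)

theorem mirror_hasActiveRight : M.mirror.HasActiveRight ↔ M.HasActiveLeft := by
  unfold HasActiveLeft HasActiveRight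
  refine exists_congr fun x => ?_
  rw [mirror_toPercMap, PercMap.mirror_rootFace, mirror_active]
  refine and_congr_right fun hx => and_congr_right fun _ =>
    PercMap.mirror_blackEdge hM (hM.rootFace_sub hx)

end

/-- The conditions under which the step `c` is compatible with the mirror symmetry. -/
structure StepCReady (M : MarkedMap) : Prop where
  tri : M.IsTriangulation
  ri : M.RootInterface
  active : M.HasActiveLeft ∨ M.HasActiveRight
  left : M.HasActiveLeft → M.WhiteEdge M.leftDart
  right : M.HasActiveRight → M.BlackEdge M.rightDart
  order : M.HasActiveLeft → M.HasActiveRight →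
    (M.PathBefore (M.faceOf (M.rev M.leftDart)) (M.faceOf (M.rev M.rightDart)) ↔
      ¬ M.PathBefore (M.faceOf (M.rev M.rightDart)) (M.faceOf (M.rev M.leftDart)))

namespace StepCReady

variable (hS : M.StepCReady)
include hS

theorem mirror_recolorsRight : M.mirror.RecolorsRight ↔ ¬ M.RecolorsRight := by
  have hC := hS.tri.comb
  unfold RecolorsRight
  rw [mirror_hasActiveLeft hC, mirror_hasActiveRight hC, mirror_leftDart hC, mirror_rightDart hC]
  rw [mirror_toPercMap, PercMap.mirror_pathBefore hS.tri hS.ri, PercMap.mirror_faceOf,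
    PercMap.mirror_faceOf]
  have h1 := hS.active
  have h2 := hS.order
  change (_ ∨ _ ∧ M.PathBefore (M.faceOf (M.rev M.rightDart)) (M.faceOf (M.rev M.leftDart))) ↔ _
  tauto

theorem mirror_recolored : M.mirror.recolored = {x | x ∈ M.darts ∧ M.rev x ∉ M.recolored} := by
  have hC := hS.tri.comb
  have h0 := hS.mirror_recolorsRight
  have hv : ∀ d x, x ∈ M.mirror.vertexOf d ↔ M.rev x ∈ M.vertexOf (M.rev d) :=
    fun d x => PercMap.mem_mirror_vertexOf hC
  have hw : ∀ x, x ∈ M.mirror.white ↔ x ∈ M.darts ∧ M.rev x ∉ M.white := fun x => Iff.rfl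
  have htD := hC.rootFace_sub (PercMap.top_mem hS.tri hS.ri)
  have hr : ∀ x, M.mirror.rev x = M.rev x := fun x => rfl
  ext x
  unfold recolored
  by_cases h : M.RecolorsRight
  · grind [mirror_top, hC.rev_rev]
  · rw [if_neg h, if_pos (h0.2 h)]
    simp only [Set.mem_sdiff, hw, hv, mirror_top hC, Set.mem_ofPred_eq, Set.mem_union]
    constructor
    · rintro (h | h)
      · tauto
      · refine ⟨?_, fun k => k.2 h⟩
        rw [← hC.rev_mem_iff, hC.vertexOf_sub h, hC.rev_mem_iff]
        exact htD
    · tauto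

omit hS in
theorem glueTop_rev (hC : M.Comb) {f : ℕ} (htf : M.top ≠ f) (htf' : M.rev M.top ≠ f)
    (ht : M.top ∈ M.darts) (hf : f ∈ M.darts) {z : ℕ} (h1 : z ≠ M.top) (h2 : z ≠ f) :
    (M.glueTop f).rev z = if z = M.rev M.top then M.rev f else if z = M.rev f then M.rev M.top
      else M.rev z := by
  have hrr := hC.rev_rev
  have d1 := hC.rev_ne _ ht
  have d2 := hC.rev_ne _ hf
  have e1 : M.rev z = f ↔ z = M.rev f := by grind
  have e2 : M.rev z = M.rev f ↔ z = f := M.rev.injective.eq_iff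
  have e3 : M.rev z = M.top ↔ z = M.rev M.top := by grind
  have e4 : M.rev z = M.rev M.top ↔ z = M.top := M.rev.injective.eq_iff
  have e5 : M.rev f ≠ M.top := by grind
  have e6 : M.rev f ≠ M.rev M.top := by grind
  simp only [glueTop, Perm.mul_apply]
  grind

/-- The step `c` commutes with the mirror symmetry. -/
theorem mirror_stepC : M.mirror.stepC = M.stepC.mirror := by
  have hC := hS.tri.comb
  have h0 := hS.mirror_recolorsRight
  have hrec := hS.mirror_recolored
  have htm := PercMap.top_mem hS.tri hS.ri
  have htb := PercMap.top_bw hS.tri hS.ri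
  have htD := hC.rootFace_sub htm
  unfold stepC
  rw [mirror_hasActiveLeft hC, mirror_hasActiveRight hC, mirror_leftDart hC, mirror_rightDart hC]
  by_cases hLR : M.HasActiveLeft ∧ M.HasActiveRight
  · rw [if_pos hLR, if_pos hLR.symm]
    have hgen : ∀ f, f ∈ M.rootFace → M.top ≠ f → M.rev M.top ≠ f →
        (M.rev f ∈ M.recolored ↔ M.top ∈ M.recolored) →
        (M.rev M.top ∈ M.recolored ↔ f ∈ M.recolored) →
        M.mirror.glueTop f = (M.glueTop f).mirror := by
      intro f hf h1 h2 h3 h4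
      have hfD := hC.rootFace_sub hf
      have e1 : M.mirror.glueTop f =
          { darts := M.darts \ {M.top, f}
            rev := (M.glueTop f).rev
            next := removeDart (removeDart M.next⁻¹ M.top) f
            root := M.root
            white := M.mirror.recolored \ {M.top, f}
            active := (M.glueTop f).active } := by
        unfold glueTop
        rw [mirror_top hC]
        rfl
      have e2 : (M.glueTop f).mirror =
          { darts := M.darts \ {M.top, f}
            rev := (M.glueTop f).rev
            next := (removeDart (removeDart M.next M.top) f)⁻¹
            root := M.root
            white := {x | x ∈ M.darts \ {M.top, f} ∧
              (M.glueTop f).rev x ∉ M.recolored \ {M.top, f}}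
            active := (M.glueTop f).active } := rfl
      rw [e1, e2, removeDart_inv, removeDart_inv, hrec]
      congr 2
      ext x
      simp only [Set.mem_sdiff, Set.mem_insert_iff, Set.mem_singleton_iff, Set.mem_ofPred_eq,
        Finset.mem_sdiff, Finset.mem_insert, Finset.mem_singleton]
      by_cases k1 : x = M.top
      · simp [k1]
      by_cases k2 : x = f
      · simp [k2]
      rw [glueTop_rev hC h1 h2 htD hfD k1 k2]
      grind [hC.rev_rev, hC.rev_ne]
    by_cases hr : M.RecolorsRight
    · rw [if_pos hr, if_neg (by rw [h0]; exact not_not.2 hr)]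
      have hl := hS.left hLR.1
      refine hgen _ (PercMap.next_mem_rootFace.2 htm) ?_ ?_ ?_ ?_
      · exact (hS.tri.next_ne htD).symm
      · intro h
        have := hl.2
        rw [← h, hC.rev_rev] at this
        exact htb.1 this
      all_goals simp only [recolored, if_pos hr, Set.mem_union]
      · simp [hl.2, PercMap.self_mem_vertexOf]
      · simp [hl.1, htb.2]
    · rw [if_neg hr, if_pos (h0.2 hr)]
      have hl := hS.right hLR.2
      refine hgen _ (PercMap.symm_mem_rootFace.2 htm) ?_ ?_ ?_ ?_
      · intro h
        have := (Equiv.eq_symm_apply _).1 h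
        exact hS.tri.next_ne htD this
      · intro h
        exact hl.1 (h ▸ htb.2)
      all_goals simp only [recolored, if_neg hr, Set.mem_sdiff]
      · simp [hl.2, htb.1]
      · simp [hl.1, PercMap.self_mem_vertexOf]
  · rw [if_neg hLR, if_neg (fun h => hLR h.symm), hrec, mirror_top hC]
    rfl

end StepCReady

end MarkedMap

theorem sameCycle_conj_apply {π p : Perm ℕ} {x y : ℕ} :
    (π * p * π⁻¹).SameCycle (π x) (π y) ↔ p.SameCycle x y := by
  rw [Perm.sameCycle_conj]
  simp

/-- A relabelling can be changed at one label which is not used. -/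
theorem exists_perm_extend (π : Perm ℕ) (S : Finset ℕ) {a b : ℕ} (ha : a ∉ S) (hb : b ∉ S.map π.toEmbedding) :
    ∃ ρ : Perm ℕ, (∀ x ∈ S, ρ x = π x) ∧ ρ a = b := by
  refine ⟨Equiv.swap (π a) b * π, fun x hx => ?_, by simp⟩
  refine Equiv.swap_apply_of_ne_of_ne (fun h => ha (π.injective h ▸ hx)) fun h => hb ?_
  rw [← h]
  exact Finset.mem_map_of_mem _ hx

namespace PercMap

variable {M : PercMap}

/-- The relabelling of a map. -/
def map (M : PercMap) (π : Perm ℕ) : PercMap where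
  darts := M.darts.map π.toEmbedding
  rev := π * M.rev * π⁻¹
  next := π * M.next * π⁻¹
  root := π M.root
  white := π '' M.white

theorem iso_iff {N : PercMap} : M.Iso N ↔ ∃ π, N = M.map π := by
  constructor
  · rintro ⟨π, h1, h2, h3, h4, h5⟩
    refine ⟨π, ?_⟩
    cases N
    simp only at h1 h2 h3 h4 h5
    subst h1 h2 h3 h4 h5
    rfl
  · rintro ⟨π, rfl⟩
    exact ⟨π, rfl, rfl, rfl, rfl, rfl⟩

section

variable (π : Perm ℕ)

theorem map_rev (x : ℕ) : (M.map π).rev (π x) = π (M.rev x) := by simp [map]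

theorem map_next (x : ℕ) : (M.map π).next (π x) = π (M.next x) := by simp [map]

theorem map_next_symm (x : ℕ) : (M.map π).next.symm (π x) = π (M.next.symm x) := by
  rw [Equiv.symm_apply_eq, map_next, Equiv.apply_symm_apply]

theorem map_white {x : ℕ} : π x ∈ (M.map π).white ↔ x ∈ M.white := by
  simp [map]

theorem map_faceOf (d : ℕ) : (M.map π).faceOf (π d) = π '' M.faceOf d := by
  ext x
  obtain ⟨x, rfl⟩ := π.surjective x
  rw [π.injective.mem_set_image]
  exact sameCycle_conj_apply

theorem map_vertexOf (d : ℕ) : (M.map π).vertexOf (π d) = π '' M.vertexOf d := by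
  have h : (M.map π).rot = π * M.rot * π⁻¹ := by
    change (π * M.next * π⁻¹) * (π * M.rev * π⁻¹) = π * (M.next * M.rev) * π⁻¹
    group
  ext x
  obtain ⟨x, rfl⟩ := π.surjective x
  rw [π.injective.mem_set_image, mem_vertexOf, h]
  exact sameCycle_conj_apply

theorem map_rootFace : (M.map π).rootFace = π '' M.rootFace := map_faceOf π _

theorem map_mem_rootFace {x : ℕ} : π x ∈ (M.map π).rootFace ↔ x ∈ M.rootFace := by
  rw [map_rootFace, π.injective.mem_set_image]

theorem map_mem_faceOf {d x : ℕ} : π x ∈ (M.map π).faceOf (π d) ↔ x ∈ M.faceOf d := by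
  rw [map_faceOf, π.injective.mem_set_image]

theorem map_whiteEdge {x : ℕ} : (M.map π).WhiteEdge (π x) ↔ M.WhiteEdge x := by
  simp only [WhiteEdge, map_rev, map_white]

theorem map_blackEdge {x : ℕ} : (M.map π).BlackEdge (π x) ↔ M.BlackEdge x := by
  simp only [BlackEdge, map_rev, map_white]

theorem map_interfaceStep (x : ℕ) :
    (M.map π).interfaceStep (π x) = π (M.interfaceStep x) := by
  grind [map_next, map_white, interfaceStep, map_rev]

theorem map_entry (k : ℕ) : (M.map π).entry k = π (M.entry k) := by
  induction k with
  | zero => exact map_rev π _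
  | succ k ih => rw [entry_succ, entry_succ, ih, map_interfaceStep]

theorem map_onPathAt {k : ℕ} {f : Set ℕ} : (M.map π).OnPathAt k (π '' f) ↔ M.OnPathAt k f := by
  simp only [OnPathAt, map_entry, map_mem_rootFace, π.injective.mem_set_image]

theorem map_pathBefore {f f' : Set ℕ} :
    (M.map π).PathBefore (π '' f) (π '' f') ↔ M.PathBefore f f' := by
  simp only [PathBefore, map_onPathAt]

theorem map_top (hM : M.IsTriangulation) (hR : M.RootInterface) : (M.map π).top = π M.top := by
  have : {d | d ∈ (M.map π).rootFace ∧ d ∉ (M.map π).white ∧ (M.map π).rev d ∈ (M.map π).white} =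
      {π M.top} := by
    ext d
    obtain ⟨d, rfl⟩ := π.surjective d
    simp only [Set.mem_ofPred_eq, map_mem_rootFace, map_rev, map_white, Set.mem_singleton_iff,
      π.injective.eq_iff]
    constructor
    · rintro ⟨h, h'⟩
      exact eq_top hM hR h h'
    · rintro rfl
      exact ⟨top_mem hM hR, top_bw hM hR⟩
  rw [top, this, csInf_singleton]

end

theorem map_map (π ρ : Perm ℕ) : (M.map π).map ρ = M.map (ρ * π) := by
  simp only [map, Finset.map_map, mul_inv_rev, Set.image_image, mul_assoc]
  rfl

theorem map_conj_congr {π ρ p : Perm ℕ} {S : Finset ℕ} (h : ∀ x ∈ S, π x = ρ x)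
    (hp : ∀ x, x ∉ S → p x = x) : π * p * π⁻¹ = ρ * p * ρ⁻¹ := by
  have key : ∀ π ρ : Perm ℕ, (∀ x ∈ S, π x = ρ x) → ∀ x, (π * p * π⁻¹) (π x) = (ρ * p * ρ⁻¹) (π x) := by
    intro π ρ h x
    have hs : ∀ y, p y ∈ S ↔ y ∈ S := by
      intro y
      constructor
      · grind
      · intro hy
        by_contra hn
        exact hn (by rwa [p.injective (hp _ hn)])
    by_cases hx : x ∈ S
    · have e1 : (ρ * p * ρ⁻¹) (π x) = ρ (p x) := by rw [h x hx]; simp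
      have e2 : (π * p * π⁻¹) (π x) = π (p x) := by simp
      rw [e1, e2, h _ ((hs x).2 hx)]
    · have e1 : (π * p * π⁻¹) (π x) = π x := by simp [hp x hx]
      have hx' : ρ⁻¹ (π x) ∉ S := fun hS => hx (by
        have := h _ hS
        change π (ρ.symm (π x)) = ρ (ρ.symm (π x)) at this
        rw [Equiv.apply_symm_apply] at this
        have h2 : ρ.symm (π x) = x := π.injective this
        exact h2 ▸ hS)
      have e2 : (ρ * p * ρ⁻¹) (π x) = π x := by
        rw [Perm.mul_apply, Perm.mul_apply, hp _ hx']; simp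
      rw [e1, e2]
  ext x
  obtain ⟨x, rfl⟩ := π.surjective x
  exact key π ρ h x

theorem map_congr (hM : M.Comb) (hw : M.white ⊆ (M.darts : Set ℕ)) {π ρ : Perm ℕ}
    (h : ∀ x ∈ M.darts, π x = ρ x) : M.map π = M.map ρ := by
  have h1 : M.darts.map π.toEmbedding = M.darts.map ρ.toEmbedding := by
    ext x; simp only [Finset.mem_map, Equiv.coe_toEmbedding]
    grind
  have h5 : π '' M.white = ρ '' M.white := by grind
  unfold map
  rw [h1, h5, map_conj_congr h hM.rev_fix, map_conj_congr h hM.next_fix, h _ hM.root_mem]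

theorem mirror_map (π : Perm ℕ) : (M.map π).mirror = M.mirror.map π := by
  unfold mirror map
  congr 1
  · ext x
    obtain ⟨x, rfl⟩ := π.surjective x
    rw [π.injective.mem_set_image]
    simp

theorem map_mul_swap (π p : Perm ℕ) (a b : ℕ) :
    π * (Equiv.swap a b * p) * π⁻¹ = Equiv.swap (π a) (π b) * (π * p * π⁻¹) := by
  rw [← mul_assoc, Equiv.mul_swap_eq_swap_mul]
  group

theorem map_removeDart (π p : Perm ℕ) (d : ℕ) :
    π * removeDart p d * π⁻¹ = removeDart (π * p * π⁻¹) (π d) := by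
  unfold removeDart
  rw [map_mul_swap]
  simp

end PercMap

namespace MarkedMap

variable {M : MarkedMap}

/-- The relabelling of a marked map. -/
def map (M : MarkedMap) (π : Perm ℕ) : MarkedMap where
  toPercMap := M.toPercMap.map π
  active := π '' M.active

theorem iso_iff {N : MarkedMap} : M.Iso N ↔ ∃ π, N = M.map π := by
  constructor
  · rintro ⟨π, h1, h2, h3, h4, h5, h6⟩
    refine ⟨π, ?_⟩
    obtain ⟨⟨_, _, _, _, _⟩, _⟩ := N
    simp only at h1 h2 h3 h4 h5 h6
    subst h1 h2 h3 h4 h5 h6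
    rfl
  · rintro ⟨π, rfl⟩
    exact ⟨π, rfl, rfl, rfl, rfl, rfl, rfl⟩

theorem map_map (π ρ : Perm ℕ) : (M.map π).map ρ = M.map (ρ * π) := by
  have : (M.map π).map ρ = ⟨(M.toPercMap.map π).map ρ, ρ '' (π '' M.active)⟩ := rfl
  rw [this, PercMap.map_map, Set.image_image]
  rfl

theorem map_congr (hM : M.Comb) (hw : M.white ⊆ (M.darts : Set ℕ))
    (ha : M.active ⊆ (M.darts : Set ℕ)) {π ρ : Perm ℕ}
    (h : ∀ x ∈ M.darts, π x = ρ x) : M.map π = M.map ρ := by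
  have h6 : π '' M.active = ρ '' M.active := Set.image_congr fun x hx => h x (ha hx)
  unfold map
  rw [h6, PercMap.map_congr hM hw h]

theorem mirror_map (π : Perm ℕ) : (M.map π).mirror = M.mirror.map π := by
  have : (M.map π).mirror = ⟨(M.toPercMap.map π).mirror, π '' M.active⟩ := rfl
  rw [this, PercMap.mirror_map]
  rfl

section

variable (π : Perm ℕ)

theorem map_active {x : ℕ} : π x ∈ (M.map π).active ↔ x ∈ M.active := by
  simp [map]

theorem map_hasActiveLeft : (M.map π).HasActiveLeft ↔ M.HasActiveLeft := by
  unfold HasActiveLeft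
  rw [π.surjective.exists]
  exact exists_congr fun x => and_congr (PercMap.map_mem_rootFace π)
    (and_congr (map_active π) (PercMap.map_whiteEdge π))

theorem map_hasActiveRight : (M.map π).HasActiveRight ↔ M.HasActiveRight := by
  unfold HasActiveRight
  rw [π.surjective.exists]
  exact exists_congr fun x => and_congr (PercMap.map_mem_rootFace π)
    (and_congr (map_active π) (PercMap.map_blackEdge π))

variable (hM : M.IsTriangulation) (hR : M.RootInterface)
include hM hR

theorem map_top : (M.map π).top = π M.top := PercMap.map_top π hM hR

theorem map_leftDart : (M.map π).leftDart = π M.leftDart := by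
  rw [leftDart, map_top π hM hR]; exact PercMap.map_next π _

theorem map_rightDart : (M.map π).rightDart = π M.rightDart := by
  rw [rightDart, map_top π hM hR]; exact PercMap.map_next_symm π _

theorem map_recolorsRight : (M.map π).RecolorsRight ↔ M.RecolorsRight := by
  unfold RecolorsRight
  have e : ∀ x, (M.map π).faceOf ((M.map π).rev (π x)) = π '' M.faceOf (M.rev x) := fun x => by
    rw [show (M.map π).rev (π x) = π (M.rev x) from PercMap.map_rev π x]
    exact PercMap.map_faceOf π _
  rw [map_hasActiveLeft, map_hasActiveRight, map_leftDart π hM hR, map_rightDart π hM hR, e, e]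
  refine or_congr Iff.rfl (and_congr Iff.rfl (PercMap.map_pathBefore π))

theorem map_recolored : (M.map π).recolored = π '' M.recolored := by
  have h1 : (M.map π).vertexOf (M.map π).top = π '' M.vertexOf M.top := by
    rw [map_top π hM hR]; exact PercMap.map_vertexOf π _
  have h2 : (M.map π).vertexOf ((M.map π).rev (M.map π).top) = π '' M.vertexOf (M.rev M.top) := by
    rw [map_top π hM hR, show (M.map π).rev (π M.top) = π (M.rev M.top) from PercMap.map_rev π _]
    exact PercMap.map_vertexOf π _
  have h3 : (M.map π).white = π '' M.white := rfl
  unfold recolored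
  rw [map_recolorsRight π hM hR, h1, h2, h3]
  split_ifs
  · rw [Set.image_union]
  · rw [Set.image_sdiff π.injective]

theorem map_glueTop (f : ℕ) : (M.map π).glueTop (π f) = (M.glueTop f).map π := by
  have hr : ∀ x, (M.map π).rev (π x) = π (M.rev x) := PercMap.map_rev π
  have e1 : (M.map π).rev = π * M.rev * π⁻¹ := rfl
  have e2 : (M.map π).next = π * M.next * π⁻¹ := rfl
  have e3 : (M.map π).darts = M.darts.map π.toEmbedding := rfl
  have e4 : (M.map π).active = π '' M.active := rfl
  unfold glueTop
  rw [map_recolored π hM hR, map_top π hM hR]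
  simp only [hr]
  rw [e1, e2, e3, e4]
  unfold map PercMap.map
  simp only [MarkedMap.mk.injEq, PercMap.mk.injEq]
  refine ⟨⟨?_, ?_, ?_, trivial, ?_⟩, ?_⟩
  · ext x
    obtain ⟨x, rfl⟩ := π.surjective x
    simp
  · rw [mul_assoc (_ * _), mul_assoc, mul_assoc (_ * _), mul_assoc _ (Equiv.swap _ _),
      PercMap.map_mul_swap, PercMap.map_mul_swap, PercMap.map_mul_swap]
  · rw [PercMap.map_removeDart, PercMap.map_removeDart]
  · rw [Set.image_sdiff π.injective, Set.image_pair]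
  · rw [Set.image_sdiff π.injective, Set.image_insert_eq, Set.image_insert_eq, Set.image_pair]

theorem map_stepC : (M.map π).stepC = M.stepC.map π := by
  unfold stepC
  rw [map_hasActiveLeft, map_hasActiveRight, map_recolorsRight π hM hR, map_recolored π hM hR,
    map_leftDart π hM hR, map_rightDart π hM hR]
  split_ifs
  · exact map_glueTop π hM hR _
  · exact map_glueTop π hM hR _
  · rw [map_top π hM hR, show (M.map π).rev (π M.top) = π (M.rev M.top) from PercMap.map_rev π _,
      show (M.map π).active = π '' M.active from rfl]
    unfold map PercMap.map
    simp only [MarkedMap.mk.injEq, true_and]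
    rw [Set.image_sdiff π.injective, Set.image_pair]

end

end MarkedMap

open KrewerasBij.PercMap (Comb Fresh4)

theorem PercMap.Fresh4.swap {D : Finset ℕ} {p q p' q' : ℕ} (h : Fresh4 D p q p' q') :
    Fresh4 D q p q' p' := by
  obtain ⟨m1, m2, m3, m4, a1, a2, a3, a4, a5, a6⟩ := h
  exact ⟨m2, m1, m4, m3, a1.symm, a5, a4, a3, a2, a6.symm⟩

theorem formPerm_map_perm (π : Perm ℕ) :
    ∀ l : List ℕ, (l.map π).formPerm = π * l.formPerm * π⁻¹
  | [] => by simp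
  | [x] => by simp
  | x :: y :: l => by
    rw [List.map_cons, List.map_cons, List.formPerm_cons_cons, ← List.map_cons,
      formPerm_map_perm π (y :: l), List.formPerm_cons_cons, PercMap.map_mul_swap]

namespace MarkedMap

variable {M : MarkedMap}

/-- Gluing a triangle to the top-edge, with arbitrary labels for the new darts. -/
noncomputable def glueTriAt (M : MarkedMap) (u : Bool) (p q p' q' : ℕ) : MarkedMap where
  toPercMap := M.toPercMap.glueAt M.top p q p' q' (M.white ∪ (if u then {q', q, p'} else {q'}))
  active := (M.active \ {M.top, M.rev M.top}) ∪ {p, q, p', q'}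

theorem glueTriangle_eq (u : Bool) :
    M.glueTriangle u = M.glueTriAt u M.fresh (M.fresh + 1) (M.fresh + 2) (M.fresh + 3) := rfl

theorem lt_fresh {x : ℕ} (hx : x ∈ M.darts) : x < M.fresh :=
  Nat.lt_succ_of_le (Finset.le_sup (f := id) hx)

theorem fresh4_fresh : Fresh4 M.darts M.fresh (M.fresh + 1) (M.fresh + 2) (M.fresh + 3) := by
  have h : ∀ k, M.fresh + k ∉ M.darts := fun k hk => by have := lt_fresh hk; omega
  refine ⟨h 0, h 1, h 2, h 3, ?_, ?_, ?_, ?_, ?_, ?_⟩ <;> omega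

/-- The mirror image exchanges the gluing of triangles with a white and with a black new vertex. -/
theorem mirror_glueTriAt (hM : M.IsTriangulation) (hR : M.RootInterface) {p q p' q' : ℕ}
    (hF : Fresh4 M.darts p q p' q') (u : Bool) :
    (M.glueTriAt u p q p' q').mirror = M.mirror.glueTriAt (!u) q p q' p' := by
  have hC := hM.comb
  have hd : M.top ∈ M.darts := hC.rootFace_sub (PercMap.top_mem hM hR)
  have hnd := hM.next_ne hd
  have hC' := PercMap.mirror_comb hC
  have hF' : Fresh4 M.toPercMap.mirror.darts q p q' p' := hF.swap
  have hnd' : M.toPercMap.mirror.next M.top ≠ M.top := fun h => hnd ((Equiv.symm_apply_eq _).1 h).symm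
  obtain ⟨m1, m2, m3, m4, a1, a2, a3, a4, a5, a6⟩ := id hF
  have hrev : ∀ x, (M.toPercMap.glueAt M.top p q p' q' (M.white ∪ (if u then {q', q, p'} else {q'}))).rev x = _ :=
    fun x => PercMap.glueAt_rev hC hF x
  have hrev' : ∀ W x, (M.toPercMap.mirror.glueAt M.top q p q' p' W).rev x = _ :=
    fun W x => PercMap.glueAt_rev hC' hF' x
  have hnext : ∀ x, (M.toPercMap.glueAt M.top p q p' q' (M.white ∪ (if u then {q', q, p'} else {q'}))).next x = _ :=
    fun x => PercMap.glueAt_next hC hd hnd hF x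
  have hnext' : ∀ W x, (M.toPercMap.mirror.glueAt M.top q p q' p' W).next x = _ :=
    fun W x => PercMap.glueAt_next hC' hd hnd' hF' x
  have hmn : ∀ x, M.toPercMap.mirror.next x = M.next.symm x := PercMap.mirror_next
  have hmr : ∀ x, M.toPercMap.mirror.rev x = M.rev x := fun _ => rfl
  have f1 := hM.white_sub
  have g : ∀ x ∈ ({p, q, p', q'} : Set ℕ), M.rev x = x ∧ M.next x = x := by
    grind [hC.rev_fix, hC.next_fix]
  have e0 : (M.glueTriAt u p q p' q').mirror = ⟨⟨M.darts ∪ {p, q, p', q'},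
      (M.toPercMap.glueAt M.top p q p' q' (M.white ∪ (if u then {q', q, p'} else {q'}))).rev,
      (M.toPercMap.glueAt M.top p q p' q' (M.white ∪ (if u then {q', q, p'} else {q'}))).next⁻¹, M.root,
      {x | x ∈ M.darts ∪ {p, q, p', q'} ∧ (M.toPercMap.glueAt M.top p q p' q' (M.white ∪ (if u then {q', q, p'} else {q'}))).rev x ∉
        M.white ∪ (if u then {q', q, p'} else {q'})}⟩, (M.active \ {M.top, M.rev M.top}) ∪ {p, q, p', q'}⟩ := rfl
  have e1 : M.mirror.glueTriAt (!u) q p q' p' = ⟨⟨M.darts ∪ {q, p, q', p'},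
      (M.toPercMap.mirror.glueAt M.top q p q' p' ∅).rev,
      (M.toPercMap.mirror.glueAt M.top q p q' p' ∅).next, M.root,
      M.toPercMap.mirror.white ∪ (if (!u) then {p', p, q'} else {p'})⟩,
      (M.active \ {M.top, M.rev M.top}) ∪ {q, p, q', p'}⟩ := by
    unfold glueTriAt
    rw [mirror_top hC]
    rfl
  rw [e0, e1]
  simp only [MarkedMap.mk.injEq, PercMap.mk.injEq]
  refine ⟨⟨?_, ?_, ?_, trivial, ?_⟩, ?_⟩
  · grind
  · ext x
    rw [hrev, hrev']
    grind
  · rw [inv_eq_iff_mul_eq_one]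
    ext x
    rw [Perm.mul_apply, hnext, hnext', Perm.one_apply]
    simp only [hmn]
    have s1 : ∀ x y, M.next.symm x = y ↔ x = M.next y := by grind
    have s2 : ∀ x, M.next (M.next.symm x) = x := by grind
    have s3 : ∀ x y, M.next x = M.next y ↔ x = y := fun x y => M.next.injective.eq_iff
    clear hrev hrev' hnext hnext' e0 e1 hmn hmr
    have := g p (by simp)
    have := g q (by simp)
    have := g p' (by simp)
    grind
  · ext x
    have hw : x ∈ M.toPercMap.mirror.white ↔ x ∈ M.darts ∧ M.rev x ∉ M.white := Iff.rfl
    simp only [Set.mem_union, hw, Set.mem_ofPred_eq, Finset.mem_union, Finset.mem_insert,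
      Finset.mem_singleton]
    rw [hrev]
    have w1 : p ∉ M.white := fun h => m1 (f1 h)
    have w2 : q ∉ M.white := fun h => m2 (f1 h)
    have w3 : p' ∉ M.white := fun h => m3 (f1 h)
    have w4 : q' ∉ M.white := fun h => m4 (f1 h)
    have r : x ∈ M.darts → M.rev x ∈ M.darts := hC.rev_mem x
    clear hrev hrev' hnext hnext' e0 e1 hmn hmr g f1 hF hF' hC hC' hM hR
    cases u <;> simp only [Bool.not_true, Bool.not_false, if_true, if_false, Set.mem_insert_iff, Set.mem_singleton_iff, Bool.false_eq_true] <;> grind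
  · grind

theorem map_glueTriAt (hM : M.IsTriangulation) (hR : M.RootInterface) (π : Perm ℕ) (u : Bool)
    (p q p' q' : ℕ) :
    (M.map π).glueTriAt u (π p) (π q) (π p') (π q') = (M.glueTriAt u p q p' q').map π := by
  have e1 : (M.map π).rev = π * M.rev * π⁻¹ := rfl
  have e2 : (M.map π).next = π * M.next * π⁻¹ := rfl
  have e3 : (M.map π).darts = M.darts.map π.toEmbedding := rfl
  have e4 : (M.map π).active = π '' M.active := rfl
  have e5 : (M.map π).white = π '' M.white := rfl
  have hr : ∀ x, (M.map π).rev (π x) = π (M.rev x) := PercMap.map_rev π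
  have hn : ∀ x, (M.map π).next (π x) = π (M.next x) := PercMap.map_next π
  unfold glueTriAt PercMap.glueAt
  rw [map_top π hM hR]
  simp only [hr, hn]
  rw [e1, e2, e3, e4, e5]
  unfold map PercMap.map
  simp only [MarkedMap.mk.injEq, PercMap.mk.injEq]
  refine ⟨⟨?_, ?_, ?_, trivial, ?_⟩, ?_⟩
  · ext x
    obtain ⟨x, rfl⟩ := π.surjective x
    simp
  · rw [mul_assoc (Equiv.swap p p'), PercMap.map_mul_swap, PercMap.map_mul_swap, mul_assoc]
  · have h : ([π M.top, π p, π q, π (M.next M.top), π q', π p'] : List ℕ).formPerm =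
        π * [M.top, p, q, M.next M.top, q', p'].formPerm * π⁻¹ := by
      exact formPerm_map_perm π [M.top, p, q, M.next M.top, q', p']
    rw [h]; group
  · rw [Set.image_union]
    cases u <;> simp [Set.image_insert_eq]
  · rw [Set.image_union, Set.image_sdiff π.injective]
    simp [Set.image_insert_eq]

/-- A relabelling can be modified so as to send given unused labels to given unused labels. -/
theorem exists_map_eq (hM : M.IsPlanarMap) (ha : M.active ⊆ (M.darts : Set ℕ)) (π : Perm ℕ)
    {l l' : List ℕ} (hl : l.Nodup) (hl' : l'.Nodup) (hll : l.length = l'.length)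
    (h : ∀ x ∈ l, x ∉ M.darts) (h' : ∀ x ∈ l', x ∉ (M.map π).darts) :
    ∃ ρ : Perm ℕ, M.map ρ = M.map π ∧ l.map ρ = l' := by
  have key : ∀ (l l' : List ℕ) (S : Finset ℕ) (π : Perm ℕ), l.Nodup → l'.Nodup →
      l.length = l'.length → (∀ x ∈ l, x ∉ S) → (∀ x ∈ l', x ∉ S.map π.toEmbedding) →
      ∃ ρ : Perm ℕ, (∀ x ∈ S, ρ x = π x) ∧ l.map ρ = l' := by
    intro l
    induction l with
    | nil =>
      grind
    | cons a l ih =>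
      intro l' S π hl hl' hll h h'
      obtain ⟨b, l', rfl⟩ := List.exists_cons_of_length_eq_add_one hll.symm
      obtain ⟨ρ, h1, h2⟩ := exists_perm_extend π S (h a (by simp)) (h' b (by simp))
      rw [List.nodup_cons] at hl hl'
      obtain ⟨τ, h3, h4⟩ := ih l' (insert a S) ρ hl.2 hl'.2 (by simpa using hll)
        (fun x hx => by
          grind)
        (fun x hx => by
          have hx' := h' x (List.mem_cons_of_mem _ hx)
          rw [Finset.map_insert, Finset.mem_insert, not_or]
          refine ⟨fun h => hl'.1 ?_, fun h => hx' ?_⟩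
          · rw [← h2]; exact h ▸ hx
          · rw [Finset.mem_map] at h ⊢
            obtain ⟨y, hy, rfl⟩ := h
            exact ⟨y, hy, (h1 y hy).symm⟩)
      grind
  obtain ⟨ρ, h1, h2⟩ := key l l' M.darts π hl hl' hll h h'
  exact ⟨ρ, map_congr hM.comb hM.white_sub ha h1, h2⟩

theorem _root_.KrewerasBij.PercMap.Fresh4.nodup {D : Finset ℕ} {p q p' q' : ℕ}
    (h : Fresh4 D p q p' q') : [p, q, p', q'].Nodup ∧ ∀ x ∈ [p, q, p', q'], x ∉ D := by
  obtain ⟨m1, m2, m3, m4, a1, a2, a3, a4, a5, a6⟩ := h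
  constructor
  · simp [*]
  · simp [*]

/-- All the labellings of the new triangle give the same map, up to relabelling. -/
theorem exists_glueTriAt_map (hM : M.IsTriangulation) (hR : M.RootInterface)
    (ha : M.active ⊆ (M.darts : Set ℕ)) (π : Perm ℕ) (u : Bool) {p q p' q' r s r' s' : ℕ}
    (hF : Fresh4 M.darts p q p' q') (hF' : Fresh4 (M.map π).darts r s r' s') :
    ∃ ρ, (M.map π).glueTriAt u r s r' s' = (M.glueTriAt u p q p' q').map ρ := by
  obtain ⟨ρ, h1, h2⟩ := exists_map_eq hM.toIsPlanarMap ha π hF.nodup.1 hF'.nodup.1 rfl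
    hF.nodup.2 hF'.nodup.2
  simp only [List.map_cons, List.map_nil, List.cons.injEq, and_true] at h2
  obtain ⟨rfl, rfl, rfl, rfl⟩ := h2
  exact ⟨ρ, by rw [← h1, map_glueTriAt hM hR]⟩

theorem iso_step (hM : M.IsTriangulation) (hR : M.RootInterface)
    (ha : M.active ⊆ (M.darts : Set ℕ)) {N : MarkedMap} (h : M.Iso N) (s : Step) :
    (M.step s).Iso (N.step s) := by
  obtain ⟨π, rfl⟩ := iso_iff.1 h
  rw [iso_iff]
  cases s
  · exact exists_glueTriAt_map hM hR ha π true fresh4_fresh fresh4_fresh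
  · exact exists_glueTriAt_map hM hR ha π false fresh4_fresh fresh4_fresh
  · exact ⟨π, map_stepC π hM hR⟩

end MarkedMap

namespace PercMap

variable {M : PercMap}

section GlueTriangulation

variable (hM : M.Comb) {d p q p' q' : ℕ} {W : Set ℕ} (hd : d ∈ M.rootFace) (hnd : M.next d ≠ d)
  (hF : Fresh4 M.darts p q p' q') (hdr : M.root ≠ d)
include hM hd hnd hF

theorem glueAt_mem_vertexOf {a x : ℕ} (ha : a ∈ M.darts) :
    x ∈ (M.glueAt d p q p' q' W).vertexOf a ↔ x ∈ M.vertexOf a ∨ (x = p ∧ d ∈ M.vertexOf a) ∨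
      (x = q' ∧ M.rev d ∈ M.vertexOf a) := by
  have hdD := hM.rootFace_sub hd
  have hC := glueAt_comb hM (W := W) hdD hnd hF
  have hR := glueAt_rot hM (W := W) hdD hnd hF
  have hsc := fun {a b : ℕ} => glueAt_rot_sameCycle hM (W := W) hdD hnd hF (a := a) (b := b)
  obtain ⟨m1, m2, m3, m4, a1, a2, a3, a4, a5, a6⟩ := id hF
  set N := M.glueAt d p q p' q' W with hN
  have hrd := hM.rev_mem d hdD
  have b1 : p ≠ d := fun h => m1 (h ▸ hdD)
  have c1 : p ≠ M.rev d := fun h => m1 (h ▸ hrd)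
  have c2 : q ≠ M.rev d := fun h => m2 (h ▸ hrd)
  have c3 : p' ≠ M.rev d := fun h => m3 (h ▸ hrd)
  have e1 : N.rot p = d := by rw [hR]; simp [c1, a3]
  have e2 : N.rot (M.rev d) = q' := by rw [hR]; simp
  have e3 : N.rot q = p' := by grind
  have e4 : N.rot p' = q := by grind
  have hold : ∀ b ∈ M.darts, (b ∈ N.vertexOf a ↔ b ∈ M.vertexOf a) := fun b hb => hsc ha hb
  have hnew : ∀ x, x = q ∨ x = p' → ¬ x ∈ N.vertexOf a := by
    intro x hx h
    have := mem_of_sameCycle (p := N.rot) (S := {y | y = q ∨ y = p'}) (D := N.darts) hC.rot_fix ?_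
      (mem_vertexOf.1 h).symm hx
    · grind
    · grind
  have hv : ∀ b, x ∈ M.vertexOf b → (x ∈ M.darts ↔ b ∈ M.darts) := fun b h => hM.vertexOf_sub h
  by_cases hx : x ∈ M.darts
  · grind
  · have hx' : x ∉ M.vertexOf a := by grind
    by_cases hxp : x = p
    · grind [rot_mem_vertexOf]
    by_cases hxq : x = q'
    · grind [rot_mem_vertexOf]
    have : x ∉ N.vertexOf a := by
      intro h
      have h2 := (hC.vertexOf_sub h).2 ((glueAt_mem (M := M)).2 (.inl ha))
      grind [glueAt_mem]
    grind

theorem glueAt_mem_vertexOf_new {x : ℕ} :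
    x ∈ (M.glueAt d p q p' q' W).vertexOf q ↔ x = q ∨ x = p' := by
  have hdD := hM.rootFace_sub hd
  have hC := glueAt_comb hM (W := W) hdD hnd hF
  have hR := glueAt_rot hM (W := W) hdD hnd hF
  obtain ⟨m1, m2, m3, m4, a1, a2, a3, a4, a5, a6⟩ := id hF
  set N := M.glueAt d p q p' q' W with hN
  have hrd := hM.rev_mem d hdD
  have c2 : q ≠ M.rev d := fun h => m2 (h ▸ hrd)
  have c3 : p' ≠ M.rev d := fun h => m3 (h ▸ hrd)
  have e3 : N.rot q = p' := by grind
  have e4 : N.rot p' = q := by grind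
  constructor
  · intro h
    refine mem_of_sameCycle (p := N.rot) (S := {y | y = q ∨ y = p'}) (D := N.darts) hC.rot_fix ?_
      (mem_vertexOf.1 h) (.inl rfl)
    grind
  · grind [self_mem_vertexOf, rot_mem_vertexOf]

include hdr

theorem glueAt_mem_rootFace {x : ℕ} :
    x ∈ (M.glueAt d p q p' q' W).rootFace ↔ (x ∈ M.rootFace ∧ x ≠ d) ∨ x = p ∨ x = q := by
  have hdD := hM.rootFace_sub hd
  have hC := glueAt_comb hM (W := W) hdD hnd hF
  obtain ⟨v1, v2, v3, v4, v5, v6, v7, v8, v9, v10, v11, v12⟩ := glueAt_values hM (W := W) hdD hnd hF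
  have hsc := fun {a b : ℕ} => glueAt_next_sameCycle hM (W := W) hdD hnd hF (a := a) (b := b)
  have hfd := fun {x : ℕ} => glueAt_faceOf_d hM (W := W) hdD hnd hF (x := x)
  obtain ⟨m1, m2, m3, m4, a1, a2, a3, a4, a5, a6⟩ := id hF
  set N := M.glueAt d p q p' q' W with hN
  have hroot : N.root = M.root := rfl
  have hold : ∀ x ∈ M.darts, x ≠ d → (x ∈ N.rootFace ↔ x ∈ M.rootFace) := fun x hx hxd =>
    hsc hM.root_mem hx hdr hxd
  have hdn : ∀ x, x = d ∨ x = q' ∨ x = p' → x ∉ N.rootFace := by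
    intro x hx h
    have h1 : x ∈ N.faceOf d := hfd.2 hx
    have h2 : N.root ∈ N.faceOf d := mem_faceOf.2 (h1.trans (mem_rootFace.1 h).symm)
    rcases hfd.1 h2 with h3 | h3 | h3
    · exact hdr h3
    · exact m4 (h3 ▸ hM.root_mem)
    · exact m3 (h3 ▸ hM.root_mem)
  have hp : p ∈ N.rootFace := by
    grind [next_mem_rootFace, hM.rootFace_sub]
  have hq : q ∈ N.rootFace := by rw [← v8, next_mem_rootFace]; exact hp
  by_cases h : x = d ∨ x = q' ∨ x = p'
  · grind [hM.rootFace_sub]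
  · by_cases hx : x = p ∨ x = q
    · grind
    · by_cases hxD : x ∈ M.darts
      · grind
      · have : x ∉ N.rootFace := fun h' => by
          have := hC.rootFace_sub h'
          grind [glueAt_mem]
        grind [hM.rootFace_sub]

theorem glueAt_mem_faceOf {a x : ℕ} (ha : a ∈ M.darts) (hai : a ∉ M.rootFace) :
    x ∈ (M.glueAt d p q p' q' W).faceOf a ↔ x ∈ M.faceOf a := by
  have hdD := hM.rootFace_sub hd
  have hC := glueAt_comb hM (W := W) hdD hnd hF
  have hrf := fun {x : ℕ} => glueAt_mem_rootFace hM (W := W) hd hnd hF hdr (x := x)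
  have hsc := fun {a b : ℕ} => glueAt_next_sameCycle hM (W := W) hdD hnd hF (a := a) (b := b)
  have hfd := fun {x : ℕ} => glueAt_faceOf_d hM (W := W) hdD hnd hF (x := x)
  obtain ⟨m1, m2, m3, m4, a1, a2, a3, a4, a5, a6⟩ := id hF
  set N := M.glueAt d p q p' q' W with hN
  have had : a ≠ d := fun h => hai (h ▸ hd)
  have key : ∀ x, x ∈ N.faceOf a → x ∈ M.darts ∧ x ≠ d := by
    intro x hx
    have h0 : a ∉ N.rootFace := by
      grind
    have h1 : x ∉ N.rootFace := fun h => h0 (h.trans (mem_faceOf.1 hx).symm)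
    have h2 : x ∉ N.faceOf d := fun h => by
      have : a ∈ N.faceOf d := mem_faceOf.2 (h.trans (mem_faceOf.1 hx).symm)
      rcases hfd.1 this with h3 | rfl | rfl
      exacts [had h3, m4 ha, m3 ha]
    have h3 : x ∈ N.darts := (hC.faceOf_sub hx).2 (glueAt_mem.2 (.inl ha))
    rw [hN, glueAt_mem] at h3
    rw [hN, hrf] at h1
    have h4 : ¬ (x = d ∨ x = q' ∨ x = p') := fun h => h2 (hfd.2 h)
    grind
  constructor
  · intro h
    obtain ⟨h1, h2⟩ := key x h
    exact (hsc ha h1 had h2).1 h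
  · intro h
    have h1 : x ∈ M.darts := (hM.faceOf_sub h).2 ha
    have h2 : x ≠ d := fun hx => hai (by
      subst hx
      exact hd.trans (mem_faceOf.1 h).symm)
    exact (hsc ha h1 had h2).2 h

set_option maxHeartbeats 1000000 in
theorem glueAt_isTriangulation_iff (hw : M.white ⊆ (M.darts : Set ℕ)) (hbw : M.BW d) :
    (M.glueAt d p q p' q' (M.white ∪ {q', q, p'})).IsTriangulation ↔ M.IsTriangulation := by
  have hdD := hM.rootFace_sub hd
  set W := M.white ∪ {q', q, p'} with hW
  have hC := glueAt_comb hM (W := W) hdD hnd hF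
  obtain ⟨v1, v2, v3, v4, v5, v6, v7, v8, v9, v10, v11, v12⟩ := glueAt_values hM (W := W) hdD hnd hF
  have hrot := glueAt_rot hM (W := W) hdD hnd hF
  have hrf := fun {x : ℕ} => glueAt_mem_rootFace hM (W := W) hd hnd hF hdr (x := x)
  have hvo := fun {a x : ℕ} => glueAt_mem_vertexOf hM (W := W) hd hnd hF (a := a) (x := x)
  have hvn := fun {x : ℕ} => glueAt_mem_vertexOf_new hM (W := W) hd hnd hF (x := x)
  have hfo := fun {a x : ℕ} => glueAt_mem_faceOf hM (W := W) hd hnd hF hdr (a := a) (x := x)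
  have hfd := fun {x : ℕ} => glueAt_faceOf_d hM (W := W) hdD hnd hF (x := x)
  have hE := glueAt_euler_iff hM (W := W) hdD hnd hF
  have hconn := glueAt_connected_iff hM (W := W) hdD hnd hF
  have hmem := fun {x : ℕ} => glueAt_mem (M := M) (d := d) (p := p) (q := q) (p' := p') (q' := q')
    (W := W) (x := x)
  obtain ⟨m1, m2, m3, m4, a1, a2, a3, a4, a5, a6⟩ := id hF
  have hrd := hM.rev_mem d hdD
  have hwN : (M.glueAt d p q p' q' W).white = W := rfl
  set N := M.glueAt d p q p' q' W with hN
  have hwo : ∀ x ∈ M.darts, (x ∈ W ↔ x ∈ M.white) := by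
    grind
  have b1 : p ≠ d := fun h => m1 (h ▸ hdD)
  have b2 : q ≠ d := fun h => m2 (h ▸ hdD)
  have hpW : p ∉ W := by
    grind
  have hqW : q ∈ W := by simp [hW]
  have hp'W : p' ∈ W := by simp [hW]
  have hq'W : q' ∈ W := by simp [hW]
  have hrotD : ∀ x ∈ M.darts, N.rot x = if x = M.rev d then q' else if M.rot x = d then p else
      M.rot x := by
    intro x hx
    have : x ≠ p := fun h => m1 (h ▸ hx)
    have : x ≠ q := fun h => m2 (h ▸ hx)
    have : x ≠ p' := fun h => m3 (h ▸ hx)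
    have : x ≠ q' := fun h => m4 (h ▸ hx)
    rw [hrot]
    simp [*]
  constructor
  · intro hN'
    have wrot : ∀ x ∈ M.darts, (M.rot x ∈ M.white ↔ x ∈ M.white) := by
      grind [rot_apply, hM.next_mem_iff, hM.rev_mem_iff, rot_mem_vertexOf, self_mem_vertexOf,
          hN'.white_vertexOf]
    refine ⟨⟨hM.rev_mem, hM.rev_ne, fun x _ => hM.rev_rev x, hM.rev_fix,
      fun x hx => hM.next_mem_iff.2 hx, hM.next_fix, hM.root_mem, hconn.1 hN'.connected,
      hE.1 hN'.euler, hw, wrot⟩, fun x hx hxi => ?_, fun x hx h => ?_, fun x hx y hy h => ?_⟩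
    · rw [← hN'.triangle x (hmem.2 (.inl hx)) (by
        rw [hrf]
        grind)]
      congr 1
      ext y
      exact (hfo hx hxi).symm
    · grind [hN'.loopless]
    · have hxD := hM.rootFace_sub hx
      have hyD := hM.rootFace_sub hy
      by_cases hxd : x = d
      · subst hxd
        by_contra hne
        have h1 := hN'.simple p (hrf.2 (.inr (.inl rfl))) y (hrf.2 (.inl ⟨hy, fun h => hne h.symm⟩))
          (mem_vertexOf_comm.1 ((hvo hyD).2 (.inr (.inl ⟨rfl, mem_vertexOf_comm.1 h⟩))))
        exact m1 (h1 ▸ hyD)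
      by_cases hyd : y = d
      · subst hyd
        have h1 := hN'.simple p (hrf.2 (.inr (.inl rfl))) x (hrf.2 (.inl ⟨hx, hxd⟩))
          (mem_vertexOf_comm.1 ((hvo hxD).2 (.inr (.inl ⟨rfl, h⟩))))
        exact absurd hxD (h1 ▸ m1)
      · grind [hN'.simple]
  · intro hM'
    refine ⟨⟨hC.rev_mem, hC.rev_ne, fun x _ => hC.rev_rev x, hC.rev_fix,
      fun x hx => hC.next_mem_iff.2 hx, hC.next_fix, hC.root_mem, hconn.2 hM'.connected,
      hE.2 hM'.euler, ?_, ?_⟩, fun x hx hxi => ?_, fun x hx h => ?_, fun x hx y hy h => ?_⟩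
    · grind
    · intro x hx
      rw [hwN]
      rcases hmem.1 hx with hx | rfl | rfl | rfl | rfl
      · rw [hrotD x hx]
        split_ifs with h1 h2
        · rw [h1, hwo _ hrd]
          exact iff_of_true hq'W hbw.2
        · rw [hwo _ hx, ← hM'.white_rot_iff x, h2]
          exact iff_of_false hpW hbw.1
        · grind [hM'.white_rot_iff, rot_apply, hM.next_mem_iff, hM.rev_mem_iff]
      · rw [rot_apply, v1, v7, hwo d hdD]
        exact iff_of_false hbw.1 hpW
      · grind [rot_apply]
      · grind [rot_apply]
      · rw [rot_apply, v4, v9, hwo _ (hM.next_mem_iff.2 hdD)]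
        refine iff_of_true ?_ hq'W
        rw [hM'.white_next]; exact hbw.2
    · have h1 : ∀ x, x = d ∨ x = q' ∨ x = p' → (N.faceOf x).ncard = 3 := by
        intro x hx
        have h2 : N.faceOf x = N.faceOf d :=
          (faceOf_eq_iff.2 (hfd.2 hx)).symm
        rw [h2, show N.faceOf d = {d, q', p'} from by ext y; exact hfd]
        rw [Set.ncard_eq_three]
        exact ⟨d, q', p', fun h => m4 (h ▸ hdD), fun h => m3 (h ▸ hdD), a6.symm, rfl⟩
      rw [hrf] at hxi
      rcases hmem.1 hx with hx | rfl | rfl | rfl | rfl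
      · by_cases hxd : x = d
        · exact h1 x (.inl hxd)
        · have hxi' : x ∉ M.rootFace := by grind
          rw [← hM'.triangle x hx hxi']
          congr 1
          grind
      · grind
      · grind
      · exact h1 _ (.inr (.inr rfl))
      · exact h1 _ (.inr (.inl rfl))
    · have hvp : ∀ y, y ∈ N.vertexOf p → y ≠ p' := by
        rintro y hy rfl
        have h2 := hvn.2 (.inr rfl : y = q ∨ y = y)
        have h3 : p ∈ N.vertexOf q := mem_vertexOf.2 (h2.trans (mem_vertexOf.1 hy).symm)
        grind
      rcases hmem.1 hx with hx | rfl | rfl | rfl | rfl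
      · rw [v10 x hx, hvo hx] at h
        grind [hM'.loopless, hM.rev_mem]
      · grind
      · grind
      · rw [v2] at h
        exact hvp _ (mem_vertexOf_comm.1 h) rfl
      · grind [mem_vertexOf_comm]
    · rw [hrf] at hx hy
      have h1 : ∀ x, x ∈ M.rootFace → p ∈ N.vertexOf x → x = d := by
        intro x hx h
        rcases (hvo (hM.rootFace_sub hx)).1 h with h | h | h
        · exact absurd ((hM.vertexOf_sub h).2 (hM.rootFace_sub hx)) m1
        · exact hM'.outer_eq hx hd h.2
        · exact absurd h.1 a3
      rcases hx with hx | rfl | rfl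
      · have hxD := hM.rootFace_sub hx.1
        rcases hy with hy | rfl | rfl
        · grind [hM.rootFace_sub, hM'.outer_eq]
        · exact absurd (h1 x hx.1 h) hx.2
        · rcases hvn.1 (mem_vertexOf_comm.1 h) with rfl | rfl
          · rfl
          · exact absurd hxD m3
      · rcases hy with hy | rfl | rfl
        · exact absurd (h1 y hy.1 (mem_vertexOf_comm.1 h)) hy.2
        · rfl
        · rcases hvn.1 (mem_vertexOf_comm.1 h) with h | h
          · exact absurd h a1
          · exact absurd h a2
      · grind [hM.rootFace_sub]

/-- The root-interface condition when a triangle with a white new vertex is glued to the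
top-edge. -/
theorem glueAt_rootInterface_iff (hw : M.white ⊆ (M.darts : Set ℕ)) (hbw : M.BW d) :
    (M.glueAt d p q p' q' (M.white ∪ {q', q, p'})).RootInterface ↔ M.RootInterface := by
  have hdD := hM.rootFace_sub hd
  set W := M.white ∪ {q', q, p'} with hW
  obtain ⟨v1, v2, v3, v4, v5, v6, v7, v8, v9, v10, v11, v12⟩ := glueAt_values hM (W := W) hdD hnd hF
  have hrf := fun {x : ℕ} => glueAt_mem_rootFace hM (W := W) hd hnd hF hdr (x := x)
  obtain ⟨m1, m2, m3, m4, a1, a2, a3, a4, a5, a6⟩ := id hF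
  have hwN : (M.glueAt d p q p' q' W).white = W := rfl
  have hroot : (M.glueAt d p q p' q' W).root = M.root := rfl
  set N := M.glueAt d p q p' q' W with hN
  have hwo : ∀ x ∈ M.darts, (x ∈ W ↔ x ∈ M.white) := by
    grind
  have hpW : p ∉ W := by
    grind
  have hq'W : q' ∈ W := by simp [hW]
  unfold RootInterface
  rw [hroot, hwN, v10 _ hM.root_mem, hwo _ hM.root_mem, hwo _ (hM.rev_mem _ hM.root_mem)]
  refine and_congr_right fun _ => ?_
  constructor
  · intro h x hx hxr h'
    have hxD := hM.rootFace_sub hx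
    by_cases hxd : x = d
    · subst hxd; exact hbw.1 h'.1
    · grind [hM.rev_mem]
  · grind [hM.rootFace_sub, hM.rev_mem]

end GlueTriangulation

/-- One of the ends of the dart `e` is the origin of the dart `x`. -/
def Touch (M : PercMap) (e x : ℕ) : Prop := e ∈ M.vertexOf x ∨ M.rev e ∈ M.vertexOf x

theorem mirror_touch (hM : M.Comb) {e x : ℕ} : M.mirror.Touch e x ↔ M.Touch e (M.rev x) := by
  have hr : ∀ x, M.mirror.rev x = M.rev x := fun _ => rfl
  unfold Touch
  rw [mem_mirror_vertexOf hM, mem_mirror_vertexOf hM, hr, hM.rev_rev]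
  exact or_comm

theorem touch_rev (hM : M.Comb) {e x : ℕ} : M.Touch (M.rev e) x ↔ M.Touch e x := by
  unfold Touch
  rw [hM.rev_rev]
  exact or_comm

theorem interfaceStep_congr {N : PercMap} {g : ℕ} (h1 : N.next g = M.next g)
    (h2 : N.next (M.next g) = M.next (M.next g))
    (h3 : M.next (M.next g) ∈ N.white ↔ M.next (M.next g) ∈ M.white)
    (h4 : N.rev (M.next g) = M.rev (M.next g))
    (h5 : N.rev (M.next (M.next g)) = M.rev (M.next (M.next g))) :
    N.interfaceStep g = M.interfaceStep g := by
  grind [interfaceStep_white, interfaceStep_black]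

end PercMap

namespace MarkedMap

open PercMap

/-- The structure of the marked map of a walk whose unmatched `a`-steps (`b`-steps) have their
indices in the list `la` (`lb`), the last one first. The outer dart `T i` was the top-edge before
the step `i`; it now belongs to an inner triangle, which is the `κ i`-th one along the path. The
path leaves the map after `K` triangles. For each unmatched step `i`, the dart `U i` is directed
from the vertex created at step `i` along the active edge of the triangle glued at that step, which
is an outer dart for an `a`-step and the reverse of an outer dart for a `b`-step. -/
structure Inv (la lb : List ℕ) (M : MarkedMap) (T U κ : ℕ → ℕ) (K : ℕ) : Prop where
  tri : M.IsTriangulation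
  ri : M.RootInterface
  active : ∀ x, x ∈ M.active ↔ (x = M.top ∨ x = M.rev M.top) ∨
    ∃ i, (i ∈ la ∨ i ∈ lb) ∧ (x = U i ∨ x = M.rev (U i))
  chainL : (M.top :: la.map U).IsChain fun x y => M.next x = y
  chainR : (M.top :: lb.map fun i => M.rev (U i)).IsChain fun x y => M.next y = x
  white : ∀ i ∈ la, M.WhiteEdge (U i)
  black : ∀ i ∈ lb, M.BlackEdge (U i)
  triL : ∀ i ∈ la, M.next (T i) = M.rev (U i)
  triR : ∀ i ∈ lb, M.next (U i) = T i
  pathEnd : M.PathEnd K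
  entry : ∀ i, (i ∈ la ∨ i ∈ lb) → κ i < K ∧ M.entry (κ i) = T i
  mono : ∀ i j, (i ∈ la ∨ i ∈ lb) → (j ∈ la ∨ j ∈ lb) → i < j → κ i < κ j
  /-- The path does not touch the vertex created at step `i` before the triangle of this step. -/
  near : ∀ i, (i ∈ la ∨ i ∈ lb) → ∀ l ≤ κ i, ¬ M.Touch (M.entry l) (U i)
  /-- Edges which a step `c` might identify with each other to form a loop do not exist. -/
  far : ∀ i j, (i ∈ la ∨ i ∈ lb) → (j ∈ la ∨ j ∈ lb) → i < j →
    ∀ x ∈ M.vertexOf (U j), M.rev x ∉ M.vertexOf (M.rev (U i))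
  sortL : la.Pairwise (· > ·)
  sortR : lb.Pairwise (· > ·)
  disj : ∀ i ∈ la, i ∉ lb

variable {la lb : List ℕ} {M : MarkedMap} {T U κ : ℕ → ℕ} {K : ℕ}

namespace Inv

theorem congr (h : Inv la lb M T U κ K) {T' U' κ' : ℕ → ℕ} (hT : ∀ i, (i ∈ la ∨ i ∈ lb) → T' i = T i)
    (hU : ∀ i, (i ∈ la ∨ i ∈ lb) → U' i = U i) (hκ : ∀ i, (i ∈ la ∨ i ∈ lb) → κ' i = κ i) :
    Inv la lb M T' U' κ' K where
  tri := h.tri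
  ri := h.ri
  active x := by
    grind [h.active]
  chainL := by
    rw [List.map_congr_left fun i hi => hU i (.inl hi)]; exact h.chainL
  chainR := by
    rw [List.map_congr_left fun i hi => by rw [hU i (.inr hi)]]; exact h.chainR
  white i hi := by rw [hU i (.inl hi)]; exact h.white i hi
  black i hi := by rw [hU i (.inr hi)]; exact h.black i hi
  triL i hi := by rw [hU i (.inl hi), hT i (.inl hi)]; exact h.triL i hi
  triR i hi := by rw [hU i (.inr hi), hT i (.inr hi)]; exact h.triR i hi
  pathEnd := h.pathEnd
  entry i hi := by rw [hκ i hi, hT i hi]; exact h.entry i hi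
  mono i j hi hj := by rw [hκ i hi, hκ j hj]; exact h.mono i j hi hj
  near i hi := by rw [hκ i hi, hU i hi]; exact h.near i hi
  far i j hi hj := by rw [hU i hi, hU j hj]; exact h.far i j hi hj
  sortL := h.sortL
  sortR := h.sortR
  disj := h.disj

variable (h : Inv la lb M T U κ K)
include h

theorem comb : M.Comb := h.tri.comb

theorem top_mem : M.top ∈ M.rootFace := PercMap.top_mem h.tri h.ri

theorem top_bw : M.BW M.top := PercMap.top_bw h.tri h.ri

theorem top_darts : M.top ∈ M.darts := h.comb.rootFace_sub h.top_mem

theorem entry_end : M.entry K = M.top := h.pathEnd.eq_top h.tri h.ri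

theorem left_mem {i : ℕ} (hi : i ∈ la) : U i ∈ M.rootFace := by
  have key : ∀ (l : List ℕ) (x : ℕ), x ∈ M.rootFace → (x :: l).IsChain (fun x y => M.next x = y) →
      ∀ y ∈ l, y ∈ M.rootFace := by
    intro l
    induction l with
    | nil => simp
    | cons a l ih =>
      grind [next_mem_rootFace]
  exact key _ _ h.top_mem h.chainL _ (List.mem_map_of_mem hi)

theorem right_mem {i : ℕ} (hi : i ∈ lb) : M.rev (U i) ∈ M.rootFace := by
  have key : ∀ (l : List ℕ) (x : ℕ), x ∈ M.rootFace → (x :: l).IsChain (fun x y => M.next y = x) →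
      ∀ y ∈ l, y ∈ M.rootFace := by
    intro l
    induction l with
    | nil => simp
    | cons a l ih =>
      grind [next_mem_rootFace]
  exact key _ _ h.top_mem h.chainR _ (List.mem_map_of_mem (f := fun i => M.rev (U i)) hi)

theorem U_darts {i : ℕ} (hi : i ∈ la ∨ i ∈ lb) : U i ∈ M.darts := by
  rcases hi with hi | hi
  · exact h.comb.rootFace_sub (h.left_mem hi)
  · rw [← h.comb.rev_mem_iff]; exact h.comb.rootFace_sub (h.right_mem hi)

theorem T_darts {i : ℕ} (hi : i ∈ la ∨ i ∈ lb) : T i ∈ M.darts := by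
  rw [← (h.entry i hi).2]; exact h.pathEnd.mem h.tri h.ri (h.entry i hi).1.le

theorem T_inner {i : ℕ} (hi : i ∈ la ∨ i ∈ lb) : T i ∉ M.rootFace := by
  rw [← (h.entry i hi).2]; exact h.pathEnd.inner _ (h.entry i hi).1

theorem rev_U_left_mem_face {i : ℕ} (hi : i ∈ la) : M.rev (U i) ∈ M.faceOf (T i) := by
  rw [← h.triL i hi, next_mem_faceOf]; exact self_mem_faceOf _

theorem U_right_mem_face {i : ℕ} (hi : i ∈ lb) : U i ∈ M.faceOf (T i) := by
  rw [← next_mem_faceOf, h.triR i hi]; exact self_mem_faceOf _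

theorem rev_left_inner {i : ℕ} (hi : i ∈ la) : M.rev (U i) ∉ M.rootFace := fun h' =>
  h.T_inner (.inl hi) (h'.trans (mem_faceOf.1 (h.rev_U_left_mem_face hi)).symm)

theorem right_inner {i : ℕ} (hi : i ∈ lb) : U i ∉ M.rootFace := fun h' =>
  h.T_inner (.inr hi) (h'.trans (mem_faceOf.1 (h.U_right_mem_face hi)).symm)

/-- The active outer darts of unicolor white edges are those of the unmatched `a`-steps. -/
theorem left_active_iff {x : ℕ} :
    (x ∈ M.rootFace ∧ M.WhiteEdge x ∧ x ∈ M.active) ↔ ∃ i ∈ la, x = U i := by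
  constructor
  · rintro ⟨h1, h2, h3⟩
    rcases (h.active x).1 h3 with (rfl | rfl) | ⟨i, hi | hi, rfl | rfl⟩
    · exact absurd h2.1 h.top_bw.1
    · have := h2.2; rw [h.comb.rev_rev] at this; exact absurd this h.top_bw.1
    · exact ⟨i, hi, rfl⟩
    · exact absurd h1 (h.rev_left_inner hi)
    · exact absurd h2.1 (h.black i hi).1
    · exact absurd h2.1 (h.black i hi).2
  · grind [h.left_mem, h.white, h.active]

/-- The active outer darts of unicolor black edges are those of the unmatched `b`-steps. -/
theorem right_active_iff {x : ℕ} :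
    (x ∈ M.rootFace ∧ M.BlackEdge x ∧ x ∈ M.active) ↔ ∃ i ∈ lb, x = M.rev (U i) := by
  constructor
  · rintro ⟨h1, h2, h3⟩
    rcases (h.active x).1 h3 with (rfl | rfl) | ⟨i, hi | hi, rfl | rfl⟩
    · exact absurd h.top_bw.2 h2.2
    · exact absurd h.top_bw.2 h2.1
    · exact absurd (h.white i hi).1 h2.1
    · exact absurd (h.white i hi).2 h2.1
    · exact absurd h1 (h.right_inner hi)
    · exact ⟨i, hi, rfl⟩
  · rintro ⟨i, hi, rfl⟩
    refine ⟨h.right_mem hi, ⟨(h.black i hi).2, ?_⟩, (h.active _).2 (.inr ⟨i, .inr hi, .inr rfl⟩)⟩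
    rw [h.comb.rev_rev]; exact (h.black i hi).1

theorem hasActiveLeft_iff : M.HasActiveLeft ↔ la ≠ [] := by
  have : M.HasActiveLeft ↔ ∃ x, x ∈ M.rootFace ∧ M.WhiteEdge x ∧ x ∈ M.active :=
    exists_congr fun x => and_congr_right fun _ => and_comm
  rw [this]
  simp only [h.left_active_iff]
  refine ⟨fun ⟨_, i, hi, _⟩ => List.ne_nil_of_mem hi, fun hl => ?_⟩
  obtain ⟨i, hi⟩ := List.exists_mem_of_ne_nil _ hl
  exact ⟨_, i, hi, rfl⟩

theorem hasActiveRight_iff : M.HasActiveRight ↔ lb ≠ [] := by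
  have : M.HasActiveRight ↔ ∃ x, x ∈ M.rootFace ∧ M.BlackEdge x ∧ x ∈ M.active :=
    exists_congr fun x => and_congr_right fun _ => and_comm
  rw [this]
  simp only [h.right_active_iff]
  refine ⟨fun ⟨_, i, hi, _⟩ => List.ne_nil_of_mem hi, fun hl => ?_⟩
  obtain ⟨i, hi⟩ := List.exists_mem_of_ne_nil _ hl
  exact ⟨_, i, hi, rfl⟩

theorem mirror : Inv lb la M.mirror T (fun i => M.rev (U i)) κ K := by
  have hC := h.comb
  have hmr : ∀ x, M.mirror.rev x = M.rev x := fun _ => rfl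
  have hmn : ∀ x, M.mirror.next x = M.next.symm x := fun _ => rfl
  have htop : M.mirror.top = M.top := mirror_top hC
  have hent : ∀ l ≤ K, M.mirror.entry l = M.entry l := fun l hl =>
    mirror_entry h.tri h.ri h.pathEnd hl
  have htouch : ∀ e x, M.mirror.Touch e x ↔ M.Touch e (M.rev x) := fun e x => mirror_touch hC
  constructor
  · exact mirror_isTriangulation h.tri
  · exact mirror_rootInterface hC h.ri
  · grind [mirror_active, h.active, hC.rev_rev]
  · rw [htop]
    refine h.chainR.imp fun x y hxy => ?_
    grind
  · rw [htop]
    simp only [hmr, hC.rev_rev]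
    refine h.chainL.imp fun x y hxy => ?_
    grind
  · intro i hi
    refine (mirror_whiteEdge hC (hC.rootFace_sub (h.right_mem hi))).2 ⟨(h.black i hi).2, ?_⟩
    rw [hC.rev_rev]; exact (h.black i hi).1
  · intro i hi
    refine (mirror_blackEdge hC (hC.rev_mem _ (h.U_darts (.inl hi)))).2 ⟨(h.white i hi).2, ?_⟩
    rw [hC.rev_rev]; exact (h.white i hi).1
  · intro i hi
    rw [hmr, hmn, hC.rev_rev, Equiv.symm_apply_eq, h.triR i hi]
  · intro i hi
    rw [hmn, Equiv.symm_apply_eq, h.triL i hi]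
  · exact mirror_pathEnd h.tri h.ri h.pathEnd
  · intro i hi
    obtain ⟨h1, h2⟩ := h.entry i hi.symm
    grind
  · intro i j hi hj
    exact h.mono i j hi.symm hj.symm
  · intro i hi l hl
    rw [hent l (hl.trans (h.entry i hi.symm).1.le), htouch, hC.rev_rev]
    exact h.near i hi.symm l hl
  · intro i j hi hj hij x hx
    have e1 : x ∈ M.mirror.vertexOf (M.rev (U j)) ↔ M.rev x ∈ M.vertexOf (U j) := by
      have := mem_mirror_vertexOf hC (d := M.rev (U j)) (x := x)
      rwa [hC.rev_rev] at this
    have e2 : M.rev x ∈ M.mirror.vertexOf (U i) ↔ x ∈ M.vertexOf (M.rev (U i)) := by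
      have := mem_mirror_vertexOf hC (d := U i) (x := M.rev x)
      rwa [hC.rev_rev] at this
    rw [hmr, hmr, hC.rev_rev, e2]
    have := h.far i j hi.symm hj.symm hij _ (e1.1 hx)
    rwa [hC.rev_rev] at this
  · exact h.sortR
  · exact h.sortL
  · exact fun i hi hi' => h.disj i hi' hi

end Inv

/-! ### Consecutive active edges -/

/-- The active edges are consecutive as soon as the predecessor of an active left edge and the
successor of an active right edge are active. -/
theorem consecutive_of_local (hM : M.IsTriangulation) (hR : M.RootInterface)
    (htop : M.top ∈ M.active) (hroot : M.root ∈ M.active → M.rev M.root = M.top)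
    (hL : ∀ x ∈ M.rootFace, M.WhiteEdge x → x ∈ M.active → M.next.symm x ∈ M.active)
    (hB : ∀ x ∈ M.rootFace, M.BlackEdge x → x ∈ M.active → M.next x ∈ M.active) :
    ∃ s ∈ M.rootFace, ∃ L : ℕ, ∀ x ∈ M.rootFace, (x ∈ M.active ↔ ∃ i < L, (M.next ^ i) s = x) := by
  classical
  by_cases hra : M.root ∈ M.active
  · have h1 := hroot hra
    have h2 := PercMap.top_mem hM hR
    rw [← h1] at h2
    obtain ⟨e1, e2, e3⟩ := hM.single_edge root_mem_rootFace h2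
    refine ⟨M.root, root_mem_rootFace, 2, fun x hx => ?_⟩
    rcases (e3 x).1 (hM.comb.rootFace_sub hx) with rfl | rfl
    · exact iff_of_true hra ⟨0, by omega, rfl⟩
    · exact iff_of_true (h1 ▸ htop) ⟨1, by omega, e1⟩
  obtain ⟨τ, n, h1, hτn, hnr, -, hb, hw⟩ := exists_boundary hM hR
  set f : ℕ → ℕ := fun i => (M.next ^ i) M.root with hf
  have hfs : ∀ i, f (i + 1) = M.next (f i) := fun i => by
    simp only [hf, pow_succ', Perm.mul_apply]
  have hfm : ∀ i, f i ∈ M.rootFace := by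
    intro i
    induction i with
    | zero => exact root_mem_rootFace
    | succ i ih => rw [hfs, next_mem_rootFace]; exact ih
  have hrev : ∀ i, (M.rev (f i) ∈ M.white ↔ f (i + 1) ∈ M.white) := fun i => by
    rw [hfs, hM.white_next]
  have hft : f τ = M.top := PercMap.eq_top hM hR (hfm τ)
    ⟨hb τ h1 le_rfl, by rw [hrev]; exact hw (τ + 1) (by omega) (by omega)⟩
  -- the active indices on the two sides of the top-edge
  have down : ∀ i j, τ ≤ i → i ≤ j → j < n → f j ∈ M.active → f i ∈ M.active := by
    intro i j hi hij hj hja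
    induction j, hij using Nat.le_induction with
    | base => exact hja
    | succ j hij ih =>
      refine ih (by omega) ?_
      have := hL (f (j + 1)) (hfm _) ⟨hw _ (by omega) (by omega),
        by rw [hrev]; exact hw _ (by omega) (by omega)⟩ hja
      grind
  have up : ∀ i j, 1 ≤ i → i ≤ j → j ≤ τ → f i ∈ M.active → f j ∈ M.active := by
    intro i j hi hij hj hia
    induction j, hij using Nat.le_induction with
    | base => exact hia
    | succ j hij ih =>
      have := hB (f j) (hfm _) ⟨hb _ (by omega) (by omega),
        by rw [hrev]; exact hb _ (by omega) (by omega)⟩ (ih (by omega))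
      rwa [hfs]
  have hex : ∃ i, 1 ≤ i ∧ f i ∈ M.active := by grind
  obtain ⟨hlo1, hlo⟩ := Nat.find_spec hex
  set lo := Nat.find hex with hlodef
  have hloτ : lo ≤ τ := Nat.find_min' hex ⟨h1, hft ▸ htop⟩
  have hlomin : ∀ i, 1 ≤ i → f i ∈ M.active → lo ≤ i := fun i h h' => Nat.find_min' hex ⟨h, h'⟩
  have hex2 : ∃ i, τ < i ∧ (f i ∉ M.active ∨ n ≤ i) := by grind
  obtain ⟨hhi1, hhi⟩ := Nat.find_spec hex2
  set hi := Nat.find hex2 with hhidef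
  have hhin : hi ≤ n := Nat.find_min' hex2 ⟨hτn, .inr le_rfl⟩
  have hhimin : ∀ i, τ < i → i < hi → f i ∈ M.active := fun i h h' => by
    by_contra hc
    exact Nat.find_min hex2 h' ⟨h, .inl hc⟩
  refine ⟨f lo, hfm lo, hi - lo, fun x hx => ?_⟩
  have hadd : ∀ i j, (M.next ^ i) (f j) = f (j + i) := fun i j => by
    simp only [hf]
    rw [← Perm.mul_apply, ← pow_add, Nat.add_comm]
  simp only [hadd]
  obtain ⟨k, hk1, hkn, rfl⟩ := rootFace_pow hM.comb hx (by omega) hnr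
  change f k ∈ M.active ↔ _
  constructor
  · intro hk
    have hkn' : k < n := by
      grind
    have h2 := hlomin k hk1 hk
    refine ⟨k - lo, ?_, by congr 1; omega⟩
    grind
  · grind

/-- Conversely, if the active edges are consecutive, then the predecessor of an active left edge and
the successor of an active right edge are active. -/
theorem IsTBar.local (h : M.IsTBar) {x : ℕ} (hx : x ∈ M.rootFace) (hxa : x ∈ M.active) :
    (M.WhiteEdge x → M.next.symm x ∈ M.active) ∧ (M.BlackEdge x → M.next x ∈ M.active) := by
  have hM := h.triangulation
  have hR := h.rootInterface
  obtain ⟨s, hs, L, hsL⟩ := h.consecutive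
  obtain ⟨τ, n, h1, hτn, hnr, -, hb, hw⟩ := exists_boundary hM hR
  have hmem : ∀ i, ∀ y ∈ M.rootFace, (M.next ^ i) y ∈ M.rootFace := by
    intro i y hy
    induction i with
    | zero => exact hy
    | succ i ih =>
      rw [pow_succ', Perm.mul_apply, next_mem_rootFace]; exact ih
  have hact : ∀ i < L, (M.next ^ i) s ∈ M.active := fun i hi =>
    (hsL _ (hmem i s hs)).2 ⟨i, hi, rfl⟩
  have htop := PercMap.top_mem hM hR
  obtain ⟨j, hjL, hj⟩ := (hsL _ htop).1 h.top_active
  obtain ⟨i, hiL, hi⟩ := (hsL x hx).1 hxa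
  have hadd : ∀ i j y, (M.next ^ i) ((M.next ^ j) y) = (M.next ^ (i + j)) y := fun i j y => by
    rw [← Perm.mul_apply, ← pow_add]
  -- the root is not active unless all the outer edges are bicolor
  have hroot : M.root ∈ M.active → ¬ (M.WhiteEdge x ∨ M.BlackEdge x) := by
    intro hra
    have h2 : M.edgeOf M.root = M.edgeOf M.top := by
      by_contra h3; exact h.root_inactive h3 hra
    rw [edgeOf_eq_iff, hM.comb.mem_edgeOf] at h2
    have h3 : M.top = M.rev M.root := by
      refine h2.resolve_left fun h4 => ?_
      exact (PercMap.top_bw hM hR).1 (h4 ▸ hR.1.1)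
    rw [h3] at htop
    have h5 := (hM.single_edge root_mem_rootFace htop).2.2
    have hr := hR.1
    rcases (h5 x).1 (hM.comb.rootFace_sub hx) with rfl | rfl
    · rintro (h6 | h6)
      · exact hr.2 h6.2
      · exact h6.1 hr.1
    · rintro (h6 | h6)
      · exact hr.2 h6.1
      · have := h6.2; rw [hM.comb.rev_rev] at this; exact this hr.1
  have hnext : ∀ k, (M.rev ((M.next ^ k) M.root) ∈ M.white ↔ (M.next ^ (k + 1)) M.root ∈ M.white) :=
    fun k => by rw [pow_succ', Perm.mul_apply, hM.white_next]
  have htopτ : (M.next ^ τ) M.root = M.top := PercMap.eq_top hM hR (hmem τ _ root_mem_rootFace)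
    ⟨hb τ h1 le_rfl, by rw [hnext]; exact hw (τ + 1) (by omega) (by omega)⟩
  constructor
  · intro hxw
    rcases Nat.eq_zero_or_pos i with rfl | hi0
    · exfalso
      obtain rfl : s = x := by simpa using hi
      obtain ⟨k, hk1, hkn, hk⟩ := rootFace_pow hM.comb hs (by omega) hnr
      have hkn' : k ≠ n := by
        rintro rfl
        rw [hnr] at hk
        exact hR.1.2 (hk ▸ hxw.2)
      have hjk : n ≤ j + k := by
        by_contra hc
        have h3 : (M.next ^ (j + k)) M.root = M.top := by rw [← hadd, hk, hj]
        have h4 : τ < k := by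
          by_contra h5
          exact hb k hk1 (by omega) (hk ▸ hxw.1)
        exact (PercMap.top_bw hM hR).1 (h3 ▸ hw (j + k) (by omega) (by omega))
      have h5 : (M.next ^ (n - k)) s = M.root := by
        rw [← hk, hadd, Nat.sub_add_cancel hkn, hnr]
      exact hroot (h5 ▸ hact (n - k) (by omega)) (.inl hxw)
    · have : M.next.symm x = (M.next ^ (i - 1)) s := by
        rw [Equiv.symm_apply_eq, ← hi, ← Perm.mul_apply, ← pow_succ', Nat.sub_add_cancel hi0]
      rw [this]
      exact hact _ (by omega)
  · intro hxb
    by_cases hi1 : i + 1 < L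
    · have : M.next x = (M.next ^ (i + 1)) s := by rw [pow_succ', Perm.mul_apply, hi]
      rw [this]
      exact hact _ hi1
    · exfalso
      obtain rfl : i = L - 1 := by omega
      set m := L - 1 - j with hm
      have h3 : (M.next ^ (m + τ)) M.root = x := by
        rw [← hadd, htopτ, ← hj, hadd, ← hi]; congr 2; omega
      have hmn : n < m + τ := by
        by_contra hc
        rcases Nat.eq_zero_or_pos m with h0 | h0
        · rw [h0, Nat.zero_add, htopτ] at h3
          exact hxb.2 (h3 ▸ (PercMap.top_bw hM hR).2)
        · exact hxb.1 (h3 ▸ hw (m + τ) (by omega) (by omega))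
      have h5 : (M.next ^ (n - τ + j)) s = M.root := by
        rw [← hadd, hj, ← htopτ, hadd, Nat.sub_add_cancel hτn.le, hnr]
      exact hroot (h5 ▸ hact (n - τ + j) (by omega)) (.inr hxb)

namespace Inv

variable (h : Inv la lb M T U κ K)
include h

theorem root_active (hr : M.root ∈ M.active) : M.rev M.root = M.top := by
  have hR := h.ri.1
  rcases (h.active _).1 hr with (h1 | h1) | ⟨i, hi | hi, h1 | h1⟩
  · exact absurd (h1 ▸ hR.1) h.top_bw.1
  · rw [h1, h.comb.rev_rev]
  · exact absurd (h1 ▸ (h.white i hi).2) hR.2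
  · have := hR.2; rw [h1, h.comb.rev_rev] at this; exact absurd (h.white i hi).1 this
  · exact absurd (h1 ▸ hR.1) (h.black i hi).1
  · exact absurd (h1 ▸ hR.1) (h.black i hi).2

theorem left_pred {i : ℕ} (hi : i ∈ la) : M.next.symm (U i) ∈ M.active := by
  have key : ∀ (l : List ℕ) (x : ℕ), x ∈ M.active → (∀ i ∈ l, i ∈ la) →
      (x :: l.map U).IsChain (fun x y => M.next x = y) → ∀ i ∈ l, M.next.symm (U i) ∈ M.active := by
    intro l
    induction l with
    | nil => simp
    | cons a l ih =>
      grind [h.active]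
  exact key la _ ((h.active _).2 (.inl (.inl rfl))) (fun _ h => h) h.chainL i hi

theorem right_succ {i : ℕ} (hi : i ∈ lb) : M.next (M.rev (U i)) ∈ M.active :=
  h.mirror.left_pred hi

theorem isTBar : M.IsTBar where
  triangulation := h.tri
  rootInterface := h.ri
  active_sub x hx := by
    rcases (h.active x).1 hx with (rfl | rfl) | ⟨i, hi, rfl | rfl⟩
    · exact h.top_darts
    · exact h.comb.rev_mem _ h.top_darts
    · exact h.U_darts hi
    · exact h.comb.rev_mem _ (h.U_darts hi)
  active_rev x hx := by
    rw [h.active]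
    rcases (h.active x).1 hx with (rfl | rfl) | ⟨i, hi, rfl | rfl⟩
    · exact .inl (.inr rfl)
    · exact .inl (.inl (h.comb.rev_rev _))
    · exact .inr ⟨i, hi, .inr rfl⟩
    · exact .inr ⟨i, hi, .inl (h.comb.rev_rev _)⟩
  active_outer x hx := by
    rcases (h.active x).1 hx with (rfl | rfl) | ⟨i, hi | hi, rfl | rfl⟩
    · exact .inl h.top_mem
    · rw [h.comb.rev_rev]; exact .inr h.top_mem
    · exact .inl (h.left_mem hi)
    · rw [h.comb.rev_rev]; exact .inr (h.left_mem hi)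
    · exact .inr (h.right_mem hi)
    · exact .inl (h.right_mem hi)
  top_active := (h.active _).2 (.inl (.inl rfl))
  root_inactive hne hr := by
    grind [edgeOf_eq_iff, h.comb.mem_edgeOf, h.root_active]
  consecutive := by
    refine consecutive_of_local h.tri h.ri ((h.active _).2 (.inl (.inl rfl))) h.root_active
      (fun x hx hw ha => ?_) fun x hx hb ha => ?_
    · obtain ⟨i, hi, rfl⟩ := h.left_active_iff.1 ⟨hx, hw, ha⟩
      exact h.left_pred hi
    · obtain ⟨i, hi, rfl⟩ := h.right_active_iff.1 ⟨hx, hb, ha⟩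
      exact h.right_succ hi
  path x hx hxi := by
    have key : ∀ l < K, x ∈ M.faceOf (M.entry l) → M.OnPath (M.faceOf x) := fun l hl hl' =>
      ⟨l, h.pathEnd.onPathAt.2 ⟨hl, mem_faceOf_comm.1 hl'⟩⟩
    have key2 : ∀ i, (i ∈ la ∨ i ∈ lb) → x ∈ M.faceOf (T i) → M.OnPath (M.faceOf x) := fun i hi hi' =>
      key (κ i) (h.entry i hi).1 (by rwa [(h.entry i hi).2])
    rcases (h.active x).1 hx with (rfl | rfl) | ⟨i, hi | hi, rfl | rfl⟩
    · exact absurd h.top_mem hxi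
    · rcases Nat.eq_zero_or_pos K with rfl | hK
      · grind [h.entry_end, entry_zero, h.comb.rev_rev, root_mem_rootFace]
      · exact key (K - 1) (by omega) (h.pathEnd.top_face h.tri (by omega) h.ri)
    · exact absurd (h.left_mem hi) hxi
    · exact key2 i (.inl hi) (h.rev_U_left_mem_face hi)
    · exact key2 i (.inr hi) (h.U_right_mem_face hi)
    · exact absurd (h.right_mem hi) hxi

theorem leftDart_eq {i : ℕ} (hi : la.head? = some i) : M.leftDart = U i := by
  have := h.chainL
  obtain ⟨l, rfl⟩ : ∃ l, la = i :: l := List.head?_eq_some_iff.1 hi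
  rw [List.map_cons, List.isChain_cons_cons] at this
  exact this.1

theorem rightDart_eq {i : ℕ} (hi : lb.head? = some i) : M.rightDart = M.rev (U i) := by
  have := h.mirror.leftDart_eq hi
  rwa [mirror_leftDart h.comb] at this

omit h in
theorem mem_of_head {l : List ℕ} {i : ℕ} (hi : l.head? = some i) : i ∈ l :=
  List.mem_of_mem_head? hi

theorem pathBefore_iff {i j : ℕ} (hi : i ∈ la ∨ i ∈ lb) (hj : j ∈ la ∨ j ∈ lb) :
    M.PathBefore (M.faceOf (T i)) (M.faceOf (T j)) ↔ i < j := by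
  have key : ∀ i, (i ∈ la ∨ i ∈ lb) → ∀ l, (M.OnPathAt l (M.faceOf (T i)) ↔ l = κ i) := by
    intro i hi l
    obtain ⟨h1, h2⟩ := h.entry i hi
    grind [h.pathEnd.onPathAt, h.pathEnd.face_inj, h.tri, h.ri, self_mem_faceOf]
  unfold PathBefore
  simp only [key i hi, key j hj]
  constructor
  · rintro ⟨a, b, hab, rfl, rfl⟩
    rcases lt_trichotomy i j with h1 | rfl | h1
    · exact h1
    · exact absurd hab (lt_irrefl _)
    · exact absurd (h.mono j i hj hi h1) hab.not_gt
  · intro hij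
    exact ⟨_, _, h.mono i j hi hj hij, rfl, rfl⟩

theorem pathBefore_heads {i j : ℕ} (hi : la.head? = some i) (hj : lb.head? = some j) :
    (M.PathBefore (M.faceOf (M.rev M.leftDart)) (M.faceOf (M.rev M.rightDart)) ↔ i < j) ∧
    (M.PathBefore (M.faceOf (M.rev M.rightDart)) (M.faceOf (M.rev M.leftDart)) ↔ j < i) := by
  have hi' := mem_of_head hi
  have hj' := mem_of_head hj
  rw [h.leftDart_eq hi, h.rightDart_eq hj, h.comb.rev_rev,
    ← faceOf_eq_iff.2 (h.rev_U_left_mem_face hi'), ← faceOf_eq_iff.2 (h.U_right_mem_face hj'),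
    h.pathBefore_iff (.inl hi') (.inr hj'), h.pathBefore_iff (.inr hj') (.inl hi')]
  exact ⟨Iff.rfl, Iff.rfl⟩

theorem stepCReady (hne : la ≠ [] ∨ lb ≠ []) : M.StepCReady where
  tri := h.tri
  ri := h.ri
  active := by rwa [h.hasActiveLeft_iff, h.hasActiveRight_iff]
  left hl := by
    obtain ⟨i, l, rfl⟩ := List.exists_cons_of_ne_nil (h.hasActiveLeft_iff.1 hl)
    rw [h.leftDart_eq (i := i) rfl]
    exact h.white i (by simp)
  right hr := by
    obtain ⟨i, l, rfl⟩ := List.exists_cons_of_ne_nil (h.hasActiveRight_iff.1 hr)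
    rw [h.rightDart_eq (i := i) rfl]
    have := h.black i (by simp)
    exact ⟨this.2, by rw [h.comb.rev_rev]; exact this.1⟩
  order hl hr := by
    obtain ⟨i, l, rfl⟩ := List.exists_cons_of_ne_nil (h.hasActiveLeft_iff.1 hl)
    obtain ⟨j, l', rfl⟩ := List.exists_cons_of_ne_nil (h.hasActiveRight_iff.1 hr)
    obtain ⟨h1, h2⟩ := h.pathBefore_heads (i := i) (j := j) rfl rfl
    rw [h1, h2]
    have : i ≠ j := fun e => h.disj i (by simp) (by simp [e])
    omega

/-- The choice made by the step `c`, in terms of the last unmatched steps. -/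
theorem recolorsRight_iff (hne : la ≠ [] ∨ lb ≠ []) : M.RecolorsRight ↔
    la = [] ∨ ∃ i j, la.head? = some i ∧ lb.head? = some j ∧ i < j := by
  unfold RecolorsRight
  rw [h.hasActiveLeft_iff, h.hasActiveRight_iff, not_not]
  rcases eq_or_ne la [] with hl | hl
  · simp [hl]
  refine or_congr Iff.rfl ?_
  constructor
  · rintro ⟨hr, hp⟩
    obtain ⟨i, l, rfl⟩ := List.exists_cons_of_ne_nil hl
    obtain ⟨j, l', rfl⟩ := List.exists_cons_of_ne_nil hr
    exact ⟨i, j, rfl, rfl, (h.pathBefore_heads (i := i) (j := j) rfl rfl).1.1 hp⟩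
  · grind [h.pathBefore_heads]

end Inv

/-- The basic facts on the gluing of a triangle with a white new vertex to the top-edge. -/
theorem glueTriAt_basic (hM : M.IsTriangulation) (hR : M.RootInterface) {p q p' q' : ℕ}
    (hF : Fresh4 M.darts p q p' q') :
    (M.glueTriAt true p q p' q').IsTriangulation ∧ (M.glueTriAt true p q p' q').RootInterface ∧
      (M.glueTriAt true p q p' q').top = p := by
  have hC := hM.comb
  have htop := PercMap.top_mem hM hR
  have hbw := PercMap.top_bw hM hR
  have hnd := hM.next_ne (hC.rootFace_sub htop)
  have hdr : M.root ≠ M.top := fun e => hbw.1 (e ▸ hR.1.1)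
  have e : (M.glueTriAt true p q p' q').toPercMap =
    M.toPercMap.glueAt M.top p q p' q' (M.white ∪ {q', q, p'}) := rfl
  have h1 := (glueAt_isTriangulation_iff hC htop hnd hF hdr hM.white_sub hbw).2 hM
  have h2 := (glueAt_rootInterface_iff hC htop hnd hF hdr hM.white_sub hbw).2 hR
  rw [e]
  refine ⟨h1, h2, ?_⟩
  refine (PercMap.eq_top h1 h2 ?_ ?_).symm
  · grind [glueAt_mem_rootFace]
  · constructor
    · rintro (h | h | h | h)
      · exact hF.p_mem (hM.white_sub h)
      · exact hF.pq' h
      · exact hF.pq h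
      · exact hF.pp' h
    · rw [(glueAt_values hC (hC.rootFace_sub htop) hnd hF).1]
      exact .inr (.inr (.inr rfl))

/-- The path traverses the new triangle last. -/
theorem glueTriAt_entry (hM : M.IsTriangulation) (hR : M.RootInterface) {p q p' q' : ℕ}
    (hF : Fresh4 M.darts p q p' q') (hK : M.PathEnd K) :
    (∀ l ≤ K, (M.glueTriAt true p q p' q').entry l = M.entry l) ∧
      (M.glueTriAt true p q p' q').entry (K + 1) = p := by
  have hC := hM.comb
  have htop := PercMap.top_mem hM hR
  obtain ⟨-, v2, -, -, v5, v6, -, -, -, v10, -, v12⟩ := glueAt_values hC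
    (W := M.white ∪ {q', q, p'}) (hC.rootFace_sub htop) (hM.next_ne (hC.rootFace_sub htop)) hF
  change (∀ l ≤ K, (M.toPercMap.glueAt M.top p q p' q' (M.white ∪ {q', q, p'})).entry l = _) ∧
    (M.toPercMap.glueAt M.top p q p' q' (M.white ∪ {q', q, p'})).entry (K + 1) = p
  have hwN : (M.toPercMap.glueAt M.top p q p' q' (M.white ∪ {q', q, p'})).white =
    M.white ∪ {q', q, p'} := rfl
  have hroot : (M.toPercMap.glueAt M.top p q p' q' (M.white ∪ {q', q, p'})).root = M.root := rfl
  generalize M.toPercMap.glueAt M.top p q p' q' (M.white ∪ {q', q, p'}) = N at *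
  have hinn : ∀ x ∈ M.darts, x ∉ M.rootFace → N.next x = M.next x := fun x hx hxi =>
    v12 x hx (fun e => hxi (e ▸ htop)) fun e => hxi (next_mem_rootFace.1 (e ▸ htop))
  have hent : ∀ l ≤ K, N.entry l = M.entry l := by
    intro l hl
    refine entry_congr (k := K) (by rw [hroot]; exact v10 _ hC.root_mem) (fun l hl => ?_) hl
    have hg := hK.mem hM hR hl.le
    have hgi := hK.inner l hl
    have hg1 := hC.next_mem_iff.2 hg
    have hg2 := hC.next_mem_iff.2 hg1
    refine interfaceStep_congr (hinn _ hg hgi) (hinn _ hg1 fun e => hgi (next_mem_rootFace.1 e))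
      ?_ (v10 _ hg1) (v10 _ hg2)
    grind [hF.q'_mem, hF.q_mem, hF.p'_mem]
  grind [entry_succ, hK.eq_top, interfaceStep_white]

namespace Inv

variable (h : Inv la lb M T U κ K)
include h

set_option maxHeartbeats 1000000 in
/-- The step `a`. -/
theorem glue {p q p' q' n : ℕ} (hF : Fresh4 M.darts p q p' q') (hn : ∀ i, (i ∈ la ∨ i ∈ lb) → i < n)
    (hT : T n = M.top) (hU : U n = q) (hκ : κ n = K) :
    Inv (n :: la) lb (M.glueTriAt true p q p' q') T U κ (K + 1) := by
  obtain ⟨htri, hri, htop⟩ := glueTriAt_basic h.tri h.ri hF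
  obtain ⟨hent, hentK⟩ := glueTriAt_entry h.tri h.ri hF h.pathEnd
  have hC := h.comb
  have hdf := h.top_mem
  have hdD := h.top_darts
  have hbw := h.top_bw
  have hnd := h.tri.next_ne hdD
  have hdr : M.root ≠ M.top := fun e => hbw.1 (e ▸ h.ri.1.1)
  set W := M.white ∪ {q', q, p'} with hW
  obtain ⟨v1, v2, v3, v4, v5, v6, v7, v8, v9, v10, v11, v12⟩ := glueAt_values hC (W := W) hdD hnd hF
  have hrf := fun {x : ℕ} => glueAt_mem_rootFace hC (W := W) hdf hnd hF hdr (x := x)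
  have hvo := fun {a x : ℕ} => glueAt_mem_vertexOf hC (W := W) hdf hnd hF (a := a) (x := x)
  have hvn := fun {x : ℕ} => glueAt_mem_vertexOf_new hC (W := W) hdf hnd hF (x := x)
  obtain ⟨m1, m2, m3, m4, a1, a2, a3, a4, a5, a6⟩ := id hF
  have e0 : (M.glueTriAt true p q p' q').toPercMap = M.toPercMap.glueAt M.top p q p' q' W := rfl
  have hact : (M.glueTriAt true p q p' q').active =
    (M.active \ {M.top, M.rev M.top}) ∪ {p, q, p', q'} := rfl
  generalize M.glueTriAt true p q p' q' = N at *
  rw [← e0] at v1 v2 v3 v4 v5 v6 v7 v8 v9 v10 v11 v12 hrf hvo hvn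
  have hwN : N.white = W := by rw [e0]; rfl
  have hroot : N.root = M.root := by rw [e0]; rfl
  have hwo : ∀ x ∈ M.darts, (x ∈ N.white ↔ x ∈ M.white) := by
    grind
  have hrD := fun {x : ℕ} (hx : x ∈ M.darts) => hC.rev_mem x hx
  have hinn : ∀ x ∈ M.darts, x ∉ M.rootFace → N.next x = M.next x := fun x hx hxi =>
    v12 x hx (fun e => hxi (e ▸ hdf)) fun e => hxi (next_mem_rootFace.1 (e ▸ hdf))
  have hwhite : ∀ x ∈ M.darts, M.WhiteEdge x → N.WhiteEdge x := fun x hx hxw =>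
    ⟨(hwo x hx).2 hxw.1, by rw [v10 x hx, hwo _ (hrD hx)]; exact hxw.2⟩
  have hblack : ∀ x ∈ M.darts, M.BlackEdge x → N.BlackEdge x := fun x hx hxb =>
    ⟨fun h' => hxb.1 ((hwo x hx).1 h'), by rw [v10 x hx, hwo _ (hrD hx)]; exact hxb.2⟩
  have hmem' : ∀ i, (i ∈ n :: la ∨ i ∈ lb) → i = n ∨ (i ∈ la ∨ i ∈ lb) := by grind
  have hentD : ∀ l ≤ K, M.entry l ∈ M.darts := fun l hl => h.pathEnd.mem h.tri h.ri hl
  have htouch : ∀ e ∈ M.darts, ∀ x ∈ M.darts, (N.Touch e x ↔ M.Touch e x) := by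
    intro e he x hx
    unfold Touch
    rw [v10 e he, hvo hx, hvo hx]
    grind
  have hUD := fun i hi => h.U_darts (i := i) hi
  have hUN : ∀ i, (i ∈ la ∨ i ∈ lb) → N.rev (U i) = M.rev (U i) := by grind
  have htopU : ∀ i, (i ∈ la ∨ i ∈ lb) → ¬ M.Touch M.top (M.rev (U i)) := by
    intro i hi
    rintro (h1 | h1) <;> rcases hi with hi | hi
    · exact hbw.1 ((h.tri.white_vertexOf h1).2 (h.white i hi).2)
    · exact (h.black i hi).1 (by
        rw [← hC.rev_rev (U i), h.tri.outer_eq (h.right_mem hi) hdf h1]; exact hbw.2)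
    · rw [← hC.next_mem_vertexOf_iff, ← vertexOf_eq_iff, ← hC.vertexOf_next, vertexOf_eq_iff] at h1
      have h2 := h.tri.outer_eq (next_mem_rootFace.2 (h.left_mem hi)) (next_mem_rootFace.2 hdf) h1
      exact hbw.1 (M.next.injective h2 ▸ (h.white i hi).1)
    · exact (h.black i hi).2 ((h.tri.white_vertexOf h1).1 hbw.2)
  constructor
  · exact htri
  · exact hri
  · intro x
    rw [hact, htop, v1]
    constructor
    · rintro (⟨hx, hx'⟩ | rfl | rfl | rfl | rfl)
      · rcases (h.active x).1 hx with hx | ⟨i, hi, hx⟩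
        · exact absurd hx hx'
        · grind
      · exact .inl (.inl rfl)
      · grind
      · exact .inl (.inr rfl)
      · grind
    · rintro ((rfl | rfl) | ⟨i, hi, hx⟩)
      · exact .inr (.inl rfl)
      · exact .inr (.inr (.inr (.inl rfl)))
      · rcases hmem' i hi with rfl | hi
        · grind
        · rw [hUN i hi] at hx
          refine .inl ⟨(h.active x).2 (.inr ⟨i, hi, hx⟩), ?_⟩
          have huni : M.WhiteEdge x ∨ M.BlackEdge x := by
            rcases hi with hi | hi
            · left
              have := h.white i hi
              rcases hx with rfl | rfl
              · exact this
              · exact ⟨this.2, by rw [hC.rev_rev]; exact this.1⟩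
            · right
              have := h.black i hi
              rcases hx with rfl | rfl
              · exact this
              · exact ⟨this.2, by rw [hC.rev_rev]; exact this.1⟩
          rintro (rfl | rfl)
          · exact huni.elim (fun h' => hbw.1 h'.1) fun h' => h'.2 hbw.2
          · refine huni.elim (fun h' => hbw.1 ?_) fun h' => h'.1 hbw.2
            have := h'.2; rwa [hC.rev_rev] at this
  · rw [htop, List.map_cons, hU, List.isChain_cons_cons]
    refine ⟨v8, ?_⟩
    have hch := h.chainL
    rw [List.isChain_cons] at hch ⊢
    refine ⟨fun y hy => by rw [v9]; exact hch.1 y hy, ?_⟩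
    refine hch.2.imp_of_mem_imp fun x y hx hy hxy => ?_
    obtain ⟨i, hi, rfl⟩ := List.mem_map.1 hx
    rw [v12 _ (hUD i (.inl hi)), hxy]
    · exact fun e => hbw.1 (e ▸ (h.white i hi).1)
    · rw [hxy]
      obtain ⟨j, hj, rfl⟩ := List.mem_map.1 hy
      exact fun e => hbw.1 (e ▸ (h.white j hj).1)
  · rw [htop]
    have hch := h.chainR
    rw [List.map_congr_left (g := fun i => M.rev (U i)) fun i hi => hUN i (.inr hi)]
    rw [List.isChain_cons] at hch ⊢
    refine ⟨fun y hy => v11 _ (hch.1 y hy), ?_⟩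
    refine hch.2.imp_of_mem_imp fun x y hx hy hxy => ?_
    obtain ⟨i, hi, rfl⟩ := List.mem_map.1 hx
    obtain ⟨j, hj, rfl⟩ := List.mem_map.1 hy
    rw [v12 _ (hrD (hUD j (.inr hj))), hxy]
    · intro e
      have := hbw.2
      rw [← e, hC.rev_rev] at this
      exact (h.black j hj).1 this
    · rw [hxy]
      intro e
      have := hbw.2
      rw [← e, hC.rev_rev] at this
      exact (h.black i hi).1 this
  · intro i hi
    rcases List.mem_cons.1 hi with rfl | hi
    · rw [hU]
      exact ⟨by rw [hwN]; exact .inr (.inr (.inl rfl)), by rw [v3, hwN]; exact .inr (.inl rfl)⟩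
    · grind [h.white]
  · grind [h.black]
  · grind [h.T_darts, h.T_inner, h.triL]
  · grind [h.right_inner, h.triR]
  · constructor
    · intro l hl
      rw [hent l (by omega), hrf]
      grind [h.pathEnd.inner, h.entry_end]
    · grind
  · intro i hi
    rcases hmem' i hi with rfl | hi
    · grind [h.entry_end]
    · obtain ⟨h1, h2⟩ := h.entry i hi
      grind
  · intro i j hi hj hij
    rcases hmem' i hi with rfl | hi1 <;> rcases hmem' j hj with rfl | hj
    · exact absurd hij (lt_irrefl _)
    · grind
    · rw [hκ]; exact (h.entry i hi1).1
    · exact h.mono i j hi1 hj hij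
  · intro i hi l hl
    rcases hmem' i hi with rfl | hi
    · rw [hκ] at hl
      rw [hent l hl, hU]
      unfold Touch
      rw [v10 _ (hentD l hl), hvn, hvn]
      grind
    · have hl' := hl.trans (h.entry i hi).1.le
      grind [h.near]
  · intro i j hi hj hij x hx
    rcases hmem' i hi with rfl | hi1
    · grind
    have hri := hrD (hUD i hi1)
    rw [hUN i hi1]
    rcases hmem' j hj with rfl | hj
    · rw [hU, hvn] at hx
      rw [hvo hri]
      rcases hx with rfl | rfl
      · rw [v3]
        rintro (h3 | h3 | h3)
        · exact m4 ((hC.vertexOf_sub h3).2 hri)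
        · exact a3 h3.1.symm
        · exact htopU i hi1 (.inr h3.2)
      · rw [v2]
        rintro (h3 | h3 | h3)
        · exact m1 ((hC.vertexOf_sub h3).2 hri)
        · exact htopU i hi1 (.inl h3.2)
        · exact a3 h3.1
    · rw [hvo hri]
      rcases (hvo (hUD j hj)).1 hx with hx | ⟨rfl, hx⟩ | ⟨rfl, hx⟩
      · have hxD := (hC.vertexOf_sub hx).2 (hUD j hj)
        grind [h.far]
      · grind [hC.vertexOf_sub]
      · grind [hC.vertexOf_sub]
  · exact List.pairwise_cons.2 ⟨fun i hi => hn i (.inl hi), h.sortL⟩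
  · exact h.sortR
  · grind [h.disj]

end Inv

end MarkedMap
namespace PercMap

variable {M : PercMap}

/-- Changing the colour of the origin of `x` to white. -/
def recolorWhite (M : PercMap) (x : ℕ) : PercMap := { M with white := M.white ∪ M.vertexOf x }

theorem recolorWhite_isTriangulation (hM : M.IsTriangulation) {x : ℕ} (hx : x ∈ M.darts) :
    (M.recolorWhite x).IsTriangulation := by
  refine ⟨⟨hM.rev_mem, hM.rev_ne, hM.rev_rev, hM.rev_fix, hM.next_mem, hM.next_fix, hM.root_mem,
    hM.connected, hM.euler, ?_, fun d hd => ?_⟩, hM.triangle, hM.loopless, hM.simple⟩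
  · rintro y (hy | hy)
    · exact hM.white_sub hy
    · exact (hM.comb.vertexOf_sub hy).2 hx
  · exact or_congr (hM.white_rot d hd) rot_mem_vertexOf

/-- A variant of `interfaceStep_congr` which only looks at the edge that is crossed. -/
theorem interfaceStep_congr' {N : PercMap} (hM : M.Comb) {g : ℕ} (h1 : N.next g = M.next g)
    (h2 : N.next (M.next g) = M.next (M.next g))
    (h3 : M.next (M.next g) ∈ N.white ↔ M.next (M.next g) ∈ M.white)
    (h4 : N.rev (M.rev (M.interfaceStep g)) = M.interfaceStep g) :
    N.interfaceStep g = M.interfaceStep g := by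
  grind [interfaceStep_white, hM.rev_rev, interfaceStep_black]

/-- The step of an interface touches the third vertex of the triangle. -/
theorem touch_third (hM : M.Comb) {g x : ℕ} (h : M.next (M.next g) ∈ M.vertexOf x) :
    M.Touch (M.interfaceStep g) x := by
  by_cases hw : M.next (M.next g) ∈ M.white
  · rw [interfaceStep_white hw, touch_rev hM]
    exact .inl h
  · rw [interfaceStep_black hw, touch_rev hM]
    exact .inr (hM.next_mem_vertexOf_iff.1 h)

end PercMap

namespace MarkedMap

open PercMap

variable {la lb : List ℕ} {M : MarkedMap} {T U κ : ℕ → ℕ} {K : ℕ}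

namespace Inv

section

variable (h : Inv la lb M T U κ K)
include h

theorem left_inj {i j : ℕ} (hi : i ∈ la ∨ i ∈ lb) (hj : j ∈ la ∨ j ∈ lb) (hT : T i = T j) : i = j := by
  obtain ⟨h1, h2⟩ := h.entry i hi
  obtain ⟨h3, h4⟩ := h.entry j hj
  have h5 := h.pathEnd.inj h.tri h.ri h1.le h3.le (by rw [h2, h4, hT])
  rcases lt_trichotomy i j with h6 | h6 | h6
  · exact absurd (h.mono i j hi hj h6) (by omega)
  · exact h6
  · exact absurd (h.mono j i hj hi h6) (by omega)

theorem U_inj {i j : ℕ} (hi : i ∈ la ∨ i ∈ lb) (hj : j ∈ la ∨ j ∈ lb) (hU : U i = U j) : i = j := by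
  refine h.left_inj hi hj ?_
  rcases hi with hi | hi <;> rcases hj with hj | hj
  · exact M.next.injective (by rw [h.triL i hi, h.triL j hj, hU])
  · exact absurd (hU ▸ (h.white i hi).1) (h.black j hj).1
  · exact absurd (h.white j hj).1 (hU ▸ (h.black i hi).1)
  · rw [← h.triR i hi, ← h.triR j hj, hU]

end

variable {j : ℕ} (h : Inv la (j :: lb) M T U κ K)
include h

theorem top_vertex : M.vertexOf (U j) = M.vertexOf M.top := by
  have h1 := h.rightDart_eq (i := j) rfl
  have h2 : M.next (M.rev (U j)) = M.top := by rw [← h1]; exact Equiv.apply_symm_apply _ _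
  rw [← h2, h.comb.vertexOf_next, h.comb.rev_rev]

theorem next_right : M.next (M.rev (U j)) = M.top := by
  rw [← h.rightDart_eq (i := j) rfl]; exact Equiv.apply_symm_apply _ _

/-- The situation after the top-right vertex has been recolored in white: the path stops just
before the triangle of the last unmatched `b`-step would have been left through another edge. -/
structure Recolored (la lb : List ℕ) (j : ℕ) (M : MarkedMap) (R : PercMap) (T U κ : ℕ → ℕ) : Prop where
  tri : R.IsTriangulation
  ri : R.RootInterface
  top : R.top = M.rev (U j)
  pathEnd : R.PathEnd (κ j + 1)
  entry_eq : ∀ l ≤ κ j, R.entry l = M.entry l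
  entry_end : R.entry (κ j + 1) = M.rev (U j)
  white : ∀ i ∈ la, R.WhiteEdge (U i)
  black : ∀ i ∈ lb, R.BlackEdge (U i)
  near : ∀ i, (i ∈ la ∨ i ∈ lb) → ∀ l ≤ κ i, ¬ R.Touch (R.entry l) (U i)

theorem recolor (hlt : ∀ i ∈ la, i < j) :
    Recolored la lb j M (M.toPercMap.recolorWhite M.top) T U κ := by
  have hC := h.comb
  have hj : j ∈ la ∨ j ∈ j :: lb := .inr (by simp)
  have hin : ∀ i, (i ∈ la ∨ i ∈ lb) → (i ∈ la ∨ i ∈ j :: lb) := by grind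
  have hltb : ∀ i, (i ∈ la ∨ i ∈ lb) → i < j := fun i hi => hi.elim (hlt i) fun hi =>
    (List.pairwise_cons.1 h.sortR).1 i hi
  have hκ : ∀ i, (i ∈ la ∨ i ∈ lb) → κ i < κ j := fun i hi => h.mono i j (hin i hi) hj (hltb i hi)
  have hdf := h.top_mem
  have hbw := h.top_bw
  have hr : M.rev (U j) ∈ M.rootFace := h.right_mem (by simp)
  have hnr := h.next_right
  have hrb := h.black j (by simp)
  obtain ⟨hκK, hTj⟩ := h.entry j hj
  have htv := h.top_vertex
  have hnear : ∀ l ≤ κ j, ¬ M.Touch (M.entry l) M.top := by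
    intro l hl ht
    refine h.near j hj l hl ?_
    unfold Touch at ht ⊢
    rwa [htv]
  have htri := recolorWhite_isTriangulation h.tri h.top_darts
  have hvout : ∀ x ∈ M.rootFace, x ∈ M.vertexOf M.top → x = M.top := by grind [h.tri.outer_eq]
  have hwR : ∀ x, x ∈ (M.toPercMap.recolorWhite M.top).white ↔ x ∈ M.white ∨ x ∈ M.vertexOf M.top :=
    fun x => Iff.rfl
  have hwr : ∀ x ∈ M.rootFace, (M.rev x ∈ M.vertexOf M.top → x = M.rev (U j)) := by
    intro x hx hv
    rw [← hC.next_mem_vertexOf_iff] at hv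
    exact M.next.injective ((hvout _ (next_mem_rootFace.2 hx) hv).trans hnr.symm)
  have e1 : (M.toPercMap.recolorWhite M.top).rev = M.rev := rfl
  have e2 : (M.toPercMap.recolorWhite M.top).next = M.next := rfl
  have e3 : (M.toPercMap.recolorWhite M.top).root = M.root := rfl
  have e4 : (M.toPercMap.recolorWhite M.top).rootFace = M.rootFace := rfl
  have e5 : ∀ x y, (M.toPercMap.recolorWhite M.top).Touch x y ↔ M.Touch x y := fun _ _ => Iff.rfl
  generalize M.toPercMap.recolorWhite M.top = R at *
  have hri : R.RootInterface := by
    unfold RootInterface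
    simp only [e1, e3, e4, hwR]
    have hR := h.ri
    refine ⟨⟨.inl hR.1.1, ?_⟩, fun x hx hxr hx' => ?_⟩
    · rintro (h1 | h1)
      · exact hR.1.2 h1
      · have := hwr _ root_mem_rootFace h1
        exact hrb.2 (this ▸ hR.1.1)
    · rw [not_or] at hx'
      rcases hx'.1 with h1 | h1
      · exact hR.2 x hx hxr ⟨h1, hx'.2.1⟩
      · obtain rfl := hvout x hx h1
        exact hx'.2.1 hbw.2
  have hent : ∀ l ≤ κ j, R.entry l = M.entry l := by
    grind [entry_congr, interfaceStep_congr, entry_succ, touch_third]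
  have hnn : M.next (M.next (T j)) = U j := by
    have h1 := h.T_darts hj
    have h2 := h.T_inner hj
    rw [← h.tri.symm_eq h1 h2, Equiv.symm_apply_eq]
    exact (h.triR j (by simp)).symm
  have hentK : R.entry (κ j + 1) = M.rev (U j) := by
    grind [entry_succ, interfaceStep_white, self_mem_vertexOf]
  have hrow : M.rev (U j) ∉ R.white := by
    rw [hwR, not_or]
    refine ⟨hrb.2, fun h1 => ?_⟩
    grind [h.tri.next_ne, h.top_darts]
  have hbwR : R.BW (M.rev (U j)) := by
    refine ⟨hrow, ?_⟩
    grind [hC.rev_rev, self_mem_vertexOf]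
  refine ⟨htri, hri, ?_, ?_, hent, hentK, ?_, ?_, ?_⟩
  · grind [PercMap.eq_top]
  · constructor
    · grind [h.pathEnd.inner]
    · rw [hentK, e4]; exact hr
  · intro i hi
    have := h.white i hi
    exact ⟨(hwR _).2 (.inl this.1), by rw [e1, hwR]; exact .inl this.2⟩
  · intro i hi
    have hi' := List.mem_cons_of_mem j hi
    have hb := h.black i hi'
    have ho := h.right_mem hi'
    refine ⟨?_, ?_⟩
    · rw [hwR, not_or]
      refine ⟨hb.1, fun h1 => ?_⟩
      grind [hC.rev_rev, h.U_inj]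
    · rw [e1, hwR, not_or]
      refine ⟨hb.2, fun h1 => ?_⟩
      have := hvout _ ho h1
      have h2 := hbw.2
      rw [← this, hC.rev_rev] at h2
      exact hb.1 h2
  · grind [h.near]

/-- The step `c`, when there is no active left edge. -/
theorem inactivate (hla : la = []) : Inv la lb M.stepC T U κ (κ j + 1) := by
  subst hla
  have hC := h.comb
  have hr := h.recolor (by simp)
  have hj : j ∈ [] ∨ j ∈ j :: lb := .inr (by simp)
  have hltb : ∀ i ∈ lb, i < j := (List.pairwise_cons.1 h.sortR).1
  have hin : ∀ i, (i ∈ [] ∨ i ∈ lb) → i ∈ [] ∨ i ∈ j :: lb := by grind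
  have hκ : ∀ i, (i ∈ [] ∨ i ∈ lb) → κ i < κ j := fun i hi =>
    h.mono i j (hin i hi) hj (hltb i (by simpa using hi))
  have hnl : ¬ M.HasActiveLeft := by rw [h.hasActiveLeft_iff]; simp
  have e : M.stepC = ⟨M.toPercMap.recolorWhite M.top, M.active \ {M.top, M.rev M.top}⟩ := by
    unfold stepC
    rw [if_neg (fun h => hnl h.1), recolored, if_pos (.inl hnl)]
    rfl
  rw [e]
  have e1 : (M.toPercMap.recolorWhite M.top).rev = M.rev := rfl
  have e2 : (M.toPercMap.recolorWhite M.top).next = M.next := rfl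
  have e3 : (M.toPercMap.recolorWhite M.top).vertexOf = M.vertexOf := rfl
  generalize M.toPercMap.recolorWhite M.top = R at *
  constructor
  · exact hr.tri
  · exact hr.ri
  · intro x
    simp only [hr.top, e1, hC.rev_rev]
    have hsplit : (∃ i, (i ∈ ([] : List ℕ) ∨ i ∈ j :: lb) ∧ (x = U i ∨ x = M.rev (U i))) ↔
        (x = M.rev (U j) ∨ x = U j) ∨ ∃ i, (i ∈ ([] : List ℕ) ∨ i ∈ lb) ∧
          (x = U i ∨ x = M.rev (U i)) := by
      grind
    rw [← hsplit, Set.mem_sdiff, h.active]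
    constructor
    · grind
    · rintro ⟨i, hi, hx⟩
      refine ⟨.inr ⟨i, hi, hx⟩, ?_⟩
      have hb := h.black i (by simpa using hi)
      have hb' : M.BlackEdge x := by
        rcases hx with rfl | rfl
        · exact hb
        · exact ⟨hb.2, by rw [hC.rev_rev]; exact hb.1⟩
      rintro (rfl | rfl)
      · exact hb'.2 h.top_bw.2
      · exact hb'.1 h.top_bw.2
  · simp
  · grind [h.chainR, hr.top]
  · simp
  · exact hr.black
  · simp
  · grind [h.triR]
  · exact hr.pathEnd
  · intro i hi
    have h1 := hκ i hi
    exact ⟨by omega, by simp only [hr.entry_eq _ h1.le]; exact (h.entry i (hin i hi)).2⟩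
  · exact fun i k hi hk => h.mono i k (hin i hi) (hin k hk)
  · exact hr.near
  · intro i k hi hk
    simp only [e1, e3]
    exact h.far i k (hin i hi) (hin k hk)
  · exact h.sortL
  · exact (List.pairwise_cons.1 h.sortR).2
  · simp

end Inv

end MarkedMap
namespace PercMap

variable {M : PercMap}

section ZipTriangulation

variable (hM : M.Comb) {x y : ℕ} {W : Set ℕ} (hz : M.Zippable x y)
include hM hz

theorem zipAt_mem_vertexOf (hv : M.next y ∉ M.vertexOf x) {a z : ℕ} (ha : a ≠ x) (ha' : a ≠ y)
    (hzx : z ≠ x) (hzy : z ≠ y) : z ∈ (M.zipAt x y W).vertexOf a ↔ z ∈ M.vertexOf a ∨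
      ((a ∈ M.vertexOf x ∨ a ∈ M.vertexOf (M.next y)) ∧
        (z ∈ M.vertexOf x ∨ z ∈ M.vertexOf (M.next y))) :=
  zipAt_rot_sameCycle hM hz hv ha hzx ha' hzy

omit hM hz in
theorem zipAt_mem_faceOf {a z : ℕ} (ha : a ≠ x) (ha' : a ≠ y) (hzx : z ≠ x) (hzy : z ≠ y) :
    z ∈ (M.zipAt x y W).faceOf a ↔ z ∈ M.faceOf a :=
  zipAt_next_sameCycle ha hzx ha' hzy

theorem zipAt_fix {z : ℕ} (h : z = x ∨ z = y) {a : ℕ} (ha : a ∈ (M.zipAt x y W).darts) :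
    z ∉ (M.zipAt x y W).faceOf a := by
  intro h1
  have h2 := ((zipAt_comb hM (W := W) hz).faceOf_sub h1).2 ha
  rw [zipAt_mem] at h2
  rcases h with rfl | rfl
  · exact h2.2.1 rfl
  · exact h2.2.2 rfl

theorem zipAt_mem_rootFace {z : ℕ} :
    z ∈ (M.zipAt x y W).rootFace ↔ z ∈ M.rootFace ∧ z ≠ x ∧ z ≠ y := by
  have hr : M.root ∈ (M.zipAt x y W).darts := zipAt_mem.2 ⟨hM.root_mem, hz.root_x, hz.root_y⟩
  by_cases h : z = x ∨ z = y
  · have := zipAt_fix hM (W := W) hz h hr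
    refine iff_of_false this fun h' => ?_
    grind
  · rw [not_or] at h
    have := zipAt_mem_faceOf (M := M) (W := W) hz.root_x hz.root_y h.1 h.2
    simp only [h, ne_eq, not_false_eq_true, and_true]
    exact this

theorem zipAt_faceOf_inner (hx : x ∈ M.rootFace) {a : ℕ} (ha : a ∈ M.darts) (hai : a ∉ M.rootFace) :
    (M.zipAt x y W).faceOf a = M.faceOf a := by
  have hy : y ∈ M.rootFace := by rw [← hz.next_x, next_mem_rootFace]; exact hx
  have hax : a ≠ x := fun h => hai (h ▸ hx)
  have hay : a ≠ y := fun h => hai (h ▸ hy)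
  ext z
  by_cases h : z = x ∨ z = y
  · refine iff_of_false (zipAt_fix hM hz h (zipAt_mem.2 ⟨ha, hax, hay⟩)) fun h' => ?_
    rcases h with rfl | rfl
    · exact hai (hx.trans (mem_faceOf.1 h').symm)
    · exact hai (hy.trans (mem_faceOf.1 h').symm)
  · grind [zipAt_mem_faceOf]

/-- Gluing two consecutive outer edges of the same colour gives a triangulation, provided their
endpoints that get identified are not adjacent. -/
theorem zipAt_isTriangulation (hT : M.IsTriangulation) (hx : x ∈ M.rootFace) (hxw : M.WhiteEdge x)
    (hyw : M.WhiteEdge y) (hfar : ∀ z ∈ M.vertexOf x, M.rev z ∉ M.vertexOf (M.next y)) :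
    (M.zipAt x y (M.white \ {x, y})).IsTriangulation := by
  have hy : y ∈ M.rootFace := by rw [← hz.next_x, next_mem_rootFace]; exact hx
  have hny : M.next y ∈ M.rootFace := next_mem_rootFace.2 hy
  have hv : M.next y ∉ M.vertexOf x := fun h => hz.next_y (hT.outer_eq hx hny h).symm
  obtain ⟨d1, d2, d3, d4, d5, d6, d7, d8⟩ := hz.distinct hM
  set W := M.white \ {x, y} with hW
  have hC := zipAt_comb hM (W := W) hz
  obtain ⟨v1, v2, v3, v4, v5, v6, v7, v8, v9⟩ := zipAt_values (W := W) hM hz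
  have hmem := fun {z : ℕ} => zipAt_mem (M := M) (x := x) (y := y) (W := W) (z := z)
  have hvo := fun {a z : ℕ} => zipAt_mem_vertexOf hM (W := W) hz hv (a := a) (z := z)
  have hrf := fun {z : ℕ} => zipAt_mem_rootFace hM (W := W) hz (z := z)
  have hfi := fun {a : ℕ} => zipAt_faceOf_inner hM (W := W) hz hx (a := a)
  have hE := (zipAt_euler_iff hM (W := W) hz hv).2 hT.euler
  have hconn := (zipAt_connected_iff hM (W := W) hz hv).2 hT.connected
  have hwN : (M.zipAt x y W).white = W := rfl
  have hnyw : M.next y ∈ M.white := by rw [hT.white_next]; exact hyw.2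
  have hyD := hM.rootFace_sub hy
  have hxD := hM.rootFace_sub hx
  generalize M.zipAt x y W = N at *
  have hfar' : ∀ z ∈ M.vertexOf (M.next y), M.rev z ∉ M.vertexOf x := by grind [hM.rev_rev]
  have hnyD := hM.next_mem_iff.2 hyD
  refine ⟨⟨hC.rev_mem, hC.rev_ne, fun z _ => hC.rev_rev z, hC.rev_fix,
    fun z hz => hC.next_mem_iff.2 hz, hC.next_fix, hC.root_mem, hconn, hE, ?_, ?_⟩,
    fun z hzD hzi => ?_, fun z hzD h => ?_, fun z hz' t ht h => ?_⟩
  · grind [hT.white_sub]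
  · intro z hz'
    have hz1 := hmem.1 hz'
    have hz2 := hmem.1 (show N.rot z ∈ N.darts by
      rw [rot_apply, hC.next_mem_iff, hC.rev_mem_iff]; exact hz')
    have h1 : N.rot z ∈ N.vertexOf z := rot_mem_vertexOf.2 (self_mem_vertexOf z)
    have hwo : ∀ u, u ≠ x → u ≠ y → (u ∈ N.white ↔ u ∈ M.white) := by grind
    rw [hwo _ hz1.2.1 hz1.2.2, hwo _ hz2.2.1 hz2.2.2]
    have hcol : ∀ u, u ∈ M.vertexOf x ∨ u ∈ M.vertexOf (M.next y) → u ∈ M.white := by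
      rintro u (hu | hu)
      · exact (hT.white_vertexOf hu).2 hxw.1
      · exact (hT.white_vertexOf hu).2 hnyw
    grind [hT.white_vertexOf]
  · grind [hT.triangle]
  · have hyx : y ∈ M.vertexOf (M.rev x) := by
      rw [← hz.next_x]; exact hM.next_mem_vertexOf_rev x
    have hz1 := hmem.1 hzD
    have hyny : y ∉ M.vertexOf (M.next y) := fun h => d6 (hT.outer_eq hny hy h)
    have hxy : y ∉ M.vertexOf x := fun h => hz.ne (hT.outer_eq hx hy h).symm
    have key : M.rev x ∉ M.vertexOf (M.rev y) ∧ ¬ (M.rev x ∈ M.vertexOf x ∨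
        M.rev x ∈ M.vertexOf (M.next y)) := by
      refine ⟨fun h1 => ?_, not_or.2 ⟨fun h1 => ?_, fun h1 => ?_⟩⟩
      · refine hT.rev_not_vertexOf hyD ?_
        exact mem_vertexOf.2 ((mem_vertexOf.1 hyx).symm.trans (mem_vertexOf.1 h1).symm)
      · exact hT.rev_not_vertexOf hxD h1
      · exact hyny (mem_vertexOf.2 ((mem_vertexOf.1 h1).trans (mem_vertexOf.1 hyx)))
    by_cases h1 : z = M.rev x
    · rw [h1, v3, hvo d1 d3 d4 d2] at h
      rcases h with h | h
      · exact key.1 (mem_vertexOf_comm.1 h)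
      · exact key.2 h.1
    by_cases h2 : z = M.rev y
    · grind
    have e1 : M.rev z ≠ x := by grind [hM.rev_rev]
    have e2 : M.rev z ≠ y := by grind [hM.rev_rev]
    rw [v5 z hz1.2.1 hz1.2.2 h1 h2, hvo hz1.2.1 hz1.2.2 e1 e2] at h
    rcases h with h | ⟨h3 | h3, h4 | h4⟩
    · exact hT.rev_not_vertexOf hz1.1 h
    · exact hT.rev_not_vertexOf hz1.1
        (mem_vertexOf.2 ((mem_vertexOf.1 h3).symm.trans (mem_vertexOf.1 h4)))
    · exact hfar z h3 h4
    · exact hfar' z h3 h4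
    · exact hT.rev_not_vertexOf hz1.1
        (mem_vertexOf.2 ((mem_vertexOf.1 h3).symm.trans (mem_vertexOf.1 h4)))
  · rw [hrf] at hz' ht
    rcases (hvo hz'.2.1 hz'.2.2 ht.2.1 ht.2.2).1 h with h1 | ⟨h1 | h1, h2 | h2⟩
    · exact hT.outer_eq hz'.1 ht.1 h1
    · exact absurd (hT.outer_eq hx hz'.1 h1).symm hz'.2.1
    · exact absurd (hT.outer_eq hx hz'.1 h1).symm hz'.2.1
    · exact absurd (hT.outer_eq hx ht.1 h2).symm ht.2.1
    · exact (hT.outer_eq hny hz'.1 h1).symm.trans (hT.outer_eq hny ht.1 h2)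

/-- The root-interface condition is not affected by the gluing of two left edges. -/
theorem zipAt_rootInterface_iff (hx : x ∈ M.rootFace) (hrx : M.rev x ∉ M.rootFace)
    (hry : M.rev y ∉ M.rootFace) (hxw : M.WhiteEdge x) (hyw : M.WhiteEdge y) :
    (M.zipAt x y (M.white \ {x, y})).RootInterface ↔ M.RootInterface := by
  have hy : y ∈ M.rootFace := by rw [← hz.next_x, next_mem_rootFace]; exact hx
  obtain ⟨v1, v2, v3, v4, v5, v6, v7, v8, v9⟩ := zipAt_values (W := M.white \ {x, y}) hM hz
  have hrf := fun {z : ℕ} => zipAt_mem_rootFace hM (W := M.white \ {x, y}) hz (z := z)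
  have hwN : (M.zipAt x y (M.white \ {x, y})).white = M.white \ {x, y} := rfl
  have hroot : (M.zipAt x y (M.white \ {x, y})).root = M.root := rfl
  generalize M.zipAt x y (M.white \ {x, y}) = N at *
  have hwo : ∀ u, u ≠ x → u ≠ y → (u ∈ N.white ↔ u ∈ M.white) := by grind
  have key : ∀ z ∈ M.rootFace, z ≠ x → z ≠ y →
      (z ∈ N.white ↔ z ∈ M.white) ∧ (N.rev z ∈ N.white ↔ M.rev z ∈ M.white) := by
    intro z hz' h1 h2
    have h3 : z ≠ M.rev x := fun h => hrx (h ▸ hz')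
    have h4 : z ≠ M.rev y := fun h => hry (h ▸ hz')
    grind [hM.rev_rev]
  obtain ⟨k1, k2⟩ := key _ root_mem_rootFace hz.root_x hz.root_y
  unfold RootInterface
  rw [hroot, k1, k2]
  refine and_congr_right fun _ => ?_
  constructor
  · intro h z hz' hzr h'
    by_cases h1 : z = x
    · exact h'.2 (h1 ▸ hxw.2)
    by_cases h2 : z = y
    · exact h'.2 (h2 ▸ hyw.2)
    grind
  · grind

end ZipTriangulation

end PercMap

namespace MarkedMap

open PercMap

variable {la lb : List ℕ} {M : MarkedMap} {T U κ : ℕ → ℕ} {K : ℕ}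

namespace Inv

variable {i j : ℕ} (h : Inv (i :: la) (j :: lb) M T U κ K)
include h

theorem next_top : M.next M.top = U i := h.leftDart_eq (i := i) rfl

/-- The top-edge can be glued to the next left edge. -/
theorem zippable : M.Zippable M.top (U i) := by
  have hC := h.comb
  have hw := h.white i (by simp)
  have hb := h.top_bw
  have hn := h.next_top
  have hnr := h.next_right
  have hrb := h.black j (by simp)
  have hroot := h.ri.1
  refine ⟨h.top_darts, hn, fun e => hb.1 (e ▸ hw.1), fun e => ?_, fun e => ?_, fun e => ?_, fun e => ?_,
    fun e => hb.1 (e ▸ hroot.1), fun e => hroot.2 (e ▸ hw.2)⟩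
  · have := hw.2; rw [← e, hC.rev_rev] at this; exact hb.1 this
  · have h1 : M.next (U i) ∈ M.white := by rw [h.tri.white_next]; exact hw.2
    exact hb.1 (e ▸ h1)
  · have := M.next.injective (e.trans hnr.symm)
    rw [← M.rev.injective this] at hrb
    exact hrb.2 hb.2
  · have := M.next.injective (e.trans hnr.symm)
    exact hrb.1 ((M.rev.injective this) ▸ hw.1)

/-- The step `c`, when the last unmatched `a`-step comes before the last unmatched `b`-step. -/
theorem stepC_eq (hij : i < j) : M.stepC = ⟨(M.toPercMap.recolorWhite M.top).zipAt M.top (U i)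
      ((M.toPercMap.recolorWhite M.top).white \ {M.top, U i}),
      M.active \ {M.top, M.rev M.top, U i, M.rev (U i)}⟩ := by
  have hl : M.HasActiveLeft := by rw [h.hasActiveLeft_iff]; simp
  have hr : M.HasActiveRight := by rw [h.hasActiveRight_iff]; simp
  have hrec : M.RecolorsRight := by grind [h.recolorsRight_iff]
  unfold stepC
  rw [if_pos ⟨hl, hr⟩, if_pos hrec, h.leftDart_eq (i := i) rfl, glueTop, recolored, if_pos hrec]
  rfl

theorem recolorWhite_zippable : (M.toPercMap.recolorWhite M.top).Zippable M.top (U i) :=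
  let hz := h.zippable
  ⟨hz.mem, hz.next_x, hz.ne, hz.rev_ne, hz.next_y, hz.next_rev_x, hz.next_rev_y, hz.root_x,
    hz.root_y⟩

theorem hlt (hij : i < j) : ∀ k ∈ i :: la, k < j := by
  intro k hk
  rcases List.mem_cons.1 hk with rfl | hk
  · exact hij
  · exact ((List.pairwise_cons.1 h.sortL).1 k hk).trans hij

theorem recolorWhite_rev_outer {x : ℕ} (hx : x ∈ M.rootFace) (hx' : x = M.top ∨ x = U i) :
    M.rev x ∉ M.rootFace := by
  rcases hx' with rfl | rfl
  · intro h1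
    have h2 := (h.tri.single_edge hx h1).1
    rw [h.next_top] at h2
    exact h.zippable.rev_ne h2.symm
  · exact h.rev_left_inner (by simp)

set_option maxHeartbeats 2000000 in
theorem zip_top_entry (hij : i < j) : Inv la lb M.stepC T U κ (κ j + 1) ∧
    M.stepC.top = M.rev (U j) ∧ ∀ l ≤ κ j, M.stepC.entry l = M.entry l := by
  have hC := h.comb
  have hr := h.recolor (h.hlt hij)
  have hj : j ∈ i :: la ∨ j ∈ j :: lb := .inr (by simp)
  have hi : i ∈ i :: la ∨ i ∈ j :: lb := .inl (by simp)
  have hlta : ∀ k ∈ la, k < i := (List.pairwise_cons.1 h.sortL).1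
  have hltb : ∀ k ∈ lb, k < j := (List.pairwise_cons.1 h.sortR).1
  have hin : ∀ k, (k ∈ la ∨ k ∈ lb) → k ∈ i :: la ∨ k ∈ j :: lb := by grind
  have hinR : ∀ k, (k ∈ la ∨ k ∈ lb) → k ∈ i :: la ∨ k ∈ lb := by grind
  have hkj : ∀ k, (k ∈ la ∨ k ∈ lb) → k < j := by grind
  have hki : ∀ k, (k ∈ la ∨ k ∈ lb) → k ≠ i := by
    grind [h.disj]
  have hκ : ∀ k, (k ∈ la ∨ k ∈ lb) → κ k < κ j := fun k hk => h.mono k j (hin k hk) hj (hkj k hk)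
  rw [h.stepC_eq hij]
  have hz := h.recolorWhite_zippable
  have hdf := h.top_mem
  have hbw := h.top_bw
  have hUf := h.left_mem (i := i) (by simp)
  have hro := fun {x : ℕ} => h.recolorWhite_rev_outer (x := x)
  have hrd := hro hdf (.inl rfl)
  have hrU := hro hUf (.inr rfl)
  have htv := h.top_vertex
  have hri := h.right_mem (i := j) (by simp)
  have hnr := h.next_right
  have hrb := h.black j (by simp)
  have e1 : (M.toPercMap.recolorWhite M.top).rev = M.rev := rfl
  have e2 : (M.toPercMap.recolorWhite M.top).next = M.next := rfl
  have e3 : (M.toPercMap.recolorWhite M.top).vertexOf = M.vertexOf := rfl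
  have e4 : (M.toPercMap.recolorWhite M.top).rootFace = M.rootFace := rfl
  have e5 : (M.toPercMap.recolorWhite M.top).darts = M.darts := rfl
  have hdW : M.top ∈ (M.toPercMap.recolorWhite M.top).white := .inr (self_mem_vertexOf _)
  have hwR : M.white ⊆ (M.toPercMap.recolorWhite M.top).white := Set.subset_union_left
  generalize M.toPercMap.recolorWhite M.top = R at *
  have hCR := hr.tri.comb
  have hdw : R.WhiteEdge M.top := ⟨hdW, by rw [e1]; exact hwR hbw.2⟩
  have hUw : R.WhiteEdge (U i) := hr.white i (by simp)
  have hdw2 : M.rev M.top ∈ R.white := by rw [← e1]; exact hdw.2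
  have hUw2 : M.rev (U i) ∈ R.white := by rw [← e1]; exact hUw.2
  have hnU : R.next (U i) ∈ R.rootFace := by rw [e4, e2, next_mem_rootFace]; exact hUf
  have hnUw : R.next (U i) ∈ R.white := by rw [hr.tri.white_next]; exact hUw.2
  have hvY : R.vertexOf (R.next (U i)) = R.vertexOf (R.rev (U i)) := hCR.vertexOf_next _
  have hfar : ∀ z ∈ R.vertexOf M.top, R.rev z ∉ R.vertexOf (R.next (U i)) := by
    rw [hvY, e3, e1, ← htv]
    exact h.far i j hi hj hij
  have hv : R.next (U i) ∉ R.vertexOf M.top := by grind [hz.next_y, hr.tri.outer_eq]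
  have htri := zipAt_isTriangulation hCR hz hr.tri (by rw [e4]; exact hdf) hdw hUw hfar
  have hrin := (zipAt_rootInterface_iff hCR hz (by rw [e4]; exact hdf) (by rw [e1, e4]; exact hrd)
    (by rw [e1, e4]; exact hrU) hdw hUw).2 hr.ri
  obtain ⟨v1, v2, v3, v4, v5, v6, v7, v8, v9⟩ :=
    zipAt_values (W := R.white \ {M.top, U i}) hCR hz
  obtain ⟨r1, r2, -⟩ := zipAt_rot_values (W := R.white \ {M.top, U i}) hCR hz
  have hvo := fun {a z : ℕ} => zipAt_mem_vertexOf hCR (W := R.white \ {M.top, U i}) hz hv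
    (a := a) (z := z)
  have hrf := fun {z : ℕ} => zipAt_mem_rootFace hCR (W := R.white \ {M.top, U i}) hz (z := z)
  have hwN : (R.zipAt M.top (U i) (R.white \ {M.top, U i})).white = R.white \ {M.top, U i} := rfl
  have hroot : (R.zipAt M.top (U i) (R.white \ {M.top, U i})).root = R.root := rfl
  generalize R.zipAt M.top (U i) (R.white \ {M.top, U i}) = N at *
  rw [e1] at v3 v4 v5
  rw [e2] at v8 v9
  -- the unmatched steps that remain are not affected by the gluing
  have hwo : ∀ u, u ≠ M.top → u ≠ U i → (u ∈ N.white ↔ u ∈ R.white) := by grind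
  have hlaW : ∀ k ∈ la, R.WhiteEdge (U k) := by grind [hr.white]
  have hlbB : ∀ k ∈ lb, R.BlackEdge (U k) := fun k hk => hr.black k hk
  have hlaO : ∀ k ∈ la, U k ∈ M.rootFace := by grind [h.left_mem]
  have hlbO : ∀ k ∈ lb, M.rev (U k) ∈ M.rootFace := by grind [h.right_mem]
  -- the darts of the two edges that are glued
  let F : Set ℕ := {M.top, M.rev M.top, U i, M.rev (U i)}
  have hFr : ∀ {u}, u ∉ F → M.rev u ∉ F := by
    rintro u hu (e | e | e | e)
    exacts [hu (.inr (.inl (by rw [← e, hC.rev_rev]))), hu (.inl (M.rev.injective e)),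
      hu (.inr (.inr (.inr (by rw [Set.mem_singleton_iff, ← e, hC.rev_rev])))),
      hu (.inr (.inr (.inl (M.rev.injective e))))]
  have hFw : ∀ {u}, u ∉ R.white → u ∉ F := by
    rintro u hu (rfl | rfl | rfl | rfl)
    exacts [hu hdw.1, hu hdw2, hu hUw.1, hu hUw2]
  have hF1 : ∀ {u}, u ∉ F → u ≠ M.top := fun hu e => hu (.inl e)
  have hF2 : ∀ {u}, u ∉ F → u ≠ U i := by grind
  replace v5 : ∀ {u}, u ∉ F → N.rev u = M.rev u := fun hu => v5 _ (hF1 hu) (hF2 hu)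
    (fun e => hu (.inr (.inl e))) fun e => hu (.inr (.inr (.inr e)))
  replace hwo : ∀ {u}, u ∉ F → (u ∈ N.white ↔ u ∈ R.white) := fun hu => by
    rw [hwN]; simp [hF1 hu, hF2 hu]
  have hUF : ∀ {k}, (k ∈ la ∨ k ∈ lb) → U k ∉ F := by
    rintro k (hk | hk)
    · rintro (e | e | e | e)
      exacts [hbw.1 (e ▸ (h.white k (List.mem_cons_of_mem _ hk)).1),
        hrd (e ▸ hlaO k hk), hki k (.inl hk) (h.U_inj (hin k (.inl hk)) hi e), hrU (e ▸ hlaO k hk)]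
    · exact hFw (hlbB k hk).1
  have hrjF : M.rev (U j) ∉ F := by
    grind [h.tri.next_ne, h.top_darts, h.white]
  have hinner : ∀ u, u ∉ M.rootFace → u ≠ M.top ∧ u ≠ U i := by grind
  have hNnext : ∀ u, u ∉ M.rootFace → N.next u = M.next u := fun u hu =>
    v9 u (hinner u hu).1 (hinner u hu).2 (hinner _ fun e => hu (next_mem_rootFace.1 e)).1
  -- neither the ends of the remaining active edges nor the path meet the identified vertices
  have hUvx : ∀ k, (k ∈ la ∨ k ∈ lb) → U k ∉ R.vertexOf M.top := by
    rintro k (hk | hk) hv'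
    · grind [hr.tri.outer_eq]
    · exact (hlbB k hk).1 ((hr.tri.white_vertexOf hv').2 hdW)
  have hrUv : ∀ k, (k ∈ la ∨ k ∈ lb) → ¬ (M.rev (U k) ∈ R.vertexOf M.top ∨
      M.rev (U k) ∈ R.vertexOf (R.next (U i))) := by
    intro k hk
    rw [not_or]
    rcases hk with hk | hk
    · constructor
      · intro hv'
        rw [e3, ← hC.next_mem_vertexOf_iff] at hv'
        have := h.tri.outer_eq hdf (next_mem_rootFace.2 (hlaO k hk)) hv'
        have h2 := M.next.injective (hnr.trans this)
        exact hrb.2 (h2 ▸ (h.white k (List.mem_cons_of_mem _ hk)).1)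
      · intro hv'
        rw [e3, ← hC.next_mem_vertexOf_iff, e2] at hv'
        have := h.tri.outer_eq (next_mem_rootFace.2 hUf) (next_mem_rootFace.2 (hlaO k hk)) hv'
        exact hF2 (hUF (.inl hk)) (M.next.injective this).symm
    · have hb := (hlbB k hk).2
      grind [hr.tri.white_vertexOf]
  have hentD : ∀ l ≤ κ j + 1, R.BW (R.entry l) := fun l hl => hr.pathEnd.bw hr.tri hr.ri hl
  have hentF : ∀ {l}, l ≤ κ j + 1 → R.entry l ∉ F := fun hl => hFw (hentD _ hl).1
  have hent : ∀ l ≤ κ j + 1, N.entry l = R.entry l := by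
    intro l hl
    have hrr : N.rev N.root = R.rev R.root := by
      have h1 := hFr (hentF (Nat.zero_le _))
      grind [entry_zero, hC.rev_rev]
    refine entry_congr (k := κ j + 1) hrr (fun l hl => ?_) hl
    have hgi := hr.pathEnd.inner l hl
    rw [e4] at hgi
    have hg1 : M.next (R.entry l) ∉ M.rootFace := fun e => hgi (next_mem_rootFace.1 e)
    have hg2 : M.next (M.next (R.entry l)) ∉ M.rootFace := fun e => hg1 (next_mem_rootFace.1 e)
    refine interfaceStep_congr' hCR (by rw [e2]; exact hNnext _ hgi) (by rw [e2]; exact hNnext _ hg1)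
      (by rw [e2, hwN]; simp [hinner _ hg2]) ?_
    rw [← entry_succ, e1]
    rw [v5 (hFr (hentF hl)), hC.rev_rev]
  have hNtop : N.top = M.rev (U j) := by
    refine (PercMap.eq_top htri hrin ?_ ⟨?_, ?_⟩).symm
    · grind
    · rw [hwo hrjF, ← hr.entry_end]; exact (hentD _ le_rfl).1
    · rw [v5 hrjF, hwo (hFr hrjF), ← hr.entry_end, ← e1]
      exact (hentD _ le_rfl).2
  -- touching a vertex of a remaining edge
  have hnotU : ∀ k, (k ∈ la ∨ k ∈ lb) → ∀ e ∈ N.vertexOf (U k), e ≠ M.top → e ≠ U i →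
      (e ∈ R.vertexOf (U k) ∨ e ∈ R.vertexOf M.top) := by
    intro k hk e he h1 h2
    rcases (hvo (hF1 (hUF hk)) (hF2 (hUF hk)) h1 h2).1 he with h3 | ⟨h3 | h3, h4 | h4⟩
    · exact .inl h3
    · exact .inr h4
    · exact absurd h3 (hUvx k hk)
    · exact .inr h4
    · exact .inl (mem_vertexOf.2 ((mem_vertexOf.1 h3).symm.trans (mem_vertexOf.1 h4)))
  have hnotrU : ∀ k, (k ∈ la ∨ k ∈ lb) → ∀ e ∈ N.vertexOf (M.rev (U k)), e ≠ M.top → e ≠ U i →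
      e ∈ R.vertexOf (M.rev (U k)) := by
    grind
  refine ⟨?_, hNtop, fun l hl => by rw [← hr.entry_eq l hl]; exact hent l (by omega)⟩
  constructor
  · exact htri
  · exact hrin
  · intro x
    have hsplit : ∀ x, (∃ k, (k ∈ i :: la ∨ k ∈ j :: lb) ∧ (x = U k ∨ x = M.rev (U k))) ↔
        (x = M.rev (U j) ∨ x = U j) ∨ (x = U i ∨ x = M.rev (U i)) ∨ ∃ k, (k ∈ la ∨ k ∈ lb) ∧
          (x = U k ∨ x = M.rev (U k)) := by
      intro x
      simp only [List.mem_cons]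
      constructor
      · grind
      · rintro (hx | hx | ⟨k, hk | hk, hx⟩)
        · grind
        · grind
        · grind
        · grind
    have hNr : N.rev (M.rev (U j)) = U j := by rw [v5 hrjF, hC.rev_rev]
    grind [h.active, hC.rev_rev]
  · simp only [hNtop]
    have hch := h.chainL
    rw [List.map_cons, List.isChain_cons_cons, List.isChain_cons] at hch
    rw [List.isChain_cons]
    refine ⟨fun y hy => by rw [v8 _ hnr]; exact hch.2.1 y hy, ?_⟩
    refine hch.2.2.imp_of_mem_imp fun x y hx hy hxy => ?_
    obtain ⟨k, hk, rfl⟩ := List.mem_map.1 hx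
    rw [v9 _ (hF1 (hUF (.inl hk))) (hF2 (hUF (.inl hk))), hxy]
    intro e
    have := M.next.injective (hnr.trans e.symm)
    exact hrb.2 (this ▸ (h.white k (List.mem_cons_of_mem _ hk)).1)
  · simp only [hNtop]
    have hch := h.chainR
    rw [List.map_cons, List.isChain_cons_cons] at hch
    rw [List.map_congr_left (g := fun i => M.rev (U i)) fun k hk => v5 (hUF (.inr hk))]
    refine hch.2.imp_of_mem_tail_imp fun x y hx hy hxy => ?_
    have hy : y ∈ lb.map fun k => M.rev (U k) := hy
    obtain ⟨k, hk, rfl⟩ := List.mem_map.1 hy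
    rw [v9 _ (hF1 (hFr (hUF (.inr hk)))) (hF2 (hFr (hUF (.inr hk)))), hxy]
    intro e
    have h2 := M.rev.injective (M.next.injective (hnr.trans e.symm))
    grind [h.U_inj]
  · intro k hk
    have hw := hlaW k hk
    rw [WhiteEdge, e1] at hw
    have hu := hUF (.inl hk)
    exact ⟨(hwo hu).2 hw.1, by simp only [v5 hu, hwo (hFr hu)]; exact hw.2⟩
  · intro k hk
    have hw := hlbB k hk
    rw [BlackEdge, e1] at hw
    have hu := hUF (.inr hk)
    exact ⟨fun h' => hw.1 ((hwo hu).1 h'), by simp only [v5 hu, hwo (hFr hu)]; exact hw.2⟩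
  · grind [h.T_inner, h.triL]
  · grind [h.right_inner, h.triR]
  · constructor
    · grind [hr.pathEnd.inner]
    · grind [hr.pathEnd.outer]
  · intro k hk
    have h1 := hκ k hk
    refine ⟨by omega, ?_⟩
    simp only [hent _ (h1.le.trans (Nat.le_succ _)), hr.entry_eq _ h1.le]
    exact (h.entry k (hin k hk)).2
  · exact fun k l hk hl => h.mono k l (hin k hk) (hin l hl)
  · intro k hk l hl
    have h1 := hκ k hk
    have hl' : l ≤ κ j + 1 := by omega
    have hjt : ∀ e, e = R.entry l ∨ e = M.rev (R.entry l) → e ∉ R.vertexOf M.top := by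
      have := h.near j hj l (by omega)
      rw [← hr.entry_eq l (by omega)] at this
      unfold Touch at this
      rw [htv, ← e3, not_or] at this
      grind
    have hR := hr.near k (hinR k hk) l hl
    unfold Touch at hR
    rw [e1, not_or] at hR
    have hn := hentF hl'
    simp only [hent l hl', Touch, v5 hn]
    grind
  · intro k l hk hl hkl x hx hx'
    simp only [v5 (hUF hk)] at hx'
    have n1 : x ≠ M.top := by
      rintro rfl
      exact hF1 (hUF hl) ((sameCycle_of_fixed r1).1 (mem_vertexOf.1 hx).symm).symm
    have n2 : x ≠ U i := by
      rintro rfl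
      exact hF2 (hUF hl) ((sameCycle_of_fixed r2).1 (mem_vertexOf.1 hx).symm).symm
    by_cases n3 : x = M.rev M.top
    · rw [n3, v3] at hx'
      have h5 := hnotrU k hk _ hx' (fun e => hz.rev_ne (by
        rw [e1, ← e, hC.rev_rev])) (hC.rev_ne _ (hC.rootFace_sub hUf))
      refine hrUv k hk (.inr ?_)
      rw [hvY, e1]
      exact mem_vertexOf_comm.1 h5
    by_cases n4 : x = M.rev (U i)
    · rw [n4, v4] at hx'
      have h5 := hnotrU k hk _ hx' (hC.rev_ne _ h.top_darts) (by rw [← e1]; exact hz.rev_ne)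
      have h6 : U i ∈ R.vertexOf (M.rev (U k)) := by
        rw [e3]
        rw [e3, ← hC.next_mem_vertexOf_iff, h.next_top] at h5
        exact h5
      rcases hk with hk | hk
      · rw [e3, mem_vertexOf_comm, ← hC.next_mem_vertexOf_iff] at h6
        have h7 := h.tri.outer_eq hUf (next_mem_rootFace.2 (hlaO k hk)) h6
        rw [← h.next_top] at h7
        exact hF1 (hUF (.inl hk)) (M.next.injective h7).symm
      · have hb := (hlbB k hk).2
        grind [hr.tri.white_vertexOf]
    have n5 : x ∉ F := by rintro (e | e | e | e) <;> contradiction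
    rw [v5 n5] at hx'
    have h5 := hnotrU k hk _ hx' (hF1 (hFr n5)) (hF2 (hFr n5))
    rw [e3] at h5
    rcases hnotU l hl x hx n1 n2 with h6 | h6
    · exact h.far k l (hin k hk) (hin l hl) hkl x (by rw [← e3]; exact h6) h5
    · refine h.far k j (hin k hk) hj (hkj k hk) x ?_ h5
      rw [htv, ← e3]
      exact h6
  · exact (List.pairwise_cons.1 h.sortL).2
  · exact (List.pairwise_cons.1 h.sortR).2
  · grind [h.disj]

theorem zip (hij : i < j) : Inv la lb M.stepC T U κ (κ j + 1) := (h.zip_top_entry hij).1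

end Inv

/-! ### The cells created at each step -/

/-- The origin of the dart `x` is an in-vertex. -/
def InV (M : MarkedMap) (x : ℕ) : Prop := x ∈ M.darts ∧ Disjoint (M.vertexOf x) M.active

theorem InV.not_mem {M : MarkedMap} {x y : ℕ} (h : M.InV x) (hy : y ∈ M.vertexOf x) :
    y ∉ M.active := Set.disjoint_left.1 h.2 hy

/-- How the in-cells of `N` are obtained from those of `M`: the in-edge of the dart
`M.rev M.top` is new, the inner triangles formed by the darts of `F` are new, and the in-vertices
formed by the darts of `V` are new. The other cells are the same sets of darts. -/
structure CellStep (M N : MarkedMap) (F V : Set ℕ) : Prop where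
  rev_eq : ∀ x ∈ M.darts, x ∉ M.active → N.rev x = M.rev x
  inactive : ∀ x, (x ∈ N.darts ∧ x ∉ N.active) ↔ (x ∈ M.darts ∧ x ∉ M.active) ∨
    (x = M.rev M.top ∨ x = N.rev (M.rev M.top))
  root : ∀ x ∈ M.darts, x ∉ M.active → (x ∈ N.rootFace ↔ x ∈ M.rootFace)
  colour : ∀ x ∈ M.rootFace, x ∉ M.active →
    (x ∈ N.white ↔ x ∈ M.white) ∧ (M.rev x ∈ N.white ↔ M.rev x ∈ M.white)
  face : ∀ x ∈ M.darts, x ∉ M.rootFace → N.faceOf x = M.faceOf x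
  inner : ∀ x, (x ∈ N.darts ∧ x ∉ N.rootFace) ↔ (x ∈ M.darts ∧ x ∉ M.rootFace) ∨ x ∈ F
  vertex : ∀ x, M.InV x → N.vertexOf x = M.vertexOf x
  inV : ∀ x, N.InV x ↔ M.InV x ∨ x ∈ V
  vcolour : ∀ x, M.InV x → (x ∈ N.white ↔ x ∈ M.white)
  fnew : ∀ x ∈ F, ¬ (x ∈ M.darts ∧ x ∉ M.rootFace)
  vnew : ∀ x ∈ V, ¬ M.InV x

theorem mirror_inV {M : MarkedMap} (hM : M.Comb) (ha : ∀ x ∈ M.active, M.rev x ∈ M.active) {x : ℕ} :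
    M.mirror.InV x ↔ M.InV (M.rev x) := by
  unfold InV
  rw [hM.rev_mem_iff]
  refine and_congr Iff.rfl ?_
  rw [Set.disjoint_left, Set.disjoint_left]
  constructor
  · intro h y hy hya
    refine h (a := M.rev y) ?_ (ha y hya)
    refine (mem_mirror_vertexOf hM).2 ?_
    rwa [hM.rev_rev]
  · intro h y hy hya
    exact h ((mem_mirror_vertexOf hM).1 hy) (ha y hya)

theorem CellStep.of_mirror {M N : MarkedMap} {F V : Set ℕ} (hM : M.Comb) (hN : N.Comb)
    (haM : ∀ x ∈ M.active, M.rev x ∈ M.active) (haN : ∀ x ∈ N.active, N.rev x ∈ N.active)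
    (h : CellStep M.mirror N.mirror F V) : CellStep M N F {x | N.rev x ∈ V} := by
  have htop : M.mirror.top = M.top := mirror_top hM
  have hia : ∀ x ∈ M.darts, x ∉ M.active → M.rev x ∈ M.darts ∧ M.rev x ∉ M.active := by grind
      [hM.rev_mem, hM.rev_rev]
  have hNd : ∀ x ∈ M.darts, x ∉ M.active → x ∈ N.darts := fun x hx hxa =>
    ((h.inactive x).2 (.inl ⟨hx, hxa⟩)).1
  have hrev : ∀ x ∈ M.darts, x ∉ M.active → N.rev x = M.rev x := h.rev_eq
  have hIV : ∀ x, M.InV x → M.mirror.InV (M.rev x) := by grind [mirror_inV, hM.rev_rev]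
  have hin : ∀ x, M.InV x → x ∈ M.darts ∧ x ∉ M.active := fun x hx =>
    ⟨hx.1, hx.not_mem (self_mem_vertexOf x)⟩
  refine ⟨hrev, ?_, fun x hx hxa => ?_, fun x hx hxa => ?_, fun x hx hxi => ?_, fun x => ?_, fun x hx => ?_,
    fun x => ?_, fun x hx => ?_, fun x hx => ?_, fun x hx hx' => ?_⟩
  · have := h.inactive
    rw [htop] at this
    exact this
  · have := h.root x hx hxa
    grind [mirror_toPercMap, mirror_rootFace]
  · have hxD := hM.rootFace_sub hx
    have := h.colour x (by rw [mirror_toPercMap, mirror_rootFace]; exact hx) hxa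
    obtain ⟨h1, h2⟩ := hia x hxD hxa
    have e1 : ∀ y, M.mirror.rev y = M.rev y := fun _ => rfl
    grind [mirror_toPercMap, mem_mirror_white, hM.rev_rev]
  · have := h.face x hx (by rw [mirror_toPercMap, mirror_rootFace]; exact hxi)
    grind [mirror_toPercMap, mirror_faceOf]
  · have := h.inner x
    rwa [mirror_toPercMap, mirror_toPercMap, mirror_rootFace, mirror_rootFace] at this
  · have h0 := hIV x hx
    have h1 := h.vertex _ h0
    obtain ⟨h2, h3⟩ := hin x hx
    have h4 := hrev x h2 h3
    ext y
    have h5 : M.rev y ∈ M.mirror.vertexOf (M.rev x) ↔ y ∈ M.vertexOf x := by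
      have := mem_mirror_vertexOf hM (d := M.rev x) (x := M.rev y)
      rwa [hM.rev_rev, hM.rev_rev] at this
    have h6 : N.rev y ∈ N.mirror.vertexOf (M.rev x) ↔ y ∈ N.vertexOf x := by
      rw [← h4]
      have h8 := mem_mirror_vertexOf hN (d := N.rev x) (x := N.rev y)
      rwa [hN.rev_rev, hN.rev_rev] at h8
    rw [← h5, ← h6, h1]
    have key : ∀ z, z ∈ M.mirror.vertexOf (M.rev x) → z ∈ M.darts ∧ z ∉ M.active := fun z hz =>
      ⟨((mirror_comb hM).vertexOf_sub hz).2 (hM.rev_mem x h2), h0.not_mem hz⟩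
    grind [hN.rev_rev, hM.rev_rev]
  · rw [← hN.rev_rev x, ← mirror_inV hN haN, h.inV, mirror_inV hM haM, hN.rev_rev]
    grind [hM.rev_rev, hN.rev_rev]
  · have := h.vcolour _ (hIV x hx)
    grind [mirror_toPercMap, mem_mirror_white, hM.rev_rev, hN.rev_rev]
  · have := h.fnew x hx
    rwa [mirror_toPercMap, mirror_rootFace] at this
  · grind [h.vnew]

namespace Inv

section

variable (h : Inv la lb M T U κ K)
include h

theorem top_active : M.top ∈ M.active := (h.active _).2 (.inl (.inl rfl))

theorem rev_top_active : M.rev M.top ∈ M.active := (h.active _).2 (.inl (.inr rfl))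

theorem active_darts {x : ℕ} (hx : x ∈ M.active) : x ∈ M.darts := h.isTBar.active_sub hx

/-- The cells created when a triangle is glued to the top-edge, which remains bicolor. -/
theorem cellStep_glue {p q p' q' : ℕ} (hF : Fresh4 M.darts p q p' q') (u : Bool) :
    CellStep M (M.glueTriAt u p q p' q') ((M.glueTriAt u p q p' q').faceOf M.top) ∅ ∧
      (∀ d ∈ (M.glueTriAt u p q p' q').edgeOf (M.rev M.top),
        ¬ (M.glueTriAt u p q p' q').WhiteEdge d ∧ ¬ (M.glueTriAt u p q p' q').BlackEdge d) := by
  have hC := h.comb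
  have hdf := h.top_mem
  have hdD := h.top_darts
  have hbw := h.top_bw
  have hnd := h.tri.next_ne hdD
  have hdr : M.root ≠ M.top := fun e => hbw.1 (e ▸ h.ri.1.1)
  set W := M.white ∪ (if u then {q', q, p'} else {q'}) with hW
  obtain ⟨v1, v2, v3, v4, v5, v6, v7, v8, v9, v10, v11, v12⟩ := glueAt_values hC (W := W) hdD hnd hF
  have hNC : (M.glueTriAt u p q p' q').Comb := glueAt_comb hC (W := W) hdD hnd hF
  have hmem := fun {x : ℕ} => glueAt_mem (M := M.toPercMap) (d := M.top) (p := p) (q := q) (p' := p')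
    (q' := q') (W := W) (x := x)
  have hrf := fun {x : ℕ} => glueAt_mem_rootFace hC (W := W) hdf hnd hF hdr (x := x)
  have hvo := fun {a x : ℕ} => glueAt_mem_vertexOf hC (W := W) hdf hnd hF (a := a) (x := x)
  have hfo := fun {a x : ℕ} => glueAt_mem_faceOf hC (W := W) hdf hnd hF hdr (a := a) (x := x)
  have hfd : ∀ {x : ℕ}, x ∈ (M.toPercMap.glueAt M.top p q p' q' W).faceOf M.top ↔ _ :=
    fun {x : ℕ} => glueAt_faceOf_d hC (W := W) hdD hnd hF (x := x)
  obtain ⟨m1, m2, m3, m4, a1, a2, a3, a4, a5, a6⟩ := id hF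
  have e0 : (M.glueTriAt u p q p' q').toPercMap = M.toPercMap.glueAt M.top p q p' q' W := rfl
  have hact : (M.glueTriAt u p q p' q').active =
    (M.active \ {M.top, M.rev M.top}) ∪ {p, q, p', q'} := rfl
  generalize M.glueTriAt u p q p' q' = N at *
  have hwN : N.white = W := by rw [e0]; rfl
  rw [← e0] at v1 v2 v3 v4 v5 v6 v7 v8 v9 v10 v11 v12 hrf hvo hfo hfd hmem
  have hta := h.top_active
  have hrta := h.rev_top_active
  have hwo : ∀ x ∈ M.darts, (x ∈ N.white ↔ x ∈ M.white) := by
    grind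
  have hnew : ∀ x, (x = p ∨ x = q ∨ x = p' ∨ x = q') ↔ x ∈ N.active ∧ x ∉ M.darts := by
    grind [h.active_darts]
  have hold : ∀ x ∈ M.darts, (x ∈ N.active ↔ x ∈ M.active ∧ x ≠ M.top ∧ x ≠ M.rev M.top) := by
    grind
  have hvert : ∀ x, M.InV x → N.vertexOf x = M.vertexOf x := by
    intro x hx
    ext y
    rw [hvo hx.1]
    grind [hx.not_mem]
  have hedge : ∀ d ∈ N.edgeOf (M.rev M.top), ¬ N.WhiteEdge d ∧ ¬ N.BlackEdge d := by
    intro d hd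
    have hrd := hC.rev_mem _ hdD
    have hNr : N.rev (M.rev M.top) = M.top := by rw [v10 _ hrd, hC.rev_rev]
    have hNr' : N.rev M.top = M.rev M.top := v10 _ hdD
    have h1 := (hwo _ hdD).not.2 hbw.1
    have h2 := (hwo _ hrd).2 hbw.2
    rw [hNC.edgeOf_eq, hNr] at hd
    rcases hd with rfl | rfl
    · exact ⟨fun h' => h1 (hNr ▸ h'.2), fun h' => h'.1 h2⟩
    · exact ⟨fun h' => h1 h'.1, fun h' => h'.2 (by rw [hNr']; exact h2)⟩
  refine ⟨⟨fun x hx _ => v10 x hx, fun x => ?_, fun x hx hxa => ?_, fun x hx hxa => ?_,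
    fun x hx hxi => ?_, fun x => ?_, hvert, fun x => ?_, fun x hx => hwo x hx.1, fun x hx hx' => ?_,
    fun x hx => absurd hx (Set.notMem_empty x)⟩, hedge⟩
  · grind [hC.rev_mem, hC.rev_rev]
  · grind
  · grind [hC.rootFace_sub, hC.rev_mem]
  · ext y; exact hfo hx hxi
  · rw [hmem, hrf, hfd]
    grind [hC.rootFace_sub, a3.symm, a5.symm, a2.symm, a4.symm]
  · simp only [Set.mem_empty_iff_false, or_false]
    constructor
    · intro hx
      have hxN := hx.not_mem (self_mem_vertexOf x)
      have hxD : x ∈ M.darts := by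
        rcases hmem.1 hx.1 with h1 | h1
        · exact h1
        · grind
      refine ⟨hxD, Set.disjoint_left.2 fun y hy hya => ?_⟩
      grind [hx.not_mem, h.active_darts]
    · intro hx
      refine ⟨hmem.2 (.inl hx.1), ?_⟩
      rw [hvert x hx, Set.disjoint_left]
      intro y hy hya
      exact hx.not_mem hy ((hold y ((hC.vertexOf_sub hy).2 hx.1)).1 hya).1
  · grind

end

section

variable {j : ℕ} (h : Inv la (j :: lb) M T U κ K)
include h

/-- Recoloring the top-right vertex does not affect inactive outer edges. -/
theorem recolor_colour {x : ℕ} (hx : x ∈ M.rootFace) (hxa : x ∉ M.active) :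
    (x ∈ (M.toPercMap.recolorWhite M.top).white ↔ x ∈ M.white) ∧
      (M.rev x ∈ (M.toPercMap.recolorWhite M.top).white ↔ M.rev x ∈ M.white) := by
  have hC := h.comb
  constructor
  · refine or_iff_left fun h1 => hxa ?_
    rw [← h.tri.outer_eq h.top_mem hx h1]
    exact h.top_active
  · refine or_iff_left fun h1 => hxa ?_
    rw [← hC.next_mem_vertexOf_iff] at h1
    have h2 := h.tri.outer_eq h.top_mem (next_mem_rootFace.2 hx) h1
    rw [M.next.injective (h.next_right.trans h2).symm]
    grind [h.active]

theorem cellStep_inactivate (hla : la = []) :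
    CellStep M M.stepC ∅ (M.stepC.vertexOf (M.rev M.top)) := by
  subst hla
  have hC := h.comb
  have hnl : ¬ M.HasActiveLeft := by rw [h.hasActiveLeft_iff]; simp
  have e : M.stepC = ⟨M.toPercMap.recolorWhite M.top, M.active \ {M.top, M.rev M.top}⟩ := by
    unfold stepC
    rw [if_neg (fun h => hnl h.1), recolored, if_pos (.inl hnl)]
    rfl
  rw [e]
  have hcol := fun {x : ℕ} => h.recolor_colour (x := x)
  have e1 : (M.toPercMap.recolorWhite M.top).rev = M.rev := rfl
  have e3 : (M.toPercMap.recolorWhite M.top).vertexOf = M.vertexOf := rfl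
  have e4 : (M.toPercMap.recolorWhite M.top).rootFace = M.rootFace := rfl
  have e5 : (M.toPercMap.recolorWhite M.top).darts = M.darts := rfl
  have e6 : (M.toPercMap.recolorWhite M.top).faceOf = M.faceOf := rfl
  have hw : ∀ x, x ∈ (M.toPercMap.recolorWhite M.top).white ↔ x ∈ M.white ∨ x ∈ M.vertexOf M.top :=
    fun _ => Iff.rfl
  generalize M.toPercMap.recolorWhite M.top = R at *
  have hta := h.top_active
  have hrta := h.rev_top_active
  have hUa : U j ∈ M.active := by grind [h.active]
  have hUb := h.black j (by simp)
  have hUv : U j ∈ M.vertexOf M.top := by rw [← h.top_vertex]; exact self_mem_vertexOf _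
  have hbw := h.top_bw
  have hUt : U j ≠ M.top := fun e => hUb.2 (e ▸ hbw.2)
  have hUt' : U j ≠ M.rev M.top := fun e => hUb.1 (e ▸ hbw.2)
  have hIn : ∀ x, InV ⟨R, M.active \ {M.top, M.rev M.top}⟩ x ↔ x ∈ M.darts ∧
      ∀ y ∈ M.vertexOf x, y ∈ M.active → y = M.top ∨ y = M.rev M.top := by
    intro x
    unfold InV
    simp only [e5, e3, Set.disjoint_left, Set.mem_sdiff, not_and, not_not, Set.mem_insert_iff,
      Set.mem_singleton_iff]
  refine ⟨fun x _ _ => by simp only [e1], fun x => ?_, fun x _ _ => by simp only [e4],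
    fun x hx hxa => hcol hx hxa, fun x _ _ => by simp only [e6], fun x => by simp only [e4, e5]; simp,
    fun x _ => by simp only [e3], fun x => ?_, fun x hx => ?_, fun x hx => absurd hx (Set.notMem_empty x),
    fun x hx hx' => ?_⟩
  · grind [hC.rev_rev, hC.rev_mem, h.top_darts]
  · rw [hIn]
    simp only [e3]
    constructor
    · rintro ⟨h1, h2⟩
      by_cases h3 : M.InV x
      · exact .inl h3
      right
      have h4 : ∃ y ∈ M.vertexOf x, y ∈ M.active := by
        by_contra hc
        push Not at hc
        exact h3 ⟨h1, Set.disjoint_left.2 hc⟩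
      obtain ⟨y, hy, hya⟩ := h4
      rcases h2 y hy hya with rfl | rfl
      · have : U j ∈ M.vertexOf x :=
          mem_vertexOf.2 ((mem_vertexOf.1 hy).trans (mem_vertexOf.1 hUv))
        grind
      · exact mem_vertexOf_comm.1 hy
    · rintro (h1 | h1)
      · exact ⟨h1.1, fun y hy hya => absurd hya (h1.not_mem hy)⟩
      · refine ⟨(hC.vertexOf_sub h1).2 (hC.rev_mem _ h.top_darts), fun y hy hya => ?_⟩
        have hyw : y ∈ M.white := (h.tri.white_vertexOf (mem_vertexOf.2
          ((mem_vertexOf.1 h1).trans (mem_vertexOf.1 hy)))).2 hbw.2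
        rcases (h.active y).1 hya with h2 | ⟨k, hk, h2⟩
        · exact h2
        · have hb := h.black k (by simpa using hk)
          rcases h2 with rfl | rfl
          · exact absurd hyw hb.1
          · exact absurd hyw hb.2
  · simp only [hw]
    exact or_iff_left fun h1 => hx.not_mem (mem_vertexOf_comm.1 h1) hta
  · simp only [e3] at hx
    exact hx'.not_mem (mem_vertexOf_comm.1 hx) hrta

end

section

variable {i j : ℕ} (h : Inv (i :: la) (j :: lb) M T U κ K)
include h

set_option maxHeartbeats 1000000 in
/-- The cells created by the step `c` when the top-edge is glued to a left edge. The last statement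
says that the new in-vertex is inner. -/
theorem cellStep_zip (hij : i < j) : CellStep M M.stepC ∅ (M.stepC.vertexOf (M.rev M.top)) ∧
    M.stepC.rev (M.rev M.top) = M.rev (U i) ∧
    (∀ x ∈ M.stepC.rootFace, x ∈ M.rootFace) ∧ M.rev M.top ∈ M.stepC.white ∧
    ∀ x ∈ M.stepC.vertexOf (M.rev M.top), x ∉ M.stepC.rootFace := by
  have hC := h.comb
  have htb := h.isTBar
  rw [h.stepC_eq hij]
  have hz := h.recolorWhite_zippable
  have hdf := h.top_mem
  have hdD := h.top_darts
  have hbw := h.top_bw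
  have hUf := h.left_mem (i := i) (by simp)
  have htv := h.top_vertex
  have hnt := h.next_top
  have hrb := h.black j (by simp)
  have hUw := h.white i (by simp)
  have hta := h.top_active
  have hrta := h.rev_top_active
  have hUia : U i ∈ M.active := by grind [h.active]
  have hrUia : M.rev (U i) ∈ M.active := by grind [h.active]
  have hUja : U j ∈ M.active := by grind [h.active]
  have htri := h.tri
  have hcol := fun {x : ℕ} => h.recolor_colour (x := x)
  have hact : ∀ y ∈ M.vertexOf (M.rev M.top), y ∈ M.active → y = U i ∨ y = M.rev M.top := by
    intro y hy hya
    have hv : M.vertexOf (M.rev M.top) = M.vertexOf (U i) := by rw [← hnt, hC.vertexOf_next]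
    rw [hv] at hy
    rcases htb.active_outer y hya with h1 | h1
    · exact .inl (htri.outer_eq hUf h1 hy).symm
    · right
      have h2 : M.next (M.rev y) ∈ M.vertexOf (U i) := by
        rw [hC.next_mem_vertexOf_iff, hC.rev_rev]; exact hy
      have h3 := htri.outer_eq hUf (next_mem_rootFace.2 h1) h2
      rw [← hnt] at h3
      rw [M.next.injective h3, hC.rev_rev]
  have hv : M.next (U i) ∉ M.vertexOf M.top := fun h' =>
    hz.next_y (htri.outer_eq hdf (next_mem_rootFace.2 hUf) h').symm
  have e1 : (M.toPercMap.recolorWhite M.top).rev = M.rev := rfl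
  have e2 : (M.toPercMap.recolorWhite M.top).next = M.next := rfl
  have e3 : (M.toPercMap.recolorWhite M.top).vertexOf = M.vertexOf := rfl
  have e4 : (M.toPercMap.recolorWhite M.top).rootFace = M.rootFace := rfl
  have e5 : (M.toPercMap.recolorWhite M.top).darts = M.darts := rfl
  have e6 : (M.toPercMap.recolorWhite M.top).faceOf = M.faceOf := rfl
  have hCR : (M.toPercMap.recolorWhite M.top).Comb :=
    (recolorWhite_isTriangulation htri hdD).comb
  have hw : ∀ x, x ∈ (M.toPercMap.recolorWhite M.top).white ↔ x ∈ M.white ∨ x ∈ M.vertexOf M.top :=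
    fun _ => Iff.rfl
  generalize M.toPercMap.recolorWhite M.top = R at *
  have hzC := zipAt_comb (W := R.white \ {M.top, U i}) hCR hz
  obtain ⟨v1, v2, v3, v4, v5, v6, v7, v8, v9⟩ :=
    zipAt_values (W := R.white \ {M.top, U i}) hCR hz
  have hvo := fun {a z : ℕ} => zipAt_mem_vertexOf hCR (W := R.white \ {M.top, U i}) hz
    (by rw [e2, e3]; exact hv) (a := a) (z := z)
  have hrf := fun {z : ℕ} => zipAt_mem_rootFace hCR (W := R.white \ {M.top, U i}) hz (z := z)
  have hfi := fun {a : ℕ} => zipAt_faceOf_inner hCR (W := R.white \ {M.top, U i}) hz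
    (by rw [e4]; exact hdf) (a := a)
  have hmem := fun {z : ℕ} => zipAt_mem (M := R) (x := M.top) (y := U i)
    (W := R.white \ {M.top, U i}) (z := z)
  have hwN : (R.zipAt M.top (U i) (R.white \ {M.top, U i})).white = R.white \ {M.top, U i} := rfl
  generalize R.zipAt M.top (U i) (R.white \ {M.top, U i}) = N at *
  rw [e1] at v3 v4 v5
  rw [e2] at hvo
  simp only [e3] at hvo
  rw [e4] at hrf
  rw [e5] at hmem
  simp only [e5, e4, e6] at hfi
  have hwo : ∀ u, u ≠ M.top → u ≠ U i → (u ∈ N.white ↔ u ∈ R.white) := by grind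
  have hrdD := hC.rev_mem _ hdD
  have n1 : M.rev M.top ≠ M.top := hC.rev_ne _ hdD
  have n2 : M.rev M.top ≠ U i := by rw [← e1]; exact hz.rev_ne
  have n3 : M.rev (U i) ≠ M.top := by grind
  have n4 : M.rev (U i) ≠ U i := by grind
  have hUv : U j ∈ M.vertexOf M.top := by rw [← htv]; exact self_mem_vertexOf _
  have hUjne : U j ≠ M.top ∧ U j ≠ M.rev M.top ∧ U j ≠ U i ∧ U j ≠ M.rev (U i) :=
    ⟨fun e => hrb.2 (e ▸ hbw.2), fun e => hrb.1 (e ▸ hbw.2), fun e => hrb.1 (e ▸ hUw.1),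
      fun e => hrb.1 (e ▸ hUw.2)⟩
  have hrYv : M.rev (U i) ∈ M.vertexOf (M.next (U i)) := by
    rw [hC.vertexOf_next]; exact self_mem_vertexOf _
  -- the darts of the new in-vertex
  have hnd : ¬ (M.rev M.top ∈ M.vertexOf M.top ∨ M.rev M.top ∈ M.vertexOf (M.next (U i))) := by
    rw [not_or]
    refine ⟨htri.rev_not_vertexOf hdD, fun h1 => ?_⟩
    rw [← hC.next_mem_vertexOf_iff, hnt] at h1
    have := htri.outer_eq (next_mem_rootFace.2 hUf) hUf h1
    exact htri.next_ne (hC.rootFace_sub hUf) this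
  have hV : ∀ x, x ∈ N.vertexOf (M.rev M.top) ↔ x ∈ M.vertexOf (M.rev M.top) ∧ x ≠ M.top ∧ x ≠ U i := by
    grind [hzC.vertexOf_sub]
  have hIn : ∀ x, InV ⟨N, M.active \ {M.top, M.rev M.top, U i, M.rev (U i)}⟩ x ↔
      x ∈ N.darts ∧ ∀ y ∈ N.vertexOf x, y ∈ M.active →
        y = M.top ∨ y = M.rev M.top ∨ y = U i ∨ y = M.rev (U i) := by
    intro x
    unfold InV
    grind
  have hine : ∀ x, x ∉ M.active → x ≠ M.top ∧ x ≠ M.rev M.top ∧ x ≠ U i ∧ x ≠ M.rev (U i) := by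
      grind
  have hvert : ∀ x, M.InV x → N.vertexOf x = M.vertexOf x := by
    intro x hx
    obtain ⟨k1, -, k2, -⟩ := hine x (hx.not_mem (self_mem_vertexOf x))
    ext y
    by_cases hy : y = M.top ∨ y = U i
    · refine iff_of_false (fun h1 => ?_) fun h1 => ?_
      · have := hmem.1 ((hzC.vertexOf_sub h1).2 (hmem.2 ⟨hx.1, k1, k2⟩))
        exact hy.elim this.2.1 this.2.2
      · grind [hx.not_mem]
    · rw [not_or] at hy
      rw [hvo k1 k2 hy.1 hy.2]
      refine or_iff_left ?_
      rintro ⟨h1 | h1, -⟩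
      · exact hx.not_mem (mem_vertexOf_comm.1 h1) hta
      · exact hx.not_mem (mem_vertexOf.2 ((mem_vertexOf.1 h1).symm.trans (mem_vertexOf.1 hrYv)))
          hrUia
  refine ⟨⟨fun x hx hxa => ?_, fun x => ?_, fun x hx hxa => ?_, fun x hx hxa => ?_,
    fun x hx hxi => ?_, fun x => ?_, hvert, fun x => ?_, fun x hx => ?_,
    fun x hx => absurd hx (Set.notMem_empty x), fun x hx hx' => ?_⟩, v3, ?_, ?_, ?_⟩
  · grind
  · grind [hC.rev_mem, hC.rootFace_sub]
  · grind
  · grind [hC.rev_rev]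
  · exact hfi hx hxi
  · grind
  · rw [hIn]
    constructor
    · rintro ⟨h1, h2⟩
      rw [hmem] at h1
      by_cases h3 : M.InV x
      · exact .inl h3
      right
      have h4 : ∃ y ∈ M.vertexOf x, y ∈ M.active := by
        by_contra hc
        push Not at hc
        exact h3 ⟨h1.1, Set.disjoint_left.2 hc⟩
      obtain ⟨y, hy, hya⟩ := h4
      have hbad : ¬ (x ∈ M.vertexOf M.top ∨ x ∈ M.vertexOf (M.next (U i))) := by grind
      rw [not_or] at hbad
      have hy4 : y = M.rev M.top ∨ y = U i := by
        by_cases k1 : y = M.top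
        · exact absurd (mem_vertexOf_comm.1 (k1 ▸ hy)) hbad.1
        by_cases k2 : y = U i
        · exact .inr k2
        rcases h2 y ((hvo h1.2.1 h1.2.2 k1 k2).2 (.inl hy)) hya with h6 | h6 | h6 | h6
        · exact absurd h6 k1
        · exact .inl h6
        · exact absurd h6 k2
        · refine absurd ?_ hbad.2
          rw [h6] at hy
          exact mem_vertexOf.2 ((mem_vertexOf.1 hrYv).trans (mem_vertexOf.1 hy).symm)
      refine (hV x).2 ⟨?_, h1.2⟩
      rcases hy4 with rfl | rfl
      · exact mem_vertexOf_comm.1 hy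
      · rw [← hC.vertexOf_next, hnt]
        exact mem_vertexOf_comm.1 hy
    · rintro (h1 | h1)
      · obtain ⟨k1, -, k2, -⟩ := hine x (h1.not_mem (self_mem_vertexOf x))
        refine ⟨hmem.2 ⟨h1.1, k1, k2⟩, fun y hy hya => absurd hya ?_⟩
        grind [h1.not_mem]
      · refine ⟨(hzC.vertexOf_sub h1).2 (hmem.2 ⟨hrdD, n1, n2⟩), fun y hy hya => ?_⟩
        have h2 : y ∈ N.vertexOf (M.rev M.top) :=
          mem_vertexOf.2 ((mem_vertexOf.1 h1).trans (mem_vertexOf.1 hy))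
        grind
  · grind [hx.not_mem, self_mem_vertexOf]
  · exact hx'.not_mem (mem_vertexOf_comm.1 ((hV x).1 hx).1) hrta
  · grind
  · simp only [hwo _ n1 n2, hw]
    exact .inl hbw.2
  · grind [hC.vertexOf_next, htri.outer_eq]

end

end Inv

/-! ### The construction along a walk -/

/-- The cells created by a step `c` from `M` to `N`, where `y` is a dart whose origin is the new
in-vertex. The new in-edge is a left (right) outer edge if and only if `pl` (`pr`), and the new
in-vertex is white if and only if `pw`. -/
structure CellC (M N : MarkedMap) (y : ℕ) (pl pr pw : Prop) : Prop where
  cell : CellStep M N ∅ (N.vertexOf y)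
  left : (∃ d ∈ N.edgeOf (M.rev M.top), d ∈ N.rootFace ∧ N.WhiteEdge d) ↔ pl
  right : (∃ d ∈ N.edgeOf (M.rev M.top), d ∈ N.rootFace ∧ N.BlackEdge d) ↔ pr
  white : y ∈ N.white ↔ pw
  outer : (∃ d ∈ N.vertexOf y, d ∈ N.rootFace) ↔ pl ∨ pr

theorem CellStep.of_mirror' {M P : MarkedMap} {F V : Set ℕ} (hM : M.IsTBar) (hP : P.IsTBar)
    (h : CellStep M.mirror P F V) : CellStep M P.mirror F {x | P.rev x ∈ V} :=
  .of_mirror hM.triangulation.comb (mirror_comb hP.triangulation.comb) hM.active_rev hP.active_rev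
    (by rwa [mirror_mirror hP.triangulation.toIsPlanarMap])

theorem CellC.of_mirror {M P : MarkedMap} {y : ℕ} {pl pr pw : Prop} (hM : M.IsTBar) (hP : P.IsTBar)
    (h : CellC M.mirror P y pl pr pw) : CellC M P.mirror (P.rev y) pr pl (¬ pw) := by
  have hC := hM.triangulation.comb
  have hCP := hP.triangulation.comb
  have hv : ∀ x, x ∈ P.mirror.vertexOf (P.rev y) ↔ P.rev x ∈ P.vertexOf y := fun x => by
    rw [mirror_toPercMap, mem_mirror_vertexOf hCP, hCP.rev_rev]
  have hy : y ∈ P.darts := ((h.cell.inV y).2 (.inr (self_mem_vertexOf y))).1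
  have he : P.mirror.edgeOf (M.rev M.top) = P.edgeOf (M.mirror.rev M.mirror.top) := by
    rw [mirror_top hC]; rfl
  refine ⟨?_, ?_, ?_, ?_, ?_⟩
  · convert h.cell.of_mirror' hM hP using 1
    ext x; exact hv x
  · grind [h.right, mirror_toPercMap, mirror_rootFace, mirror_whiteEdge, hCP.rootFace_sub]
  · grind [h.left, mirror_toPercMap, mirror_rootFace, mirror_blackEdge, hCP.rootFace_sub]
  · grind [mirror_toPercMap, mem_mirror_white, hCP.rev_rev, h.white, hCP.rev_mem_iff]
  · rw [or_comm, ← h.outer]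
    simp only [hv]
    rw [mirror_toPercMap, mirror_rootFace]
    constructor
    · rintro ⟨d, h1, h2⟩
      exact ⟨P.next d, (hCP.next_mem_vertexOf_iff).2 h1, next_mem_rootFace.2 h2⟩
    · rintro ⟨d, h1, h2⟩
      refine ⟨P.next.symm d, ?_, symm_mem_rootFace.2 h2⟩
      rwa [← hCP.next_mem_vertexOf_iff, Equiv.apply_symm_apply]

namespace Inv

/-- The step `c`, when it recolors the top-right vertex. The last statement locates the other end of
the new in-edge. -/
theorem stepC_right (h : Inv la lb M T U κ K) (hb : lb ≠ [])
    (hab : la = [] ∨ ∃ i j, la.head? = some i ∧ lb.head? = some j ∧ i < j) :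
    (∃ K', Inv la.tail lb.tail M.stepC T U κ K') ∧
      CellC M M.stepC (M.rev M.top) (la = []) (lb = []) True ∧
      M.stepC.vertexOf (M.stepC.rev (M.rev M.leftDart)) = M.stepC.vertexOf (M.rev M.top) := by
  obtain ⟨j, lb, rfl⟩ := List.exists_cons_of_ne_nil hb
  have hC := h.comb
  rcases la with _ | ⟨i, la⟩
  · have hN := h.inactivate rfl
    have hc := h.cellStep_inactivate rfl
    have hns : ¬ (M.HasActiveLeft ∧ M.HasActiveRight) := by grind [h.hasActiveLeft_iff]
    have hrr : M.RecolorsRight := (h.recolorsRight_iff (.inr (by simp))).2 hab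
    have hs : M.stepC = ⟨M.toPercMap.recolorWhite M.top, M.active \ {M.top, M.rev M.top}⟩ := by
      unfold stepC
      rw [if_neg hns]
      unfold recolored
      rw [if_pos hrr]
      rfl
    have h1 : M.stepC.rev = M.rev := by rw [hs]; rfl
    have h2 : M.stepC.rootFace = M.rootFace := by rw [hs]; rfl
    have h3 : M.stepC.vertexOf = M.vertexOf := by rw [hs]; rfl
    have h4 : M.top ∈ M.stepC.white := by rw [hs]; exact .inr (self_mem_vertexOf _)
    have h5 : M.rev M.top ∈ M.stepC.white := by rw [hs]; exact .inl h.top_bw.2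
    have h6 : M.stepC.edgeOf (M.rev M.top) = {M.rev M.top, M.top} := by
      rw [hN.comb.edgeOf_eq, h1, hC.rev_rev]
    refine ⟨⟨_, hN⟩, ⟨hc, ?_, ?_, by simp [h5], ?_⟩, ?_⟩
    · simp only [iff_true, h6]
      exact ⟨_, .inr rfl, by rw [h2]; exact h.top_mem, h4, by rw [h1]; exact h5⟩
    · simp only [reduceCtorEq, iff_false, h6]
      rintro ⟨d, rfl | rfl, -, hd1, hd2⟩
      exacts [hd1 h5, hd1 h4]
    · simp only [true_or, iff_true, h3, h2]
      exact ⟨M.next M.top, hC.next_mem_vertexOf_rev _, next_mem_rootFace.2 h.top_mem⟩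
    · rw [h1, hC.rev_rev, h3, leftDart, hC.vertexOf_next]
  · have hij : i < j := by simpa using hab
    obtain ⟨hc, h1, h2, h3, h4⟩ := h.cellStep_zip hij
    have hN := h.zip hij
    have h5 : M.stepC.rev (M.rev (U i)) = M.rev M.top := by rw [← h1, hN.comb.rev_rev]
    have h6 : ∀ d ∈ M.stepC.edgeOf (M.rev M.top), d ∉ M.stepC.rootFace := by grind
        [hN.comb.edgeOf_eq, self_mem_vertexOf, h.rev_left_inner]
    refine ⟨⟨_, hN⟩, ⟨hc, ?_, ?_, by simp [h3], ?_⟩, ?_⟩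
    · grind
    · grind
    · grind
    · rw [leftDart, h.next_top, h5]

/-- The step `c`, when it recolors the top-left vertex. -/
theorem stepC_left (h : Inv la lb M T U κ K) (ha : la ≠ [])
    (hab : lb = [] ∨ ∃ i j, la.head? = some i ∧ lb.head? = some j ∧ j < i) :
    (∃ U' K', Inv la.tail lb.tail M.stepC T U' κ K') ∧
      ∃ y, CellC M M.stepC y (la = []) (lb = []) False ∧
      M.stepC.vertexOf y = M.stepC.vertexOf (M.rev M.rightDart) := by
  have hC := h.comb
  obtain ⟨⟨K', hP⟩, hc, hy⟩ := h.mirror.stepC_right ha (by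
    grind)
  have hs : M.stepC = M.mirror.stepC.mirror := by
    have := (h.mirror.stepCReady (.inr ha)).mirror_stepC
    rwa [mirror_mirror h.tri.toIsPlanarMap] at this
  rw [mirror_leftDart hC, mirror_top hC] at hy
  rw [mirror_top hC] at hc
  have hCP := hP.comb
  rw [hs]
  generalize M.mirror.stepC = P at *
  refine ⟨⟨_, _, hP.mirror⟩, _, by simpa using hc.of_mirror h.isTBar hP.isTBar, ?_⟩
  change P.vertexOf (P.rev (M.rev M.rightDart)) = P.vertexOf (M.rev M.top) at hy
  change P.toPercMap.mirror.vertexOf (P.rev (M.rev M.top)) =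
    P.toPercMap.mirror.vertexOf (M.rev M.rightDart)
  rw [mirror_vertexOf hCP, mirror_vertexOf hCP, hCP.rev_rev, hy]

/-- Gluing a triangle to the top-edge at a step of index `n`. -/
theorem step_glue (h : Inv la lb M T U κ K) (u : Bool) {n : ℕ}
    (hn : ∀ i, (i ∈ la ∨ i ∈ lb) → i < n) (hT : T n = M.top) :
    ∃ U' κ' K', Inv (if u then n :: la else la) (if u then lb else n :: lb) (M.glueTriangle u)
      T U' κ' K' := by
  have hF := fresh4_fresh (M := M)
  have hne : ∀ i, (i ∈ la ∨ i ∈ lb) → i ≠ n := fun i hi => (hn i hi).ne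
  have key : ∀ q, Inv la lb M T (Function.update U n q) (Function.update κ n K) K := fun q =>
    h.congr (fun _ _ => rfl) (fun i hi => Function.update_of_ne (hne i hi) _ _)
      fun i hi => Function.update_of_ne (hne i hi) _ _
  rw [glueTriangle_eq]
  cases u
  · have hm := mirror_glueTriAt (M := M.mirror) (mirror_isTriangulation h.tri)
      (mirror_rootInterface h.comb h.ri) hF.swap true
    rw [mirror_mirror h.tri.toIsPlanarMap] at hm
    refine ⟨_, _, _, hm ▸ Inv.mirror (Inv.glue (M := M.mirror) (la := lb) (lb := la) (n := n)
      (U := Function.update (fun i => M.rev (U i)) n M.fresh) (κ := Function.update κ n K) (K := K)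
      ?_ hF.swap (fun i hi => hn i hi.symm) (by rw [hT, mirror_top h.comb]) (by simp) (by simp))⟩
    exact h.mirror.congr (fun _ _ => rfl)
      (fun i hi => Function.update_of_ne (hne i hi.symm) _ _)
      fun i hi => Function.update_of_ne (hne i hi.symm) _ _
  · exact ⟨_, _, _, (key (M.fresh + 1)).glue hF hn hT (by simp) (by simp)⟩

theorem not_recolorsRight_iff (h : Inv la lb M T U κ K) (hne : la ≠ [] ∨ lb ≠ []) :
    ¬ M.RecolorsRight ↔
      lb = [] ∨ ∃ i j, la.head? = some i ∧ lb.head? = some j ∧ j < i := by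
  rw [h.recolorsRight_iff hne]
  have hd := h.disj
  rcases la with _ | ⟨i, la⟩ <;> rcases lb with _ | ⟨j, lb⟩ <;> simp at *
  omega

/-- The step `c`. -/
theorem stepC_cell (h : Inv la lb M T U κ K) (hne : la ≠ [] ∨ lb ≠ []) :
    (∃ U' K', Inv la.tail lb.tail M.stepC T U' κ K') ∧
      ∃ y, CellC M M.stepC y (la = []) (lb = []) M.RecolorsRight ∧
        (M.RecolorsRight → y = M.rev M.top) ∧
        (¬ M.RecolorsRight → M.stepC.vertexOf y = M.stepC.vertexOf (M.rev M.rightDart)) := by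
  have hr := h.recolorsRight_iff hne
  by_cases hc : M.RecolorsRight
  · rw [hr] at hc
    have hb : lb ≠ [] := by
      grind
    obtain ⟨⟨K', h1⟩, h2, -⟩ := h.stepC_right hb hc
    grind
  · have ha : la ≠ [] := by grind
    obtain ⟨h1, y, h2, h3⟩ := h.stepC_left ha ((h.not_recolorsRight_iff hne).1 hc)
    grind

end Inv

theorem Phi_append (w : Word) (s : Step) : Phi (w ++ [s]) = (Phi w).step s := by simp [Phi]

theorem before_append {w : Word} {s : Step} {i : ℕ} (hi : i ≤ w.length) :
    before (w ++ [s]) i = before w i := by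
  unfold before
  rw [List.take_append_of_le_length hi]

theorem before_length (w : Word) (s : Step) : before (w ++ [s]) w.length = Phi w := by
  unfold before
  rw [List.take_left']
  rfl

theorem mem_KBar_of_append {w : Word} {s : Step} (hw : w ++ [s] ∈ KBar) : w ∈ KBar := by
  cases s
  exacts [(mem_KBar_append (by decide)).1 hw, (mem_KBar_append (by decide)).1 hw,
    (mem_KBar_append_c.1 hw).1]

theorem isTriangulation_init : init.IsTriangulation := by
  have hs : ∀ d ∈ init.darts, ∀ x, (Equiv.swap 0 1 : Perm ℕ).SameCycle d x ↔ x = 0 ∨ x = 1 := by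
    intro d hd x
    have h0 : (Equiv.swap 0 1 : Perm ℕ).SameCycle 0 1 := ⟨1, by simp⟩
    have hd' : d = 0 ∨ d = 1 := by simpa [init] using hd
    constructor
    · intro h
      refine (mem_iff_of_sameCycle (S := {y | y = 0 ∨ y = 1}) (fun y => ?_) h).1 hd'
      grind
    · rcases hd' with rfl | rfl <;> rintro (rfl | rfl)
      exacts [.refl _ _, h0, h0.symm, .refl _ _]
  have hrot : init.rot = 1 := by ext x; simp [rot, init]
  have hv : ∀ d, init.vertexOf d = {d} := by
    intro d; ext x
    change init.rot.SameCycle d x ↔ _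
    rw [hrot, Perm.sameCycle_one, Set.mem_singleton_iff, eq_comm]
  have he : ∀ d ∈ init.darts, init.edgeOf d = {0, 1} := fun d hd => by ext x; exact hs d hd x
  have hf : ∀ d ∈ init.darts, init.faceOf d = {0, 1} := fun d hd => by ext x; exact hs d hd x
  have hroot : init.rootFace = {0, 1} := hf 0 (by simp [init])
  have hD : (init.darts : Set ℕ) = {0, 1} := by simp [init]
  have hc : ∀ {A : Set (Set ℕ)} {g : ℕ → Set ℕ}, (∀ d ∈ init.darts, g d = {0, 1}) →
      A = g '' (init.darts : Set ℕ) → A.ncard = 1 := by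
    rintro A g h rfl
    rw [Set.ncard_eq_one]
    refine ⟨{0, 1}, ?_⟩
    rw [hD, Set.image_pair, h 0 (by simp [init]), h 1 (by simp [init]), Set.pair_eq_singleton]
  refine ⟨⟨?_, ?_, ?_, ?_, ?_, ?_, by simp [init], ?_, ?_, by simp [init], ?_⟩, ?_, ?_, ?_⟩
  · simp [init]
  · simp [init]
  · simp [init]
  · intro d hd
    simp only [init, Finset.mem_insert, Finset.mem_singleton, not_or] at hd
    exact Equiv.swap_apply_of_ne_of_ne hd.1 hd.2
  · simp [init]
  · intro d hd
    simp only [init, Finset.mem_insert, Finset.mem_singleton, not_or] at hd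
    exact Equiv.swap_apply_of_ne_of_ne hd.1 hd.2
  · intro d hd
    simp only [init, Finset.mem_insert, Finset.mem_singleton] at hd
    rcases hd with rfl | rfl
    · exact ⟨1, one_mem _, rfl⟩
    · exact ⟨init.rev, Subgroup.subset_closure (by simp), by simp [init]⟩
  · rw [show init.faces.ncard = 1 from hc hf rfl, show init.edges.ncard = 1 from hc he rfl]
    have : init.vertices = {{0}, {1}} := by
      unfold vertices
      rw [hD, Set.image_pair, hv, hv]
    rw [this, Set.ncard_pair (by simp)]
  · intro d _
    rw [hrot]; rfl
  · grind
  · intro d hd h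
    rw [hv] at h
    simp only [init, Finset.mem_insert, Finset.mem_singleton] at hd
    rcases hd with rfl | rfl <;> simp [init] at h
  · grind

theorem inv_init : ∃ U κ K, Inv [] [] init (fun _ => 0) U κ K := by
  have h1 : 1 ∈ init.rootFace := by
    simpa [init] using next_mem_rootFace.2 (root_mem_rootFace (M := init.toPercMap))
  have hri : init.RootInterface := by
    refine ⟨by simp [init], fun d hd h0 => ?_⟩
    have := isTriangulation_init.comb.rootFace_sub hd
    simp only [init, Finset.mem_insert, Finset.mem_singleton] at this
    rcases this with rfl | rfl
    · exact absurd rfl h0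
    · simp [init]
  have htop : init.top = 1 :=
    (eq_top isTriangulation_init hri h1 (by simp [BW, init])).symm
  obtain ⟨K, hK⟩ := exists_pathEnd isTriangulation_init hri
  refine ⟨fun _ => 0, fun _ => 0, K, isTriangulation_init, hri, ?_, ?_, ?_, ?_, ?_, ?_, ?_, hK, ?_,
    ?_, ?_, ?_, ?_, ?_, ?_⟩
  all_goals simp
  intro x
  rw [htop]
  simp [init]
  omega

/-- The map of a walk has the expected structure. -/
theorem exists_inv {w : Word} (hw : w ∈ KBar) : ∃ U κ K,
    Inv (stack w Step.a) (stack w Step.b) (Phi w) (fun i => (before w i).top) U κ K := by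
  induction w using List.reverseRecOn with
  | nil =>
    obtain ⟨U, κ, K, h⟩ := inv_init
    exact ⟨U, κ, K, h.congr (by simp) (by simp) (by simp)⟩
  | append_singleton w s ih =>
    have hlt : ∀ i, (i ∈ stack w Step.a ∨ i ∈ stack w Step.b) → i < w.length := fun i hi =>
      hi.elim (stackSpec w (by decide)).lt (stackSpec w (by decide)).lt
    obtain ⟨U, κ, K, h⟩ := ih (mem_KBar_of_append hw)
    replace h := h.congr (T' := fun i => (before (w ++ [s]) i).top)
      (fun i hi => by rw [before_append (hlt i hi).le]) (fun _ _ => rfl) fun _ _ => rfl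
    rw [Phi_append]
    cases s
    · rw [stack_append_self, stack_append_other w (by decide) (by decide)]
      exact h.step_glue true hlt (by rw [before_length])
    · rw [stack_append_self, stack_append_other w (by decide) (by decide)]
      exact h.step_glue false hlt (by rw [before_length])
    · rw [stack_append_c w (by decide), stack_append_c w (by decide)]
      have hne := (mem_KBar_append_c.1 hw).2
      obtain ⟨⟨U', K', h'⟩, -⟩ := h.stepC_cell hne
      exact ⟨_, _, _, h'⟩

/-! ### Steps and cells -/

/-- Extension of an enumeration of the classes `c x`, for `x` in a set of darts, when one more class
appears, or none. -/
theorem bijOn_cells {D D' : ℕ → Prop} {c c' : ℕ → Set ℕ} {S : Set ℕ} (hc : ∀ x, x ∈ c x)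
    (hD : ∀ x, D x → ∀ y ∈ c x, D y)
    (h1 : ∀ x, D' x ↔ D x ∨ x ∈ S) (h2 : ∀ x, D x → c' x = c x) (h3 : ∀ x ∈ S, ¬ D x)
    {e e' : ℕ → Set ℕ} {A B : Set ℕ} (he : Set.BijOn e A {s | ∃ x, D x ∧ s = c x})
    (he' : ∀ k ∈ A, ∃ z, e k = c z ∧ e' k = c' z)
    (hB : S = ∅ ∧ B = A ∨ ∃ n y, S = c' y ∧ y ∈ S ∧ (∀ x ∈ S, c' x = c' y) ∧ n ∉ A ∧
      B = insert n A ∧ e' n = c' y) :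
    Set.BijOn e' B {s | ∃ x, D' x ∧ s = c' x} ∧ ∀ k ∈ A, e' k = e k ∧ ∀ d ∈ e k, D d := by
  have hee : ∀ k ∈ A, e' k = e k := fun k hk => by
    obtain ⟨x, hx, hxe⟩ := he.mapsTo hk
    grind
  have he2 : Set.BijOn e' A {s | ∃ x, D x ∧ s = c x} := he.congr fun k hk => (hee k hk).symm
  refine ⟨?_, fun k hk => ⟨hee k hk, fun d hd => ?_⟩⟩
  swap
  · obtain ⟨x, hx, hxe⟩ := he.mapsTo hk
    exact hD x hx d (hxe ▸ hd)
  rcases hB with ⟨rfl, rfl⟩ | ⟨n, y, hS, hyS, hS', hn, rfl, hen⟩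
  · grind
  · have hset : {s | ∃ x, D' x ∧ s = c' x} = insert (e' n) {s | ∃ x, D x ∧ s = c x} := by
      ext s
      simp only [Set.mem_ofPred_eq, Set.mem_insert_iff, h1, hen]
      grind
    rw [hset]
    refine he2.insert ?_
    grind

/-- Extension of a characterization of the steps whose cell contains a dart with property `R`. -/
theorem cells_prop {e e' : ℕ → Set ℕ} {A : Set ℕ} {P P' : ℕ → Prop} {R R' : ℕ → Prop} {n k : ℕ}
    {p q : Prop} (hP : ∀ k ∈ A, P k ↔ ∃ d ∈ e k, R d) (hk : k ∈ A ∨ k = n ∧ q) (hn : n ∉ A)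
    (hee : ∀ k ∈ A, e' k = e k ∧ ∀ d ∈ e k, R' d ↔ R d) (hPA : P k → k ∈ A)
    (hP' : P' k ↔ P k ∨ k = n ∧ p) (hnew : q → ((∃ d ∈ e' n, R' d) ↔ p)) :
    P' k ↔ ∃ d ∈ e' k, R' d := by
  grind

theorem bijOn_sep {f : ℕ → Set ℕ} {A A' : Set ℕ} {B B' : Set (Set ℕ)} {P : ℕ → Prop} {Q : Set ℕ → Prop}
    (h : Set.BijOn f A B) (hPQ : ∀ k ∈ A, P k ↔ Q (f k)) (hA : ∀ k, k ∈ A' ↔ k ∈ A ∧ P k)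
    (hB : ∀ s, s ∈ B' ↔ s ∈ B ∧ Q s) : Set.BijOn f A' B' := by
  refine ⟨fun k hk => ?_, fun k hk l hl => h.injOn ((hA k).1 hk).1 ((hA l).1 hl).1, fun s hs => ?_⟩
  · obtain ⟨h1, h2⟩ := (hA k).1 hk
    exact (hB _).2 ⟨h.mapsTo h1, (hPQ k h1).1 h2⟩
  · obtain ⟨h1, h2⟩ := (hB s).1 hs
    obtain ⟨k, hk, rfl⟩ := h.surjOn h1
    grind

variable {M : MarkedMap}

theorem inEdges_eq (hM : M.IsTBar) : M.inEdges = {s | ∃ x, (x ∈ M.darts ∧ x ∉ M.active) ∧ s = M.edgeOf x} := by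
  have hC := hM.triangulation.comb
  ext e
  constructor
  · rintro ⟨⟨x, hx, rfl⟩, h⟩
    grind [self_mem_edgeOf]
  · rintro ⟨x, ⟨hx, hxa⟩, rfl⟩
    refine ⟨⟨x, hx, rfl⟩, Set.disjoint_left.2 fun y hy hya => ?_⟩
    rcases hC.mem_edgeOf.1 hy with rfl | rfl
    · exact hxa hya
    · have := hM.active_rev _ hya
      rw [hC.rev_rev] at this
      exact hxa this

theorem innerFaces_eq :
    M.innerFaces = {s | ∃ x, (x ∈ M.darts ∧ x ∉ M.rootFace) ∧ s = M.faceOf x} := by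
  ext e
  constructor
  · rintro ⟨⟨x, hx, rfl⟩, h⟩
    exact ⟨x, ⟨hx, fun h' => h (faceOf_eq_iff.2 h').symm⟩, rfl⟩
  · rintro ⟨x, ⟨hx, hxa⟩, rfl⟩
    exact ⟨⟨x, hx, rfl⟩, fun h' => hxa (h' ▸ self_mem_faceOf x)⟩

theorem inVertices_eq : M.inVertices = {s | ∃ x, M.InV x ∧ s = M.vertexOf x} := by
  ext e
  constructor
  · rintro ⟨⟨x, hx, rfl⟩, h⟩
    exact ⟨x, ⟨hx, h⟩, rfl⟩
  · rintro ⟨x, ⟨hx, hxa⟩, rfl⟩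
    exact ⟨⟨x, hx, rfl⟩, hxa⟩

/-- Indices of the `c`-steps. -/
def cSteps (w : Word) : Set ℕ := {k | w[k]? = some Step.c}

/-- The correspondences between steps and cells which were created for good: in-edges, inner
triangles and in-vertices. -/
structure Corr (w : Word) : Prop where
  edge : Set.BijOn (etaE w) (steps w) {s | ∃ x, (x ∈ (Phi w).darts ∧ x ∉ (Phi w).active) ∧
    s = (Phi w).edgeOf x}
  left : ∀ k ∈ steps w, k ∈ unmatchedC w Step.a ↔
    ∃ d ∈ etaE w k, d ∈ (Phi w).rootFace ∧ (Phi w).WhiteEdge d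
  right : ∀ k ∈ steps w, k ∈ unmatchedC w Step.b ↔
    ∃ d ∈ etaE w k, d ∈ (Phi w).rootFace ∧ (Phi w).BlackEdge d
  face : Set.BijOn (etaVF w) (abSteps w) {s | ∃ x, (x ∈ (Phi w).darts ∧ x ∉ (Phi w).rootFace) ∧
    s = (Phi w).faceOf x}
  vertex : Set.BijOn (etaVF w) (cSteps w) {s | ∃ x, (Phi w).InV x ∧ s = (Phi w).vertexOf x}
  white : ∀ k ∈ cSteps w, k ∈ matchedCa w ∪ unmatchedC w Step.a ↔
    ∃ d ∈ etaVF w k, d ∈ (Phi w).white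
  black : ∀ k ∈ cSteps w, k ∈ matchedCb w ∪ unmatchedC w Step.b ↔
    ∃ d ∈ etaVF w k, d ∉ (Phi w).white
  outer : ∀ k ∈ cSteps w, k ∈ unmatchedC w Step.a ∪ unmatchedC w Step.b ↔
    ∃ d ∈ etaVF w k, d ∈ (Phi w).rootFace

theorem etaE_append {w : Word} {s : Step} {k : ℕ} (hk : k ∈ steps w) :
    ∃ z, etaE w k = (Phi w).edgeOf z ∧ etaE (w ++ [s]) k = (Phi (w ++ [s])).edgeOf z := by
  refine ⟨_, rfl, ?_⟩
  unfold etaE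
  rw [before_append (le_of_lt hk)]

theorem etaVF_append {w : Word} {s : Step} {k : ℕ} (hk : k ∈ abSteps w) :
    ∃ z, etaVF w k = (Phi w).faceOf z ∧ etaVF (w ++ [s]) k = (Phi (w ++ [s])).faceOf z := by
  have hl : k < w.length := hk.elim lt_of_getElem? lt_of_getElem?
  have h1 : (w ++ [s])[k]? = w[k]? := by grind
  have h2 : w[k]? ≠ some Step.c := by rcases hk with h | h <;> rw [h] <;> decide
  refine ⟨(before w k).top, ?_, ?_⟩ <;> unfold etaVF
  · rw [if_neg h2]
  · rw [h1, if_neg h2, before_append hl.le]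

theorem etaVF_append_c {w : Word} {s : Step} {k : ℕ} (hk : k ∈ cSteps w) :
    ∃ z, etaVF w k = (Phi w).vertexOf z ∧ etaVF (w ++ [s]) k = (Phi (w ++ [s])).vertexOf z := by
  have hl : k < w.length := lt_of_getElem? hk
  have h1 : (w ++ [s])[k]? = w[k]? := List.getElem?_append_left hl
  have h2 : w[k]? = some Step.c := hk
  unfold etaVF
  rw [h1, if_pos h2, if_pos h2, before_append hl.le]
  split_ifs
  exacts [⟨_, rfl, rfl⟩, ⟨_, rfl, rfl⟩]

theorem cSteps_append {w : Word} {s : Step} (hs : s ≠ Step.c) : cSteps (w ++ [s]) = cSteps w := by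
  ext; simp [cSteps, getElem?_append_last, hs]

theorem cSteps_append_c {w : Word} : cSteps (w ++ [Step.c]) = insert w.length (cSteps w) := by
  ext; simp [cSteps, getElem?_append_last, or_comm]

theorem mem_unmatchedC_append {w : Word} {s x : Step} (hx : x ≠ Step.c) {k : ℕ} :
    k ∈ unmatchedC (w ++ [s]) x ↔
      k ∈ unmatchedC w x ∨ k = w.length ∧ s = Step.c ∧ stack w x = [] := by
  by_cases hs : s = Step.c
  · subst hs; rw [unmatchedC_append_c hx]; simp
  · rw [unmatchedC_append hs]; simp [hs]

theorem mem_typeA_append {w : Word} {s : Step} {k : ℕ} :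
    k ∈ matchedCa (w ++ [s]) ∪ unmatchedC (w ++ [s]) Step.a ↔
      k ∈ matchedCa w ∪ unmatchedC w Step.a ∨ k = w.length ∧ s = Step.c ∧ (stack w Step.a = [] ∨
        ∃ i j, (stack w Step.a).head? = some i ∧ (stack w Step.b).head? = some j ∧ i < j) := by
  rw [Set.mem_union, mem_unmatchedC_append (by decide)]
  by_cases hs : s = Step.c
  · grind [matchedCa_append_c]
  · rw [matchedCa_append hs]; simp [hs]

theorem mem_typeB_append {w : Word} {s : Step} {k : ℕ} :
    k ∈ matchedCb (w ++ [s]) ∪ unmatchedC (w ++ [s]) Step.b ↔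
      k ∈ matchedCb w ∪ unmatchedC w Step.b ∨ k = w.length ∧ s = Step.c ∧ (stack w Step.b = [] ∨
        ∃ i j, (stack w Step.a).head? = some i ∧ (stack w Step.b).head? = some j ∧ j < i) := by
  rw [Set.mem_union, mem_unmatchedC_append (by decide)]
  by_cases hs : s = Step.c
  · grind [matchedCb_append_c]
  · rw [matchedCb_append hs]; simp [hs]

theorem mem_cSteps_of {w : Word} {k : ℕ} (h : k ∈ matchedCa w ∨ k ∈ matchedCb w ∨
    k ∈ unmatchedC w Step.a ∨ k ∈ unmatchedC w Step.b) : k ∈ cSteps w := by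
  rcases h with ⟨i, j, h, -⟩ | ⟨i, j, h, -⟩ | h | h
  exacts [h.2.2.1, h.2.2.1, h.1, h.1]

/-- The effect of one more step on the correspondences, up to the properties of the new cells. -/
theorem Corr.append {w : Word} {s : Step} (hc : Corr w) {F V : Set ℕ}
    (hM : (Phi w).IsTBar) (hN : (Phi (w ++ [s])).IsTBar)
    (h : CellStep (Phi w) (Phi (w ++ [s])) F V)
    (hF : F = ∅ ∧ s = Step.c ∨ s ≠ Step.c ∧ F = (Phi (w ++ [s])).faceOf (Phi w).top)
    (hV : V = ∅ ∧ s ≠ Step.c ∨ s = Step.c ∧ V = etaVF (w ++ [s]) w.length ∧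
      ∃ y, V = (Phi (w ++ [s])).vertexOf y)
    (hl : (∃ d ∈ etaE (w ++ [s]) w.length, d ∈ (Phi (w ++ [s])).rootFace ∧
      (Phi (w ++ [s])).WhiteEdge d) ↔ s = Step.c ∧ stack w Step.a = [])
    (hr : (∃ d ∈ etaE (w ++ [s]) w.length, d ∈ (Phi (w ++ [s])).rootFace ∧
      (Phi (w ++ [s])).BlackEdge d) ↔ s = Step.c ∧ stack w Step.b = [])
    (hw : s = Step.c → ((∃ d ∈ V, d ∈ (Phi (w ++ [s])).white) ↔ stack w Step.a = [] ∨
      ∃ i j, (stack w Step.a).head? = some i ∧ (stack w Step.b).head? = some j ∧ i < j))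
    (hb : s = Step.c → ((∃ d ∈ V, d ∉ (Phi (w ++ [s])).white) ↔ stack w Step.b = [] ∨
      ∃ i j, (stack w Step.a).head? = some i ∧ (stack w Step.b).head? = some j ∧ j < i))
    (ho : s = Step.c → ((∃ d ∈ V, d ∈ (Phi (w ++ [s])).rootFace) ↔
      stack w Step.a = [] ∨ stack w Step.b = [])) :
    Corr (w ++ [s]) := by
  have hCM := hM.triangulation.comb
  have hCN := hN.triangulation.comb
  have hbl : before (w ++ [s]) w.length = Phi w := before_length w s
  have hst : w.length ∉ steps w := lt_irrefl w.length
  have hcs : w.length ∉ cSteps w := fun h' => lt_irrefl _ (lt_of_getElem? h')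
  obtain ⟨hE, hE2⟩ := bijOn_cells (S := (Phi (w ++ [s])).edgeOf ((Phi w).rev (Phi w).top))
    (c' := (Phi (w ++ [s])).edgeOf) (B := steps (w ++ [s]))
    (D' := fun x => x ∈ (Phi (w ++ [s])).darts ∧ x ∉ (Phi (w ++ [s])).active)
    self_mem_edgeOf (fun x hx y hy => by
      rcases hCM.mem_edgeOf.1 hy with rfl | rfl
      · exact hx
      · exact ⟨hCM.rev_mem x hx.1, fun h' => hx.2 (by
          have := hM.active_rev _ h'
          rwa [hCM.rev_rev] at this)⟩)
    (fun x => by rw [h.inactive, hCN.mem_edgeOf])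
    (fun x hx => by rw [hCN.edgeOf_eq, hCM.edgeOf_eq, h.rev_eq x hx.1 hx.2])
    (fun x hx hx' => by
      rcases hCN.mem_edgeOf.1 hx with rfl | rfl
      · exact hx'.2 (hM.active_rev _ hM.top_active)
      · have h1 := h.rev_eq _ hx'.1 hx'.2
        rw [hCN.rev_rev] at h1
        rw [← (Phi w).rev.injective h1] at hx'
        exact hx'.2 hM.top_active)
    hc.edge (fun k hk => etaE_append hk)
    (.inr ⟨w.length, _, rfl, self_mem_edgeOf _, fun x hx => (edgeOf_eq_iff.2 hx).symm, hst,
      steps_append, by unfold etaE; rw [hbl]⟩)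
  obtain ⟨hFa, -⟩ := bijOn_cells (S := F) (c' := (Phi (w ++ [s])).faceOf) (B := abSteps (w ++ [s]))
    (D' := fun x => x ∈ (Phi (w ++ [s])).darts ∧ x ∉ (Phi (w ++ [s])).rootFace)
    self_mem_faceOf (fun x hx y hy => ⟨(hCM.faceOf_sub hy).2 hx.1, fun h' => hx.2
      ((mem_rootFace_of_mem_faceOf hy).1 h')⟩)
    h.inner (fun x hx => h.face x hx.1 hx.2) h.fnew hc.face (fun k hk => etaVF_append hk) (by
      rcases hF with ⟨h1, rfl⟩ | ⟨h1, h2⟩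
      · exact .inl ⟨h1, abSteps_append_c⟩
      · refine .inr ⟨w.length, (Phi w).top, h2, h2 ▸ self_mem_faceOf _, ?_, ?_, abSteps_append h1, ?_⟩
        · rw [h2]; exact fun x hx => (faceOf_eq_iff.2 hx).symm
        · exact fun h' => lt_irrefl _ (h'.elim lt_of_getElem? lt_of_getElem?)
        · unfold etaVF
          grind)
  obtain ⟨hVe, hV2⟩ := bijOn_cells (S := V) (c' := (Phi (w ++ [s])).vertexOf)
    (B := cSteps (w ++ [s])) (D' := (Phi (w ++ [s])).InV)
    self_mem_vertexOf (fun x hx y hy =>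
      ⟨(hCM.vertexOf_sub hy).2 hx.1, by rw [← vertexOf_eq_iff.2 hy]; exact hx.2⟩)
    h.inV (fun x hx => h.vertex x hx) h.vnew hc.vertex (fun k hk => etaVF_append_c hk) (by
      rcases hV with ⟨h1, h2⟩ | ⟨rfl, h2, y, h3⟩
      · exact .inl ⟨h1, cSteps_append h2⟩
      · refine .inr ⟨w.length, y, h3, h3 ▸ self_mem_vertexOf _, ?_, hcs, cSteps_append_c, ?_⟩
        · rw [h3]; exact fun x hx => (vertexOf_eq_iff.2 hx).symm
        · rw [← h2, h3])
  have hua := fun {k : ℕ} => mem_unmatchedC_append (w := w) (s := s) (x := Step.a) (by decide) (k := k)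
  have hub := fun {k : ℕ} => mem_unmatchedC_append (w := w) (s := s) (x := Step.b) (by decide) (k := k)
  have hkE : ∀ k ∈ steps (w ++ [s]), k ∈ steps w ∨ k = w.length ∧ True := by grind [steps_append]
  have hkV : ∀ k ∈ cSteps (w ++ [s]), k ∈ cSteps w ∨ k = w.length ∧ s = Step.c :=
    fun k hk => getElem?_append_last.1 hk
  have hkc := fun {k : ℕ} => mem_cSteps_of (w := w) (k := k)
  have hsub : ∀ {k}, k ∈ cSteps w → k ∈ steps w := fun hk => lt_of_getElem? hk
  have hVn : s = Step.c → etaVF (w ++ [s]) w.length = V := by grind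
  have hla : ∀ d, d ∈ (Phi w).darts ∧ d ∉ (Phi w).active → (d ∈ (Phi w).rootFace →
      ((d ∈ (Phi
      (w ++ [s])).white ↔ d ∈ (Phi w).white) ∧
      ((Phi (w ++ [s])).rev d ∈ (Phi (w ++
          [s])).white ↔ (Phi w).rev d ∈ (Phi w).white))) := by grind [h.rev_eq, h.colour]
  refine ⟨hE, fun k hk => ?_, fun k hk => ?_, hFa, hVe, fun k hk => ?_, fun k hk => ?_, fun k hk => ?_⟩
  · refine cells_prop (q := True) hc.left (hkE k hk) hst (fun k hk => ⟨(hE2 k hk).1, fun d hd => ?_⟩)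
      (fun h' => hsub (hkc (.inr (.inr (.inl h'))))) hua fun _ => hl
    have hd' := (hE2 k hk).2 d hd
    rw [h.root d hd'.1 hd'.2]
    exact and_congr_right fun hdr => and_congr (hla d hd' hdr).1 (hla d hd' hdr).2
  · refine cells_prop (q := True) hc.right (hkE k hk) hst (fun k hk => ⟨(hE2 k hk).1, fun d hd => ?_⟩)
      (fun h' => hsub (hkc (.inr (.inr (.inr h'))))) hub fun _ => hr
    have hd' := (hE2 k hk).2 d hd
    rw [h.root d hd'.1 hd'.2]
    exact and_congr_right fun hdr => and_congr (hla d hd' hdr).1.not (hla d hd' hdr).2.not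
  · refine cells_prop hc.white (hkV k hk) hcs (fun k hk => ⟨(hV2 k hk).1, fun d hd =>
      h.vcolour d ((hV2 k hk).2 d hd)⟩) (fun h' => hkc (h'.elim .inl fun h' => .inr (.inr (.inl h'))))
      mem_typeA_append fun hs => by rw [hVn hs, hw hs]; exact (and_iff_right hs).symm
  · refine cells_prop hc.black (hkV k hk) hcs (fun k hk => ⟨(hV2 k hk).1, fun d hd =>
      (h.vcolour d ((hV2 k hk).2 d hd)).not⟩)
      (fun h' => hkc (h'.elim (.inr ∘ .inl) fun h' => .inr (.inr (.inr h'))))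
      mem_typeB_append fun hs => by rw [hVn hs, hb hs]; exact (and_iff_right hs).symm
  · refine cells_prop hc.outer (hkV k hk) hcs (fun k hk => ⟨(hV2 k hk).1, fun d hd =>
      h.root d ((hV2 k hk).2 d hd).1 (((hV2 k hk).2 d hd).not_mem (self_mem_vertexOf d))⟩)
      (fun h' => hkc (h'.elim (.inr ∘ .inr ∘ .inl) fun h' => .inr (.inr (.inr h'))))
      (p := s = Step.c ∧ (stack w Step.a = [] ∨ stack w Step.b = []))
      (by simp only [Set.mem_union, hua, hub, and_or_left]; exact or_or_or_comm)
      fun hs => by rw [hVn hs, ho hs]; exact (and_iff_right hs).symm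

theorem corr {w : Word} (hw : w ∈ KBar) : Corr w := by
  induction w using List.reverseRecOn with
  | nil =>
    have h1 : ∀ {s : Set (Set ℕ)}, s = ∅ → ∀ {f : ℕ → Set ℕ} {A : Set ℕ}, A = ∅ → Set.BijOn f A s := by
      rintro s rfl f A rfl; exact Set.bijOn_empty f
    have hr : ∀ x ∈ init.darts, x ∈ init.rootFace := by
      have h0 := root_mem_rootFace (M := init.toPercMap)
      have h1 := next_mem_rootFace.2 h0
      intro x hx
      simp only [init, Finset.mem_insert, Finset.mem_singleton] at hx
      rcases hx with rfl | rfl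
      · exact h0
      · simpa [init] using h1
    have ha : ∀ x ∈ init.darts, x ∈ init.active := by simp [init]
    have hP : Phi [] = init := rfl
    refine ⟨h1 (Set.eq_empty_of_forall_notMem ?_) (by simp [steps]), by simp [steps], by simp [steps],
      h1 (Set.eq_empty_of_forall_notMem ?_) (by simp [abSteps]),
      h1 (Set.eq_empty_of_forall_notMem ?_) (by simp [cSteps]), by simp [cSteps], by simp [cSteps],
      by simp [cSteps]⟩
    · grind
    · grind
    · rintro _ ⟨x, hx, -⟩; exact hx.not_mem (self_mem_vertexOf x) (ha x hx.1)
  | append_singleton w s ih =>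
    have hw' := mem_KBar_of_append hw
    obtain ⟨U, κ, K, h⟩ := exists_inv hw'
    obtain ⟨U', κ', K', h'⟩ := exists_inv hw
    have hP := Phi_append w s
    have hN := h'.isTBar
    have hE : etaE (w ++ [s]) w.length = (Phi (w ++ [s])).edgeOf ((Phi w).rev (Phi w).top) := by
      unfold etaE; rw [before_length]
    by_cases hs : s = Step.c
    · have hne := (mem_KBar_append_c.1 (hs ▸ hw)).2
      have hR := h.recolorsRight_iff hne
      obtain ⟨-, y, hc, hy1, hy2⟩ := h.stepC_cell hne
      have hP' : Phi (w ++ [s]) = (Phi w).stepC := by rw [hP, hs]; rfl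
      rw [← hP'] at hc hy2
      have hV : etaVF (w ++ [s]) w.length = (Phi (w ++ [s])).vertexOf y := by
        unfold etaVF
        grind [before_length]
      have hyw : ∀ d ∈ (Phi (w ++ [s])).vertexOf y, (d ∈ (Phi (w ++ [s])).white ↔
          (Phi
          w).RecolorsRight) := by grind [hc.white, hN.triangulation.white_vertexOf]
      have hex : ∀ {R : ℕ → Prop} {p : Prop}, (∀ d ∈ (Phi (w ++ [s])).vertexOf y, (R d ↔ p)) →
    
               ((∃ d ∈ (Phi (w ++ [s])).vertexOf y, R d) ↔ p) := by grind [self_mem_vertexOf]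
      refine (ih hw').append h.isTBar hN hc.cell (.inl ⟨rfl, hs⟩)
        (.inr ⟨hs, hV.symm, y, rfl⟩) ?_ ?_ (fun _ => ?_) (fun _ => ?_) fun _ => hc.outer
      · grind [hc.left]
      · grind [hc.right]
      · rw [hex hyw, hR]
      · rw [hex fun d hd => (hyw d hd).not, h.not_recolorsRight_iff hne]
    · have hF := fresh4_fresh (M := Phi w)
      obtain ⟨u, hu⟩ : ∃ u, (Phi w).step s = (Phi w).glueTriangle u := by
        cases s
        exacts [⟨true, rfl⟩, ⟨false, rfl⟩, absurd rfl hs]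
      obtain ⟨hc, hd⟩ := h.cellStep_glue hF u
      rw [← glueTriangle_eq, ← hu, ← hP] at hc hd
      refine (ih hw').append h.isTBar hN hc (.inr ⟨hs, rfl⟩) (.inl ⟨rfl, hs⟩) ?_ ?_
        (fun h' => absurd h' hs) (fun h' => absurd h' hs) fun h' => absurd h' hs
      · grind
      · grind

/-! ### The correspondences -/

theorem IsTBar.inner_of_rev {M : MarkedMap} (hM : M.IsTBar) {v y : ℕ}
    (hv : ∀ d ∈ M.vertexOf v, d ∉ M.rootFace) (hy : y ∈ M.vertexOf v) : y ∉ M.active := fun hya =>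
  (hM.active_outer y hya).elim (hv y hy) fun h => hv (M.next (M.rev y))
    (hM.triangulation.comb.next_mem_vertexOf_iff.2 (by rwa [hM.triangulation.comb.rev_rev]))
    (next_mem_rootFace.2 h)

section Vertices

variable {M : MarkedMap} (hM : M.IsTBar)
include hM

theorem mem_whiteVertices {s : Set ℕ} (hs : s ∈ M.vertices) :
    s ∈ M.whiteVertices ↔ ∃ d ∈ s, d ∈ M.white := by
  obtain ⟨x, hx, rfl⟩ := hs
  have hw := fun {y} => hM.triangulation.white_vertexOf (d := x) (x := y)
  refine ⟨fun h => ⟨x, self_mem_vertexOf x, h.2 (self_mem_vertexOf x)⟩, fun ⟨d, hd, hd'⟩ =>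
    ⟨⟨x, hx, rfl⟩, fun y hy => (hw hy).2 ((hw hd).1 hd')⟩⟩

theorem mem_blackVertices {s : Set ℕ} (hs : s ∈ M.vertices) :
    s ∈ M.blackVertices ↔ ∃ d ∈ s, d ∉ M.white := by
  obtain ⟨x, hx, rfl⟩ := hs
  have hw := fun {y} => hM.triangulation.white_vertexOf (d := x) (x := y)
  refine ⟨fun h => ⟨x, self_mem_vertexOf x, Set.disjoint_left.1 h.2 (self_mem_vertexOf x)⟩,
    fun ⟨d, hd, hd'⟩ => ⟨⟨x, hx, rfl⟩, Set.disjoint_left.2 fun y hy h => hd' ((hw hd).2 ((hw hy).1 h))⟩⟩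

omit hM in
theorem mem_outerVertices {s : Set ℕ} (hs : s ∈ M.vertices) :
    s ∈ M.outerVertices ↔ ∃ d ∈ s, d ∈ M.rootFace := by
  obtain ⟨x, hx, rfl⟩ := hs
  exact ⟨fun ⟨d, hd, h⟩ => ⟨d, h ▸ self_mem_vertexOf d, hd⟩, fun ⟨d, hd, hd'⟩ =>
    ⟨d, hd', (vertexOf_eq_iff.2 hd).symm⟩⟩

theorem mem_innerVertices {s : Set ℕ} : s ∈ M.innerVertices ↔
    s ∈ M.inVertices ∧ ¬ ∃ d ∈ s, d ∈ M.rootFace := by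
  constructor
  · rintro ⟨hs, h⟩
    rw [mem_outerVertices hs] at h
    refine ⟨⟨hs, ?_⟩, h⟩
    obtain ⟨x, hx, rfl⟩ := hs
    grind [hM.inner_of_rev]
  · rintro ⟨⟨hs, -⟩, h⟩
    exact ⟨hs, by rwa [mem_outerVertices hs]⟩

/-- The inactive outer edges with a property `R` of their outer darts. -/
theorem mem_inactive {R : ℕ → Prop} {s : Set ℕ} :
    s ∈ M.edgeOf '' {d | d ∈ M.rootFace ∧ R d ∧ d ∉ M.active} ↔
      s ∈ M.inEdges ∧ ∃ d ∈ s, d ∈ M.rootFace ∧ R d := by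
  rw [inEdges_eq hM]
  constructor
  · grind [hM.triangulation.comb.rootFace_sub, self_mem_edgeOf]
  · rintro ⟨⟨x, ⟨hx, hxa⟩, rfl⟩, d, hd, h1, h2⟩
    refine ⟨d, ⟨h1, h2, fun h' => hxa ?_⟩, (edgeOf_eq_iff.2 hd).symm⟩
    rcases hM.triangulation.comb.mem_edgeOf.1 hd with rfl | rfl
    · exact h'
    · have := hM.active_rev _ h'
      rwa [hM.triangulation.comb.rev_rev] at this

end Vertices

variable {w : Word}

/-- The correspondences with the active edges and their triangles, where `o i` is the outer dart of
the active edge of the unmatched step `i`. -/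
theorem Corr.active (hc : Corr w) (hM : (Phi w).IsTBar) {S : Set ℕ} {E : Set (Set ℕ)} (o : ℕ → ℕ)
    (hE : ∀ s, s ∈ E ↔ ∃ i ∈ S, s = (Phi w).edgeOf (o i))
    (ho : ∀ i ∈ S, o i ∈ (Phi w).rootFace)
    (hn : ∀ i ∈ S, (Phi w).rev (o i) ∈ etaVF w i) (hS : S ⊆ abSteps w)
    (hLR : ∀ i ∈ S, etaLR w i = (Phi w).edgeOf (o i)) :
    Set.BijOn (etaVF w) S ((Phi w).trianglesAt E) ∧ Set.BijOn (etaLR w) S E ∧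
      ∀ i ∈ S, ∀ e ∈ E, ((etaVF w i ∩ e).Nonempty ↔ e = etaLR w i) := by
  have hF := innerFaces_eq (M := Phi w) ▸ hc.face
  have hme : ∀ i ∈ S, (Phi w).rev (o i) ∈ (Phi w).edgeOf (o i) := fun i _ =>
    hM.triangulation.comb.mem_edgeOf.2 (.inr rfl)
  have key : ∀ k ∈ abSteps w, ∀ j ∈ S, (etaVF w k ∩ (Phi w).edgeOf (o j)).Nonempty → k = j := by
    rintro k hk j hj ⟨x, hx, hxj⟩
    obtain ⟨y, ⟨hy, hyr⟩, hye⟩ := hc.face.mapsTo hk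
    obtain ⟨z, -, hze⟩ := hc.face.mapsTo (hS hj)
    have hj' := hn j hj
    refine hc.face.injOn hk (hS hj) ?_
    rw [hye] at hx ⊢
    rw [hze] at hj' ⊢
    rcases hM.triangulation.comb.mem_edgeOf.1 hxj with rfl | rfl
    · grind [mem_rootFace_of_mem_faceOf]
    · rw [faceOf_eq_iff.2 hx, faceOf_eq_iff.2 hj']
  refine ⟨⟨fun i hi => ⟨hF.mapsTo (hS hi), _, (hE _).2 ⟨i, hi, rfl⟩, _, hn i hi, hme i hi⟩,
    hF.injOn.mono hS, ?_⟩, ⟨fun i hi => (hE _).2 ⟨i, hi, hLR i hi⟩, fun i hi j hj hij => ?_, ?_⟩, ?_⟩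
  · rintro f ⟨hf, e, he, hfe⟩
    obtain ⟨k, hk, rfl⟩ := hF.surjOn hf
    grind
  · rw [hLR i hi, hLR j hj] at hij
    exact key i (hS hi) j hj ⟨_, hn i hi, hij ▸ hme i hi⟩
  · intro e he
    grind
  · intro i hi e he
    rw [hLR i hi]
    obtain ⟨j, hj, rfl⟩ := (hE e).1 he
    refine ⟨fun h => by rw [key i (hS hi) j hj h], fun h => ⟨_, hn i hi, ?_⟩⟩
    rw [h]; exact hme i hi

theorem etaVF_of_ne {i : ℕ} (h : w[i]? ≠ some Step.c) : etaVF w i = (Phi w).faceOf (before w i).top := by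
  unfold etaVF; rw [if_neg h]

/-- The correspondences for unmatched `a`-steps. -/
theorem active_left (hw : w ∈ KBar) :
    Set.BijOn (etaVF w) (unmatchedSteps w Step.a) ((Phi w).trianglesAt (Phi w).leftActiveEdges) ∧
      Set.BijOn (etaLR w) (unmatchedSteps w Step.a) (Phi w).leftActiveEdges ∧
      ∀ i ∈ unmatchedSteps w Step.a, ∀ e ∈ (Phi w).leftActiveEdges,
        ((etaVF w i ∩ e).Nonempty ↔ e = etaLR w i) := by
  obtain ⟨U, κ, K, h⟩ := exists_inv hw
  have hC := h.comb
  have hS : ∀ i, i ∈ unmatchedSteps w Step.a ↔ i ∈ stack w Step.a := by grind [unmatchedSteps_eq]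
  refine (corr hw).active h.isTBar U (fun s => ?_) (fun i hi => h.left_mem ((hS i).1 hi))
    (fun i hi => ?_) (fun i hi => .inl hi.1) fun i hi => ?_
  · constructor
    · rintro ⟨d, ⟨h1, h2, h3⟩, rfl⟩
      obtain ⟨i, hi, rfl⟩ := h.left_active_iff.1 ⟨h1, h2, h3⟩
      exact ⟨i, (hS i).2 hi, rfl⟩
    · rintro ⟨i, hi, rfl⟩
      obtain ⟨h1, h2, h3⟩ := h.left_active_iff.2 ⟨i, (hS i).1 hi, rfl⟩
      exact ⟨_, ⟨h1, h2, h3⟩, rfl⟩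
  · rw [etaVF_of_ne (by rw [hi.1]; decide)]
    exact h.rev_U_left_mem_face ((hS i).1 hi)
  · unfold etaLR
    rw [if_pos hi.1, h.triL i ((hS i).1 hi), hC.edgeOf_eq, hC.edgeOf_eq, hC.rev_rev, Set.pair_comm]

/-- The correspondences for unmatched `b`-steps. -/
theorem active_right (hw : w ∈ KBar) :
    Set.BijOn (etaVF w) (unmatchedSteps w Step.b) ((Phi w).trianglesAt (Phi w).rightActiveEdges) ∧
      Set.BijOn (etaLR w) (unmatchedSteps w Step.b) (Phi w).rightActiveEdges ∧
      ∀ i ∈ unmatchedSteps w Step.b, ∀ e ∈ (Phi w).rightActiveEdges,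
        ((etaVF w i ∩ e).Nonempty ↔ e = etaLR w i) := by
  obtain ⟨U, κ, K, h⟩ := exists_inv hw
  have hC := h.comb
  have hS : ∀ i, i ∈ unmatchedSteps w Step.b ↔ i ∈ stack w Step.b := by grind [unmatchedSteps_eq]
  refine (corr hw).active h.isTBar (fun i => (Phi w).rev (U i)) (fun s => ?_)
    (fun i hi => h.right_mem ((hS i).1 hi)) (fun i hi => ?_) (fun i hi => .inr hi.1) fun i hi => ?_
  · constructor
    · rintro ⟨d, ⟨h1, h2, h3⟩, rfl⟩
      obtain ⟨i, hi, rfl⟩ := h.right_active_iff.1 ⟨h1, h2, h3⟩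
      exact ⟨i, (hS i).2 hi, rfl⟩
    · rintro ⟨i, hi, rfl⟩
      obtain ⟨h1, h2, h3⟩ := h.right_active_iff.2 ⟨i, (hS i).1 hi, rfl⟩
      exact ⟨_, ⟨h1, h2, h3⟩, rfl⟩
  · rw [etaVF_of_ne (by rw [hi.1]; decide), hC.rev_rev]
    exact h.U_right_mem_face ((hS i).1 hi)
  · unfold etaLR
    have hi' := (hS i).1 hi
    rw [if_neg (by rw [hi.1]; decide), hC.edgeOf_eq, hC.edgeOf_eq, hC.rev_rev, Set.pair_comm]
    have := h.tri.next3 (h.U_darts (.inr hi')) (h.right_inner hi')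
    rw [h.triR i hi'] at this
    rw [this.1]

/-- The types of the `c`-steps, and the vertices with the corresponding properties. -/
theorem vertex_corr (hw : w ∈ KBar) :
    Set.BijOn (etaVF w) (matchedCa w ∪ unmatchedC w Step.a)
      ((Phi w).inVertices ∩ (Phi w).whiteVertices) ∧
    Set.BijOn (etaVF w) (matchedCb w ∪ unmatchedC w Step.b)
      ((Phi w).inVertices ∩ (Phi w).blackVertices) ∧
    Set.BijOn (etaVF w) (matchedCa w) ((Phi w).innerVertices ∩ (Phi w).whiteVertices) ∧
    Set.BijOn (etaVF w) (matchedCb w) ((Phi w).innerVertices ∩ (Phi w).blackVertices) ∧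
    Set.BijOn (etaVF w) (unmatchedC w Step.a)
      ((Phi w).inVertices ∩ (Phi w).outerVertices ∩ (Phi w).whiteVertices) ∧
    Set.BijOn (etaVF w) (unmatchedC w Step.b)
      ((Phi w).inVertices ∩ (Phi w).outerVertices ∩ (Phi w).blackVertices) := by
  have hc := corr hw
  obtain ⟨U, κ, K, h⟩ := exists_inv hw
  have hM := h.isTBar
  have hV := inVertices_eq (M := Phi w) ▸ hc.vertex
  have hk := fun {k} => mem_cSteps_of (w := w) (k := k)
  have hma : ∀ k, k ∈ matchedCa w → ¬ (k ∈ unmatchedC w Step.a ∪ unmatchedC w Step.b) := by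
    rintro k ⟨i, j, hi, hj, -⟩ (h | h)
    exacts [h.2 _ hi, h.2 _ hj]
  have hmb : ∀ k, k ∈ matchedCb w → ¬ (k ∈ unmatchedC w Step.a ∪ unmatchedC w Step.b) := by
    rintro k ⟨i, j, hi, hj, -⟩ (h | h)
    exacts [h.2 _ hi, h.2 _ hj]
  have hWo := fun k hk => and_congr (hc.white k hk) (hc.outer k hk)
  have hBo := fun k hk => and_congr (hc.black k hk) (hc.outer k hk)
  have hWi := fun k hk => and_congr (hc.white k hk) (hc.outer k hk).not
  have hBi := fun k hk => and_congr (hc.black k hk) (hc.outer k hk).not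
  refine ⟨bijOn_sep (Q := fun s => ∃ d ∈ s, d ∈ (Phi w).white) hV hc.white (fun k => ?_) (fun s => ?_),
    bijOn_sep (Q := fun s => ∃ d ∈ s, d ∉ (Phi w).white) hV hc.black (fun k => ?_) (fun s => ?_),
    bijOn_sep (Q := fun s => (∃ d ∈ s, d ∈ (Phi w).white) ∧
      ¬ ∃ d ∈ s, d ∈ (Phi w).rootFace) hV hWi (fun k => ?_) (fun s => ?_),
    bijOn_sep (Q := fun s => (∃ d ∈ s, d ∉ (Phi w).white) ∧
      ¬ ∃ d ∈ s, d ∈ (Phi w).rootFace) hV hBi (fun k => ?_) (fun s => ?_),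
    bijOn_sep (Q := fun s => (∃ d ∈ s, d ∈ (Phi w).white) ∧
      ∃ d ∈ s, d ∈ (Phi w).rootFace) hV hWo (fun k => ?_) (fun s => ?_), bijOn_sep (Q := fun s => (∃ d ∈ s, d ∉ (Phi w).white) ∧
      ∃ d ∈ s, d ∈ (Phi w).rootFace) hV hBo (fun k => ?_) (fun s => ?_)⟩
  all_goals try rw [Set.mem_inter_iff]
  · grind
  · exact and_congr_right fun hs => mem_whiteVertices hM hs.1
  · grind
  · exact and_congr_right fun hs => mem_blackVertices hM hs.1
  · grind
  · rw [mem_innerVertices hM, and_assoc, and_comm (b := s ∈ _)]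
    exact and_congr_right fun hs => and_congr_left' (mem_whiteVertices hM hs.1)
  · grind
  · rw [mem_innerVertices hM, and_assoc, and_comm (b := s ∈ _)]
    exact and_congr_right fun hs => and_congr_left' (mem_blackVertices hM hs.1)
  · grind
  · rw [Set.mem_inter_iff, and_assoc, and_comm (b := s ∈ whiteVertices _)]
    exact and_congr_right fun hs => and_congr (mem_whiteVertices hM hs.1) (mem_outerVertices hs.1)
  · grind
  · rw [Set.mem_inter_iff, and_assoc, and_comm (b := s ∈ blackVertices _)]
    exact and_congr_right fun hs => and_congr (mem_blackVertices hM hs.1) (mem_outerVertices hs.1)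

/-- The correspondence between steps and in-edges. -/
theorem edge_corr (hw : w ∈ KBar) : Set.BijOn (etaE w) (steps w) (Phi w).inEdges ∧
    Set.BijOn (etaE w) (unmatchedC w Step.a) (Phi w).leftInactiveEdges ∧
    Set.BijOn (etaE w) (unmatchedC w Step.b) (Phi w).rightInactiveEdges := by
  have hc := corr hw
  obtain ⟨U, κ, K, h⟩ := exists_inv hw
  have hM := h.isTBar
  have hE := inEdges_eq hM ▸ hc.edge
  have hk : ∀ {k x}, k ∈ unmatchedC w x ↔ k ∈ steps w ∧ k ∈ unmatchedC w x := fun {k x} =>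
    (and_iff_right_of_imp fun h => lt_of_getElem? h.1).symm
  exact ⟨hE, bijOn_sep hE hc.left (fun k => hk) fun s => mem_inactive hM,
    bijOn_sep hE hc.right (fun k => hk) fun s => mem_inactive hM⟩

/-! ### Marked triangulations described locally -/

theorem exists_top_triangle {N : PercMap} (hM : N.IsTriangulation) (hR : N.RootInterface) {K : ℕ}
    (hK : N.PathEnd K) (hi : N.rev N.top ∉ N.rootFace) :
    ∃ m, K = m + 1 ∧ N.rev N.top ∈ N.faceOf (N.entry m) := by
  obtain ⟨m, rfl⟩ : ∃ m, K = m + 1 := by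
    refine ⟨K - 1, (Nat.succ_pred_eq_of_pos (Nat.pos_of_ne_zero ?_)).symm⟩
    rintro rfl
    have := hK.eq_top hM hR
    grind [PercMap.entry_zero, hM.comb.rev_rev, root_mem_rootFace]
  exact ⟨m, rfl, hK.top_face hM rfl hR⟩

/-- The conditions of `IsTBar`, where the condition that the active edges are consecutive is
replaced with a condition on the successive right edges. -/
structure TBRight (M : MarkedMap) : Prop where
  tri : M.IsTriangulation
  ri : M.RootInterface
  active_sub : M.active ⊆ (M.darts : Set ℕ)
  active_rev : ∀ d ∈ M.active, M.rev d ∈ M.active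
  active_outer : ∀ d ∈ M.active, d ∈ M.rootFace ∨ M.rev d ∈ M.rootFace
  top_active : M.top ∈ M.active
  root : M.root ∈ M.active → M.rev M.root = M.top
  right : ∀ x ∈ M.rootFace, x ∈ M.active → M.BlackEdge x → M.next x ∈ M.active
  path : ∀ d ∈ M.active, d ∉ M.rootFace → M.OnPath (M.faceOf d)

/-- The conditions of `IsTBar`, where the condition that the active edges are consecutive is
replaced with conditions on the successive left edges and on the successive right edges. -/
structure TB (M : MarkedMap) : Prop extends M.TBRight where
  left : ∀ x ∈ M.rootFace, x ∈ M.active → M.WhiteEdge x → M.next.symm x ∈ M.active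

variable {N : MarkedMap}

theorem IsTBar.tb (h : N.IsTBar) : N.TB where
  tri := h.triangulation
  ri := h.rootInterface
  active_sub := h.active_sub
  active_rev := h.active_rev
  active_outer := h.active_outer
  top_active := h.top_active
  root hr := by
    have h2 : N.edgeOf N.root = N.edgeOf N.top := by
      by_contra h3; exact h.root_inactive h3 hr
    rw [PercMap.edgeOf_eq_iff, h.triangulation.comb.mem_edgeOf] at h2
    refine (h2.resolve_left fun h4 => ?_).symm
    exact (PercMap.top_bw h.triangulation h.rootInterface).1 (h4 ▸ h.rootInterface.1.1)
  left x hx hxa := (h.local hx hxa).1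
  right x hx hxa := (h.local hx hxa).2
  path := h.path

namespace TBRight

variable (h : N.TBRight)
include h

theorem comb : N.Comb := h.tri.comb

theorem top_mem : N.top ∈ N.rootFace := PercMap.top_mem h.tri h.ri

theorem top_bw : N.BW N.top := PercMap.top_bw h.tri h.ri

theorem top_darts : N.top ∈ N.darts := h.comb.rootFace_sub h.top_mem

end TBRight

theorem TB.mirror (h : N.TB) : N.mirror.TB := by
  have hC := h.comb
  have hr := fun {x : ℕ} (hx : x ∈ N.rootFace) => hC.rootFace_sub hx
  have hf : N.mirror.rootFace = N.rootFace := PercMap.mirror_rootFace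
  refine ⟨⟨PercMap.mirror_isTriangulation h.tri, PercMap.mirror_rootInterface hC h.ri, h.active_sub, h.active_rev,
    by rw [hf]; exact h.active_outer, by rw [mirror_top hC]; exact h.top_active,
    by rw [mirror_top hC]; exact h.root, fun x hx hxa hxw => ?_, fun x hxa hx => ?_⟩,
    fun x hx hxa hxw => ?_⟩
  · rw [hf] at hx
    exact h.left x hx hxa ((PercMap.mirror_blackEdge hC (hr hx)).1 hxw)
  · rw [hf] at hx
    obtain ⟨k, hk⟩ := h.path x hxa hx
    refine ⟨k, (PercMap.mirror_onPathAt h.tri h.ri).2 ?_⟩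
    change N.OnPathAt k (N.toPercMap.mirror.faceOf x)
    rwa [PercMap.mirror_faceOf]
  · rw [hf] at hx
    exact h.right x hx hxa ((PercMap.mirror_whiteEdge hC (hr hx)).1 hxw)

/-! ### Removing a triangle -/

/-- The triangle at the top-edge is incident to an active left edge. -/
def EndsA (N : MarkedMap) : Prop :=
  ∃ x ∈ N.rootFace, x ∈ N.active ∧ N.WhiteEdge x ∧ N.rev x ∈ N.faceOf (N.rev N.top)

/-- Removing the triangle at the top-edge, when it is incident to the next outer edge. -/
noncomputable def unglue (N : MarkedMap) : MarkedMap :=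
  let p := N.top
  let q := N.next p
  let d := N.next (N.rev p)
  { darts := N.darts \ {p, q, N.rev p, N.rev q}
    rev := Equiv.swap q (N.rev q) * Equiv.swap p (N.rev p) * N.rev
    next := [d, p, q, N.next q, N.rev q, N.rev p].formPerm⁻¹ * N.next
    root := N.root
    white := N.white \ {N.rev q, q, N.rev p}
    active := (N.active \ {p, q, N.rev p, N.rev q}) ∪ {d, N.rev d} }

theorem unglue_map (hN : N.TB) (π : Perm ℕ) : (N.map π).unglue = N.unglue.map π := by
  have e1 : (N.map π).rev = π * N.rev * π⁻¹ := rfl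
  have e2 : (N.map π).next = π * N.next * π⁻¹ := rfl
  have e3 : (N.map π).darts = N.darts.map π.toEmbedding := rfl
  have e4 : (N.map π).active = π '' N.active := rfl
  have e5 : (N.map π).white = π '' N.white := rfl
  have hr : ∀ x, (N.map π).rev (π x) = π (N.rev x) := PercMap.map_rev π
  have hn : ∀ x, (N.map π).next (π x) = π (N.next x) := PercMap.map_next π
  unfold unglue
  rw [map_top π hN.tri hN.ri]
  simp only [hr, hn]
  rw [e1, e2, e3, e4, e5]
  unfold map PercMap.map
  simp only [MarkedMap.mk.injEq, PercMap.mk.injEq]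
  refine ⟨⟨?_, ?_, ?_, trivial, ?_⟩, ?_⟩
  · ext x
    obtain ⟨x, rfl⟩ := π.surjective x
    simp
  · rw [mul_assoc (Equiv.swap (π _) _), mul_assoc (Equiv.swap (N.next _) _), PercMap.map_mul_swap,
      PercMap.map_mul_swap]
  · have h := formPerm_map_perm π [N.next (N.rev N.top), N.top, N.next N.top,
      N.next (N.next N.top), N.rev (N.next N.top), N.rev N.top]
    simp only [List.map_cons, List.map_nil] at h
    rw [h]; group
  · rw [Set.image_sdiff π.injective]
    simp [Set.image_insert_eq]
  · rw [Set.image_union, Set.image_sdiff π.injective]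
    simp [Set.image_insert_eq]

theorem unglue_glueTriAt {M : MarkedMap} (hM : M.TB) {p q p' q' : ℕ}
    (hF : Fresh4 M.darts p q p' q') : (M.glueTriAt true p q p' q').unglue = M := by
  have hC := hM.comb
  obtain ⟨m1, m2, m3, m4, a1, a2, a3, a4, a5, a6⟩ := id hF
  obtain ⟨-, -, ht⟩ := glueTriAt_basic hM.tri hM.ri hF
  obtain ⟨v1, v2, v3, v4, v5, v6, v7, v8, v9, v10, -⟩ := glueAt_values hC
    (W := M.white ∪ {q', q, p'}) hM.top_darts (hM.tri.next_ne hM.top_darts) hF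
  have hr : (M.glueTriAt true p q p' q').rev = Equiv.swap p p' * Equiv.swap q q' * M.rev := rfl
  have hn : (M.glueTriAt true p q p' q').next =
    [M.top, p, q, M.next M.top, q', p'].formPerm * M.next := rfl
  have hD : (M.glueTriAt true p q p' q').darts = M.darts ∪ {p, q, p', q'} := rfl
  have hW : (M.glueTriAt true p q p' q').white = M.white ∪ {q', q, p'} := rfl
  have hA : (M.glueTriAt true p q p' q').active =
    (M.active \ {M.top, M.rev M.top}) ∪ {p, q, p', q'} := rfl
  have hroot : (M.glueTriAt true p q p' q').root = M.root := rfl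
  have e : (M.glueTriAt true p q p' q').toPercMap =
    M.toPercMap.glueAt M.top p q p' q' (M.white ∪ {q', q, p'}) := rfl
  rw [← e] at v1 v2 v3 v4 v5 v6 v7 v8 v9 v10
  generalize M.glueTriAt true p q p' q' = N at *
  unfold unglue
  simp only [ht, v8, v3, v1, v7, v9, v10 _ hM.top_darts]
  obtain ⟨⟨D, r, n, root, w⟩, A⟩ := M
  simp only at *
  simp only [MarkedMap.mk.injEq, PercMap.mk.injEq]
  refine ⟨⟨?_, ?_, ?_, hroot, ?_⟩, ?_⟩
  · grind
  · rw [hr]; simp [← mul_assoc]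
  · rw [hn, inv_mul_cancel_left]
  · grind [hM.tri.white_sub]
  · ext x
    have hx := @hM.active_sub x
    grind [hM.top_active, hM.active_rev]

theorem EndsA.rev_top_inner (hN : N.TB) (h : N.EndsA) : N.rev N.top ∉ N.rootFace := by
  obtain ⟨x, hx, -, hxw, -⟩ := h
  intro h1
  have hb := hN.top_bw
  rcases ((hN.tri.single_edge hN.top_mem h1).2.2 x).1 (hN.comb.rootFace_sub hx) with rfl | rfl
  · exact hb.1 hxw.1
  · exact hb.1 (by rw [← hN.comb.rev_rev N.top]; exact hxw.2)

/-- The shape of the triangle at the top-edge, when it is incident to the next outer edge. -/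
theorem EndsA.values (hN : N.TB) (h : N.EndsA) :
    (N.next N.top ∈ N.active ∧ N.WhiteEdge (N.next N.top)) ∧
    N.next (N.next (N.rev N.top)) = N.rev (N.next N.top) ∧
    N.next (N.rev (N.next N.top)) = N.rev N.top := by
  have hC := hN.comb
  have hi := h.rev_top_inner hN
  obtain ⟨x, hx, hxa, hxw, hxf⟩ := h
  have hb := hN.top_bw
  have hD := hC.rev_mem _ hN.top_darts
  have h3 := (hN.tri.next3 hD hi).1
  have e : N.rev x = N.next (N.next (N.rev N.top)) := by
    rcases (hN.tri.mem_faceOf_inner hD hi).1 hxf with h1 | h1 | h1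
    · exact absurd (N.rev.injective h1 ▸ hxw.1) hb.1
    · have h2 := hxw.2
      rw [h1, hN.tri.white_next, hC.rev_rev] at h2
      exact absurd h2 hb.1
    · exact h1
  have hx' : N.next N.top = x := by
    refine hN.tri.outer_eq (next_mem_rootFace.2 hN.top_mem) hx ?_
    grind [hC.next_mem_vertexOf_rev, hC.rev_rev, mem_vertexOf_comm, hC.vertexOf_next]
  grind

set_option maxHeartbeats 1000000 in
/-- A map whose last triangle is incident to an active left edge is obtained by gluing this
triangle. -/
theorem EndsA.eq_glueTriAt (hN : N.TB) (h : N.EndsA) :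
    Fresh4 N.unglue.darts N.top (N.next N.top) (N.rev N.top) (N.rev (N.next N.top)) ∧
    N.unglue.TB ∧ N = N.unglue.glueTriAt true N.top (N.next N.top) (N.rev N.top)
      (N.rev (N.next N.top)) ∧
    N.unglue.top ∈ N.darts ∧ N.unglue.top ∉ N.active := by
  have hC := hN.comb
  have hpi := h.rev_top_inner hN
  obtain ⟨⟨hqa, hqw⟩, h2, h3⟩ := h.values hN
  have hpb := hN.top_bw
  have hp := hN.top_darts
  have hpf := hN.top_mem
  have hqf := next_mem_rootFace.2 hpf
  have hroot := hN.ri.1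
  have hq := hC.rootFace_sub hqf
  have hp' := hC.rev_mem _ hp
  have hq' := hC.rev_mem _ hq
  have hr := hC.next_mem_iff.2 hq
  have hrf := next_mem_rootFace.2 hqf
  have hpa := hN.top_active
  have hpa' := hN.active_rev _ hpa
  have hqa' := hN.active_rev _ hqa
  have hd := hC.next_mem_iff.2 hp'
  have hrr := hC.rev_rev
  have hrw : N.next (N.next N.top) ∈ N.white := by rw [hN.tri.white_next]; exact hqw.2
  have hdb : N.next (N.rev N.top) ∉ N.white := by rw [hN.tri.white_next, hrr]; exact hpb.1
  have hdw : N.rev (N.next (N.rev N.top)) ∈ N.white := by grind [hN.tri.white_next]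
  have hq'i : N.rev (N.next N.top) ∉ N.rootFace := by grind [next_mem_rootFace]
  have hdi : N.next (N.rev N.top) ∉ N.rootFace := fun h => hpi (next_mem_rootFace.1 h)
  have hpq' := hN.tri.next_ne hq'
  rw [h3] at hpq'
  have hrq := hN.tri.next_ne hq
  have hrp := hC.rev_ne _ hp
  have hrq' := hC.rev_ne _ hq
  -- the third edge of the triangle is not active
  have hrda : N.rev (N.next (N.rev N.top)) ∉ N.active := by
    intro ha
    rcases hN.active_outer _ ha with h1 | h1
    · have h4 : N.rev (N.next (N.rev N.top)) = N.root := by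
        by_contra h4
        exact hN.ri.2 _ h1 h4 ⟨hdw, by rw [hrr]; exact hdb⟩
      grind [hN.root]
    · rw [hrr] at h1; exact hdi h1
  have hda : N.next (N.rev N.top) ∉ N.active := fun h => hrda (hN.active_rev _ h)
  have hM : N.unglue = ⟨⟨N.darts \ {N.top, N.next N.top, N.rev N.top, N.rev (N.next N.top)}, _, _,
    N.root, N.white \ {N.rev (N.next N.top), N.next N.top, N.rev N.top}⟩,
    (N.active \ {N.top, N.next N.top, N.rev N.top, N.rev (N.next N.top)}) ∪
      {N.next (N.rev N.top), N.rev (N.next (N.rev N.top))}⟩ := rfl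
  generalize hpe : N.top = p at *
  generalize hqe : N.next p = q at *
  generalize hpe' : N.rev p = p' at *
  generalize hqe' : N.rev q = q' at *
  generalize hde : N.next p' = d at *
  have hqw' : q' ∈ N.white := hqe' ▸ hqw.2
  have hwx : ∀ {x y}, x ∈ N.white → y ∉ N.white → x ≠ y := by grind
  have hfx : ∀ {x y}, x ∈ N.rootFace → y ∉ N.rootFace → x ≠ y := by grind
  have n1 := hwx hqw.1 hpb.1
  have n2 := hwx hrw hpb.1
  have n3 := hfx hpf hpi
  have n4 := hfx hpf hq'i
  have n5 := hfx hpf hdi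
  have n6 := hfx hqf hpi
  have n8 := hfx hqf hdi
  have n9 := hfx hrf hpi
  have n10 := hfx hrf hq'i
  have n11 := hfx hrf hdi
  have n12 : p' ≠ d := hwx (hpe' ▸ hpb.2) hdb
  have n13 := hwx hqw' hdb
  have nr1 := hwx hroot.1 hpb.1
  have nr2 : N.root ≠ q := by grind
  have nr3 : N.root ≠ p' := hfx root_mem_rootFace hpi
  have nr4 : N.root ≠ q' := hfx root_mem_rootFace hq'i
  have nr5 : N.root ≠ d := hfx root_mem_rootFace hdi
  set c := [d, p, q, N.next q, q', p'].formPerm with hc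
  have hcx : ∀ x, c x = if x = d then p else if x = p then q else if x = q then N.next q
      else if x = N.next q then q' else if x = q' then p' else if x = p' then d else x := by
    intro x
    simp only [hc, List.formPerm_cons_cons, List.formPerm_singleton, Perm.mul_apply,
      Equiv.swap_apply_def, mul_one]
    clear hM
    grind
  have hMr : N.unglue.rev = Equiv.swap q q' * Equiv.swap p p' * N.rev := by
    grind
  have hMn : N.unglue.next = c⁻¹ * N.next := by
    grind
  have hMD : N.unglue.darts = N.darts \ {p, q, p', q'} := by rw [hM]
  have hMw : N.unglue.white = N.white \ {q', q, p'} := by rw [hM]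
  have hMa : N.unglue.active = (N.active \ {p, q, p', q'}) ∪ {d, N.rev d} := by rw [hM]
  have hMroot : N.unglue.root = N.root := rfl
  clear hM
  generalize N.unglue = M at *
  have hmem : ∀ x, x ∈ M.darts ↔ x ∈ N.darts ∧ x ≠ p ∧ x ≠ q ∧ x ≠ p' ∧ x ≠ q' := by grind
  have hrev : ∀ x, M.rev x = if x = p ∨ x = q ∨ x = p' ∨ x = q' then x else N.rev x := by
    intro x
    have i1 : ∀ y, N.rev x = y ↔ x = N.rev y := by grind
    rw [hMr]
    change Equiv.swap q q' (Equiv.swap p p' (N.rev x)) = _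
    grind
  have hnext : ∀ {x y}, M.next x = y ↔ N.next x = c y := fun {x y} => by
    rw [hMn, Perm.mul_apply]
    exact Perm.inv_eq_iff_eq
  have hMd : M.next d = N.next q := by rw [hnext, h2, hcx]; grind
  have hMC : M.Comb := by
    refine ⟨fun x hx => ?_, fun x hx => ?_, fun x => ?_, fun x hx => ?_, fun x hx => ?_,
      (hmem _).2 (by rw [hMroot]; exact ⟨hC.root_mem, nr1, nr2, nr3, nr4⟩)⟩
    · grind [hC.rev_mem]
    · grind [hC.rev_ne]
    · grind
    · grind [hC.rev_fix]
    · rw [hmem] at hx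
      have := hC.next_fix x
      rw [hnext, hcx]
      grind
  have hMnd : M.next d ≠ d := by rw [hMd]; exact n11
  have hdM : d ∈ M.darts := by grind
  -- otherwise the root-face would not contain the top-edge
  have hdf : d ∈ M.rootFace := by
    by_contra hd0
    refine ((hmem p).1 (hMC.rootFace_sub (mem_of_sameCycle hC.next_fix (S := M.rootFace)
      (fun x hx => ?_) (PercMap.mem_rootFace.1 hpf) (hMroot ▸ root_mem_rootFace)))).2.1 rfl
    have h1 : M.next x ∈ M.rootFace := next_mem_rootFace.2 hx
    have h4 := (hmem _).1 (hMC.rootFace_sub h1)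
    have h5 : M.next x ≠ d := fun e => hd0 (e ▸ h1)
    have h6 : M.next x ≠ N.next q := fun e => hd0 (M.next.injective (e.trans hMd.symm) ▸ hx)
    rw [hnext.1 rfl, hcx, if_neg h5, if_neg h4.2.1, if_neg h4.2.2.1, if_neg h6,
      if_neg h4.2.2.2.2, if_neg h4.2.2.2.1]
    exact h1
  have hF : Fresh4 M.darts p q p' q' :=
    ⟨by simp [hmem], by simp [hmem], by simp [hmem], by simp [hmem], n1.symm, n3, n4, n6, hrq'.symm,
      hpq'⟩
  have hMrd : M.rev d = N.rev d := by
    grind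
  have hdd : N.rev d ≠ p ∧ N.rev d ≠ q ∧ N.rev d ≠ p' ∧ N.rev d ≠ q' := by grind
  have hMw' : ∀ {x}, x ∈ M.darts → (x ∈ M.white ↔ x ∈ N.white) := by grind
  have hMbw : M.BW d := by
    refine ⟨fun h => hdb ((hMw' hdM).1 h), ?_⟩
    grind
  have hMws : M.white ⊆ (M.darts : Set ℕ) := fun x hx => by
    rw [hMw] at hx
    have h1 := hN.tri.white_mem hx.1
    have h4 := hx.2
    simp only [Set.mem_insert_iff, Set.mem_singleton_iff, not_or] at h4
    exact (hmem x).2 ⟨h1, fun e => hpb.1 (e ▸ hx.1), h4.2.1, h4.2.2, h4.1⟩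
  have hE : M.toPercMap.glueAt d p q p' q' (M.white ∪ {q', q, p'}) = N.toPercMap := by
    have hD : M.darts ∪ {p, q, p', q'} = N.darts := by
      grind
    have hR : Equiv.swap p p' * Equiv.swap q q' * M.rev = N.rev := by
      rw [hMr]; simp [← mul_assoc]
    have hX : [d, p, q, M.next d, q', p'].formPerm * M.next = N.next := by
      rw [hMd, ← hc, hMn, mul_inv_cancel_left]
    have hW : M.white ∪ {q', q, p'} = N.white := by
      rw [hMw, Set.sdiff_union_self, Set.union_eq_left]
      rintro x (rfl | rfl | rfl)
      exacts [hqw', hqw.1, hpe' ▸ hpb.2]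
    unfold PercMap.glueAt
    rw [hD, hR, hX, hW, hMroot]
  have hdr : M.root ≠ d := hMroot ▸ nr5
  have htri := (glueAt_isTriangulation_iff hMC hdf hMnd hF hdr hMws hMbw).1 (hE ▸ hN.tri)
  have hri := (glueAt_rootInterface_iff hMC hdf hMnd hF hdr hMws hMbw).1 (hE ▸ hN.ri)
  have htop : M.top = d := (PercMap.eq_top htri hri hdf hMbw).symm
  have hE' : N = M.glueTriAt true p q p' q' := by
    have hA : (M.active \ {d, M.rev d}) ∪ {p, q, p', q'} = N.active := by
      rw [hMa, hMrd]
      ext x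
      simp only [Set.mem_sdiff, Set.mem_union, Set.mem_insert_iff, Set.mem_singleton_iff]
      clear hcx hc
      grind
    unfold glueTriAt
    simp only [htop, if_true]
    rw [hA, hE]
  refine ⟨hF, ?_, hE', htop ▸ hd, htop ▸ hda⟩
  have hrf' : ∀ {x}, x ∈ N.rootFace ↔ (x ∈ M.rootFace ∧ x ≠ d) ∨ x = p ∨ x = q := by grind
      [glueAt_mem_rootFace]
  have hact : ∀ {x}, x ∈ M.active ↔ (x ∈ N.active ∧ x ∈ M.darts) ∨ x = d ∨ x = N.rev d := by
    intro x
    rw [hMa, hmem]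
    simp only [Set.mem_sdiff, Set.mem_union, Set.mem_insert_iff, Set.mem_singleton_iff, not_or]
    have := @hN.active_sub x
    simp only [Finset.mem_coe] at this
    clear hcx hc
    grind
  have hMrev : ∀ {x}, x ∈ M.darts → M.rev x = N.rev x := by grind
  have hMrrd : M.rev (N.rev d) = d := by grind
  have hc1 : ∀ {x}, x ∈ M.darts → x ≠ d → x ≠ N.next q → c x = x := by grind
  have hout : ∀ {x}, x ∈ N.rootFace → x ≠ p → x ≠ q → x ∈ M.rootFace ∧ x ∈ M.darts := by grind
      [hMC.rootFace_sub]
  refine ⟨⟨htri, hri, fun x hx => ?_, fun x hx => ?_, fun x hx => ?_, htop ▸ hact.2 (.inr (.inl rfl)),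
    fun hx => ?_, fun x hx hxa hxb => ?_, fun x hxa hx => ?_⟩, fun x hx hxa hxw => ?_⟩
  · grind [hMC.rev_mem]
  · rcases hact.1 hx with h1 | rfl | rfl
    · grind [hN.active_rev, hMC.rev_mem]
    · exact hact.2 (.inr (.inr hMrd))
    · exact hact.2 (.inr (.inl hMrrd))
  · grind [hN.active_outer, hMC.rev_mem]
  · grind [hN.root]
  · have h1 : x ≠ d := fun e => hxb.2 (e ▸ hMbw.2)
    have hxD := hMC.rootFace_sub hx
    have hxN := hrf'.2 (.inl ⟨hx, h1⟩)
    have hxa' := ((hact.1 hxa).resolve_right fun h4 => h4.elim h1 fun h4 =>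
      hxb.1 ((hMw' hxD).2 (h4 ▸ hdw))).1
    have hya := hN.right x hxN hxa' ⟨fun h4 => hxb.1 ((hMw' hxD).2 h4), fun h4 => hxb.2 (by
      grind [hMC.rev_mem])⟩
    have hy := next_mem_rootFace.2 hxN
    by_cases hyp : N.next x = p
    · grind
    · have h5 := hout hy hyp fun e => ((hmem _).1 hxD).2.1 (N.next.injective (e.trans hqe.symm))
      have h4 : M.next x = N.next x := hnext.2 (hc1 h5.2 (hfx hy hdi)
        fun e => ((hmem _).1 hxD).2.2.1 (N.next.injective e)).symm
      grind
  · obtain ⟨K, hK⟩ := exists_pathEnd htri hri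
    rcases hact.1 hxa with ⟨hxa, hxD⟩ | rfl | rfl
    · obtain ⟨hent, hentK⟩ := glueTriAt_entry htri hri hF hK
      rw [← hE'] at hent hentK
      obtain ⟨k, hk, hkx⟩ := hN.path x hxa fun h1 => (hrf'.1 h1).elim (fun h1 => hx h1.1)
        fun h1 => ((hmem x).1 hxD).elim fun _ h4 => h1.elim h4.1 h4.2.1
      have hkK : k ≤ K := by
        grind
      rw [hent k hkK] at hkx
      rcases hkK.lt_or_eq with hkK | rfl
      · refine ⟨k, hK.onPathAt.2 ⟨hkK, ?_⟩⟩
        grind [PercMap.glueAt_mem_faceOf]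
      · grind [hK.eq_top, PercMap.mem_faceOf_comm, hN.tri.mem_faceOf_inner]
    · exact absurd hdf hx
    · rw [← hMrd, ← htop] at hx ⊢
      obtain ⟨m, rfl, h1⟩ := exists_top_triangle htri hri hK hx
      exact ⟨m, hK.onPathAt.2 ⟨by omega, PercMap.mem_faceOf_comm.1 h1⟩⟩
  · have h1 : x ≠ d := fun e => hMbw.1 (e ▸ hxw.1)
    have hxD := hMC.rootFace_sub hx
    have hxN := hrf'.2 (.inl ⟨hx, h1⟩)
    have hxa' := ((hact.1 hxa).resolve_right fun h4 => h4.elim h1 fun h4 =>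
      hMbw.1 (by rw [← hMrrd, ← h4]; exact hxw.2)).1
    have hya := hN.left x hxN hxa' ⟨(hMw' hxD).1 hxw.1, by
      rw [← hMrev hxD, ← hMw' (hMC.rev_mem _ hxD)]; exact hxw.2⟩
    obtain ⟨y, rfl⟩ := N.next.surjective x
    rw [Equiv.symm_apply_apply] at hya
    have hy := next_mem_rootFace.1 hxN
    by_cases hyq : y = q
    · grind
    · have h4 : M.next y = N.next y :=
        hnext.2 (hc1 hxD h1 fun e => hyq (N.next.injective e)).symm
      grind

end MarkedMap
/-! ### Undoing a recoloring -/

namespace PercMap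

/-- The percolation path enters a triangle through the dart that precedes `y`, so that the origin
of `y` is on the left of the path there. -/
def PathLeft (M : PercMap) (y : ℕ) : Prop :=
  ∃ k, (∀ i ≤ k, M.entry i ∉ M.rootFace) ∧ M.next (M.entry k) = y

theorem PathEnd.pathLeft {M : PercMap} {K y : ℕ} (hK : M.PathEnd K) :
    M.PathLeft y ↔ ∃ l < K, M.next (M.entry l) = y := by
  refine exists_congr fun k => ?_
  have := hK.onPathAt (k := k) (f := {x | M.next x = y})
  exact this

theorem map_pathLeft (π : Perm ℕ) {M : PercMap} {y : ℕ} :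
    (M.map π).PathLeft (π y) ↔ M.PathLeft y := by
  unfold PathLeft
  simp only [map_entry, map_mem_rootFace, map_next, π.injective.eq_iff]

end PercMap

namespace MarkedMap

open PercMap

variable {N : MarkedMap}

/-- The third vertex of the triangle at the top-edge is white: a step that colors no vertex in black
creates such a map. -/
def Third (N : MarkedMap) : Prop := N.next (N.next (N.rev N.top)) ∈ N.white

/-- Recoloring the top-left vertex in black and making the next outer edge active. -/
noncomputable def unrecolor (N : MarkedMap) : MarkedMap :=
  ⟨{ N.toPercMap with white := N.white \ N.vertexOf (N.next N.top) },
    N.active ∪ {N.next N.top, N.rev (N.next N.top)}⟩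

theorem unrecolor_map (hN : N.TBRight) (π : Perm ℕ) : (N.map π).unrecolor = N.unrecolor.map π := by
  have e4 : (N.map π).active = π '' N.active := rfl
  have e5 : (N.map π).white = π '' N.white := rfl
  have hr : ∀ x, (N.map π).rev (π x) = π (N.rev x) := PercMap.map_rev π
  have hn : ∀ x, (N.map π).next (π x) = π (N.next x) := PercMap.map_next π
  have hv : ∀ x, (N.map π).vertexOf (π x) = π '' (N.vertexOf x) := PercMap.map_vertexOf π
  unfold unrecolor
  rw [map_top π hN.tri hN.ri, hn, hr, hv, e4, e5, ← Set.image_sdiff π.injective]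
  unfold map PercMap.map
  simp only [MarkedMap.mk.injEq, true_and]
  rw [Set.image_union]
  simp [Set.image_insert_eq]

theorem TBRight.entry_third (hN : N.TBRight) (hi : N.rev N.top ∉ N.rootFace) (hT : N.Third) {m : ℕ}
    (hK : N.PathEnd (m + 1)) : N.entry m = N.next (N.rev N.top) := by
  have hC := hN.comb
  have hb := hK.bw hN.tri hN.ri (Nat.le_succ m)
  have hD := hC.rev_mem _ hN.top_darts
  have h1 := PercMap.mem_faceOf_comm.1 (hK.top_face hN.tri rfl hN.ri)
  rcases (hN.tri.mem_faceOf_inner hD hi).1 h1 with h2 | h2 | h2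
  · exact absurd hN.top_bw.2 (h2 ▸ hb.1)
  · exact h2
  · rw [h2] at hb; exact absurd hT hb.1

theorem TBRight.unrecolor (hN : N.TBRight) (hi : N.rev N.top ∉ N.rootFace)
    (hP : ∀ y ∈ N.vertexOf (N.next N.top), ¬ N.PathLeft y) (how : N.WhiteEdge (N.next N.top))
    (hl : ∀ x ∈ N.rootFace, x ∈ N.active → N.WhiteEdge x →
      N.next.symm x ∈ N.active ∨ N.next.symm x = N.next N.top) :
    N.unrecolor.TB ∧ N.unrecolor.top = N.next N.top ∧
    ∀ K, N.PathEnd (K + 1) → ∀ l ≤ K, N.unrecolor.entry l = N.entry l := by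
  have hC := hN.comb
  have hb := hN.top_bw
  have hof := next_mem_rootFace.2 hN.top_mem
  have hr := hN.ri.1
  have hvo : ∀ {x}, x ∈ N.rootFace → x ∈ N.vertexOf (N.next N.top) → x = N.next N.top := by grind
      [hN.tri.outer_eq]
  have hvo' : ∀ {x}, x ∈ N.rootFace → N.rev x ∈ N.vertexOf (N.next N.top) → x = N.top := fun hx h =>
    N.next.injective (hvo (next_mem_rootFace.2 hx) (hC.next_mem_vertexOf_iff.2 h))
  have hro : N.root ≠ N.next N.top := fun e => hr.2 (e ▸ how.2)
  have hvr : N.root ∉ N.vertexOf (N.next N.top) := fun h => hro (hvo root_mem_rootFace h)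
  have hVw : ∀ {x}, x ∈ N.vertexOf (N.next N.top) → x ∈ N.white := fun h =>
    (hN.tri.white_vertexOf h).2 how.1
  have hoi : N.rev (N.next N.top) ∉ N.rootFace := fun h => by
    rcases ((hN.tri.single_edge hof h).2.2 N.top).1 hN.top_darts with e | e
    · exact hb.1 (e ▸ how.1)
    · exact hb.1 (e ▸ how.2)
  have hrv : N.rev (N.next N.top) ∉ N.vertexOf (N.next N.top) :=
    hN.tri.rev_not_vertexOf (hC.rootFace_sub hof)
  have htv : N.rev N.top ∈ N.vertexOf (N.next N.top) :=
    hC.next_mem_vertexOf_iff.1 (self_mem_vertexOf _)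
  set M := N.unrecolor with hM
  have e1 : M.rev = N.rev := rfl
  have e2 : M.next = N.next := rfl
  have e3 : M.rootFace = N.rootFace := rfl
  have e4 : M.root = N.root := rfl
  have e5 : M.faceOf = N.faceOf := rfl
  have hw : ∀ x, x ∈ M.white ↔ x ∈ N.white ∧ x ∉ N.vertexOf (N.next N.top) := fun x => Iff.rfl
  have hA : ∀ x, x ∈ M.active ↔ x ∈ N.active ∨ x = N.next N.top ∨ x = N.rev (N.next N.top) :=
    fun x => Iff.rfl
  have hD : M.darts = N.darts := rfl
  have htri : M.IsTriangulation := by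
    have h := hN.tri
    refine ⟨⟨h.rev_mem, h.rev_ne, h.rev_rev, h.rev_fix, h.next_mem, h.next_fix, h.root_mem,
      h.connected, h.euler, fun x hx => h.white_sub hx.1, fun d hd => ?_⟩, h.triangle, h.loopless,
      h.simple⟩
    exact and_congr (h.white_rot d hd) (not_congr rot_mem_vertexOf)
  have hri : M.RootInterface := by
    refine ⟨⟨⟨hr.1, hvr⟩, fun h => hr.2 h.1⟩, fun d hd hdr h => ?_⟩
    by_cases h1 : N.rev d ∈ N.white
    · have h2 : N.rev d ∈ N.vertexOf (N.next N.top) := by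
        grind
      exact hb.1 (hvo' hd h2 ▸ h.1.1)
    · exact hN.ri.2 d hd hdr ⟨h.1.1, h1⟩
  clear_value M
  have htop : M.top = N.next N.top := by
    refine (PercMap.eq_top htri hri (by rw [e3]; exact hof) ⟨fun h => ?_, ?_⟩).symm
    · exact ((hw _).1 h).2 (self_mem_vertexOf _)
    · rw [e1, hw]; exact ⟨how.2, hrv⟩
  have hent : ∀ K, N.PathEnd (K + 1) → ∀ l ≤ K, M.entry l = N.entry l := by
    intro K hK l hl
    refine PercMap.entry_congr (k := K) (by rw [e1, e4]) (fun l hl => ?_) hl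
    refine PercMap.interfaceStep_congr' hC (by rw [e2]) (by rw [e2]) ?_ (by rw [e1, hC.rev_rev])
    rw [hw, and_iff_left_iff_imp]
    intro h1 h2
    refine hP _ ?_ (hK.pathLeft.2 ⟨l + 1, by omega, rfl⟩)
    rw [entry_succ, interfaceStep_white h1, hC.next_mem_vertexOf_iff, hC.rev_rev]
    exact h2
  refine ⟨⟨⟨htri, hri, ?_, ?_, ?_, ?_, ?_, ?_, ?_⟩, ?_⟩, htop, hent⟩
  · grind [hN.active_sub, hC.rootFace_sub, hC.rev_mem]
  · grind [hN.active_rev, hC.rev_rev]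
  · grind [hN.active_outer, hC.rev_rev]
  · grind
  · grind [hN.root, hC.rev_rev, root_mem_rootFace]
  · intro x hx hxa hxb
    rw [e3] at hx
    rw [e2, hA]
    have hxb' : x ∉ M.white ∧ N.rev x ∉ M.white := e1 ▸ hxb
    rw [hw, hw] at hxb'
    by_cases h1 : x ∈ N.vertexOf (N.next N.top)
    · have := hvo hx h1
      exact absurd ⟨this ▸ how.2, this ▸ hrv⟩ hxb'.2
    · by_cases h2 : N.rev x ∈ N.vertexOf (N.next N.top)
      · grind
      · refine .inl (hN.right x hx ?_ ⟨fun h => hxb'.1 ⟨h, h1⟩, fun h => hxb'.2 ⟨h, h2⟩⟩)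
        grind [self_mem_vertexOf]
  · intro x hxa hx
    rw [e5]
    rw [e3] at hx
    obtain ⟨K, hK⟩ := exists_pathEnd htri hri
    obtain ⟨K', hK'⟩ := exists_pathEnd hN.tri hN.ri
    obtain ⟨m, rfl, -⟩ := exists_top_triangle hN.tri hN.ri hK' hi
    rcases (hA x).1 hxa with h | rfl | rfl
    · obtain ⟨k, hk⟩ := hN.path x h hx
      obtain ⟨h1, h2⟩ := hK'.onPathAt.1 hk
      refine ⟨k, fun i hik => ?_, ?_⟩
      · rw [hent m hK' i (by omega), e3]; exact hk.1 i hik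
      · grind
    · exact absurd hof hx
    · rw [← e1, ← htop] at hx ⊢
      obtain ⟨n, rfl, h1⟩ := exists_top_triangle htri hri hK (by rw [e3]; exact hx)
      exact ⟨n, hK.onPathAt.2 ⟨by omega, by
        rw [← e5]; exact PercMap.mem_faceOf_comm.1 h1⟩⟩
  · intro x hx hxa hxw
    rw [e3] at hx
    have hx1 := (hw _).1 hxw.1
    have hx2 := (hw _).1 (e1 ▸ hxw.2)
    rw [e2, hA]
    rcases (hA x).1 hxa with h | rfl | rfl
    · exact (hl x hx h ⟨hx1.1, hx2.1⟩).imp_right .inl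
    · exact absurd (self_mem_vertexOf _) hx1.2
    · exact absurd hx hoi

theorem exists_pow_top (hN : N.TBRight) {x : ℕ} (hx : x ∈ N.rootFace) :
    ∃ n : ℕ, (N.next ^ n) (N.next N.top) = x :=
  exists_nat_pow_eq hN.comb.next_fix
    ((PercMap.mem_rootFace.1 (next_mem_rootFace.2 hN.top_mem)).symm.trans (PercMap.mem_rootFace.1 hx))

/-- The case of a map obtained by recoloring the top-right vertex and making the top-edge
inactive. -/
theorem TB.stepC_unrecolor (hN : N.TB) (hi : N.rev N.top ∉ N.rootFace)
    (hE : ¬ N.EndsA) (hP : ∀ y ∈ N.vertexOf (N.next N.top), ¬ N.PathLeft y) :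
    N.unrecolor.TB ∧ N.unrecolor.HasActiveRight ∧ N.unrecolor.stepC = N ∧
    N.next N.top ∈ N.darts ∧ N.next N.top ∉ N.active := by
  have hC := hN.comb
  have hb := hN.top_bw
  have hof := next_mem_rootFace.2 hN.top_mem
  have hoD := hC.rootFace_sub hof
  obtain ⟨K, hK⟩ := exists_pathEnd hN.tri hN.ri
  obtain ⟨m, rfl, htm⟩ := exists_top_triangle hN.tri hN.ri hK hi
  have hro : N.root ≠ N.next N.top := by
    intro e
    refine hP (N.next (N.rev N.root)) ?_ (hK.pathLeft.2 ⟨0, by omega, by rw [PercMap.entry_zero]⟩)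
    rw [hC.next_mem_vertexOf_iff, hC.rev_rev, ← e]
    exact self_mem_vertexOf _
  have how : N.WhiteEdge (N.next N.top) := by
    have h1 : N.next N.top ∈ N.white := by rw [hN.tri.white_next]; exact hb.2
    refine ⟨h1, ?_⟩
    by_contra h2
    exact hN.ri.2 _ hof hro.symm ⟨h1, h2⟩
  have hoi : N.rev (N.next N.top) ∉ N.rootFace := fun h => by
    rcases ((hN.tri.single_edge hof h).2.2 N.top).1 hN.top_darts with e | e
    · exact hb.1 (e ▸ how.1)
    · exact hb.1 (e ▸ how.2)
  have hoa : N.next N.top ∉ N.active := by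
    intro ha
    obtain ⟨l, hl⟩ := hN.path _ (hN.active_rev _ ha) hoi
    obtain ⟨hlK, hl⟩ := hK.onPathAt.1 hl
    have hD := hC.rev_mem _ hoD
    have hlb := hK.bw hN.tri hN.ri hlK.le
    -- the path enters this triangle through the edge that does not contain the top-left vertex
    have hle : N.entry l = N.next (N.next (N.rev (N.next N.top))) := by
      rcases (hN.tri.mem_faceOf_inner hD hoi).1 hl with h2 | h2 | h2
      · exact absurd how.2 (h2 ▸ hlb.1)
      · refine absurd ?_ hlb.1
        rw [h2, hN.tri.white_next, hC.rev_rev]; exact how.1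
      · exact h2
    have h3 := (hN.tri.next3 hD hoi).1
    have hnn : N.next (N.next (N.entry l)) = N.next (N.rev (N.next N.top)) := by rw [hle, h3]
    have hes : N.entry (l + 1) = N.rev (N.next (N.rev (N.next N.top))) := by
      rw [entry_succ, interfaceStep_white, hnn]
      rw [hnn, hN.tri.white_next, hC.rev_rev]; exact how.1
    rcases (Nat.succ_le_of_lt hlK).lt_or_eq with h4 | h4
    · refine hP _ ?_ (hK.pathLeft.2 ⟨l + 1, h4, rfl⟩)
      grind [hC.next_mem_vertexOf_iff, hC.rev_rev, self_mem_vertexOf]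
    · refine hE ⟨_, hof, ha, how, ?_⟩
      grind [hK.eq_top, hN.tri, hN.ri, hC.rev_rev, PercMap.mem_faceOf_comm,
          PercMap.next_mem_faceOf, PercMap.self_mem_faceOf]
  have hnl : ∀ n, (N.next ^ n) (N.next N.top) ∈ N.active →
      ¬ N.WhiteEdge ((N.next ^ n) (N.next N.top)) := by
    intro n
    induction n with
    | zero => exact fun h => absurd h hoa
    | succ n ih =>
      intro ha hw
      have hx : (N.next ^ n) (N.next N.top) ∈ N.rootFace := by
        refine (PercMap.mem_rootFace.1 hof).trans ⟨n, by simp⟩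
      rw [pow_succ', Perm.mul_apply] at ha hw
      have hxa := hN.left _ (next_mem_rootFace.2 hx) ha hw
      rw [Equiv.symm_apply_apply] at hxa
      have hxw := hw.1
      rw [hN.tri.white_next] at hxw
      by_cases h1 : (N.next ^ n) (N.next N.top) ∈ N.white
      · exact ih hxa ⟨h1, hxw⟩
      · rw [PercMap.eq_top hN.tri hN.ri hx ⟨h1, hxw⟩] at ha
        exact hoa ha
  have hnl' : ∀ x ∈ N.rootFace, x ∈ N.active → ¬ N.WhiteEdge x := fun x hx => by
    obtain ⟨n, rfl⟩ := exists_pow_top hN.toTBRight hx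
    exact hnl n
  obtain ⟨hTB, htop, -⟩ := hN.unrecolor hi hP how fun x hx hxa hxw => absurd hxw (hnl' x hx hxa)
  have htv : N.rev N.top ∈ N.vertexOf (N.next N.top) :=
    hC.next_mem_vertexOf_iff.1 (self_mem_vertexOf _)
  have hL : ¬ N.unrecolor.HasActiveLeft := by
    rintro ⟨x, hx, hxa | rfl | rfl, hxw⟩
    · exact hnl' x hx hxa ⟨hxw.1.1, hxw.2.1⟩
    · exact hxw.1.2 (self_mem_vertexOf _)
    · exact hoi hx
  refine ⟨hTB, ⟨N.top, hN.top_mem, .inl hN.top_active, fun h => hb.1 h.1, fun h => h.2 htv⟩, ?_, hoD,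
    hoa⟩
  unfold stepC
  rw [if_neg fun h => hL h.1, recolored, if_pos (.inl hL), htop]
  have e1 : N.unrecolor.active \ {N.next N.top, N.rev (N.next N.top)} = N.active := by
    refine Set.union_sdiff_cancel_right ?_
    rintro x ⟨hx, rfl | rfl⟩
    · exact (hoa hx).elim
    · exact (hoa (by have := hN.active_rev _ hx; rwa [hC.rev_rev] at this)).elim
  have e2 : N.unrecolor.white ∪ N.unrecolor.vertexOf (N.next N.top) = N.white :=
    Set.sdiff_union_of_subset fun x hx => (hN.tri.white_vertexOf hx).2 how.1
  change (⟨⟨N.darts, N.rev, N.next, N.root, _⟩, N.unrecolor.active \ {N.next N.top,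
    N.rev (N.next N.top)}⟩ : MarkedMap) = N
  rw [e1, e2]

end MarkedMap
/-! ### Cutting along an inner edge -/

namespace PercMap

/-- Cutting along the edge of the dart `h` and opening it at the outer corner after the dart `t`:
the new outer darts `d` and `f` follow `t`. -/
def unzipAt (N : PercMap) (t h d f : ℕ) : PercMap where
  darts := N.darts ∪ {d, f}
  rev := Equiv.swap f h * (Equiv.swap d (N.rev h) * (Equiv.swap (N.rev h) h * N.rev))
  next := Equiv.swap d f * (Equiv.swap f (N.next t) * N.next)
  root := N.root
  white := N.white ∪ {d, f}

theorem unzipAt_map (π : Perm ℕ) (N : PercMap) (t h d f : ℕ) :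
    (N.map π).unzipAt (π t) (π h) (π d) (π f) = (N.unzipAt t h d f).map π := by
  have hr : ∀ x, (N.map π).rev (π x) = π (N.rev x) := map_rev π
  have hn : ∀ x, (N.map π).next (π x) = π (N.next x) := map_next π
  unfold unzipAt
  rw [hr, hn]
  unfold map
  simp only [mk.injEq, true_and]
  refine ⟨?_, ?_, ?_, ?_⟩
  · ext x
    obtain ⟨x, rfl⟩ := π.surjective x
    simp
  · simp only [map_mul_swap]
  · simp only [map_mul_swap]
  · rw [Set.image_union]; simp [Set.image_insert_eq]

theorem unzipAt_zipAt {M : PercMap} (hM : M.Comb) {x y t : ℕ} (hz : M.Zippable x y) (ht : M.next t = x)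
    (W : Set ℕ) : (M.zipAt x y W).unzipAt t (M.rev y) x y = { M with white := W ∪ {x, y} } := by
  obtain ⟨-, -, -, v4, -, v6, v7, v8, v9⟩ := zipAt_values (W := W) hM hz
  unfold unzipAt
  rw [v4, v8 t ht]
  simp only [mk.injEq]
  refine ⟨?_, ?_, ?_, rfl, rfl⟩
  · refine Finset.sdiff_union_of_subset ?_
    grind [hz.mem, hz.mem_y]
  · change _ * (_ * (_ * (_ * M.rev))) = M.rev
    simp [← mul_assoc]
  · ext z
    simp only [Perm.mul_apply]
    have hyx := hz.ne
    have hnx := hz.next_x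
    have hny := hz.next_y
    by_cases h1 : M.next z = x
    · grind
    · by_cases h2 : z = x
      · grind
      · by_cases h3 : z = y
        · rw [h3, v7, Equiv.swap_apply_left, Equiv.swap_apply_of_ne_of_ne hny ?_]
          exact fun e => hyx (M.next.injective (e.trans hnx.symm))
        · have h4 : M.next z ≠ y := fun e => h2 (M.next.injective (e.trans hnx.symm))
          rw [v9 z h2 h3 h1, Equiv.swap_apply_of_ne_of_ne h4 fun e => h3 (M.next.injective e),
            Equiv.swap_apply_of_ne_of_ne h1 h4]

/-- The edge of the dart `h` can be cut, with new darts `d` and `f`. -/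
structure Cuttable (N : PercMap) (t h d f : ℕ) : Prop where
  comb : N.Comb
  d_notMem : d ∉ N.darts
  f_notMem : f ∉ N.darts
  ne : d ≠ f
  t_mem : t ∈ N.darts
  h_mem : h ∈ N.darts
  h_ne : h ≠ t
  rev_ne : N.rev h ≠ t

namespace Cuttable

variable {N : PercMap} {t h d f : ℕ} (c : N.Cuttable t h d f)
include c

theorem mem {x : ℕ} : x ∈ (N.unzipAt t h d f).darts ↔ x ∈ N.darts ∨ x = d ∨ x = f := by
  simp only [unzipAt, Finset.mem_union, Finset.mem_insert, Finset.mem_singleton]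

theorem values : (N.unzipAt t h d f).rev d = N.rev h ∧ (N.unzipAt t h d f).rev (N.rev h) = d ∧
    (N.unzipAt t h d f).rev f = h ∧ (N.unzipAt t h d f).rev h = f ∧
    (∀ x ∈ N.darts, x ≠ h → x ≠ N.rev h → (N.unzipAt t h d f).rev x = N.rev x) ∧
    (N.unzipAt t h d f).next t = d ∧ (N.unzipAt t h d f).next d = f ∧
    (N.unzipAt t h d f).next f = N.next t ∧
    ∀ x ∈ N.darts, x ≠ t → (N.unzipAt t h d f).next x = N.next x := by
  obtain ⟨hC, hd, hf, hdf, ht, hh, hht, hrt⟩ := c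
  have hg := hC.rev_mem h hh
  have hgh := hC.rev_ne h hh
  have hrr := hC.rev_rev
  have n1 : ∀ {x}, x ∈ N.darts → x ≠ d := fun hx e => hd (e ▸ hx)
  have n2 : ∀ {x}, x ∈ N.darts → x ≠ f := fun hx e => hf (e ▸ hx)
  have hnt := hC.next_mem_iff.2 ht
  refine ⟨?_, ?_, ?_, ?_, fun x hx h1 h2 => ?_, ?_, ?_, ?_, fun x hx h1 => ?_⟩ <;>
    simp only [unzipAt, Perm.mul_apply]
  · grind [hC.rev_fix]
  · grind
  · grind [hC.rev_fix, hdf.symm]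
  · grind
  · grind [hC.rev_mem]
  · grind
  · grind [hC.next_fix]
  · grind [hC.next_fix]
  · have hx' := hC.next_mem_iff.2 hx
    rw [Equiv.swap_apply_of_ne_of_ne (n2 hx') fun e => h1 (N.next.injective e),
      Equiv.swap_apply_of_ne_of_ne (n1 hx') (n2 hx')]

theorem unzipAt_comb : (N.unzipAt t h d f).Comb := by
  obtain ⟨v1, v2, v3, v4, v5, v6, v7, v8, v9⟩ := c.values
  have hm := fun {x : ℕ} => c.mem (x := x)
  have hr : (N.unzipAt t h d f).root = N.root := rfl
  have e1 : (N.unzipAt t h d f).rev =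
    Equiv.swap f h * (Equiv.swap d (N.rev h) * (Equiv.swap (N.rev h) h * N.rev)) := rfl
  have e2 : (N.unzipAt t h d f).next = Equiv.swap d f * (Equiv.swap f (N.next t) * N.next) := rfl
  obtain ⟨hC, hd, hf, hdf, ht, hh, hht, hrt⟩ := c
  have hg := hC.rev_mem h hh
  have hrr := hC.rev_rev
  generalize N.unzipAt t h d f = R at *
  have hrev : ∀ x ∈ R.darts, R.rev x ∈ R.darts ∧ R.rev x ≠ x ∧ R.rev (R.rev x) = x := by
    grind [hC.rev_mem, hC.rev_ne]
  have hfix : ∀ x ∉ R.darts, R.rev x = x ∧ R.next x = x := by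
    intro x hx
    rw [hm] at hx
    push Not at hx
    have n1 : ∀ {y}, y ∈ N.darts → x ≠ y := by grind
    rw [e1, e2]
    simp only [Perm.mul_apply]
    rw [hC.rev_fix x hx.1, hC.next_fix x hx.1, Equiv.swap_apply_of_ne_of_ne (n1 hg) (n1 hh),
      Equiv.swap_apply_of_ne_of_ne hx.2.1 (n1 hg), Equiv.swap_apply_of_ne_of_ne hx.2.2 (n1 hh),
      Equiv.swap_apply_of_ne_of_ne hx.2.2 (n1 (hC.next_mem_iff.2 ht)),
      Equiv.swap_apply_of_ne_of_ne hx.2.1 hx.2.2]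
    exact ⟨rfl, rfl⟩
  refine ⟨fun x hx => (hrev x hx).1, fun x hx => (hrev x hx).2.1, fun x => ?_,
    fun x hx => (hfix x hx).1, fun x hx => (hfix x hx).2, hm.2 (.inl (hr ▸ hC.root_mem))⟩
  grind

theorem zippable : (N.unzipAt t h d f).Zippable d f := by
  obtain ⟨v1, -, v3, -, -, -, v7, v8, v9⟩ := c.values
  have hr : (N.unzipAt t h d f).root = N.root := rfl
  obtain ⟨hC, hd, hf, hdf, ht, hh, hht, hrt⟩ := id c
  have hg := hC.rev_mem h hh
  have n1 : ∀ {x}, x ∈ N.darts → x ≠ d := fun hx e => hd (e ▸ hx)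
  refine ⟨c.mem.2 (.inr (.inl rfl)), v7, hdf.symm, ?_, ?_, ?_, ?_, ?_, ?_⟩
  · rw [v1]; exact fun e => hf (e ▸ hg)
  · rw [v8]; exact n1 (hC.next_mem_iff.2 ht)
  · rw [v1, v9 _ hg hrt]; exact n1 (hC.next_mem_iff.2 hg)
  · rw [v3, v9 _ hh hht]; exact n1 (hC.next_mem_iff.2 hh)
  · exact fun e => hd (e ▸ hr ▸ hC.root_mem)
  · exact fun e => hf (e ▸ hr ▸ hC.root_mem)

theorem zipAt_unzipAt (W : Set ℕ) : (N.unzipAt t h d f).zipAt d f W = { N with white := W } := by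
  obtain ⟨v1, -, v3, -, -, v6, v7, v8, v9⟩ := c.values
  have hCR := c.unzipAt_comb
  have hz := c.zippable
  have e1 : (N.unzipAt t h d f).rev =
    Equiv.swap f h * (Equiv.swap d (N.rev h) * (Equiv.swap (N.rev h) h * N.rev)) := rfl
  have hD : (N.unzipAt t h d f).darts = N.darts ∪ {d, f} := rfl
  obtain ⟨-, -, -, -, -, z6, z7, z8, z9⟩ := zipAt_values (W := W) hCR hz
  have hn : ((N.unzipAt t h d f).zipAt d f W).next = N.next := by
    obtain ⟨hC, hd, hf, hdf, ht, hh, hht, hrt⟩ := id c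
    ext x
    by_cases hx : x ∈ N.darts
    · by_cases h1 : x = t
      · rw [h1, z8 t v6, v8]
      · rw [z9 x (fun e => hd (e ▸ hx)) (fun e => hf (e ▸ hx)), v9 x hx h1]
        rw [v9 x hx h1]
        exact fun e => hd (e ▸ hC.next_mem_iff.2 hx)
    · rw [hC.next_fix x hx]
      by_cases h1 : x ∈ (N.unzipAt t h d f).darts
      · grind
      · exact (zipAt_comb hCR hz).next_fix x fun h2 => h1 (zipAt_mem.1 h2).1
  have hr : ((N.unzipAt t h d f).zipAt d f W).rev = N.rev := by
    simp only [zipAt, v1, v3]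
    rw [e1]
    simp [← mul_assoc]
  have hd' : ((N.unzipAt t h d f).zipAt d f W).darts = N.darts := by
    have := c.d_notMem
    have := c.f_notMem
    simp only [zipAt, hD]
    grind
  generalize hE : (N.unzipAt t h d f).zipAt d f W = E at *
  have hw : E.white = W := by rw [← hE]; rfl
  have hro : E.root = N.root := by rw [← hE]; rfl
  obtain ⟨D, r, n, o, w⟩ := E
  grind

end Cuttable

variable {N : PercMap}

/-- Among the darts `y` with the same origin as the top-left one which satisfy `PathLeft`, the dart
`h` is the first one clockwise from the top-edge. -/
structure CutAt (N : PercMap) (h k : ℕ) : Prop where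
  left : N.PathLeft h
  pow : (N.rot ^ k) h = N.rev N.top
  min : ∀ j < k, ∀ y, N.PathLeft y → (N.rot ^ j) y ≠ N.rev N.top

theorem exists_cutAt (hC : N.Comb) {y : ℕ} (hy : y ∈ N.vertexOf (N.next N.top)) (hP : N.PathLeft y) :
    ∃ h k, N.CutAt h k := by
  classical
  have h1 : ∃ k, ∃ y, N.PathLeft y ∧ (N.rot ^ k) y = N.rev N.top := by
    rw [hC.vertexOf_next] at hy
    obtain ⟨k, hk⟩ := exists_nat_pow_eq hC.rot_fix (mem_vertexOf.1 hy).symm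
    exact ⟨k, y, hP, hk⟩
  obtain ⟨h, hh, hk⟩ := Nat.find_spec h1
  exact ⟨h, _, hh, hk, fun j hj y hy e => Nat.find_min h1 hj ⟨y, hy, e⟩⟩

theorem CutAt.unique {h k h' k' : ℕ} (c : N.CutAt h k) (c' : N.CutAt h' k') : h = h' := by
  obtain rfl : k = k' := le_antisymm (not_lt.1 fun hk => c.min _ hk _ c'.left c'.pow)
    (not_lt.1 fun hk => c'.min _ hk _ c.left c.pow)
  exact (N.rot ^ k).injective (c.pow.trans c'.pow.symm)

theorem CutAt.map {h k : ℕ} (hT : N.IsTriangulation) (hR : N.RootInterface) (c : N.CutAt h k)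
    (π : Perm ℕ) : (N.map π).CutAt (π h) k := by
  have hrot : ∀ j y, ((N.map π).rot ^ j) (π y) = π ((N.rot ^ j) y) := by
    intro j y
    induction j with
    | zero => rfl
    | succ j ih =>
      rw [pow_succ', pow_succ', Perm.mul_apply, Perm.mul_apply, ih, rot_apply, rot_apply, map_rev,
        map_next]
  refine ⟨(map_pathLeft π).2 c.left, ?_, fun j hj y hy => ?_⟩
  · rw [hrot, map_top π hT hR, map_rev, c.pow]
  · obtain ⟨y, rfl⟩ := π.surjective y
    rw [hrot, map_top π hT hR, map_rev]
    exact fun e => c.min j hj y ((map_pathLeft π).1 hy) (π.injective e)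

/-- The edge of the inner dart `h`, which leads to the top-left vertex, can be cut: the path enters
the triangle of index `l` through the dart that precedes `h`, and ends in the triangle of index `m`
at the top-edge. The vertex of `d` after the cut takes the corners of the top-left vertex between
the top-edge and `h`. -/
structure Opening (N : PercMap) (h d f l m : ℕ) : Prop where
  tri : N.IsTriangulation
  ri : N.RootInterface
  cut : N.Cuttable N.top h d f
  pathEnd : N.PathEnd (m + 1)
  lt : l < m
  next_entry : N.next (N.entry l) = h
  entry_m : N.entry m = N.next (N.rev N.top)
  inner : N.rev N.top ∉ N.rootFace
  white : N.WhiteEdge h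
  vertex : h ∈ N.vertexOf (N.next N.top)
  sub : ∀ y ∈ (N.unzipAt N.top h d f).vertexOf d, y = d ∨
    (y ∈ N.vertexOf (N.next N.top) ∧ ¬ N.PathLeft y ∧ y ≠ N.next N.top)

theorem CutAt.opening {h k m d f : ℕ} (c : N.CutAt h k) (hT : N.IsTriangulation)
    (hR : N.RootInterface) (hi : N.rev N.top ∉ N.rootFace) (hK : N.PathEnd (m + 1))
    (hm : N.entry m = N.next (N.rev N.top)) (hd : d ∉ N.darts) (hf : f ∉ N.darts) (hdf : d ≠ f) :
    ∃ l, N.Opening h d f l m := by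
  have hC := hT.comb
  have htf := top_mem hT hR
  have ht := hC.rootFace_sub htf
  have hrt := hC.rev_mem _ ht
  have hb := top_bw hT hR
  obtain ⟨l, hl, rfl⟩ := hK.pathLeft.1 c.left
  obtain ⟨-, hpow, hmin⟩ := id c
  have hlb := hK.bw hT hR hl.le
  have hlD := hK.mem hT hR hl.le
  have hli := hK.inner l hl
  have hhi : N.next (N.entry l) ∉ N.rootFace := fun e => hli (next_mem_rootFace.1 e)
  have hhD := hC.next_mem_iff.2 hlD
  have h3 := (hT.next3 hrt hi).1
  have hv : N.next (N.entry l) ∈ N.vertexOf (N.next N.top) := by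
    rw [hC.vertexOf_next, mem_vertexOf_comm, mem_vertexOf, ← hpow]
    exact ⟨k, by simp⟩
  have hne : N.next (N.entry l) ≠ N.rev N.top := by
    intro e
    have h4 : l = m := by
      refine hK.face_inj hT hR hl (Nat.lt_succ_self m) ?_
      grind [next_mem_faceOf, self_mem_faceOf]
    grind [hT.next3]
  have hk : 0 < k := Nat.pos_of_ne_zero fun e => hne (by rw [← hpow, e]; rfl)
  have hP : ∀ i, 1 ≤ i → i ≤ k → ¬ N.PathLeft ((N.rot ^ i) (N.next (N.entry l))) := by
    intro i h1 h2 h4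
    refine hmin (k - i) (by omega) _ h4 ?_
    rw [← Perm.mul_apply, ← pow_add, Nat.sub_add_cancel h2, hpow]
  have hgt : N.rev (N.next (N.entry l)) ≠ N.top := by grind [hC.rev_rev]
  have hht : N.next (N.entry l) ≠ N.top := fun e => hhi (e ▸ htf)
  have hgv : N.rev (N.next (N.entry l)) ∉ N.vertexOf (N.next N.top) := by
    rw [← vertexOf_eq_iff.2 (mem_vertexOf_comm.1 hv)]
    exact hT.rev_not_vertexOf hhD
  have hlm : l ≠ m := by
    grind [hC.vertexOf_next, self_mem_vertexOf]
  -- otherwise the path would leave the triangle through the edge of `h`, hence with the top-left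
  -- vertex still on its left
  have hw : N.next (N.next (N.entry l)) ∈ N.white := by
    by_contra hw
    refine hP 1 le_rfl hk (hK.pathLeft.2 ⟨l + 1, by omega, ?_⟩)
    rw [entry_succ, interfaceStep_black hw, pow_one, rot_apply]
  have hcut : N.Cuttable N.top (N.next (N.entry l)) d f := ⟨hC, hd, hf, hdf, ht, hhD, hht, hgt⟩
  refine ⟨l, hT, hR, hcut, hK, by omega, rfl, hm, hi, ?_, hv, ?_⟩
  · have h4 : N.next (N.entry l) ∈ N.white := by rw [hT.white_next]; exact hlb.2
    exact ⟨h4, by rw [← hT.white_next]; exact hw⟩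
  · obtain ⟨v1, -, -, -, v5, v6, -, -, v9⟩ := hcut.values
    have hCR := hcut.unzipAt_comb
    generalize N.unzipAt N.top (N.next (N.entry l)) d f = R at *
    generalize N.next (N.entry l) = h at *
    have hvi : ∀ i, (N.rot ^ i) h ∈ N.vertexOf (N.next N.top) := fun i =>
      (mem_vertexOf.1 hv).trans ⟨i, by simp⟩
    intro y hy
    have key : y = d ∨ ∃ i, 1 ≤ i ∧ i ≤ k ∧ (N.rot ^ i) h = y := by
      refine mem_of_sameCycle hCR.rot_fix
        (S := {y | y = d ∨ ∃ i, 1 ≤ i ∧ i ≤ k ∧ (N.rot ^ i) h = y}) ?_ (mem_vertexOf.1 hy) (.inl rfl)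
      rintro x (rfl | ⟨i, h1, h2, rfl⟩)
      · refine .inr ⟨1, le_rfl, hk, ?_⟩
        rw [rot_apply, v1, v9 _ (hC.rev_mem _ hhD) hgt, pow_one, rot_apply]
      · have hxD : (N.rot ^ i) h ∈ N.darts :=
          (hC.vertexOf_sub (hvi i)).2 (hC.next_mem_iff.2 ht)
        have hxh : (N.rot ^ i) h ≠ h := by grind [c.left]
        have hxg : (N.rot ^ i) h ≠ N.rev h := by grind
        rw [rot_apply, v5 _ hxD hxh hxg]
        by_cases hik : i = k
        · grind [hC.rev_rev]
        · refine .inr ⟨i + 1, by omega, by omega, ?_⟩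
          rw [v9 _ (hC.rev_mem _ hxD), pow_succ', Perm.mul_apply, rot_apply]
          grind [c.left, hC.rev_rev]
    refine key.imp_right ?_
    rintro ⟨i, h1, h2, rfl⟩
    refine ⟨hvi i, hP i h1 h2, fun e => ?_⟩
    -- the corner at the top-edge comes just after the last one of these corners
    obtain ⟨i, rfl⟩ := Nat.exists_eq_add_of_le' h1
    refine hmin i (by omega) h c.left ?_
    rw [pow_succ', Perm.mul_apply, ← hC.rev_rev N.top, ← rot_apply] at e
    exact N.rot.injective e

namespace Opening

variable {h d f l m : ℕ} (o : N.Opening h d f l m)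
include o

theorem comb : N.Comb := o.tri.comb

theorem rev_h : N.rev h ∉ N.vertexOf (N.next N.top) := by
  rw [← vertexOf_eq_iff.2 (mem_vertexOf_comm.1 o.vertex)]
  exact o.tri.rev_not_vertexOf o.cut.h_mem

theorem next_notMem : N.next N.top ∉ (N.unzipAt N.top h d f).vertexOf d := fun hv =>
  (o.sub _ hv).elim
    (fun e => o.cut.d_notMem (e ▸ o.comb.next_mem_iff.2 o.cut.t_mem)) fun h1 => h1.2.2 rfl

theorem zip_eq : (N.unzipAt N.top h d f).zipAt d f N.white = N := o.cut.zipAt_unzipAt N.white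

theorem mem_vertexOf_iff {a z : ℕ} (ha : a ∈ N.darts) (hz : z ∈ N.darts) : z ∈ N.vertexOf a ↔
    z ∈ (N.unzipAt N.top h d f).vertexOf a ∨
    ((a ∈ (N.unzipAt N.top h d f).vertexOf d ∨ a ∈ (N.unzipAt N.top h d f).vertexOf (N.next N.top)) ∧
    (z ∈ (N.unzipAt N.top h d f).vertexOf d ∨
      z ∈ (N.unzipAt N.top h d f).vertexOf (N.next N.top))) := by
  grind [o.cut.d_notMem, o.cut.f_notMem, o.cut.values, zipAt_mem_vertexOf, o.cut.unzipAt_comb,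
      o.cut.zippable, o.next_notMem, o.zip_eq]

theorem mem_rootFace {z : ℕ} : z ∈ (N.unzipAt N.top h d f).rootFace ↔ z ∈ N.rootFace ∨ z = d ∨ z = f := by
  grind [zipAt_mem_rootFace, o.cut.unzipAt_comb, o.cut.zippable, o.cut.values, o.zip_eq, top_mem,
      o.tri, o.ri, next_mem_rootFace]

/-- The vertices of the cut map refine those of the initial map. -/
theorem vertex_h {z : ℕ} (hz : z ∈ N.darts) (hv : z ∈ N.vertexOf (N.rev h)) :
    z ∈ (N.unzipAt N.top h d f).vertexOf (N.rev h) := by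
  have hg := o.comb.rev_mem _ o.cut.h_mem
  refine ((o.mem_vertexOf_iff hg hz).1 hv).resolve_right ?_
  rintro ⟨h1 | h1, -⟩
  · rcases o.sub _ h1 with e | h2
    · exact o.cut.d_notMem (e ▸ hg)
    · exact o.rev_h h2.1
  · exact o.rev_h ((o.mem_vertexOf_iff (o.comb.next_mem_iff.2 o.cut.t_mem) hg).2 (.inl h1))

theorem f_mem_vertexOf : f ∈ (N.unzipAt N.top h d f).vertexOf (N.rev h) := by
  obtain ⟨-, v2, -, -, -, -, v7, -, -⟩ := o.cut.values
  generalize N.unzipAt N.top h d f = R at *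
  rw [← v7, ← v2, ← rot_apply, rot_mem_vertexOf]
  exact self_mem_vertexOf _

end Opening

theorem Comb.card_le (hM : N.Comb) : N.darts.card ≤ 2 * cyc N.darts N.rev := by
  classical
  have h1 : cyc N.darts N.rev = (N.darts.image N.edgeOf).card := by
    rw [← edges_ncard, edges, ← Finset.coe_image, Set.ncard_coe_finset]
  rw [h1]
  refine Finset.card_le_mul_card_image _ 2 fun e he => ?_
  obtain ⟨d, -, rfl⟩ := Finset.mem_image.1 he
  refine (Finset.card_le_card (t := {d, N.rev d}) fun x hx => ?_).trans Finset.card_le_two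
  have h2 := (Finset.mem_filter.1 hx).2
  have h3 := hM.mem_edgeOf.1 (edgeOf_eq_iff.1 h2.symm)
  simpa using h3

namespace Opening

variable {h d f l m : ℕ} (o : N.Opening h d f l m)
include o

/-- The cut map is planar. -/
theorem isPlanarMap : (N.unzipAt N.top h d f).IsPlanarMap := by
  have hC := o.comb
  have hT := o.tri
  have hCR := o.cut.unzipAt_comb
  have hz := o.cut.zippable
  have hm := fun {x : ℕ} => o.cut.mem (x := x)
  obtain ⟨v1, v2, v3, v4, v5, v6, v7, v8, v9⟩ := o.cut.values
  have hv : (N.unzipAt N.top h d f).next f ∉ (N.unzipAt N.top h d f).vertexOf d := by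
    rw [v8]; exact o.next_notMem
  have hE := zipAt_euler_iff hCR (W := N.white) hz hv
  have hconn := zipAt_connected_iff hCR (W := N.white) hz hv
  rw [o.zip_eq] at hE hconn
  have hw : ∀ x, x ∈ (N.unzipAt N.top h d f).white ↔ x ∈ N.white ∨ x = d ∨ x = f := fun x => Iff.rfl
  have hb := top_bw hT o.ri
  have hhw := o.white
  generalize N.unzipAt N.top h d f = R at *
  refine ⟨hCR.rev_mem, hCR.rev_ne, fun x _ => hCR.rev_rev x, hCR.rev_fix,
    fun x hx => hCR.next_mem_iff.2 hx, hCR.next_fix, hCR.root_mem, hconn.1 hT.connected,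
    hE.1 hT.euler, fun x hx => ?_, fun x hx => ?_⟩
  · grind [hT.white_sub]
  · have hg := hC.rev_mem _ o.cut.h_mem
    have n1 : N.next N.top ∈ N.white := by rw [hT.white_next]; exact hb.2
    rw [hw, hw, rot_apply]
    rcases hm.1 hx with hx | rfl | rfl
    · by_cases h1 : x = h
      · rw [h1, v4, v8]; exact iff_of_true (.inl n1) (.inl hhw.1)
      · by_cases h2 : x = N.rev h
        · rw [h2, v2, v7]; exact iff_of_true (.inr (.inr rfl)) (.inl hhw.2)
        · rw [v5 x hx h1 h2]
          by_cases h3 : N.rev x = N.top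
          · rw [h3, v6]
            refine iff_of_true (.inr (.inl rfl)) (.inl ?_)
            rw [← hC.rev_rev x, h3]; exact hb.2
          · have h4 : ∀ {y}, y ∈ N.darts → ¬ (y = d ∨ y = f) := by grind [o.cut.d_notMem,
              o.cut.f_notMem]
            have h5 := hC.rev_mem x hx
            rw [v9 _ h5 h3, or_iff_left (h4 (hC.next_mem_iff.2 h5)), or_iff_left (h4 hx)]
            exact hT.white_rot_iff x
    · rw [v1, v9 _ hg o.cut.rev_ne, hT.white_next, hC.rev_rev]
      exact iff_of_true (.inl hhw.1) (.inr (.inl rfl))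
    · rw [v3, v9 _ o.cut.h_mem o.cut.h_ne, hT.white_next]
      exact iff_of_true (.inl hhw.2) (.inr (.inr rfl))

/-- The vertex at the other end of the edge that is cut is an inner vertex: otherwise, this edge
would separate a triangle at the top-edge from the other triangle of the path that it is incident
to, whereas the path leads from one to the other. -/
theorem rev_h_inner {y : ℕ} (hy : y ∈ N.rootFace) : y ∉ N.vertexOf (N.rev h) := by
  intro hyv
  have hC := o.comb
  have hT := o.tri
  have hyD := hC.rootFace_sub hy
  have hP := o.isPlanarMap
  have hCR := o.cut.unzipAt_comb
  have hm := fun {x : ℕ} => o.cut.mem (x := x)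
  have hyR := o.vertex_h hyD hyv
  have hfR := o.f_mem_vertexOf
  have hyf := o.mem_rootFace.2 (.inl hy)
  have hff := o.mem_rootFace.2 (.inr (.inr rfl))
  obtain ⟨v1, v2, v3, v4, v5, v6, v7, v8, v9⟩ := o.cut.values
  have hb := top_bw hT o.ri
  have ht := top_mem hT o.ri
  have hhw := o.white
  have hK := o.pathEnd
  have hyf' : y ≠ f := fun e => o.cut.f_notMem (e ▸ hyD)
  have hyd' : y ≠ d := fun e => o.cut.d_notMem (e ▸ hyD)
  generalize N.unzipAt N.top h d f = R at *
  have hS : R.darts.card + 2 ≤ cyc R.darts R.rev + cyc R.darts R.next + cyc R.darts R.rot := by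
    grind [hCR.card_le, hP.euler, vertices_ncard, faces_ncard, edges_ncard]
  refine not_connected_of_pinch hCR.rev_fix hCR.next_fix hS (hm.2 (.inr (.inr rfl)))
    (hm.2 (.inl hyD)) hyf'.symm ((PercMap.mem_rootFace.1 hff).symm.trans
      (PercMap.mem_rootFace.1 hyf))
    ((mem_vertexOf.1 hfR).symm.trans (mem_vertexOf.1 hyR)) ?_
  set r := conn R.rev (Equiv.swap f y * R.next) with hr
  have hre : Equivalence r := conn_equivalence _ _
  have hr1 : ∀ u, r u (R.rev u) := conn_left _ _
  have hr2 : ∀ u, r u (Equiv.swap f y (R.next u)) := conn_right R.rev (Equiv.swap f y * R.next)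
  clear_value r
  have hin : ∀ {x}, x ∈ N.darts → x ∉ N.rootFace → r x (N.next x) := by
    intro x hx hxi
    have h1 := hr2 x
    have h2 := hC.next_mem_iff.2 hx
    have h3 : N.next x ≠ f := fun e => o.cut.f_notMem (e ▸ h2)
    have h4 : N.next x ≠ y := fun e => hxi (next_mem_rootFace.1 (e.symm ▸ hy))
    rwa [v9 x hx fun e => hxi (e ▸ ht), Equiv.swap_apply_of_ne_of_ne h3 h4] at h1
  have hface : ∀ {x z}, x ∈ N.darts → x ∉ N.rootFace → z ∈ N.faceOf x → r x z := by
    intro x z hx hxi hz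
    have h1 := hin hx hxi
    rcases (hT.mem_faceOf_inner hx hxi).1 hz with rfl | rfl | rfl
    exacts [hre.refl _, h1, hre.trans h1 (hin (hC.next_mem_iff.2 hx)
      fun e => hxi (next_mem_rootFace.1 e))]
  -- the path connects the triangle of `h` with the triangle at the top-edge
  have hpath : ∀ i, l + i ≤ m → r (N.entry l) (N.entry (l + i)) := by
    intro i
    induction i with
    | zero => exact fun _ => hre.refl _
    | succ i ih =>
      intro hi
      have hD := hK.mem hT o.ri (l := l + i) (by omega)
      have hD' := hK.mem hT o.ri (l := l + i + 1) (by omega)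
      have hb' := hK.bw hT o.ri (l := l + i + 1) (by omega)
      refine hre.trans (hre.trans (ih (by omega)) (hface hD (hK.inner _ (by omega))
        (rev_interfaceStep_mem hT _))) ?_
      rw [← entry_succ, ← v5 _ hD' (fun e => hb'.1 (e ▸ hhw.1)) fun e => hb'.1 (e ▸ hhw.2)]
      exact hre.symm (hr1 _)
  have hdf : r d f := by
    have h1 := hpath (m - l) (by have := o.lt; omega)
    rw [Nat.add_sub_cancel' o.lt.le, o.entry_m] at h1
    have h2 := hface (hC.rev_mem _ o.cut.t_mem) o.inner (next_mem_faceOf.2 (self_mem_faceOf _))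
    have h3 := hr1 N.top
    rw [v5 _ o.cut.t_mem o.cut.h_ne.symm o.cut.rev_ne.symm] at h3
    have h4 := hr2 N.top
    rw [v6, Equiv.swap_apply_of_ne_of_ne o.cut.ne hyd'.symm] at h4
    have h5 := hface (hK.mem hT o.ri (by have := o.lt; omega)) (hK.inner l (by have := o.lt; omega))
      (next_mem_faceOf.2 (self_mem_faceOf _))
    grind [o.next_entry, hre.trans, hre.symm]
  have hnext : ∀ u, r u (R.next u) := by
    intro u
    have h1 := hr2 u
    by_cases e1 : R.next u = f
    · rw [R.next.injective (e1.trans v7.symm), v7]; exact hdf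
    · grind [hre.trans, hre.symm]
  have hroot : ∀ u ∈ R.darts, r R.root u := by
    refine connected_iff.1 hP.connected {u | r R.root u} (hre.refl _) (fun x => ?_) fun x => ?_
    · exact ⟨fun h => hre.trans h (hr1 x), fun h => hre.trans h (hre.symm (hr1 x))⟩
    · exact ⟨fun h => hre.trans h (hnext x), fun h => hre.trans h (hre.symm (hnext x))⟩
  exact fun u hu v hv => hre.trans (hre.symm (hroot u hu)) (hroot v hv)

theorem isTriangulation : (N.unzipAt N.top h d f).IsTriangulation := by
  have hC := o.comb
  have hT := o.tri
  have hP := o.isPlanarMap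
  have hCR := o.cut.unzipAt_comb
  have hm := fun {x : ℕ} => o.cut.mem (x := x)
  have hfR := o.f_mem_vertexOf
  have hrf := fun {x : ℕ} => o.mem_rootFace (z := x)
  have hfa := fun {x : ℕ} => zipAt_faceOf_inner hCR o.cut.zippable (W := N.white)
    (hrf.2 (.inr (.inl rfl))) (a := x)
  rw [o.zip_eq] at hfa
  have hvx := fun {a z : ℕ} ha hz hv => (o.mem_vertexOf_iff (a := a) (z := z) ha hz).2 (.inl hv)
  have hsub := o.sub
  obtain ⟨v1, v2, v3, v4, v5, -⟩ := o.cut.values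
  have hg := hC.rev_mem _ o.cut.h_mem
  have hgd : N.rev h ∉ (N.unzipAt N.top h d f).vertexOf d := by grind [o.cut.d_notMem, o.rev_h]
  have hhg := hT.rev_not_vertexOf o.cut.h_mem
  generalize N.unzipAt N.top h d f = R at *
  have hfg : ∀ {x}, x ∈ R.vertexOf f → x ∈ N.darts → x ∈ N.vertexOf (N.rev h) := fun hx hxD =>
    hvx hg hxD ((mem_vertexOf.1 hfR).trans (mem_vertexOf.1 hx))
  have hfd : f ∉ R.vertexOf d := fun hv =>
    hgd ((mem_vertexOf.1 hv).trans (mem_vertexOf.1 hfR).symm)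
  have hhf : h ∉ R.vertexOf f := fun hv => hhg (mem_vertexOf_comm.1 (hfg hv o.cut.h_mem))
  refine ⟨hP, fun x hx hxi => ?_, fun x hx hv => ?_, ?_⟩
  · grind [hT.triangle]
  · grind [mem_vertexOf_comm, hT.rev_not_vertexOf, hC.rev_mem]
  · have hdN : ∀ {x}, x ∈ N.rootFace → x ∉ R.vertexOf d := fun hx hv =>
      (hsub _ hv).elim (fun e => o.cut.d_notMem (e ▸ hC.rootFace_sub hx)) fun h1 =>
        h1.2.2 (hT.outer_eq hx (next_mem_rootFace.2 (top_mem hT o.ri)) (mem_vertexOf_comm.1 h1.1))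
    have hfN : ∀ {x}, x ∈ N.rootFace → x ∉ R.vertexOf f := by grind [o.rev_h_inner, hC.rootFace_sub]
    rintro a ha b hb hv
    rcases hrf.1 ha with h1 | rfl | rfl <;> rcases hrf.1 hb with h2 | rfl | rfl
    · grind [hT.simple, hC.rootFace_sub]
    · exact absurd (mem_vertexOf_comm.1 hv) (hdN h1)
    · exact absurd (mem_vertexOf_comm.1 hv) (hfN h1)
    · exact absurd hv (hdN h2)
    · rfl
    · exact absurd hv hfd
    · exact absurd hv (hfN h2)
    · exact absurd (mem_vertexOf_comm.1 hv) hfd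
    · rfl

theorem rootInterface : (N.unzipAt N.top h d f).RootInterface := by
  have hP := o.isPlanarMap
  obtain ⟨v1, -, v3, -⟩ := o.cut.values
  have hw : (N.unzipAt N.top h d f).white = N.white ∪ {d, f} := rfl
  have hg := o.comb.rev_mem _ o.cut.h_mem
  have hin : ∀ {x}, x ∈ N.darts → x ∉ N.rootFace → x ∉ (N.unzipAt N.top h d f).rootFace :=
    fun hx hxi hx' => (o.mem_rootFace.1 hx').elim hxi fun e =>
      e.elim (fun e => o.cut.d_notMem (e ▸ hx)) fun e => o.cut.f_notMem (e ▸ hx)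
  have hhi : h ∉ N.rootFace := by
    grind [o.next_entry, next_mem_rootFace, o.pathEnd.inner, o.lt]
  have h1 := zipAt_rootInterface_iff o.cut.unzipAt_comb o.cut.zippable
    (o.mem_rootFace.2 (.inr (.inl rfl))) (by
      grind [o.rev_h_inner, self_mem_vertexOf])
    (by rw [v3]; exact hin o.cut.h_mem hhi)
    ⟨.inr (.inl rfl), by rw [v1]; exact .inl o.white.2⟩
    ⟨.inr (.inr rfl), by rw [v3]; exact .inl o.white.1⟩
  have h2 : (N.unzipAt N.top h d f).white \ {d, f} = N.white := by
    grind [o.cut.d_notMem, o.tri.white_sub, o.cut.f_notMem]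
  rw [h2, o.zip_eq] at h1
  exact h1.1 o.ri

end Opening

end PercMap
namespace PercMap.Opening

variable {N : PercMap} {h d f l m : ℕ} (o : N.Opening h d f l m)
include o

theorem unzip_top : (N.unzipAt N.top h d f).top = N.top := by
  obtain ⟨-, -, -, -, v5, -⟩ := o.cut.values
  have hb := top_bw o.tri o.ri
  have h1 : ¬ (N.top = d ∨ N.top = f) := by grind [o.cut.d_notMem, o.cut.t_mem, o.cut.f_notMem]
  refine (eq_top o.isTriangulation o.rootInterface (o.mem_rootFace.2 (.inl (top_mem o.tri o.ri)))
    ⟨fun h => h.elim hb.1 h1, ?_⟩).symm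
  rw [v5 _ o.cut.t_mem o.cut.h_ne.symm o.cut.rev_ne.symm]
  exact .inl hb.2

theorem unzip_inner {x : ℕ} (hx : x ∈ N.darts) (hxi : x ∉ N.rootFace) :
    x ∉ (N.unzipAt N.top h d f).rootFace := fun hx' => (o.mem_rootFace.1 hx').elim hxi fun e =>
  e.elim (fun e => o.cut.d_notMem (e ▸ hx)) fun e => o.cut.f_notMem (e ▸ hx)

theorem h_inner : h ∉ N.rootFace := by
  rw [← o.next_entry, next_mem_rootFace]
  exact o.pathEnd.inner l (by have := o.lt; omega)

theorem rev_h_notMem : N.rev h ∉ N.rootFace := fun h1 => o.rev_h_inner h1 (self_mem_vertexOf _)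

/-- The path of the cut map goes through the same triangles. -/
theorem unzip_entry : ∀ i ≤ m + 1, (N.unzipAt N.top h d f).entry i = N.entry i := by
  have hC := o.comb
  have hK := o.pathEnd
  have hw : ∀ x, x ∈ (N.unzipAt N.top h d f).white ↔ x ∈ N.white ∨ x = d ∨ x = f := fun x => Iff.rfl
  have hr : (N.unzipAt N.top h d f).root = N.root := rfl
  obtain ⟨-, -, -, -, v5, -, -, -, v9⟩ := o.cut.values
  have hin : ∀ {x}, x ∈ N.darts → x ∉ N.rootFace →
      (N.unzipAt N.top h d f).next x = N.next x
      := by grind [top_mem, o.tri, o.ri]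
  intro i hi
  refine entry_congr (k := m + 1) ?_ (fun i hi => ?_) hi
  · grind [hC.root_mem, o.h_inner, root_mem_rootFace, o.rev_h_notMem]
  · have h1 := hK.mem o.tri o.ri hi.le
    have h2 := hK.inner i hi
    have h3 := hC.next_mem_iff.2 h1
    have h4 := hK.bw o.tri o.ri (l := i + 1) hi
    have h5 := hC.next_mem_iff.2 h3
    refine interfaceStep_congr' hC (hin h1 h2) (hin h3 fun e => h2 (next_mem_rootFace.1 e)) ?_ ?_
    · grind [o.cut.d_notMem, o.cut.f_notMem]
    · rw [← entry_succ, v5 _ (hC.rev_mem _ (hK.mem o.tri o.ri (l := i + 1) hi)), hC.rev_rev]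
      · exact fun e => h4.1 (by rw [← hC.rev_rev (N.entry (i + 1)), e]; exact o.white.2)
      · exact fun e => h4.1 (N.rev.injective e ▸ o.white.1)

theorem unzip_pathEnd : (N.unzipAt N.top h d f).PathEnd (m + 1) where
  inner i hi := by
    rw [o.unzip_entry i hi.le]
    exact o.unzip_inner (o.pathEnd.mem o.tri o.ri hi.le) (o.pathEnd.inner i hi)
  outer := by rw [o.unzip_entry _ le_rfl]; exact o.mem_rootFace.2 (.inl o.pathEnd.outer)

theorem unzip_faceOf {x : ℕ} (hx : x ∈ N.darts) (hxi : x ∉ N.rootFace) :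
    (N.unzipAt N.top h d f).faceOf x = N.faceOf x := by
  have := zipAt_faceOf_inner o.cut.unzipAt_comb o.cut.zippable (W := N.white)
    (o.mem_rootFace.2 (.inr (.inl rfl))) (o.cut.mem.2 (.inl hx)) (o.unzip_inner hx hxi)
  rw [o.zip_eq] at this
  exact this.symm

end PercMap.Opening

namespace MarkedMap

open PercMap

variable {N : MarkedMap}

/-- The result of `unzipAt`, where the new edge of the darts `f` and `h` is active. -/
def unzip (N : MarkedMap) (t h d f : ℕ) : MarkedMap := ⟨N.toPercMap.unzipAt t h d f, N.active ∪ {f, h}⟩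

theorem unzip_map (π : Perm ℕ) (t h d f : ℕ) :
    (N.map π).unzip (π t) (π h) (π d) (π f) = (N.unzip t h d f).map π := by
  have e := PercMap.unzipAt_map π N.toPercMap t h d f
  unfold unzip map
  rw [MarkedMap.mk.injEq]
  refine ⟨e, ?_⟩
  rw [Set.image_union]
  simp [Set.image_insert_eq]

variable {h d f l m : ℕ}

theorem TBRight.unzip (hN : N.TBRight) (o : N.Opening h d f l m) :
    h ∉ N.active ∧ N.rev h ∉ N.active ∧ (N.unzip N.top h d f).TBRight := by
  have hC := o.comb
  have hh : h ∉ N.active := fun ha => (hN.active_outer _ ha).elim o.h_inner o.rev_h_notMem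
  have hg : N.rev h ∉ N.active := fun ha => hh (by have := hN.active_rev _ ha; rwa [hC.rev_rev] at this)
  have hR := o.isTriangulation
  have hri := o.rootInterface
  have htop := o.unzip_top
  have hrf := fun {x : ℕ} => o.mem_rootFace (z := x)
  have hin := fun {x : ℕ} => o.unzip_inner (x := x)
  have hfa := fun {x : ℕ} => o.unzip_faceOf (x := x)
  have hent := o.unzip_entry
  have hKR := o.unzip_pathEnd
  obtain ⟨-, -, v3, v4, v5, -, -, -, v9⟩ := o.cut.values
  have hm := fun {x : ℕ} => o.cut.mem (x := x)
  have hw : ∀ x, x ∈ (N.toPercMap.unzipAt N.top h d f).white ↔ x ∈ N.white ∨ x = d ∨ x = f :=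
    fun x => Iff.rfl
  have hr : (N.toPercMap.unzipAt N.top h d f).root = N.root := rfl
  refine ⟨hh, hg, ?_⟩
  unfold MarkedMap.unzip
  generalize N.toPercMap.unzipAt N.top h d f = R at *
  have hrev : ∀ {x}, x ∈ N.active → R.rev x = N.rev x := by grind [hN.active_sub]
  have hrr := hrf.1 (root_mem_rootFace (M := R))
  refine ⟨hR, hri, ?_, ?_, ?_, ?_, ?_, ?_, ?_⟩
  · grind [hN.active_sub, o.cut.h_mem]
  · grind [hN.active_rev]
  · grind [hN.active_outer]
  · simp only [htop]; exact .inl hN.top_active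
  · grind [hN.root, hC.root_mem, o.cut.f_notMem, root_mem_rootFace, o.h_inner]
  · rintro x hx (hxa | rfl | rfl) hxb
    · have h1 : x ∉ N.white ∧ R.rev x ∉ R.white := ⟨fun h1 => hxb.1 ((hw x).2 (.inl h1)), hxb.2⟩
      rw [hrev hxa, hw] at h1
      have h2 : x ≠ N.top := fun e => h1.2 (.inl (e ▸ hN.top_bw.2))
      have h3 := (hrf.1 hx).resolve_right fun e => hxb.1 ((hw x).2 (.inr e))
      simp only [v9 x (hN.active_sub hxa) h2]
      exact .inl (hN.right x h3 hxa ⟨h1.1, fun h4 => h1.2 (.inl h4)⟩)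
    · exact absurd ((hw x).2 (.inr (.inr rfl))) hxb.1
    · exact absurd ((hw x).2 (.inl o.white.1)) hxb.1
  · have hpath : ∀ {x}, x ∈ N.darts → x ∉ N.rootFace → ∀ k < m + 1, N.entry k ∈ N.faceOf x →
        R.OnPath (R.faceOf x) := fun hx hxi k hk hkx =>
      ⟨k, hKR.onPathAt.2 ⟨hk, by rw [hent k hk.le, hfa hx hxi]; exact hkx⟩⟩
    rintro x (hxa | rfl | rfl) hx
    · have hxi : x ∉ N.rootFace := by grind
      obtain ⟨k, hk⟩ := hN.path x hxa hxi
      obtain ⟨hk, hkx⟩ := o.pathEnd.onPathAt.1 hk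
      exact hpath (hN.active_sub hxa) hxi k hk hkx
    · grind
    · grind [o.cut.h_mem, o.h_inner, o.lt, mem_faceOf_comm, o.next_entry, next_mem_faceOf,
        self_mem_faceOf]

/-- The case of a map obtained by recoloring the top-right vertex and gluing the top-edge to the
next left edge. -/
theorem TB.stepC_unzip (hN : N.TB) (o : N.Opening h d f l m) :
    (N.unzip N.top h d f).unrecolor.TB ∧ (N.unzip N.top h d f).unrecolor.HasActiveRight ∧
    (N.unzip N.top h d f).unrecolor.stepC = N := by
  have hC := o.comb
  obtain ⟨hh, hg, hB⟩ := hN.toTBRight.unzip o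
  have htop := o.unzip_top
  have hrf := fun {x : ℕ} => o.mem_rootFace (z := x)
  have hent := o.unzip_entry
  have hKR := o.unzip_pathEnd
  have hK := o.pathEnd
  have hin := o.unzip_inner (hC.rev_mem _ o.cut.t_mem) o.inner
  have hsub := o.sub
  have hzip := o.zip_eq
  have hfv := o.f_mem_vertexOf
  obtain ⟨v1, v2, v3, v4, v5, v6, v7, v8, v9⟩ := o.cut.values
  have hw : ∀ x, x ∈ (N.toPercMap.unzipAt N.top h d f).white ↔ x ∈ N.white ∨ x = d ∨ x = f :=
    fun x => Iff.rfl
  have hv5 := v5 _ o.cut.t_mem o.cut.h_ne.symm o.cut.rev_ne.symm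
  have e1 : (N.unzip N.top h d f).active = N.active ∪ {f, h} := rfl
  have e2 : (N.unzip N.top h d f).toPercMap = N.toPercMap.unzipAt N.top h d f := rfl
  rw [← e2] at htop hrf hent hKR hin hsub hzip v1 v2 v3 v4 v5 v6 v7 v8 v9 hw hv5 hfv
  generalize N.unzip N.top h d f = R at *
  have hdD : d ∉ N.darts := o.cut.d_notMem
  have hwd : R.WhiteEdge d := ⟨(hw d).2 (.inr (.inl rfl)), by rw [v1, hw]; exact .inl o.white.2⟩
  obtain ⟨hTB, htM, hentM⟩ := hB.unrecolor (by rw [htop, hv5]; exact hin) (by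
    rw [htop, v6]
    intro y hy hP
    obtain ⟨i, hi, rfl⟩ := hKR.pathLeft.1 hP
    rw [hent i hi.le] at hy
    have h1 := hK.mem o.tri o.ri hi.le
    have h2 : N.entry i ≠ N.top := fun e => hK.inner i hi (e ▸ hN.top_mem)
    rw [v9 _ h1 h2] at hy
    rcases hsub _ hy with e | h3
    · exact hdD (e ▸ hC.next_mem_iff.2 h1)
    · exact h3.2.1 (hK.pathLeft.2 ⟨i, hi, rfl⟩)) (by rw [htop, v6]; exact hwd) (by
    rw [htop, v6, e1]
    rintro x hx hxa hxw
    by_cases hxf : x = f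
    · grind
    · have hxh : x ≠ h := by grind [o.h_inner, o.cut.h_mem]
      have hxa : x ∈ N.active := by grind
      have hxD := hN.active_sub hxa
      have hxN : x ∈ N.rootFace := by grind
      have hxg : x ≠ N.rev h := fun e => hg (e ▸ hxa)
      have hxw : N.WhiteEdge x := by
        have h1 : ∀ {y}, y ∈ N.darts → y ∈ R.white → y ∈ N.white := by grind [o.cut.f_notMem]
        refine ⟨h1 hxD hxw.1, h1 (hC.rev_mem _ hxD) ?_⟩
        rw [← v5 x hxD hxh hxg]; exact hxw.2
      by_cases h1 : x = N.next N.top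
      · grind
      · have h2 := hN.left x hxN hxa hxw
        grind [hN.active_sub])
  rw [htop, v6] at htM
  have hV : ∀ x, x ∈ R.unrecolor.white ↔ x ∈ R.white ∧ x ∉ R.vertexOf d := by
    intro x
    rw [← v6, ← htop]; exact Iff.rfl
  have hA : ∀ x, x ∈ R.unrecolor.active ↔ (x ∈ N.active ∨ x = f ∨ x = h) ∨ x = d ∨ x = N.rev h := by
    intro x
    have h1 : x ∈ R.unrecolor.active ↔ x ∈ R.active ∨ x = R.next R.top ∨ x = R.rev (R.next R.top) :=
      Iff.rfl
    grind
  have hPM : R.unrecolor.toPercMap = { R.toPercMap with white := R.unrecolor.white } := rfl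
  have r1 : R.unrecolor.rev = R.rev := rfl
  have r2 : R.unrecolor.next = R.next := rfl
  have r3 : R.unrecolor.rootFace = R.rootFace := rfl
  have r4 : R.unrecolor.faceOf = R.faceOf := rfl
  have r5 : R.unrecolor.vertexOf = R.vertexOf := rfl
  have hentM := hentM m hKR
  generalize R.unrecolor = M at *
  have hgd : N.rev h ∉ R.vertexOf d := by grind [hC.rev_mem, o.cut.h_mem, o.rev_h]
  have hL : M.HasActiveLeft := by
    refine ⟨f, by rw [r3]; exact hrf.2 (.inr (.inr rfl)), (hA f).2 (.inl (.inr (.inl rfl))), ?_, ?_⟩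
    · refine (hV f).2 ⟨(hw f).2 (.inr (.inr rfl)), fun hv => hgd ?_⟩
      exact (PercMap.mem_vertexOf.1 hv).trans (PercMap.mem_vertexOf.1 hfv).symm
    · rw [r1, v3, hV, hw]
      refine ⟨.inl o.white.1, fun hv => (hsub _ hv).elim (fun e => hdD (e ▸ o.cut.h_mem)) fun h1 =>
        h1.2.1 (hK.pathLeft.2 ⟨l, by have := o.lt; omega, o.next_entry⟩)⟩
  have hRt : M.HasActiveRight := by
    refine ⟨N.top, by rw [r3]; exact hrf.2 (.inl hN.top_mem),
      (hA _).2 (.inl (.inl hN.top_active)), fun h1 => ?_, fun h1 => ?_⟩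
    · refine ((hw _).1 ((hV _).1 h1).1).elim hN.top_bw.1 fun e => e.elim
        (fun e => hdD (e ▸ o.cut.t_mem)) fun e => o.cut.f_notMem (e ▸ o.cut.t_mem)
    · grind [hB.comb.next_mem_vertexOf_iff, self_mem_vertexOf]
  have hin' : ∀ i ≤ m, M.entry i ∉ M.rootFace := by grind [hKR.inner]
  have hrec : M.RecolorsRight := by
    refine .inr ⟨hRt, l, m, o.lt, ⟨fun i hi => hin' i (hi.trans o.lt.le), ?_⟩, hin', ?_⟩
    · rw [leftDart, htM, r2, v7, r1, v3, r4, hentM l o.lt.le, mem_faceOf_comm, ← o.next_entry,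
        hent l (by have := o.lt; omega), ← v9 _ (hK.mem o.tri o.ri (by have := o.lt; omega)),
        next_mem_faceOf]
      · exact self_mem_faceOf _
      · grind [hK.inner, o.lt, hN.top_mem]
    · have h1 : M.rightDart = N.top := by rw [rightDart, Equiv.symm_apply_eq, htM, r2, v6]
      grind [o.entry_m, hC.rev_mem, o.cut.t_mem, hC.rev_ne, next_mem_faceOf, self_mem_faceOf]
  refine ⟨hTB, hRt, ?_⟩
  have hwN : M.recolored \ {d, f} = N.white := by
    rw [recolored, if_pos hrec, htM, r5]
    ext x
    have hx1 : x ∈ R.vertexOf d → x ∈ R.white := fun hv => (hB.tri.white_vertexOf hv).2 hwd.1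
    grind [hN.tri.white_sub, o.cut.f_notMem]
  have haN : M.active \ {d, M.rev d, f, M.rev f} = N.active := by
    ext x
    have h1 := hA x
    have h2 : x ∈ N.active → ¬ (x = d ∨ x = N.rev h ∨ x = f ∨ x = h) := by
      grind [hN.active_sub, o.cut.f_notMem]
    grind
  have hl : M.leftDart = f := by rw [leftDart, htM, r2, v7]
  unfold stepC
  rw [if_pos ⟨hL, hRt⟩, if_pos hrec, hl]
  unfold glueTop
  simp only [htM]
  rw [hwN, haN, hPM]
  change (⟨R.toPercMap.zipAt d f N.white, N.active⟩ : MarkedMap) = N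
  rw [hzip]

end MarkedMap
theorem PercMap.CutAt.mem_vertexOf_next {N : PercMap} (hC : N.Comb) {h k : ℕ} (c : N.CutAt h k) :
    h ∈ N.vertexOf (N.next N.top) := by
  rw [hC.vertexOf_next, mem_vertexOf_comm, PercMap.mem_vertexOf, ← c.pow]
  exact ⟨k, by simp⟩

namespace MarkedMap

open PercMap

/-! ### Recovering the map before a step -/

variable {M N : MarkedMap}

/-- The map `M` is recovered from `N` by undoing a step which recolors the top-right vertex and
which either makes the top-edge inactive or glues it to the next left edge. -/
def Undo (M N : MarkedMap) : Prop :=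
  ((∀ h k, ¬ N.CutAt h k) ∧ N.unrecolor = M) ∨
  ∃ h k d f, N.CutAt h k ∧ d ∉ N.darts ∧ f ∉ N.darts ∧ d ≠ f ∧ (N.unzip N.top h d f).unrecolor = M

theorem EndsA.third (hN : N.TB) (h : N.EndsA) : N.Third := by
  unfold Third
  rw [(h.values hN).2.1]
  exact (h.values hN).1.2.2

theorem endsA_glueTriAt (hM : M.TB) {p q p' q' : ℕ} (hF : Fresh4 M.darts p q p' q') :
    (M.glueTriAt true p q p' q').EndsA := by
  have hC := hM.comb
  have hnd := hM.tri.next_ne hM.top_darts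
  obtain ⟨-, -, ht⟩ := glueTriAt_basic hM.tri hM.ri hF
  obtain ⟨v1, v2, v3, v4, v5, v6, v7, v8, v9, v10, -⟩ := glueAt_values hC
    (W := M.white ∪ {q', q, p'}) hM.top_darts hnd hF
  have hdr : M.root ≠ M.top := fun e => hM.top_bw.1 (e ▸ hM.ri.1.1)
  have hrf := glueAt_mem_rootFace hC (W := M.white ∪ {q', q, p'}) hM.top_mem hnd hF hdr (x := q)
  have e : (M.glueTriAt true p q p' q').toPercMap =
    M.toPercMap.glueAt M.top p q p' q' (M.white ∪ {q', q, p'}) := rfl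
  have hW : (M.glueTriAt true p q p' q').white = M.white ∪ {q', q, p'} := rfl
  have hA : (M.glueTriAt true p q p' q').active =
    (M.active \ {M.top, M.rev M.top}) ∪ {p, q, p', q'} := rfl
  rw [← e] at v1 v2 v3 v4 v5 v6 v7 v8 v9 v10 hrf
  generalize M.glueTriAt true p q p' q' = N at *
  refine ⟨q, hrf.2 (.inr (.inr rfl)), by rw [hA]; simp, ⟨by rw [hW]; simp, by rw [v3, hW]; simp⟩, ?_⟩
  rw [ht, v1, v3, mem_faceOf_comm, ← v6, next_mem_faceOf]
  exact self_mem_faceOf _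

variable {la lb : List ℕ} {T U κ : ℕ → ℕ} {K : ℕ}

theorem Inv.not_endsA (h : Inv la lb N T U κ (K + 1)) (hκ : ∀ k ∈ la, κ k < K) : ¬ N.EndsA := by
  rintro ⟨x, hx, hxa, hxw, hxf⟩
  obtain ⟨k, hk, rfl⟩ := h.left_active_iff.1 ⟨hx, hxw, hxa⟩
  have h1 := h.pathEnd.top_face h.tri rfl h.ri
  have h2 := h.rev_U_left_mem_face hk
  obtain ⟨h3, h4⟩ := h.entry k (.inl hk)
  refine (hκ k hk).ne (h.pathEnd.face_inj h.tri h.ri h3 (Nat.lt_succ_self K) ?_)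
  rw [h4]
  exact (PercMap.mem_faceOf.1 h2).trans ((PercMap.mem_faceOf.1 hxf).symm.trans
    (PercMap.mem_faceOf.1 h1).symm)

namespace Inv

variable {j : ℕ} (h : Inv la (j :: lb) M T U κ K)
include h

theorem unrecolor_recolorWhite (hlt : ∀ i ∈ la, i < j) {A : Set ℕ}
    (hA : A ∪ {M.top, M.rev M.top} = M.active) :
    (⟨M.toPercMap.recolorWhite M.top, A⟩ : MarkedMap).unrecolor = M := by
  have hr := h.recolor hlt
  have ht : (M.toPercMap.recolorWhite M.top).next (M.toPercMap.recolorWhite M.top).top = M.top := by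
    rw [hr.top]; exact h.next_right
  have e : (M.white ∪ M.vertexOf M.top) \ M.vertexOf M.top = M.white := by
    refine Set.union_sdiff_cancel_right ?_
    rintro x ⟨hx, hv⟩
    exact h.top_bw.1 ((h.tri.white_vertexOf hv).1 hx)
  unfold unrecolor
  simp only [ht]
  change (⟨⟨M.darts, M.rev, M.next, M.root, (M.white ∪ M.vertexOf M.top) \ M.vertexOf M.top⟩,
    A ∪ {M.top, M.rev M.top}⟩ : MarkedMap) = M
  rw [e, hA]

theorem not_near {l : ℕ} (hl : l ≤ κ j) : M.next (M.entry l) ∉ M.vertexOf M.top := fun hv => by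
  rw [← h.top_vertex, h.comb.next_mem_vertexOf_iff] at hv
  exact h.near j (.inr (by simp)) l hl (.inr hv)

theorem undo_inactivate (hla : la = []) : M.stepC.top = M.rev (U j) ∧
    (∀ l ≤ κ j, M.stepC.entry l = M.entry l) ∧ M.stepC.rev (M.rev (U j)) = U j ∧
    M.stepC.next (U j) = T j ∧ Undo M M.stepC := by
  subst hla
  have hC := h.comb
  have hr := h.recolor (by simp)
  have hI := h.inactivate rfl
  have hu := h.unrecolor_recolorWhite (by simp) (A := M.active \ {M.top, M.rev M.top})
    (Set.sdiff_union_of_subset (by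
      grind [h.isTBar.top_active, h.isTBar.active_rev]))
  have hnl : ¬ M.HasActiveLeft := by rw [h.hasActiveLeft_iff]; simp
  have e : M.stepC = ⟨M.toPercMap.recolorWhite M.top, M.active \ {M.top, M.rev M.top}⟩ := by
    unfold stepC
    rw [if_neg (fun h => hnl h.1), recolored, if_pos (.inl hnl)]
    rfl
  have e1 : M.stepC.rev = M.rev := by rw [e]; rfl
  have e2 : M.stepC.next = M.next := by rw [e]; rfl
  have e3 : M.stepC.vertexOf = M.vertexOf := by rw [e]; rfl
  rw [← e] at hu
  have htop : M.stepC.top = M.rev (U j) := by rw [e]; exact hr.top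
  have hent : ∀ l ≤ κ j, M.stepC.entry l = M.entry l := by rw [e]; exact hr.entry_eq
  refine ⟨htop, hent, by rw [e1, hC.rev_rev], by rw [e2]; exact h.triR j (by simp),
    .inl ⟨fun y k c => ?_, hu⟩⟩
  obtain ⟨l, hl, rfl⟩ := hI.pathEnd.pathLeft.1 c.left
  have hv := c.mem_vertexOf_next hI.comb
  rw [htop, e2, e3, h.next_right, hent l (by omega)] at hv
  exact h.not_near (by omega) hv

theorem undo_zip {i : ℕ} {la' : List ℕ} (hla : la = i :: la') (hij : i < j) :
    M.stepC.top = M.rev (U j) ∧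
    (∀ l ≤ κ j, M.stepC.entry l = M.entry l) ∧ M.stepC.rev (M.rev (U j)) = U j ∧
    M.stepC.next (U j) = T j ∧ Undo M M.stepC := by
  subst hla
  have hC := h.comb
  obtain ⟨hI, htop, hent⟩ := h.zip_top_entry hij
  have hlt := h.hlt hij
  have hj : j ∈ i :: la' ∨ j ∈ j :: lb := .inr (by simp)
  have hi : i ∈ i :: la' ∨ i ∈ j :: lb := .inl (by simp)
  have hU := h.left_mem (i := i) (by simp)
  have hUw := h.white i (by simp)
  have hrU := h.rev_left_inner (i := i) (by simp)
  have hUi := h.right_inner (i := j) (by simp)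
  have hrb := h.black j (by simp)
  have hnr := h.next_right
  have hta := h.isTBar.top_active
  have hUa : U i ∈ M.active := by grind [h.active]
  have hu := h.unrecolor_recolorWhite hlt
    (A := M.active \ {M.top, M.rev M.top, U i, M.rev (U i)} ∪ {U i, M.rev (U i)}) (by
      grind [h.isTBar.active_rev])
  have hz := h.recolorWhite_zippable
  have hzM := h.zippable
  obtain ⟨d1, d2, d3, d4, d5, d6, d7, d8⟩ := hzM.distinct hC
  have hCR : (M.toPercMap.recolorWhite M.top).Comb := (h.recolor hlt).tri.comb
  have hWW : (M.toPercMap.recolorWhite M.top).white \ {M.top, U i} ∪ {M.top, U i} =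
      (M.toPercMap.recolorWhite M.top).white := Set.sdiff_union_of_subset (by
    rintro x (rfl | rfl)
    exacts [.inr (self_mem_vertexOf _), .inl hUw.1])
  have hun := PercMap.unzipAt_zipAt hCR hz (t := M.rev (U j)) hnr
    ((M.toPercMap.recolorWhite M.top).white \ {M.top, U i})
  rw [hWW] at hun
  obtain ⟨v1, v2, v3, v4, v5, v6, v7, v8, v9⟩ :=
    zipAt_values (W := (M.toPercMap.recolorWhite M.top).white \ {M.top, U i}) hCR hz
  obtain ⟨r1, r2, r3, r4, r5, r6⟩ :=
    zipAt_rot_values (W := (M.toPercMap.recolorWhite M.top).white \ {M.top, U i}) hCR hz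
  have e1 : (M.toPercMap.recolorWhite M.top).rev = M.rev := rfl
  have e2 : (M.toPercMap.recolorWhite M.top).next = M.next := rfl
  have e3 : (M.toPercMap.recolorWhite M.top).rot = M.rot := rfl
  have hD : ∀ x, x ∈ M.stepC.darts ↔ x ∈ M.darts ∧ x ≠ M.top ∧ x ≠ U i := fun x => by
    rw [h.stepC_eq hij]; exact PercMap.zipAt_mem
  have hP : M.stepC.toPercMap = (M.toPercMap.recolorWhite M.top).zipAt M.top (U i)
    ((M.toPercMap.recolorWhite M.top).white \ {M.top, U i}) := by rw [h.stepC_eq hij]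
  have hAc : M.stepC.active = M.active \ {M.top, M.rev M.top, U i, M.rev (U i)} := by
    rw [h.stepC_eq hij]
  rw [← hP] at v1 v2 v3 v4 v5 v6 v7 v8 v9 r1 r2 r3 r4 r5 r6 hun
  have hundo : (M.stepC.unzip M.stepC.top (M.rev (U i)) M.top (U i)).unrecolor = M := by
    unfold unzip
    rw [htop]
    rw [e1] at hun
    rw [hun, hAc]
    exact hu
  rw [e1] at v3 v4 v5 r3 r4 r6
  rw [e2] at v8 v9 r3 r4 r5
  rw [e3] at r5 r6
  clear hun
  generalize M.stepC = N at *
  have hin : ∀ {x}, x ∉ M.rootFace → N.next x = M.next x := fun {x} hx =>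
    v9 x (fun e => hx (e ▸ h.top_mem)) (fun e => hx (e ▸ hU)) fun e =>
      hx (next_mem_rootFace.1 (e ▸ h.top_mem))
  have hPL : ∀ {y}, N.PathLeft y → y ∉ M.vertexOf M.top := by
    intro y hy
    obtain ⟨l, hl, rfl⟩ := hI.pathEnd.pathLeft.1 hy
    have hK := (h.entry j hj).1
    rw [hent l (by omega), hin (h.pathEnd.inner l (by omega))]
    exact h.not_near (by omega)
  have hrj : N.rev (M.rev (U j)) = U j := by
    grind [hC.rev_rev, h.tri.next_ne, h.top_darts]
  refine ⟨htop, hent, hrj, by rw [hin hUi]; exact h.triR j (by simp),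
    .inr ⟨M.rev (U i), ?_⟩⟩
  -- the corners of the top-right vertex before the step
  have hper : ∃ n, 0 < n ∧ (M.rot ^ n) M.top = M.top := exists_pow_fixed hC.rot_fix _
  classical
  obtain ⟨k, hk⟩ : ∃ k, Nat.find hper = k + 1 := Nat.exists_eq_succ_of_ne_zero (Nat.find_spec hper).1.ne'
  have hk1 : (M.rot ^ (k + 1)) M.top = M.top := by grind
  have hk2 : ∀ n, 0 < n → n ≤ k → (M.rot ^ n) M.top ≠ M.top := fun n h1 h2 h3 =>
    Nat.find_min hper (by omega) ⟨h1, h3⟩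
  have hvt : ∀ n, (M.rot ^ n) M.top ∈ M.vertexOf M.top := fun n => ⟨n, by simp⟩
  have hrot : ∀ n, n < k → (N.rot ^ (n + 1)) (M.rev (U i)) = (M.rot ^ (n + 1)) M.top := by
    intro n
    induction n with
    | zero => intro _; rw [pow_one, pow_one, r4, PercMap.rot_apply]
    | succ n ih =>
      intro hn
      have hv := hvt (n + 1)
      rw [pow_succ', Perm.mul_apply, ih (by omega), r6, ← Perm.mul_apply, ← pow_succ']
      · grind
      · exact fun e => hzM.ne (h.tri.outer_eq h.top_mem hU (e ▸ hv)).symm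
      · exact fun e => h.tri.rev_not_vertexOf h.top_darts (e ▸ hv)
      · intro e
        rw [e, ← hC.next_mem_vertexOf_iff] at hv
        exact hzM.next_y (h.tri.outer_eq h.top_mem (next_mem_rootFace.2 hU) hv).symm
      · rw [← Perm.mul_apply, ← pow_succ']
        grind
  have hk0 : k ≠ 0 := by
    rintro rfl
    rw [zero_add, pow_one, PercMap.rot_apply] at hk1
    exact hzM.next_rev_x hk1
  obtain ⟨k, rfl⟩ := Nat.exists_eq_succ_of_ne_zero hk0
  have hkU : (M.rot ^ (k + 1)) M.top = U j := by
    rw [pow_succ', Perm.mul_apply] at hk1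
    refine M.rot.injective (hk1.trans ?_)
    rw [PercMap.rot_apply, hnr]
  refine ⟨k + 1, M.top, U i, ⟨?_, ?_, fun n hn y hy e => hPL hy ?_⟩, fun hd => ((hD _).1 hd).2.1 rfl,
    fun hd => ((hD _).1 hd).2.2 rfl, hzM.ne.symm, hundo⟩
  · have hκ := h.mono i j hi hj hij
    refine hI.pathEnd.pathLeft.2 ⟨κ i, by omega, ?_⟩
    rw [hent _ hκ.le, (h.entry i hi).2, hin (h.T_inner hi)]
    exact h.triL i (by simp)
  · grind
  · rw [htop, hrj, ← hkU, ← hrot k (by omega)] at e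
    obtain ⟨n', rfl⟩ : ∃ n', k = n + n' := ⟨k - n, by omega⟩
    rw [add_assoc, pow_add, Perm.mul_apply] at e
    rw [(N.rot ^ n).injective e, hrot n' (by omega)]
    exact hvt _

end Inv

end MarkedMap
open PercMap

/-- The exchange of the letters `a` and `b`. -/
def Step.swap : Step → Step
  | .a => .b
  | .b => .a
  | .c => .c

@[simp] theorem Step.swap_swap (s : Step) : s.swap.swap = s := by cases s <;> rfl

theorem stackFrom_swap (x : Step) (w : Word) : ∀ (n : ℕ) (s : List ℕ),
    stackFrom x.swap n s (w.map Step.swap) = stackFrom x n s w := by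
  induction w with
  | nil => intros; rfl
  | cons y w ih => intro n s; cases x <;> cases y <;> exact ih _ _

theorem stack_swap (w : Word) (x : Step) : stack (w.map Step.swap) x.swap = stack w x :=
  stackFrom_swap x w 0 []

/-- The step `s` after `w` is an `a`-step or a `c`-step which recolors the top-right vertex while
there are active right edges. -/
def RightLast (w : Word) (s : Step) : Prop :=
  s = .a ∨ s = .c ∧ ∃ j lb, stack w .b = j :: lb ∧
    (stack w .a = [] ∨ ∃ i la, stack w .a = i :: la ∧ i < j)

theorem rightLast_or {w : Word} {s : Step} (hw : w ++ [s] ∈ KBar) :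
    RightLast w s ∨ RightLast (w.map Step.swap) s.swap := by
  rcases s with _ | _ | _
  · exact .inl (.inl rfl)
  · exact .inr (.inl rfl)
  have h := (mem_KBar_append_c.1 hw).2
  have ea := stack_swap w .a
  have eb := stack_swap w .b
  change stack _ .b = _ at ea
  change stack _ .a = _ at eb
  unfold RightLast
  rw [ea, eb]
  have hA := stackSpec w (x := .a) (by decide)
  have hB := stackSpec w (x := .b) (by decide)
  rcases e1 : stack w .a with _ | ⟨i, la⟩ <;> rcases e2 : stack w .b with _ | ⟨j, lb⟩
  · simp [e1, e2] at h
  · grind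
  · exact .inr (.inr ⟨rfl, i, la, rfl, .inl rfl⟩)
  · rcases lt_trichotomy i j with hij | rfl | hij
    · grind
    · have h1 := hA.get i (by simp [e1])
      grind [hB.get]
    · exact .inr (.inr ⟨rfl, i, la, rfl, .inr ⟨j, lb, rfl, hij⟩⟩)

namespace MarkedMap

variable {M N : MarkedMap}

/-- The map `N` is obtained from `M` by a step `s` which is an `a`-step or a `c`-step recoloring the
top-right vertex; `M` is described in terms of `N`. -/
structure RightOf (M : MarkedMap) (s : Step) (N : MarkedMap) : Prop where
  tb : N.TB
  inner : N.rev N.top ∉ N.rootFace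
  third : N.Third
  last : s = .a ∧ N.EndsA ∧ N.unglue = M ∨ s = .c ∧ ¬ N.EndsA ∧ Undo M N

theorem rightOf_append {w : Word} {s : Step} (hw : w ++ [s] ∈ KBar) (hl : RightLast w s) :
    RightOf (Phi w) s (Phi (w ++ [s])) := by
  obtain ⟨U', κ', K', hI⟩ := exists_inv hw
  obtain ⟨U, κ, K, h⟩ := exists_inv (mem_KBar_of_append hw)
  have hT := hI.isTBar.tb
  rcases hl with rfl | ⟨rfl, j, lb, hb, ha⟩
  · have e : Phi (w ++ [.a]) = _ := (Phi_append w .a).trans (glueTriangle_eq true)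
    have hE := endsA_glueTriAt h.isTBar.tb (M := Phi w) fresh4_fresh
    have hu := unglue_glueTriAt h.isTBar.tb (M := Phi w) fresh4_fresh
    rw [← e] at hE hu
    exact ⟨hT, hE.rev_top_inner hT, hE.third hT, .inl ⟨rfl, hE, hu⟩⟩
  · rw [Phi_append] at hT ⊢
    change (Phi w).stepC.TB at hT
    change RightOf _ _ (Phi w).stepC
    rw [hb] at h
    obtain ⟨la', ⟨htop, hent, hr, hn, hU⟩, hI, hκ⟩ : ∃ la', ((Phi w).stepC.top = (Phi w).rev (U j) ∧
        (∀ l ≤ κ j, (Phi w).stepC.entry l = (Phi w).entry l) ∧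
        (Phi w).stepC.rev ((Phi w).rev (U j)) = U j ∧
        (Phi w).stepC.next (U j) = (before w j).top ∧ Undo (Phi w) (Phi w).stepC) ∧
        Inv la' lb (Phi w).stepC (fun i => (before w i).top) U κ (κ j + 1) ∧
        ∀ k ∈ la', κ k < κ j := by
      rcases ha with ha | ⟨i, la, ha, hij⟩
      · rw [ha] at h
        exact ⟨[], h.undo_inactivate rfl, h.inactivate rfl, by simp⟩
      · rw [ha] at h
        refine ⟨la, h.undo_zip rfl hij, h.zip hij, fun k hk => ?_⟩
        exact h.mono k j (.inl (by simp [hk])) (.inr (by simp)) (h.hlt hij k (by simp [hk]))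
    have hj := h.entry j (.inr (by simp))
    have hC := hI.comb
    have he : (Phi w).stepC.entry (κ j) = (before w j).top := by grind
    have hin := hI.pathEnd.inner (κ j) (Nat.lt_succ_self _)
    have hbw := hI.pathEnd.bw hI.tri hI.ri (Nat.le_succ (κ j))
    rw [he] at hin hbw
    refine ⟨hT, ?_, ?_, .inr ⟨rfl, hI.not_endsA hκ, hU⟩⟩
    · rwa [htop, hr, ← next_mem_rootFace, hn]
    · unfold Third
      rw [htop, hr, hn]
      exact (hI.tri.white_next _).2 hbw.2

theorem map_one (N : MarkedMap) : N.map 1 = N := by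
  simp only [map, PercMap.map]
  congr <;> first | exact Finset.map_refl | simp

theorem map_inv (π : Perm ℕ) : (N.map π).map π⁻¹ = N := by
  rw [map_map, inv_mul_cancel, map_one]

theorem map_endsA (hN : N.TB) (π : Perm ℕ) : (N.map π).EndsA ↔ N.EndsA := by
  unfold EndsA
  rw [π.surjective.exists, map_top π hN.tri hN.ri]
  have hr : ∀ x, (N.map π).rev (π x) = π (N.rev x) := PercMap.map_rev π
  simp only [hr]
  refine exists_congr fun x => and_congr (PercMap.map_mem_rootFace π) (and_congr (map_active π)
    (and_congr (PercMap.map_whiteEdge π) (PercMap.map_mem_faceOf π)))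

theorem map_third (hN : N.TB) (π : Perm ℕ) : (N.map π).Third ↔ N.Third := by
  unfold Third
  have hr : ∀ x, (N.map π).rev (π x) = π (N.rev x) := PercMap.map_rev π
  have hn : ∀ x, (N.map π).next (π x) = π (N.next x) := PercMap.map_next π
  rw [map_top π hN.tri hN.ri, hr, hn, hn]
  exact PercMap.map_white π

theorem mirror_third (hN : N.TB) (hi : N.rev N.top ∉ N.rootFace) : N.mirror.Third ↔ ¬ N.Third := by
  have hC := hN.comb
  have hd := hC.rev_mem_iff.2 hN.top_darts
  have h3 := (hN.tri.next3 hd hi).1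
  unfold Third
  rw [mirror_top hC]
  change N.next.symm (N.next.symm (N.rev N.top)) ∈ N.mirror.white ↔ _
  have e : N.next.symm (N.next.symm (N.rev N.top)) = N.next (N.rev N.top) := by
    grind
  rw [e, hN.tri.white_next]
  exact and_iff_right (hC.next_mem_iff.2 hd)

theorem opening_of_cutAt (hN : N.TBRight) (hi : N.rev N.top ∉ N.rootFace) (hT : N.Third)
    {h k d f : ℕ} (c : N.CutAt h k) (hd : d ∉ N.darts) (hf : f ∉ N.darts) (hdf : d ≠ f) :
    ∃ l m, N.Opening h d f l m := by
  obtain ⟨K, hK⟩ := exists_pathEnd hN.tri hN.ri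
  grind [exists_top_triangle, hN.tri, hN.ri, c.opening, hN.entry_third]

theorem Undo.iso {M' : MarkedMap} (hN : N.TBRight) (hi : N.rev N.top ∉ N.rootFace) (hT : N.Third)
    {π : Perm ℕ} (hN' : (N.map π).TBRight) (h : Undo M N) (h' : Undo M' (N.map π)) : M.Iso M' := by
  rcases h with ⟨h1, rfl⟩ | ⟨h, k, d, f, c, hd, hf, hdf, rfl⟩ <;>
    rcases h' with ⟨h1', rfl⟩ | ⟨h', k', d', f', c', hd', hf', hdf', rfl⟩
  · exact iso_iff.2 ⟨π, unrecolor_map hN π⟩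
  · have := c'.map hN'.tri hN'.ri π⁻¹
    rw [show (N.map π).toPercMap.map π⁻¹ = N.toPercMap from
      congrArg MarkedMap.toPercMap (map_inv (N := N) π)] at this
    exact absurd this (h1 _ _)
  · exact absurd (c.map hN.tri hN.ri π) (h1' _ _)
  · obtain ⟨ρ, hρ, he⟩ := exists_map_eq hN.tri.toIsPlanarMap hN.active_sub π (l := [d, f])
      (l' := [d', f']) (by simpa using hdf) (by simpa using hdf') rfl (by simp [hd, hf])
      (by simp [hd', hf'])
    rw [← hρ] at c' ⊢
    have e : ρ h = h' := (c.map hN.tri hN.ri ρ).unique c'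
    obtain ⟨l, m, o⟩ := opening_of_cutAt hN hi hT c hd hf hdf
    simp only [List.map_cons, List.map_nil, List.cons.injEq, and_true] at he
    refine iso_iff.2 ⟨ρ, ?_⟩
    rw [← e, ← he.1, ← he.2, map_top ρ hN.tri hN.ri, unzip_map, unrecolor_map (hN.unzip o).2.2]

/-- The last step and the map before it are determined by the map after it. -/
theorem RightOf.inj {M' : MarkedMap} {s s' : Step} {π : Perm ℕ} (h : RightOf M s N)
    (h' : RightOf M' s' (N.map π)) : s = s' ∧ M.Iso M' := by
  have hE := map_endsA h.tb π
  rcases h.last with ⟨rfl, h1, rfl⟩ | ⟨rfl, h1, hu⟩ <;>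
    rcases h'.last with ⟨rfl, h1', rfl⟩ | ⟨rfl, h1', hu'⟩
  · exact ⟨rfl, iso_iff.2 ⟨π, unglue_map h.tb π⟩⟩
  · exact absurd (hE.2 h1) h1'
  · exact absurd (hE.1 h1') h1
  · exact ⟨rfl, hu.iso h.tb.toTBRight h.inner h.third h'.tb.toTBRight hu'⟩

theorem Iso.mirror (h : M.Iso N) : M.mirror.Iso N.mirror := by
  obtain ⟨π, rfl⟩ := iso_iff.1 h
  exact iso_iff.2 ⟨π, mirror_map π⟩

theorem Iso.trans {P : MarkedMap} : M.Iso N → N.Iso P → M.Iso P := MarkedMap.iso_equivalence.trans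

theorem Iso.symm : M.Iso N → N.Iso M := MarkedMap.iso_equivalence.symm

theorem Iso.of_eq (h : M = N) : M.Iso N := h ▸ MarkedMap.iso_equivalence.refl M

theorem glueTriAt_iso (hM : M.TB) (u : Bool) {p q p' q' r s r' s' : ℕ}
    (hF : PercMap.Fresh4 M.darts p q p' q') (hF' : PercMap.Fresh4 M.darts r s r' s') :
    (M.glueTriAt u p q p' q').Iso (M.glueTriAt u r s r' s') := by
  obtain ⟨ρ, h⟩ := exists_glueTriAt_map hM.tri hM.ri hM.active_sub 1 u hF
    (r := r) (s := s) (r' := r') (s' := s') (by rwa [map_one])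
  rw [map_one] at h
  exact iso_iff.2 ⟨ρ, h⟩

theorem init_mirror_iso : init.mirror.Iso init := by
  have h : init.mirror = init := by
    change (⟨⟨_, _, _, _, _⟩, _⟩ : MarkedMap) = ⟨⟨_, _, _, _, _⟩, _⟩
    congr 2
    ext x
    simp [init]
    grind
  exact .of_eq h

theorem tb_phi {w : Word} (hw : w ∈ KBar) : (Phi w).TB := by
  obtain ⟨U, κ, K, h⟩ := exists_inv hw
  exact h.isTBar.tb

/-- Exchanging the letters `a` and `b` amounts to reflecting the map and exchanging the colours. -/
theorem Phi_mirror {w : Word} (hw : w ∈ KBar) :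
    w.map Step.swap ∈ KBar ∧ (Phi w).mirror.Iso (Phi (w.map Step.swap)) := by
  induction w using List.reverseRecOn with
  | nil => exact ⟨hw, init_mirror_iso⟩
  | append_singleton w s ih =>
    have hw' := mem_KBar_of_append hw
    obtain ⟨h1, h2⟩ := ih hw'
    have hT := tb_phi hw'
    have hTm := hT.mirror
    rw [List.map_append, List.map_singleton, Phi_append, Phi_append]
    have h3 := iso_step hTm.tri hTm.ri hTm.active_sub h2 s.swap
    have hF := fresh4_fresh (M := Phi w)
    have glue : ∀ u, ((Phi w).glueTriangle u).mirror.Iso ((Phi w).mirror.glueTriangle !u) := by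
      intro u
      rw [glueTriangle_eq, mirror_glueTriAt hT.tri hT.ri hF, glueTriangle_eq]
      exact glueTriAt_iso hTm _ hF.swap hF
    rcases s with _ | _ | _
    · exact ⟨(mem_KBar_append (by decide)).2 h1, (glue true).trans h3⟩
    · exact ⟨(mem_KBar_append (by decide)).2 h1, (glue false).trans h3⟩
    · have hne := (mem_KBar_append_c.1 hw).2
      refine ⟨mem_KBar_append_c.2 ⟨h1, ?_⟩, ?_⟩
      · rw [← stack_swap w, ← stack_swap w] at hne
        exact hne.symm
      · obtain ⟨U, κ, K, h⟩ := exists_inv hw'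
        have := (h.stepCReady hne).mirror_stepC
        change (Phi w).stepC.mirror.Iso _
        rw [← this]
        exact h3

theorem inner_of_append {w : Word} {s : Step} (hw : w ++ [s] ∈ KBar) :
    (Phi (w ++ [s])).rev (Phi (w ++ [s])).top ∉ (Phi (w ++ [s])).rootFace := by
  rcases rightLast_or hw with h | h
  · exact (rightOf_append hw h).inner
  · obtain ⟨h1, h2⟩ := Phi_mirror hw
    rw [List.map_append, List.map_singleton] at h1 h2
    have hR := (rightOf_append h1 h).inner
    obtain ⟨π, e⟩ := iso_iff.1 h2
    have hT := tb_phi hw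
    have hr : ∀ (N : MarkedMap) x, (N.map π).rev (π x) = π (N.rev x) := fun _ => PercMap.map_rev π
    rw [e, map_top π hT.mirror.tri hT.mirror.ri, hr, mirror_top hT.comb] at hR
    have := (PercMap.map_mem_rootFace π).not.1 hR
    rwa [mirror_toPercMap, PercMap.mirror_rootFace] at this

theorem last_step_inj {w w' : Word} {s s' : Step} (hw : w ++ [s] ∈ KBar) (hw' : w' ++ [s'] ∈ KBar)
    (hl : RightLast w s) (h : (Phi (w ++ [s])).Iso (Phi (w' ++ [s']))) :
    s = s' ∧ (Phi w).Iso (Phi w') := by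
  have hR := rightOf_append hw hl
  obtain ⟨π, e⟩ := iso_iff.1 h
  rcases rightLast_or hw' with hl' | hl'
  · grind [rightOf_append, hR.inj]
  · obtain ⟨h1, h2⟩ := Phi_mirror hw'
    rw [List.map_append, List.map_singleton] at h1 h2
    have hR' := rightOf_append h1 hl'
    obtain ⟨ρ, e'⟩ := iso_iff.1 h2
    have hT := tb_phi hw'
    grind [hR'.third, map_third, hT.mirror, mirror_third, inner_of_append, hR.tb, hR.third]

theorem Phi_injective {w : Word} : ∀ {w'}, w ∈ KBar → w' ∈ KBar → (Phi w).Iso (Phi w') → w = w' := by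
  have base : ∀ {w}, w ∈ KBar → (Phi []).Iso (Phi w) → w = [] := by
    intro w hw h
    induction w using List.reverseRecOn with
    | nil => rfl
    | append_singleton w s _ =>
      exfalso
      obtain ⟨π, e⟩ := iso_iff.1 h
      have hi := inner_of_append hw
      have hT := tb_phi (mem_KBar_of_append (w := []) (s := .a) ((mem_KBar_append (by decide)).2
        fun k hk => by simp at hk))
      have hr : ∀ (N : MarkedMap) x, (N.map π).rev (π x) = π (N.rev x) := fun _ => PercMap.map_rev π
      rw [e, map_top π hT.tri hT.ri, hr] at hi
      refine (PercMap.map_mem_rootFace π).not.1 hi ?_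
      have : ∀ x, (Phi []).next x = (Phi []).rev x := fun _ => rfl
      rw [← this, next_mem_rootFace]
      exact hT.top_mem
  induction w using List.reverseRecOn with
  | nil => exact fun _ hw' h => (base hw' h).symm
  | append_singleton w s ih =>
    intro w' hw hw' h
    induction w' using List.reverseRecOn with
    | nil => exact base hw h.symm
    | append_singleton w' s' _ =>
      have hv := mem_KBar_of_append hw
      have hv' := mem_KBar_of_append hw'
      rcases rightLast_or hw with hl | hl
      · grind [last_step_inj]
      · obtain ⟨h1, h2⟩ := Phi_mirror hw
        obtain ⟨h1', h2'⟩ := Phi_mirror hw'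
        rw [List.map_append, List.map_singleton] at h1 h2 h1' h2'
        obtain ⟨h3, h4⟩ := last_step_inj h1 h1' hl (h2.symm.trans (h.mirror.trans h2'))
        have h5 : s = s' := by rw [← s.swap_swap, h3, s'.swap_swap]
        obtain ⟨k1, k2⟩ := Phi_mirror hv
        obtain ⟨k1', k2'⟩ := Phi_mirror hv'
        have h6 := (k2.trans (h4.trans k2'.symm)).mirror
        rw [mirror_mirror (tb_phi hv).tri.toIsPlanarMap,
          mirror_mirror (tb_phi hv').tri.toIsPlanarMap] at h6
        rw [h5, ih hv hv' h6]

/-- The number of darts of the in-edges. -/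
noncomputable def numFree (N : MarkedMap) : ℕ := ((N.darts : Set ℕ) \ N.active).ncard

theorem numFree_lt {x : ℕ} (h : ∀ y ∈ M.darts, y ∉ M.active → y ∈ N.darts ∧ y ∉ N.active ∧ y ≠ x)
    (hx : x ∈ N.darts) (hxa : x ∉ N.active) : M.numFree < N.numFree :=
  Set.ncard_lt_ncard ⟨fun y hy => ⟨(h y hy.1 hy.2).1, (h y hy.1 hy.2).2.1⟩,
    fun hs => (h x (hs ⟨hx, hxa⟩).1 (hs ⟨hx, hxa⟩).2).2.2 rfl⟩ (N.darts.finite_toSet.sdiff)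

theorem exists_step_of_third (hN : N.TB) (hi : N.rev N.top ∉ N.rootFace) (hT : N.Third) :
    ∃ (M : MarkedMap) (s : Step), M.TB ∧ (s = .a ∨ s = .c ∧ M.HasActiveRight) ∧ (M.step s).Iso N ∧
      M.numFree < N.numFree := by
  by_cases hE : N.EndsA
  · obtain ⟨hF, hM, e, h1, h2⟩ := hE.eq_glueTriAt hN
    refine ⟨N.unglue, .a, hM, .inl rfl, ?_, ?_⟩
    · have := glueTriAt_iso hM true (fresh4_fresh (M := N.unglue)) hF
      rwa [← e] at this
    · refine numFree_lt (fun y hy hya => ?_) h1 h2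
      have hy' : y ∈ N.darts ∧ _ := Finset.mem_sdiff.1 hy
      refine ⟨hy'.1, fun hya' => hya (.inl ⟨hya', ?_⟩), fun e => hya (e ▸ hM.top_active)⟩
      simpa using hy'.2
  by_cases hP : ∀ y ∈ N.vertexOf (N.next N.top), ¬ N.PathLeft y
  · obtain ⟨hM, h1, h2, h3, h4⟩ := hN.stepC_unrecolor hi hE hP
    refine ⟨N.unrecolor, .c, hM, .inr ⟨rfl, h1⟩, Iso.of_eq h2, ?_⟩
    exact numFree_lt (fun y hy hya => ⟨hy, fun h => hya (.inl h), fun e => hya (.inr (.inl e))⟩) h3 h4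
  · push Not at hP
    obtain ⟨y, hy, hl⟩ := hP
    obtain ⟨h, k, c⟩ := exists_cutAt hN.comb hy hl
    have h0 : N.fresh ∉ N.darts := fun h => (lt_fresh h).ne rfl
    have h1 : N.fresh + 1 ∉ N.darts := fun h => by have := lt_fresh h; omega
    obtain ⟨l, m, o⟩ := opening_of_cutAt hN.toTBRight hi hT c h0 h1 (Nat.lt_succ_self _).ne
    obtain ⟨hM, h2, h3⟩ := hN.stepC_unzip o
    obtain ⟨h4, -, -⟩ := hN.unzip o
    refine ⟨_, .c, hM, .inr ⟨rfl, h2⟩, Iso.of_eq h3, numFree_lt (x := h) (fun y hy hya => ?_) o.cut.h_mem h4⟩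
    have hn : (N.unzip N.top h N.fresh (N.fresh + 1)).next (N.unzip N.top h N.fresh (N.fresh + 1)).top
        = N.fresh := by
      change (N.unzipAt N.top h N.fresh (N.fresh + 1)).next
        (N.unzipAt N.top h N.fresh (N.fresh + 1)).top = _
      rw [o.unzip_top]
      exact o.cut.values.2.2.2.2.2.1
    have ha : ∀ z, z ∈ N.active ∨ z = N.fresh + 1 ∨ z = h ∨ z = N.fresh →
        z ∈ (N.unzip N.top h N.fresh (N.fresh + 1)).unrecolor.active := by
      rintro z (hz | hz | hz | hz)
      · exact .inl (.inl hz)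
      · exact .inl (.inr (.inl hz))
      · exact .inl (.inr (.inr hz))
      · exact .inr (.inl (hz.trans hn.symm))
    refine ⟨?_, fun hz => hya (ha y (.inl hz)), fun hz => hya (ha y (.inr (.inr (.inl hz))))⟩
    exact (o.cut.mem.1 hy).resolve_right fun hz => hya (ha y (by tauto))

theorem init_iso (hN : N.TB) (hi : N.rev N.top ∈ N.rootFace) : init.Iso N := by
  obtain ⟨h1, h2, h3⟩ := hN.tri.single_edge hN.top_mem hi
  have hC := hN.comb
  have hne : N.rev N.top ≠ N.top := hC.rev_ne _ hN.top_darts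
  have hbw := hN.top_bw
  have hroot : N.root = N.rev N.top := ((h3 _).1 hC.root_mem).resolve_left fun e =>
    hbw.1 (e ▸ hN.ri.1.1)
  obtain ⟨σ, -, hσ⟩ := exists_perm_extend 1 ∅ (a := 0) (b := N.root) (by simp) (by simp)
  obtain ⟨π, hπ, hπ1⟩ := exists_perm_extend σ {0} (a := 1) (b := N.top) (by simp)
    (by simp [hσ, hroot, hne.symm])
  have hπ0 : π 0 = N.rev N.top := by grind
  have hsw : π * Equiv.swap 0 1 * π⁻¹ = Equiv.swap (N.rev N.top) N.top := by
    rw [Equiv.mul_swap_eq_swap_mul, hπ0, hπ1]; simp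
  have key : ∀ p : Perm ℕ, p N.top = N.rev N.top → p (N.rev N.top) = N.top →
      (∀ x ∉ N.darts, p x = x) → p = π * Equiv.swap 0 1 * π⁻¹ := by
    grind
  refine ⟨π, ?_, key _ rfl (hC.rev_rev _) hC.rev_fix, key _ h1 h2 hC.next_fix, ?_, ?_, ?_⟩
  · ext x
    rw [h3]
    simp [init, hπ0, hπ1, or_comm]
  · exact hroot.trans hπ0.symm
  · change _ = π '' {0}
    rw [Set.image_singleton, hπ0]
    ext x
    refine ⟨fun hx => ((h3 x).1 (hN.tri.white_sub hx)).resolve_left fun e => hbw.1 (e ▸ hx), ?_⟩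
    rintro rfl
    exact hbw.2
  · change _ = π '' {0, 1}
    grind [hN.active_sub, hN.active_rev, hN.top_active]

theorem exists_word (n : ℕ) : ∀ {N : MarkedMap}, N.TB → N.numFree = n → ∃ w ∈ KBar, (Phi w).Iso N := by
  induction n using Nat.strong_induction_on with
  | _ n ih =>
  have main : ∀ {N : MarkedMap}, N.TB → N.numFree = n → N.rev N.top ∉ N.rootFace → N.Third →
      ∃ w ∈ KBar, (Phi w).Iso N := by
    intro N hN hn hi hT
    obtain ⟨M, s, hM, hs, h1, h2⟩ := exists_step_of_third hN hi hT
    obtain ⟨w, hw, h3⟩ := ih _ (hn ▸ h2) hM rfl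
    obtain ⟨U, κ, K, h⟩ := exists_inv hw
    refine ⟨w ++ [s], ?_, ?_⟩
    · rcases hs with rfl | ⟨rfl, hr⟩
      · exact (mem_KBar_append (by decide)).2 hw
      · refine mem_KBar_append_c.2 ⟨hw, .inr ?_⟩
        obtain ⟨π, rfl⟩ := iso_iff.1 h3
        exact h.hasActiveRight_iff.1 ((map_hasActiveRight π).1 hr)
    · rw [Phi_append]
      exact (iso_step h.tri h.ri h.isTBar.active_sub h3 s).trans h1
  intro N hN hn
  by_cases hi : N.rev N.top ∈ N.rootFace
  · exact ⟨[], fun k hk => by simp at hk, init_iso hN hi⟩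
  by_cases hT : N.Third
  · exact main hN hn hi hT
  · obtain ⟨w, hw, h⟩ := main hN.mirror hn (by
      rw [mirror_top hN.comb, mirror_toPercMap, PercMap.mirror_rootFace]
      exact hi) ((mirror_third hN hi).2 hT)
    obtain ⟨h1, h2⟩ := Phi_mirror hw
    have h3 := h.mirror
    rw [mirror_mirror hN.tri.toIsPlanarMap] at h3
    exact ⟨_, h1, h2.symm.trans h3⟩

theorem bijOn_toClass : Set.BijOn (fun w : Word => (Phi w).toClass) KBar TBar := by
  refine ⟨fun w hw => ?_, fun w hw w' hw' h => Phi_injective hw hw' (Quotient.exact h), ?_⟩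
  · obtain ⟨U, κ, K, h⟩ := exists_inv hw
    exact ⟨_, h.isTBar, rfl⟩
  · rintro _ ⟨N, hN, rfl⟩
    obtain ⟨w, hw, h⟩ := exists_word _ hN.tb rfl
    exact ⟨w, hw, Quotient.sound h⟩

theorem stack_eq_nil {w : Word} {x : Step} (hx : x ≠ .c) : unmatchedSteps w x = ∅ ↔ stack w x = [] := by
  rw [unmatchedSteps_eq w hx, Set.eq_empty_iff_forall_notMem]
  exact List.eq_nil_iff_forall_not_mem.symm

theorem active_of_mem_KSuf {w : Word} (hw : w ∈ KSuf) :
    (Phi w).active = {(Phi w).top, (Phi w).rev (Phi w).top} := by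
  obtain ⟨U, κ, K, h⟩ := exists_inv hw.1
  rw [(stack_eq_nil (by decide)).1 hw.2.1, (stack_eq_nil (by decide)).1 hw.2.2] at h
  ext x
  rw [h.active]
  simp

theorem nonTopOuterVertices_eq {w : Word} (hw : w ∈ KSuf) :
    (Phi w).nonTopOuterVertices = (Phi w).inVertices ∩ (Phi w).outerVertices := by
  ext v
  simp only [PercMap.nonTopOuterVertices, inVertices, active_of_mem_KSuf hw, Set.mem_inter_iff,
    Set.mem_ofPred_eq, Set.disjoint_insert_right, Set.disjoint_singleton_right]
  refine ⟨fun h => ⟨⟨?_, h.2⟩, h.1⟩, fun h => ⟨h.2, h.1.2⟩⟩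
  exact Set.image_mono (fun _ => (tb_phi hw.1).comb.rootFace_sub) h.1

/-- With the top-edge as its only active edge, any percolated triangulation fulfills the
conditions. -/
theorem isTBar_topActive {P : PercMap} (hT : P.IsTriangulation) (hR : P.RootInterface) :
    (⟨P, {P.top, P.rev P.top}⟩ : MarkedMap).IsTBar := by
  have hC := hT.comb
  have hm := PercMap.top_mem hT hR
  have hbw := PercMap.top_bw hT hR
  have hd := hC.rootFace_sub hm
  have hroot : P.root ∈ ({P.top, P.rev P.top} : Set ℕ) → P.rev P.root = P.top := by
    rintro (h | h)
    · exact absurd (h ▸ hR.1.1) hbw.1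
    · rw [h, hC.rev_rev]
  have huni : ∀ x ∈ ({P.top, P.rev P.top} : Set ℕ), ¬ P.WhiteEdge x ∧ ¬ P.BlackEdge x := by
    rintro x (rfl | rfl)
    · exact ⟨fun h => hbw.1 h.1, fun h => h.2 hbw.2⟩
    · exact ⟨fun h => hbw.1 (hC.rev_rev P.top ▸ h.2), fun h => h.1 hbw.2⟩
  refine ⟨hT, hR, ?_, ?_, ?_, .inl rfl, fun h1 h2 => h1 ?_, ?_, ?_⟩
  · rintro x (rfl | rfl)
    exacts [hd, hC.rev_mem_iff.2 hd]
  · grind [hC.rev_rev]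
  · grind [hC.rev_rev]
  · grind [hC.mem_edgeOf]
  · exact consecutive_of_local hT hR (.inl rfl) hroot (fun x _ hw ha => absurd hw (huni x ha).1)
      fun x _ hb ha => absurd hb (huni x ha).2
  · rintro x (rfl | rfl) hx
    · exact absurd hm hx
    · obtain ⟨K, hK⟩ := exists_pathEnd hT hR
      obtain ⟨m, rfl, h⟩ := exists_top_triangle hT hR hK hx
      exact ⟨m, fun i hi => hK.inner i (by omega), PercMap.mem_faceOf_comm.1 h⟩

theorem bijOn_toClass_KSuf : Set.BijOn (fun w : Word => (Phi w).toPercMap.toClass) KSuf TSuf := by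
  refine ⟨fun w hw => ⟨_, ⟨(tb_phi hw.1).tri, (tb_phi hw.1).ri⟩, rfl⟩, fun w hw w' hw' h => ?_, ?_⟩
  · obtain ⟨π, h1, h2, h3, h4, h5⟩ : (Phi w).toPercMap.Iso (Phi w').toPercMap := Quotient.exact h
    have hT := tb_phi hw.1
    refine Phi_injective hw.1 hw'.1 ⟨π, h1, h2, h3, h4, h5, ?_⟩
    have e : (Phi w').toPercMap = (Phi w).toPercMap.map π := by
      rw [show (Phi w').toPercMap = ⟨_, _, _, _, _⟩ from rfl, h1, h2, h3, h4, h5]; rfl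
    grind [active_of_mem_KSuf, PercMap.map_top, hT.tri, hT.ri, PercMap.map_rev]
  · rintro _ ⟨P, ⟨hT, hR⟩, rfl⟩
    have hN := isTBar_topActive hT hR
    obtain ⟨w, hw, h⟩ := exists_word _ hN.tb rfl
    obtain ⟨U, κ, K, hI⟩ := exists_inv hw
    have hm := PercMap.top_bw hT hR
    refine ⟨w, ⟨hw, (stack_eq_nil (by decide)).2 ?_, (stack_eq_nil (by decide)).2 ?_⟩, ?_⟩
    · by_contra hne
      obtain ⟨π, e⟩ := iso_iff.1 h
      obtain ⟨x, -, hx | hx, hxw⟩ := e ▸ (map_hasActiveLeft π).2 (hI.hasActiveLeft_iff.2 hne)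
      · exact hm.1 (hx ▸ hxw.1)
      · refine hm.1 ?_
        rw [← hT.comb.rev_rev P.top, ← hx]
        exact hxw.2
    · by_contra hne
      obtain ⟨π, e⟩ := iso_iff.1 h
      obtain ⟨x, -, hx | hx, hxw⟩ := e ▸ (map_hasActiveRight π).2 (hI.hasActiveRight_iff.2 hne)
      · rw [hx] at hxw
        exact hxw.2 hm.2
      · rw [hx] at hxw
        exact hxw.1 hm.2
    · obtain ⟨π, h1, h2, h3, h4, h5, -⟩ := h
      exact Quotient.sound ⟨π, h1, h2, h3, h4, h5⟩

end MarkedMap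
end KrewerasBij

theorem mainTheorem4 :
    -- the mapping is well defined: `c`-steps only occur at maps in its domain
    (∀ w : Word, w ++ [Step.c] ∈ KBar →
      w ∈ KBar ∧ ((Phi w).HasActiveLeft ∨ (Phi w).HasActiveRight)) ∧
    -- the bijection
    Set.BijOn (fun w : Word => (Phi w).toClass) KBar TBar ∧
    -- the correspondences
    (∀ w ∈ KBar,
      -- (i)
      (Set.BijOn (etaE w) (steps w) (Phi w).inEdges ∧
        Set.BijOn (etaE w) (unmatchedC w Step.a) (Phi w).leftInactiveEdges ∧
        Set.BijOn (etaE w) (unmatchedC w Step.b) (Phi w).rightInactiveEdges) ∧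
      -- (ii)
      (Set.BijOn (etaVF w) (abSteps w) (Phi w).innerFaces ∧
        Set.BijOn (etaVF w) (unmatchedSteps w Step.a)
          ((Phi w).trianglesAt (Phi w).leftActiveEdges) ∧
        Set.BijOn (etaVF w) (unmatchedSteps w Step.b)
          ((Phi w).trianglesAt (Phi w).rightActiveEdges) ∧
        Set.BijOn (etaVF w) (matchedCa w ∪ unmatchedC w Step.a)
          ((Phi w).inVertices ∩ (Phi w).whiteVertices) ∧
        Set.BijOn (etaVF w) (matchedCb w ∪ unmatchedC w Step.b)
          ((Phi w).inVertices ∩ (Phi w).blackVertices) ∧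
        Set.BijOn (etaVF w) (matchedCa w) ((Phi w).innerVertices ∩ (Phi w).whiteVertices) ∧
        Set.BijOn (etaVF w) (matchedCb w) ((Phi w).innerVertices ∩ (Phi w).blackVertices) ∧
        Set.BijOn (etaVF w) (unmatchedC w Step.a)
          ((Phi w).inVertices ∩ (Phi w).outerVertices ∩ (Phi w).whiteVertices) ∧
        Set.BijOn (etaVF w) (unmatchedC w Step.b)
          ((Phi w).inVertices ∩ (Phi w).outerVertices ∩ (Phi w).blackVertices)) ∧
      -- (iii), where `etaLR` of a step is the unique active left (right) edge of its triangle
      (Set.BijOn (etaLR w) (unmatchedSteps w Step.a) (Phi w).leftActiveEdges ∧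
        Set.BijOn (etaLR w) (unmatchedSteps w Step.b) (Phi w).rightActiveEdges ∧
        (∀ i ∈ unmatchedSteps w Step.a, ∀ e ∈ (Phi w).leftActiveEdges,
          ((etaVF w i ∩ e).Nonempty ↔ e = etaLR w i)) ∧
        (∀ i ∈ unmatchedSteps w Step.b, ∀ e ∈ (Phi w).rightActiveEdges,
          ((etaVF w i ∩ e).Nonempty ↔ e = etaLR w i)))) ∧
    -- the case of all percolated triangulations satisfying the root-interface condition
    Set.BijOn (fun w : Word => (Phi w).toPercMap.toClass) KSuf TSuf ∧
    (∀ w ∈ KSuf,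
      Set.BijOn (etaVF w) (abSteps w) (Phi w).innerFaces ∧
      Set.BijOn (etaVF w) (matchedCa w) ((Phi w).innerVertices ∩ (Phi w).whiteVertices) ∧
      Set.BijOn (etaVF w) (matchedCb w) ((Phi w).innerVertices ∩ (Phi w).blackVertices) ∧
      Set.BijOn (etaVF w) (unmatchedC w Step.a)
        ((Phi w).nonTopOuterVertices ∩ (Phi w).whiteVertices) ∧
      Set.BijOn (etaVF w) (unmatchedC w Step.b)
        ((Phi w).nonTopOuterVertices ∩ (Phi w).blackVertices)) := by
  refine ⟨fun w hw => ?_, MarkedMap.bijOn_toClass, fun w hw => ?_, MarkedMap.bijOn_toClass_KSuf,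
    fun w hw => ?_⟩
  · obtain ⟨hw, hne⟩ := mem_KBar_append_c.1 hw
    obtain ⟨U, κ, K, h⟩ := MarkedMap.exists_inv hw
    exact ⟨hw, hne.imp h.hasActiveLeft_iff.2 h.hasActiveRight_iff.2⟩
  · obtain ⟨l1, l2, l3⟩ := MarkedMap.active_left hw
    obtain ⟨r1, r2, r3⟩ := MarkedMap.active_right hw
    exact ⟨MarkedMap.edge_corr hw, ⟨MarkedMap.innerFaces_eq ▸ (MarkedMap.corr hw).face, l1, r1,
      MarkedMap.vertex_corr hw⟩, l2, r2, l3, r3⟩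
  · obtain ⟨-, -, h1, h2, h3, h4⟩ := MarkedMap.vertex_corr hw.1
    rw [MarkedMap.nonTopOuterVertices_eq hw]
    exact ⟨MarkedMap.innerFaces_eq ▸ (MarkedMap.corr hw.1).face, h1, h2, h3, h4⟩
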